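/- **Setting.** Let $M$ be a connected $C^\infty$ manifold (Hausdorff, second countable, without boundary) of dimension $n\ge 2$, and let $\mathfrak m$ be a positive $C^\infty$-measure on $M$. A *Lagrangian* is a function $L:TM\to[0,\infty)$ that is $C^1$ on $TM$, $C^\infty$ off the zero section, zero on the zero section, has positive-definite fibrewise Hessian $(L_{v^iv^j}(v))$ at every $v\neq0$, and is super-linear on fibres, in the sense that $H(\alpha):=\sup_{v\in T_xM}\{\alpha(v)-L(v)\}$ is finite for all $x\in M$, $\alpha\in T_x^*M$. Let $\tau^*(\alpha)\in T_xM$ be the unique $v$ with $H(\alpha)=\alpha(v)-L(v)$, let $\Phi_t$ be the flow on $T^*M$ of the Hamiltonian vector field $\sum_i(H_{\alpha_i}\partial_{x^i}-H_{x^i}\partial_{\alpha_i})$, $\pi:T^*M\to M$ the projection and $\omega=\sum_i d\alpha_i\wedge dx^i$. Assume that $\Phi_t$ exists on all of $T^*M$ for all $t\ge0$. The action-minimizing curve (a solution of the Euler--Lagrange equation) with $\dot\eta(0)=\tau^*(\alpha)$ is $\eta(t)=\pi(\Phi_t(\alpha))$. *Curvature.* For $\alpha\ne0$ put $J^t_\alpha=(d\Phi_t)^{-1}(\ker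 d\pi)\subset T_\alpha(T^*M)$. A canonical frame is a family of smooth curves $e_i^t\in J_\alpha^t$ ($i=1,\dots,n$, $|t|<\varepsilon$) with $\omega(\dot e_i^t,e_j^t)=\delta_{ij}$ and $\ddot e_i^t\in J^t_\alpha$; $\mathrm{Ric}^H(\alpha)$ is the trace of the operator $e_i^0\mapsto-\ddot e_i^0$ on $J^0_\alpha$. Along $\eta(t)=\pi(\Phi_t(\alpha))$ write $\mathfrak m=e^{-\psi}\sqrt{\det[L_{v^iv^j}(\dot\eta)]}\,dx^1\cdots dx^n$, and for $N\in(n,\infty)$ set $\mathrm{Ric}^H_N(\alpha)=\mathrm{Ric}^H(\alpha)+(\psi\circ\eta)''(0)-(\psi\circ\eta)'(0)^2/(N-n)$; for $N=n$ set $\mathrm{Ric}^H_n(\alpha)=\mathrm{Ric}^H(\alpha)+(\psi\circ\eta)''(0)$ if $(\psi\circ\eta)'(0)=0$ and $-\infty$ otherwise. *Laplacian.* $\nabla u:=\tau^*(du)$ and $\Delta^H_{\mathfrak m}u:=\mathrm{div}_{\mathfrak m}(\nabla u)$, where $\mathrm{div}_{\mathfrak m}V=\sum_i(\partial_{x^i}V^i-V^i\partial_{x^i}\varsigma)$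 if $\mathfrak m=e^{-\varsigma}dx^1\cdots dx^n$. *Exponential map and $u_z^c$.* Fix $c>0$. For $z\in M$ let $\exp_z^c(0)=z$, and for $\beta\in T_z^*M\setminus\{0\}$ let $\exp_z^c(\beta)=\pi(\Phi_{1/a}(a\beta))$, where $a>0$ is such that $H(a\beta)=c$. For $\alpha\in T_z^*M$ with $H(\alpha)=c$, let $T_\alpha$ be the supremum of those $T>0$ such that, for all $t\in(0,T)$, $d\exp_z^c$ is invertible at $t\alpha$ and there is no $\alpha'\in T^*_zM\setminus\{\alpha\}$ with $H(\alpha')=c$ and $\exp_z^c(t\alpha')=\exp_z^c(t\alpha)$. Call an open set $W\subset T_z^*M\setminus\{0\}$ *regular* if $\exp_z^c$ is injective on $W$ with invertible differential at every point of $W$; on $\exp_z^c(W)$ define $$u_z^c(\exp_z^c(t\alpha))=ct+\int_0^tL(\tau^*(\Phi_s(\alpha)))\,ds\qquad(t\alpha\in W,\ t>0,\ H(\alpha)=c).$$ Let $\mathbf s_{K,N}(t)$ be $\sqrt{N/K}\sin(\sqrt{K/N}\,t)$ if $K>0$, $t$ if $K=0$, and $\sqrt{-N/K}\sinh(\sqrt{-K/N}\,t)$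 if $K<0$. **Theorem (Laplacian comparison).** Let $c>0$, $K\in\mathbb R$, $N\in[n,\infty)$. Below, $z\in M$, $\alpha\in T_z^*M$ with $H(\alpha)=c$, and $\eta(t)=\pi(\Phi_t(\alpha))$ are arbitrary. 1. For $0<t<T_\alpha$ we have $\exp_z^c(t\alpha)=\eta(t)$, and there is a regular set $W$ containing $t\alpha$, so that $u_z^c$ is defined near $\eta(t)$. 2. For every regular $W$, $u_z^c\in C^\infty(\exp_z^c(W))$, and $(du_z^c)_{\eta(t)}=\Phi_t(\alpha)$ and $u_z^c(\eta(t))=ct+\int_0^tL(\dot\eta)\,ds$ whenever $t>0$, $t\alpha\in W$. 3. Assume $\mathrm{Ric}^H_N(\beta)\ge K$ for all $\beta\in T^*M$ with $H(\beta)=c$. Then, for all $t\in(0,T_\alpha)$, $\mathbf s_{K,N}(t)>0$, and for every regular $W\ni t\alpha$, $$\Delta^H_{\mathfrak m}u_z^c(\eta(t))\le N\frac{\mathbf s_{K,N}'(t)}{\mathbf s_{K,N}(t)},$$ that is, the left-hand side is at most $\sqrt{NK}\cot(\sqrt{K/N}\,t)$ if $K>0$, $N/t$ if $K=0$, and $\sqrt{-NK}\coth(\sqrt{-K/N}\,t)$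 if $K<0$. 4. (No curvature assumption.) Let $W$ be regular, $(x^i)$ a coordinate system on an open set $U\subset\exp_z^c(W)$ with $\nabla u_z^c\equiv\partial_{x^1}$, write $\mathfrak m=e^{\varsigma}dx^1\cdots dx^n$ on $U$, and let $(a,b)$, $a\ge0$, be an interval with $t\alpha\in W$, $\eta(t)\in U$ and $\mathbf s_{K,N}(t)>0$ for all $t\in(a,b)$. Then $e^{\varsigma(\eta(t))}/\mathbf s_{K,N}(t)^N$ is non-increasing on $(a,b)$ if and only if $\Delta^H_{\mathfrak m}u_z^c(\eta(t))\le N\mathbf s_{K,N}'(t)/\mathbf s_{K,N}(t)$ for all $t\in(a,b)$. 5. (No curvature assumption.) Suppose $\mathbf s_{K,N}>0$ on $(0,T_\alpha)$. The measure contraction property along $\eta$, namely that every $T\in(0,T_\alpha)$ lies in an interval $(a,b)$, $a\ge 0$, for which there are $W$, $U$ and $(x^i)$ as in 4 with $e^{\varsigma(\eta(t))}/\mathbf s_{K,N}(t)^N$ non-increasing on $(a,b)$, holds if and only if $\Delta^H_{\mathfrak m}u_z^c(\eta(t))\le N\mathbf s_{K,N}'(t)/\mathbf s_{K,N}(t)$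 for all $t\in(0,T_\alpha)$ and all regular $W\ni t\alpha$. -/

import Mathlib

open Set Filter Topology MeasureTheory
open scoped Manifold ContDiff

noncomputable section

namespace HamLap

/-- The model space `ℝⁿ`. -/
abbrev E (n : ℕ) : Type := EuclideanSpace ℝ (Fin n)

/-- The dual of the model space. -/
abbrev Dual (n : ℕ) : Type := E n →L[ℝ] ℝ

/-- The coordinate vector `∂_{x^i}` of the model space. -/
def basisVec {n : ℕ} (i : Fin n) : E n := EuclideanSpace.single i 1

/-- The coordinate covector `dx^i` of the model space. -/
def basisCov {n : ℕ} (i : Fin n) : Dual n := EuclideanSpace.proj i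

section Bundles

variable (n : ℕ) (M : Type*) [TopologicalSpace M] [ChartedSpace (E n) M]
  [IsManifold 𝓘(ℝ, E n) ∞ M]

/-- The cotangent space `T_x^* M`. -/
abbrev CotangentSpace (x : M) : Type :=
  TangentSpace 𝓘(ℝ, E n) x →L[ℝ] Bundle.Trivial M ℝ x

/-- The cotangent bundle `T^* M`, with Mathlib's topology and smooth structure. -/
abbrev CotangentBundle : Type _ :=
  Bundle.TotalSpace (Dual n) (CotangentSpace n M)

/-- The model with corners of `T^* M`. -/
abbrev cotModel : ModelWithCorners ℝ (E n × Dual n) (ModelProd (E n) (Dual n)) :=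
  𝓘(ℝ, E n).prod 𝓘(ℝ, Dual n)

end Bundles

section Points

variable {n : ℕ} {M : Type*} [TopologicalSpace M] [ChartedSpace (E n) M]
  [IsManifold 𝓘(ℝ, E n) ∞ M]

/-- The tangent vector at `x` with components `v` in the preferred chart at `x`. -/
def tvec (x : M) (v : E n) : TangentBundle 𝓘(ℝ, E n) M :=
  ⟨x, (show TangentSpace 𝓘(ℝ, E n) x from v)⟩

/-- The covector at `x` with components `β` in the preferred chart at `x`. -/
def covec (x : M) (β : Dual n) : CotangentBundle n M :=
  ⟨x, (show CotangentSpace n M x from β)⟩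

/-- The components of a tangent vector in the preferred chart at its base point. -/
def tcoord (v : TangentBundle 𝓘(ℝ, E n) M) : E n := v.2

/-- The components of a covector in the preferred chart at its base point. -/
def ccoord (α : CotangentBundle n M) : Dual n := α.2

/-- The one-form `du`, as a map `M → T^* M`. -/
def dform (u : M → ℝ) (x : M) : CotangentBundle n M :=
  covec x (show Dual n from mfderiv 𝓘(ℝ, E n) 𝓘(ℝ, ℝ) u x)

end Points

/-! ### Lagrangians and Hamiltonians -/

section Lagrangian

variable {n : ℕ} {M : Type*} [TopologicalSpace M] [ChartedSpace (E n) M]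
  [IsManifold 𝓘(ℝ, E n) ∞ M]

/-- The Hessian of `L` restricted to the tangent space, at the tangent vector `v`:
`fiberHess L v a b = ∑ L_{v^i v^j}(v) a^i b^j`. -/
def fiberHess (L : TangentBundle 𝓘(ℝ, E n) M → ℝ) (v : TangentBundle 𝓘(ℝ, E n) M)
    (a b : E n) : ℝ :=
  fderiv ℝ (fderiv ℝ (fun w : E n => L (tvec v.proj w))) (tcoord v) a b

/-- Lagrangians: nonnegative, `C¹`, smooth off the zero section, zero on the zero section, with
fibrewise positive-definite Hessian off the zero section, and fibrewise super-linear
in the sense that every linear function minus `L` is bounded above on each fibre. -/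
structure IsLagrangian (L : TangentBundle 𝓘(ℝ, E n) M → ℝ) : Prop where
  nonneg : ∀ v, 0 ≤ L v
  contMDiff_one : ContMDiff 𝓘(ℝ, E n).tangent 𝓘(ℝ, ℝ) 1 L
  smooth : ContMDiffOn 𝓘(ℝ, E n).tangent 𝓘(ℝ, ℝ) ∞ L {v | tcoord v ≠ 0}
  zero_section : ∀ x : M, L (tvec x 0) = 0
  convex : ∀ v, tcoord v ≠ 0 → ∀ w : E n, w ≠ 0 → 0 < fiberHess L v w w
  superlinear : ∀ (x : M) (β : Dual n),
    BddAbove (range fun w : E n => β w - L (tvec x w))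

/-- The Hamiltonian `H(α) = sup_v (α(v) - L(v))`. -/
def hamiltonian (L : TangentBundle 𝓘(ℝ, E n) M → ℝ) (α : CotangentBundle n M) : ℝ :=
  ⨆ w : E n, (ccoord α w - L (tvec α.proj w))

open Classical in
/-- The Legendre transform `τ^*(α)`: the (unique) vector `v` with `H(α) = α(v) - L(v)`. -/
def legendre (L : TangentBundle 𝓘(ℝ, E n) M → ℝ) (α : CotangentBundle n M) :
    TangentBundle 𝓘(ℝ, E n) M :=
  tvec α.proj (Classical.epsilon fun w : E n =>
    hamiltonian L α = ccoord α w - L (tvec α.proj w))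

/-! ### The Hamiltonian flow -/

/-- The differential of `H` at `α` in the canonical coordinates `(x^i; α_j)`. -/
def dHam (H : CotangentBundle n M → ℝ) (α : CotangentBundle n M) : (E n × Dual n) →L[ℝ] ℝ :=
  show (E n × Dual n) →L[ℝ] ℝ from mfderiv (cotModel n) 𝓘(ℝ, ℝ) H α

/-- The Hamiltonian vector field `∑ H_{α_i} ∂_{x^i} - H_{x^i} ∂_{α_i}`. A tangent vector of
`T^* M` at `α` is written in the canonical coordinates of the preferred chart at the base
point of `α`, so it is a pair `(∑ a^i ∂_{x^i}, ∑ ξ_i ∂_{α_i})` in `E n × Dual n`. -/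
def hamField (H : CotangentBundle n M → ℝ) (α : CotangentBundle n M) :
    TangentSpace (cotModel n) α :=
  show E n × Dual n from
    (∑ i, dHam H α (0, basisCov i) • basisVec i, -∑ i, dHam H α (basisVec i, 0) • basisCov i)

/-- The Hamiltonian flow exists for all nonnegative times. -/
def ForwardComplete (H : CotangentBundle n M → ℝ) : Prop :=
  ∀ α, ∃ γ : ℝ → CotangentBundle n M, γ 0 = α ∧
    IsMIntegralCurveOn (I := cotModel n) γ (hamField H) (Ici 0)

open Classical in
/-- The Hamiltonian flow `Φ_t(α)`: the value at `t` of an integral curve of the Hamiltonian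
vector field defined on an open interval containing `0` and `t` and starting at `α`. -/
def flow (H : CotangentBundle n M → ℝ) (t : ℝ) (α : CotangentBundle n M) : CotangentBundle n M :=
  if h : ∃ γ : ℝ → CotangentBundle n M, γ 0 = α ∧ ∃ a b : ℝ, (0 : ℝ) ∈ Ioo a b ∧ t ∈ Ioo a b ∧
      IsMIntegralCurveOn (I := cotModel n) γ (hamField H) (Ioo a b)
  then h.choose t else α

/-- The differential `dΦ_t : T_α(T^*M) → T_{Φ_t(α)}(T^*M)` in canonical coordinates. -/
def dflow (H : CotangentBundle n M → ℝ) (t : ℝ) (α : CotangentBundle n M) :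
    (E n × Dual n) →L[ℝ] (E n × Dual n) :=
  show (E n × Dual n) →L[ℝ] (E n × Dual n) from
    mfderiv (cotModel n) (cotModel n) (flow H t) α

/-! ### Curvature of the Hamiltonian -/

/-- The canonical symplectic form `ω = ∑ dα_i ∧ dx^i` in canonical coordinates. -/
def symp (v w : E n × Dual n) : ℝ := v.2 w.1 - w.2 v.1

/-- The vertical space `span {∂_{α_i}}`. -/
def vertical (n : ℕ) : Submodule ℝ (E n × Dual n) :=
  LinearMap.ker (LinearMap.fst ℝ (E n) (Dual n))

/-- The Jacobi curve `J_α^t = (dΦ_t)^{-1}(V_{Φ_t(α)})`. -/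
def jacobi (H : CotangentBundle n M → ℝ) (α : CotangentBundle n M) (t : ℝ) :
    Submodule ℝ (E n × Dual n) :=
  (vertical n).comap (dflow H t α : (E n × Dual n) →ₗ[ℝ] (E n × Dual n))

/-- `e` is a canonical frame along `t ↦ Φ_t(α)`, `t ∈ (-ε, ε)`. -/
structure IsCanonicalFrame (H : CotangentBundle n M → ℝ) (α : CotangentBundle n M) (ε : ℝ)
    (e : Fin n → ℝ → E n × Dual n) : Prop where
  smooth : ∀ i, ContDiffOn ℝ ∞ (e i) (Ioo (-ε) ε)
  mem : ∀ i, ∀ t ∈ Ioo (-ε) ε, e i t ∈ jacobi H α t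
  orthonormal : ∀ i j, ∀ t ∈ Ioo (-ε) ε, symp (deriv (e i) t) (e j t) = if i = j then 1 else 0
  second : ∀ i, ∀ t ∈ Ioo (-ε) ε, deriv (deriv (e i)) t ∈ jacobi H α t

/-- `R` is the curvature operator `R_α^0` on `J_α^0 = V_α`, determined by `R(e_i^0) = -ë_i^0` for a
canonical frame. -/
def IsCurvatureOperator (H : CotangentBundle n M → ℝ) (α : CotangentBundle n M)
    (R : jacobi H α 0 →ₗ[ℝ] jacobi H α 0) : Prop :=
  ∃ (ε : ℝ) (e : Fin n → ℝ → E n × Dual n), 0 < ε ∧ IsCanonicalFrame H α ε e ∧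
    ∀ (i : Fin n) (h : e i 0 ∈ jacobi H α 0),
      ((R ⟨e i 0, h⟩ : jacobi H α 0) : E n × Dual n) = -deriv (deriv (e i)) 0

open Classical in
/-- The Ricci curvature `Ric^H(α)`, the trace of the curvature operator; zero on the zero
section. -/
def ricci (H : CotangentBundle n M → ℝ) (α : CotangentBundle n M) : ℝ :=
  if ccoord α = 0 then 0
  else LinearMap.trace ℝ (jacobi H α 0) (Classical.epsilon (IsCurvatureOperator H α))

end Lagrangian

/-! ### Smooth measures, weighted Ricci curvature, Laplacian -/

section Measure

variable {n : ℕ} {M : Type*} [TopologicalSpace M] [ChartedSpace (E n) M]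
  [IsManifold 𝓘(ℝ, E n) ∞ M] [MeasurableSpace M]

/-- `m = e^{-ς} dx^1 ⋯ dx^n` in the chart `e`, with `ς` smooth. -/
def IsLogDensity (m : Measure M) (e : OpenPartialHomeomorph M (E n)) (s : E n → ℝ) : Prop :=
  ContDiffOn ℝ ∞ s e.target ∧
    ∀ A : Set M, MeasurableSet A → A ⊆ e.source →
      m A = ∫⁻ y in e '' A, ENNReal.ofReal (Real.exp (-s y))

/-- `m` is a positive smooth measure: it has a smooth positive density in every chart of the smooth
structure. -/
def IsSmoothMeasure (n : ℕ) {M : Type*} [TopologicalSpace M] [ChartedSpace (E n) M]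
    [IsManifold 𝓘(ℝ, E n) ∞ M] [MeasurableSpace M] (m : Measure M) : Prop :=
  ∀ e ∈ IsManifold.maximalAtlas 𝓘(ℝ, E n) ∞ M, ∃ s : E n → ℝ, IsLogDensity m e s

open Classical in
/-- The function `ς` with `m = e^{-ς} dx^1 ⋯ dx^n` in the chart `e` (unique on the target). -/
def logDensity (m : Measure M) (e : OpenPartialHomeomorph M (E n)) : E n → ℝ :=
  Classical.epsilon (IsLogDensity m e)

/-- The weight `ψ` at a nonzero tangent vector `v`, determined by
`e^{-ς} = e^{-ψ} √det [L_{v^i v^j}(v)]`. -/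
def weight (m : Measure M) (L : TangentBundle 𝓘(ℝ, E n) M → ℝ)
    (v : TangentBundle 𝓘(ℝ, E n) M) : ℝ :=
  logDensity m (chartAt (E n) v.proj) (chartAt (E n) v.proj v.proj) +
    Real.log (Matrix.of fun i j : Fin n => fiberHess L v (basisVec i) (basisVec j)).det / 2

/-- `ψ ∘ η` along the action-minimizing curve `η(t) = π(Φ_t(α))`, `η'(t) = τ^*(Φ_t(α))`. -/
def weightAlong (m : Measure M) (L : TangentBundle 𝓘(ℝ, E n) M → ℝ) (α : CotangentBundle n M)
    (t : ℝ) : ℝ :=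
  weight m L (legendre L (flow (hamiltonian L) t α))

open Classical in
/-- The weighted Ricci curvature `Ric^H_N(α)` for `N ∈ [n, ∞)`. -/
def ricciN (m : Measure M) (L : TangentBundle 𝓘(ℝ, E n) M → ℝ) (N : ℝ)
    (α : CotangentBundle n M) : EReal :=
  if ccoord α = 0 then 0
  else if N = n then
    if deriv (weightAlong m L α) 0 = 0 then
      ((ricci (hamiltonian L) α + deriv (deriv (weightAlong m L α)) 0 : ℝ) : EReal)
    else ⊥
  else
    ((ricci (hamiltonian L) α + deriv (deriv (weightAlong m L α)) 0
      - (deriv (weightAlong m L α) 0) ^ 2 / (N - n) : ℝ) : EReal)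

/-- The gradient vector `∇u(x) = τ^*(du_x)`. -/
def gradient (L : TangentBundle 𝓘(ℝ, E n) M → ℝ) (u : M → ℝ) (x : M) :
    TangentSpace 𝓘(ℝ, E n) x :=
  show E n from tcoord (legendre L (dform u x))

/-- The components `(V^1, …, V^n)` at `x` of a vector field `V` in the chart `e`. -/
def components (e : OpenPartialHomeomorph M (E n)) (V : ∀ x : M, TangentSpace 𝓘(ℝ, E n) x)
    (x : M) : E n :=
  show E n from mfderiv 𝓘(ℝ, E n) 𝓘(ℝ, E n) e x (V x)

/-- The divergence `div_m V = ∑ (∂V^i/∂x^i - V^i ∂ς/∂x^i)`, `m = e^{-ς} dx^1 ⋯ dx^n`, of a vector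
field that is differentiable at `x`, computed in the preferred chart at `x`. -/
def divergence (m : Measure M) (V : ∀ x : M, TangentSpace 𝓘(ℝ, E n) x) (x : M) : ℝ :=
  ∑ i : Fin n,
    ((fderiv ℝ (fun y => components (chartAt (E n) x) V ((chartAt (E n) x).symm y))
        (chartAt (E n) x x) (basisVec i)) i
      - components (chartAt (E n) x) V x i *
        fderiv ℝ (logDensity m (chartAt (E n) x)) (chartAt (E n) x x) (basisVec i))

/-- The Laplacian `Δ^H_m u = div_m (∇u)`. -/
def laplacian (m : Measure M) (L : TangentBundle 𝓘(ℝ, E n) M → ℝ) (u : M → ℝ) (x : M) : ℝ :=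
  divergence m (gradient L u) x

end Measure

/-! ### The exponential map of scale `c` and the function `u_z^c` -/

section Exponential

variable {n : ℕ} {M : Type*} [TopologicalSpace M] [ChartedSpace (E n) M]
  [IsManifold 𝓘(ℝ, E n) ∞ M]

/-- For `β ≠ 0` in `T_z^* M`, the (unique) `a > 0` with `H(aβ) = c`. -/
def scale (L : TangentBundle 𝓘(ℝ, E n) M → ℝ) (c : ℝ) (z : M) (β : Dual n) : ℝ :=
  Classical.epsilon fun a : ℝ => 0 < a ∧ hamiltonian L (covec z (a • β)) = c

open Classical in
/-- The exponential map of scale `c` at `z`: `exp_z^c(β) = π(Φ_{1/a}(aβ))` with `H(aβ) = c`, and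
`exp_z^c(0) = z`. -/
def expMap (L : TangentBundle 𝓘(ℝ, E n) M → ℝ) (c : ℝ) (z : M) (β : Dual n) : M :=
  if β = 0 then z
  else (flow (hamiltonian L) (scale L c z β)⁻¹ (covec z (scale L c z β • β))).proj

/-- The differential of `exp_z^c` at `β` is invertible. -/
def ExpRegularAt (L : TangentBundle 𝓘(ℝ, E n) M → ℝ) (c : ℝ) (z : M) (β : Dual n) : Prop :=
  Function.Bijective (mfderiv 𝓘(ℝ, Dual n) 𝓘(ℝ, E n) (expMap L c z) β)

/-- `T_α`, for `α ∈ T_z^* M` with `H(α) = c`. -/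
def cutTime (L : TangentBundle 𝓘(ℝ, E n) M → ℝ) (c : ℝ) (z : M) (α : Dual n) : EReal :=
  sSup ((fun T : ℝ => (T : EReal)) '' {T : ℝ | 0 < T ∧ ∀ t ∈ Ioo 0 T,
    ExpRegularAt L c z (t • α) ∧
    ∀ α' : Dual n, α' ≠ α → hamiltonian L (covec z α') = c →
      expMap L c z (t • α') ≠ expMap L c z (t • α)})

/-- The function `ct + ∫_0^t L(η') ds` of `tα`, where `H(α) = c` and `η` is the action-minimizing
curve with `η'(0) = τ^*(α)`; it is the pull-back of `u_z^c` by `exp_z^c`. -/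
def potential (L : TangentBundle 𝓘(ℝ, E n) M → ℝ) (c : ℝ) (z : M) (β : Dual n) : ℝ :=
  c * (scale L c z β)⁻¹ + ∫ s in (0 : ℝ)..(scale L c z β)⁻¹,
    L (legendre L (flow (hamiltonian L) s (covec z (scale L c z β • β))))

/-- `W` is an open set of nonzero covectors at `z` which `exp_z^c` maps diffeomorphically onto its
image. -/
structure IsRegularDomain (L : TangentBundle 𝓘(ℝ, E n) M → ℝ) (c : ℝ) (z : M)
    (W : Set (Dual n)) : Prop where
  isOpen : IsOpen W
  zero_notMem : (0 : Dual n) ∉ W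
  injOn : InjOn (expMap L c z) W
  regular : ∀ β ∈ W, ExpRegularAt L c z β

/-- The function `u_z^c` on `exp_z^c(W)`. -/
def uFun (L : TangentBundle 𝓘(ℝ, E n) M → ℝ) (c : ℝ) (z : M) (W : Set (Dual n)) (x : M) : ℝ :=
  potential L c z (Function.invFunOn (expMap L c z) W x)

/-- The action-minimizing curve `η(t) = π(Φ_t(α))` with `η'(0) = τ^*(α)`. -/
def curve (L : TangentBundle 𝓘(ℝ, E n) M → ℝ) (z : M) (α : Dual n) (t : ℝ) : M :=
  (flow (hamiltonian L) t (covec z α)).proj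

end Exponential

/-! ### Comparison functions and the measure contraction property -/

/-- The comparison function `s_{K,N}`. -/
def sKN (K N t : ℝ) : ℝ :=
  if 0 < K then √(N / K) * Real.sin (√(K / N) * t)
  else if K = 0 then t
  else √(-N / K) * Real.sinh (√(-K / N) * t)

section MCP

variable {n : ℕ} {M : Type*} [TopologicalSpace M] [ChartedSpace (E n) M]
  [IsManifold 𝓘(ℝ, E n) ∞ M] [MeasurableSpace M]

/-- `e` is a chart of the smooth structure, contained in `exp_z^c(W)`, in which
`∇u_z^c ≡ ∂_{x^i}`. -/
structure IsStraightChart (L : TangentBundle 𝓘(ℝ, E n) M → ℝ) (c : ℝ) (z : M) (W : Set (Dual n))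
    (i : Fin n) (e : OpenPartialHomeomorph M (E n)) : Prop where
  mem : e ∈ IsManifold.maximalAtlas 𝓘(ℝ, E n) ∞ M
  source_subset : e.source ⊆ expMap L c z '' W
  straight : ∀ x ∈ e.source, components e (gradient L (uFun L c z W)) x = basisVec i

/-- The ratio `e^{ς(η(t))} / s_{K,N}(t)^N`, where `m = e^ς dx^1 ⋯ dx^n` in the chart `e`. -/
def mcpRatio (m : Measure M) (L : TangentBundle 𝓘(ℝ, E n) M → ℝ) (z : M) (α : Dual n) (K N : ℝ)
    (e : OpenPartialHomeomorph M (E n)) (t : ℝ) : ℝ :=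
  Real.exp (-logDensity m e (e (curve L z α t))) / (sKN K N t) ^ N

/-- The measure contraction property along `η` up to the time `T_α`: around every `η(T)`,
`0 < T < T_α`, there is a chart with `∇u_z^c ≡ ∂_{x^i}` in which the above ratio is non-increasing
in `t` near `T`. -/
def MCPAlong (m : Measure M) (L : TangentBundle 𝓘(ℝ, E n) M → ℝ) (c : ℝ) (z : M) (α : Dual n)
    (K N : ℝ) (i : Fin n) : Prop :=
  ∀ T : ℝ, 0 < T → (T : EReal) < cutTime L c z α →
    ∃ (W : Set (Dual n)) (e : OpenPartialHomeomorph M (E n)) (a b : ℝ),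
      IsRegularDomain L c z W ∧ IsStraightChart L c z W i e ∧
      0 ≤ a ∧ T ∈ Ioo a b ∧
      (∀ t ∈ Ioo a b, t • α ∈ W ∧ curve L z α t ∈ e.source) ∧
      AntitoneOn (mcpRatio m L z α K N e) (Ioo a b)

end MCP

end HamLap

end

/-!
The functions `u_z^c` solve the Hamilton–Jacobi equation `H(du) = c`: by the first variation of
the action, the differential of `u_z^c` at the end point of an integral curve issuing from the
fibre at `z` is the covector `Φ_t(α)` that the curve has reached. This is `hasFDerivAt_potential`,
which states that `u_z^c ∘ exp_z^c` has the pull-back of the canonical one-form as differential,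
and `IsRegularDomain.dform_uFun`. It rests on the smoothness of the Hamiltonian flow off the zero
section: the Legendre transform is smooth there by the implicit function theorem, and flows of
smooth vector fields are smooth because the derivative of a flow solves the variational equation.

Hence the graph of `du_z^c` is a Lagrangian submanifold invariant under the flow
(`IsRegularDomain.graph_invariant`), and the projected flow lines are the integral curves of the
gradient. The Laplacian is therefore the logarithmic derivative, along such a curve, of the
Jacobian `J` of the projected flow on the graph, weighted by the density of the measure. In a
canonical frame (`IsJacobiFamily.exists_orthFrame`), the operator `K` that represents `J`
satisfies `K'' = M K`, where the trace of `M` is minus the Ricci curvature (`exists_frame_ricci`),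
and `K' K⁻¹` is symmetric because the graph is Lagrangian. The Cauchy–Schwarz inequality for the
trace turns this into a Riccati inequality (`IsOrthFrame.riccati`). Including the weight, the Laplacian
`f` along the curve satisfies `f' ≤ -Ric_N - f²/N` (`IsRegularDomain.exists_deriv_laplacian`), and
a comparison of scalar Riccati inequalities (`riccati_comparison`) bounds `f` by the logarithmic
derivative of `s_{K,N}^N`, and shows that `s_{K,N}` has no zero before the end of the interval.

In coordinates with `∇u_z^c = ∂_{x^i}`, the divergence of the gradient is the derivative of the
log-density of the measure along the curve (`IsStraightChart.hasDerivAt_logDensity`). So the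
density ratio is non-increasing exactly when the Laplacian is bounded by the logarithmic
derivative of `s_{K,N}^N` (`IsStraightChart.antitoneOn_mcpRatio_iff`). Such coordinates exist
around every point of a curve before the cut time (`IsRegularDomain.exists_isStraightChart`): the
flow time and parameters for a hypersurface of initial covectors.

Local computations take place in the preferred charts of the manifold; the transformation rules
`exists_symplectic_lift`, `divE_chart_change` and `weight_eq` make their results independent of
the chart.
-/


noncomputable section

set_option linter.unusedSectionVars false
set_option linter.style.haveILetI false

namespace HamLap

/-! ### Smooth dependence of solutions of ordinary differential equations on the initial value -/

section ODE

open Metric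

universe u

/-- `Φ` is a local flow of the vector field `f`, for the times `|t| < ε` and the initial values in
the ball of radius `r` about `x₀`. -/
def IsLocalFlow {F : Type*} [NormedAddCommGroup F] [NormedSpace ℝ F] (f : F → F) (x₀ : F)
    (ε r : ℝ) (Φ : ℝ → F → F) : Prop :=
  ∀ x ∈ ball x₀ r, Φ 0 x = x ∧ ∀ t ∈ Ioo (-ε) ε, HasDerivAt (fun s => Φ s x) (f (Φ t x)) t

/-- Picard–Lindelöf, with continuity in the time and the initial value together. -/
theorem exists_isLocalFlow_continuousOn {F : Type*} [NormedAddCommGroup F] [NormedSpace ℝ F]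
    [CompleteSpace F] {f : F → F} {x₀ : F} (hf : ContDiffAt ℝ 1 f x₀) :
    ∃ (ε r : ℝ) (Φ : ℝ → F → F), 0 < ε ∧ 0 < r ∧ IsLocalFlow f x₀ ε r Φ ∧
      ContinuousOn (fun p : ℝ × F => Φ p.1 p.2) (Ioo (-ε) ε ×ˢ ball x₀ r) := by
  obtain ⟨ε, hε, a, r, L, K, hr, hpl⟩ := IsPicardLindelof.of_contDiffAt_one hf
  obtain ⟨α, h1, h2⟩ := (hpl 0).exists_forall_mem_closedBall_eq_hasDerivWithinAt_continuousOn
  refine ⟨ε, r, fun t x => α (x, t), hε, hr, ?_, ?_⟩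
  · intro x hx
    obtain ⟨h3, h4⟩ := h1 x (ball_subset_closedBall hx)
    refine ⟨h3, fun t ht => ?_⟩
    have h5 : t ∈ Icc (0 - ε) (0 + ε) := by constructor <;> linarith [ht.1, ht.2]
    exact (h4 t h5).hasDerivAt (Icc_mem_nhds (by linarith [ht.1]) (by linarith [ht.2]))
  · refine h2.comp (f := fun p : ℝ × F => (p.2, p.1)) (by fun_prop) ?_
    rintro ⟨t, x⟩ ⟨ht, hx⟩
    exact ⟨ball_subset_closedBall hx, by constructor <;> linarith [ht.1, ht.2]⟩

theorem gronwallBound_zero_eq_mul (K c T : ℝ) :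
    gronwallBound 0 K c T = c * gronwallBound 0 K 1 T := by
  unfold gronwallBound
  split_ifs <;> ring

/-- A solution starting at `φ 0 + h` is approximated to second order in `h` by `φ + A h`, where
`A` solves the variational equation along `φ`. -/
theorem norm_sub_variation_le {F : Type*} [NormedAddCommGroup F] [NormedSpace ℝ F]
    {f : F → F} {f' : F → F →L[ℝ] F} {B : Set F} {K : NNReal} {C D T : ℝ}
    {φ χ : ℝ → F} {A : ℝ → F →L[ℝ] F} {h : F}
    (hlip : LipschitzOnWith K f B)
    (hquad : ∀ p ∈ B, ∀ q ∈ B, ‖f q - f p - f' p (q - p)‖ ≤ D * ‖q - p‖ ^ 2) (hD : 0 ≤ D)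
    (hT : 0 ≤ T)
    (hφ : ∀ t ∈ Icc 0 T, HasDerivAt φ (f (φ t)) t)
    (hχ : ∀ t ∈ Icc 0 T, HasDerivAt χ (f (χ t)) t)
    (hA : ∀ t ∈ Icc 0 T, HasDerivAt A ((f' (φ t)).comp (A t)) t)
    (hA0 : A 0 = 1) (h0 : χ 0 = φ 0 + h)
    (hφB : ∀ t ∈ Icc 0 T, φ t ∈ B) (hχB : ∀ t ∈ Icc 0 T, χ t ∈ B)
    (hAB : ∀ t ∈ Icc 0 T, φ t + A t h ∈ B) (hC : ∀ t ∈ Icc 0 T, ‖A t‖ ≤ C) :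
    ‖χ T - φ T - A T h‖ ≤ D * (C * ‖h‖) ^ 2 * gronwallBound 0 K 1 T := by
  have hg : ∀ t ∈ Icc 0 T, HasDerivAt (fun s => φ s + A s h)
      (f (φ t) + f' (φ t) (A t h)) t := fun t ht =>
    (hφ t ht).add ((hA t ht).clm_apply (hasDerivAt_const t h) |>.congr_deriv (by simp))
  have key := dist_le_of_approx_trajectories_ODE_of_mem (v := fun _ => f) (s := fun _ => B)
    (f := χ) (g := fun s => φ s + A s h) (f' := fun t => f (χ t))
    (g' := fun t => f (φ t) + f' (φ t) (A t h)) (a := 0) (b := T) (δ := 0) (εf := 0)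
    (εg := D * (C * ‖h‖) ^ 2) (K := K) (fun _ _ => hlip)
    (fun t ht => (hχ t ht).continuousAt.continuousWithinAt)
    (fun t ht => (hχ t (Ico_subset_Icc_self ht)).hasDerivWithinAt)
    (fun t ht => by simp) (fun t ht => hχB t (Ico_subset_Icc_self ht))
    (fun t ht => (hg t ht).continuousAt.continuousWithinAt)
    (fun t ht => (hg t (Ico_subset_Icc_self ht)).hasDerivWithinAt)
    (fun t ht => ?_) (fun t ht => hAB t (Ico_subset_Icc_self ht)) (by simp [hA0, h0])
    T ⟨hT, le_rfl⟩
  · rw [zero_add, sub_zero, gronwallBound_zero_eq_mul, dist_eq_norm] at key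
    rwa [sub_sub]
  · have ht' := Ico_subset_Icc_self ht
    have h1 := hquad _ (hφB t ht') _ (hAB t ht')
    rw [add_sub_cancel_left] at h1
    rw [dist_comm, dist_eq_norm, ← sub_sub]
    refine h1.trans (mul_le_mul_of_nonneg_left ?_ hD)
    gcongr
    exact (A t).le_of_opNorm_le (hC t ht') h

/-- On a small ball a smooth vector field is Lipschitz and its Taylor expansion of order one has a
quadratic remainder, with uniform constants. -/
theorem exists_ball_quadratic_estimate {F : Type*} [NormedAddCommGroup F] [NormedSpace ℝ F]
    {f : F → F} {x₀ : F} (hf : ContDiffAt ℝ ∞ f x₀) (m : ℕ) :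
    ∃ (R : ℝ) (K D : NNReal), 0 < R ∧ (∀ x ∈ ball x₀ R, ContDiffAt ℝ m f x) ∧
      LipschitzOnWith K f (ball x₀ R) ∧
      ∀ p ∈ ball x₀ R, ∀ q ∈ ball x₀ R,
        ‖f q - f p - fderiv ℝ f p (q - p)‖ ≤ D * ‖q - p‖ ^ 2 := by
  have hf2 : ContDiffAt ℝ 2 f x₀ := mod_cast contDiffAt_infty.1 hf 2
  obtain ⟨K, s, hs, hK⟩ := (hf2.of_le one_le_two).exists_lipschitzOnWith
  obtain ⟨D, s', hs', hD⟩ :=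
    (hf2.fderiv_right (m := 1) (by norm_num)).exists_lipschitzOnWith
  have hev : ∀ᶠ x in 𝓝 x₀, ContDiffAt ℝ 2 f x := hf2.eventually (by simp)
  have hev' : ∀ᶠ x in 𝓝 x₀, ContDiffAt ℝ m f x := (contDiffAt_infty.1 hf m).eventually (by simp)
  obtain ⟨R, hR, hsub⟩ := Metric.mem_nhds_iff.1 (inter_mem (inter_mem hs hs') (hev.and hev'))
  refine ⟨R, K, D, hR, fun x hx => (hsub hx).2.2, hK.mono fun x hx => (hsub hx).1.1, ?_⟩
  intro p hp q hq
  have hseg : segment ℝ p q ⊆ ball x₀ R := (convex_ball x₀ R).segment_subset hp hq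
  have h := (convex_segment p q).norm_image_sub_le_of_norm_hasFDerivWithin_le'
    (f := f) (f' := fderiv ℝ f) (φ := fderiv ℝ f p) (C := D * ‖q - p‖)
    (fun x hx => (ContDiffAt.differentiableAt (n := 2) (hsub (hseg hx)).2.1
      (by norm_num)).hasFDerivAt.hasFDerivWithinAt) (fun x hx => ?_)
    (left_mem_segment ℝ p q) (right_mem_segment ℝ p q)
  · calc _ ≤ _ := h
      _ = _ := by ring
  · have h1 := hD.dist_le_mul x (hsub (hseg hx)).1.2 p (hsub hp).1.2
    rw [dist_eq_norm, dist_eq_norm] at h1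
    refine h1.trans ?_
    gcongr
    obtain ⟨a, b, ha, hb, hab, rfl⟩ := hx
    have : a • p + b • q - p = b • (q - p) := by
      rw [← eq_sub_iff_add_eq] at hab; subst hab; module
    rw [this, norm_smul, Real.norm_of_nonneg hb]
    exact mul_le_of_le_one_left (norm_nonneg _) (by linarith)

/-- A local flow is differentiable, and its derivative with respect to the initial value solves the
variational equation. -/
theorem hasFDerivAt_of_variation {F : Type*} [NormedAddCommGroup F] [NormedSpace ℝ F]
    {f : F → F} {x₀ : F} {ε r ρ : ℝ} {K D : NNReal} {Φ : ℝ → F → F} {A : ℝ → F → F →L[ℝ] F}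
    (hlip : LipschitzOnWith K f (ball x₀ (2 * ρ)))
    (hquad : ∀ p ∈ ball x₀ (2 * ρ), ∀ q ∈ ball x₀ (2 * ρ),
        ‖f q - f p - fderiv ℝ f p (q - p)‖ ≤ D * ‖q - p‖ ^ 2)
    (hΦ : IsLocalFlow f x₀ ε r Φ)
    (hA0 : ∀ x ∈ ball x₀ r, A 0 x = 1)
    (hA : ∀ x ∈ ball x₀ r, ∀ t ∈ Ioo (-ε) ε,
      HasDerivAt (fun s => A s x) ((fderiv ℝ f (Φ t x)).comp (A t x)) t)
    (hρ : 0 < ρ) (hΦρ : ∀ x ∈ ball x₀ r, ∀ t ∈ Ioo (-ε) ε, Φ t x ∈ ball x₀ ρ)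
    (hAρ : ∀ x ∈ ball x₀ r, ∀ t ∈ Ioo (-ε) ε, ‖A t x‖ ≤ 2)
    (hAc : ContinuousOn (fun p : ℝ × F => A p.1 p.2) (Ioo (-ε) ε ×ˢ ball x₀ r))
    {x : F} (hx : x ∈ ball x₀ r) {t : ℝ} (ht : t ∈ Ioo (-ε) ε) :
    HasFDerivAt (fun p : ℝ × F => Φ p.1 p.2)
      ((ContinuousLinearMap.fst ℝ ℝ F).smulRight (f (Φ t x)) +
        (A t x).comp (ContinuousLinearMap.snd ℝ ℝ F)) (t, x) := by
  have hε : 0 < ε := by linarith [ht.1, ht.2]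
  set G := gronwallBound 0 K 1 ε with hG
  have hG0 : 0 ≤ G := by
    have := gronwallBound_mono (δ := 0) (K := K) (ε := 1) le_rfl zero_le_one K.2 hε.le
    rwa [gronwallBound_x0] at this
  -- the second order estimate, for positive and for negative times
  have est : ∀ s ∈ Ioo (-ε) ε, ∀ y ∈ ball x₀ r, ‖y - x‖ ≤ ρ / 2 →
      ‖Φ s y - Φ s x - A s x (y - x)‖ ≤ D * (2 * ‖y - x‖) ^ 2 * G := by
    intro s hs y hy hyx
    have hmem : ∀ τ ∈ Ioo (-ε) ε, Φ τ x + A τ x (y - x) ∈ ball x₀ (2 * ρ) := by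
      intro τ hτ
      have h1 := hΦρ x hx τ hτ
      rw [mem_ball_iff_norm] at h1 ⊢
      have h2 : ‖A τ x (y - x)‖ ≤ 2 * (ρ / 2) :=
        (ContinuousLinearMap.le_of_opNorm_le _ (hAρ x hx τ hτ) _).trans (by gcongr)
      calc _ = ‖(Φ τ x - x₀) + A τ x (y - x)‖ := by congr 1; abel
        _ ≤ _ := norm_add_le _ _
        _ < 2 * ρ := by linarith
    have hball : ball x₀ ρ ⊆ ball x₀ (2 * ρ) := ball_subset_ball (by linarith)
    rcases le_total 0 s with h0 | h0
    · have hI : ∀ τ ∈ Icc 0 s, τ ∈ Ioo (-ε) ε := fun τ hτ =>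
        ⟨by linarith [hτ.1], by linarith [hτ.2, hs.2]⟩
      refine (norm_sub_variation_le (f' := fderiv ℝ f) (φ := fun s => Φ s x)
        (χ := fun s => Φ s y) (A := fun s => A s x) (C := 2) hlip hquad D.2 h0
        (fun τ hτ => (hΦ x hx).2 τ (hI τ hτ)) (fun τ hτ => (hΦ y hy).2 τ (hI τ hτ))
        (fun τ hτ => hA x hx τ (hI τ hτ)) (hA0 x hx) ?_
        (fun τ hτ => hball (hΦρ x hx τ (hI τ hτ))) (fun τ hτ => hball (hΦρ y hy τ (hI τ hτ)))
        (fun τ hτ => hmem τ (hI τ hτ)) (fun τ hτ => hAρ x hx τ (hI τ hτ))).trans ?_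
      · simp only [(hΦ x hx).1, (hΦ y hy).1]; abel
      · gcongr
        exact gronwallBound_mono le_rfl zero_le_one K.2 hs.2.le
    -- for negative times, reverse time and apply the estimate to the vector field `-f`
    · have hI : ∀ τ ∈ Icc 0 (-s), -τ ∈ Ioo (-ε) ε := fun τ hτ =>
        ⟨by linarith [hτ.2, hs.1], by linarith [hτ.1]⟩
      have hneg : fderiv ℝ (fun z => -f z) = fun z => -fderiv ℝ f z := by
        ext1 z; exact fderiv_fun_neg
      have hrev : ∀ {g : ℝ → F} {g' : F} {τ : ℝ}, HasDerivAt g g' (-τ) →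
          HasDerivAt (fun s => g (-s)) (-g') τ := by
        intro g g' τ h
        have := HasDerivAt.scomp τ h (hasDerivAt_neg τ)
        simpa [Function.comp_def] using this
      have hrevA : ∀ {g : ℝ → F →L[ℝ] F} {g' : F →L[ℝ] F} {τ : ℝ}, HasDerivAt g g' (-τ) →
          HasDerivAt (fun s => g (-s)) (-g') τ := by
        intro g g' τ h
        have := HasDerivAt.scomp τ h (hasDerivAt_neg τ)
        simpa [Function.comp_def] using this
      have hmain := norm_sub_variation_le (f := fun z => -f z) (f' := fderiv ℝ (fun z => -f z))
        (φ := fun s => Φ (-s) x)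
        (χ := fun s => Φ (-s) y) (A := fun s => A (-s) x) (C := 2) (T := -s) (h := y - x)
        (B := ball x₀ (2 * ρ)) (K := K) (D := D)
        (hlip.neg) (fun p hp q hq => by
          rw [hneg]
          have := hquad p hp q hq
          rw [← norm_neg] at this
          have e : -f q - -f p - (-fderiv ℝ f p) (q - p) =
              -(f q - f p - fderiv ℝ f p (q - p)) := by rw [neg_apply]; abel
          rwa [e]) D.2 (by linarith)
        (fun τ hτ => hrev ((hΦ x hx).2 (-τ) (hI τ hτ)))
        (fun τ hτ => hrev ((hΦ y hy).2 (-τ) (hI τ hτ)))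
        (fun τ hτ => by
          rw [hneg, ContinuousLinearMap.neg_comp]
          exact hrevA (hA x hx (-τ) (hI τ hτ))) (by simp [hA0 x hx])
        (by simp only [neg_zero, (hΦ x hx).1, (hΦ y hy).1]; abel)
        (fun τ hτ => hball (hΦρ x hx _ (hI τ hτ))) (fun τ hτ => hball (hΦρ y hy _ (hI τ hτ)))
        (fun τ hτ => hmem _ (hI τ hτ)) (fun τ hτ => hAρ x hx _ (hI τ hτ))
      simp only [neg_neg] at hmain
      refine hmain.trans ?_
      gcongr
      exact gronwallBound_mono le_rfl zero_le_one K.2 (by linarith [hs.1])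
  have hdt := (hΦ x hx).2 t ht
  have hnhds : Ioo (-ε) ε ×ˢ ball x₀ r ∈ 𝓝 (t, x) :=
    (isOpen_Ioo.prod isOpen_ball).mem_nhds ⟨ht, hx⟩
  have hAcx : ContinuousAt (fun p : ℝ × F => A p.1 x) (t, x) := by
    have h1 : ContinuousAt (fun p : ℝ × F => A p.1 p.2) ((t, x) : ℝ × F) :=
      hAc.continuousAt hnhds
    exact ContinuousAt.comp (f := fun p : ℝ × F => (p.1, x)) (x := (t, x)) h1 (by fun_prop)
  rw [hasFDerivAt_iff_isLittleO]
  -- split the increment into a change of the initial value and a change of time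
  have e1 : (fun p : ℝ × F => Φ p.1 p.2 - Φ p.1 x - A p.1 x (p.2 - x))
      =o[𝓝 (t, x)] fun p => p - (t, x) := by
    have hO : (fun p : ℝ × F => Φ p.1 p.2 - Φ p.1 x - A p.1 x (p.2 - x))
        =O[𝓝 (t, x)] fun p => ‖p - (t, x)‖ ^ 2 := by
      refine Asymptotics.IsBigO.of_bound (D * 4 * G) ?_
      filter_upwards [hnhds, (ball_mem_nhds ((t, x) : ℝ × F) (half_pos hρ))] with p hp hp2
      have hle : ‖p.2 - x‖ ≤ ‖p - (t, x)‖ := by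
        have := norm_snd_le (p - (t, x)); simpa using this
      have h2 := est p.1 hp.1 p.2 hp.2 (hle.trans (by
        rw [mem_ball_iff_norm] at hp2; exact hp2.le))
      refine h2.trans ?_
      rw [Real.norm_of_nonneg (by positivity)]
      have : ‖p.2 - x‖ ^ 2 ≤ ‖p - (t, x)‖ ^ 2 := by gcongr
      have hD0 : (0 : ℝ) ≤ D * 4 * G := by positivity
      nlinarith [mul_le_mul_of_nonneg_left this hD0]
    refine hO.trans_isLittleO ?_
    have h3 : Tendsto (fun p : ℝ × F => ‖p - (t, x)‖) (𝓝 (t, x)) (𝓝 0) := by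
      have : Continuous fun p : ℝ × F => ‖p - (t, x)‖ := by fun_prop
      simpa using this.tendsto (t, x)
    have h4 : (fun p : ℝ × F => ‖p - (t, x)‖) =o[𝓝 (t, x)] fun _ => (1 : ℝ) :=
      (Asymptotics.isLittleO_one_iff ℝ).2 h3
    have h5 := h4.mul_isBigO (Asymptotics.isBigO_refl (fun p : ℝ × F => ‖p - (t, x)‖) (𝓝 (t, x)))
    simp only [one_mul, ← sq] at h5
    exact h5.of_norm_right
  have e2 : (fun p : ℝ × F => Φ p.1 x - Φ t x - (p.1 - t) • f (Φ t x))
      =o[𝓝 (t, x)] fun p => p - (t, x) := by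
    have h1 := hasDerivAt_iff_isLittleO.1 hdt
    have h2 : Tendsto (fun p : ℝ × F => p.1) (𝓝 (t, x)) (𝓝 t) := continuous_fst.tendsto (t, x)
    refine (h1.comp_tendsto h2).trans_isBigO (Asymptotics.IsBigO.of_bound 1 ?_)
    filter_upwards with p
    have := norm_fst_le (p - (t, x))
    simpa using this
  have e3 : (fun p : ℝ × F => A p.1 x (p.2 - x) - A t x (p.2 - x))
      =o[𝓝 (t, x)] fun p => p - (t, x) := by
    have h1 : (fun p : ℝ × F => A p.1 x - A t x) =o[𝓝 (t, x)] fun _ => (1 : ℝ) := by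
      rw [Asymptotics.isLittleO_one_iff]
      have := hAcx.tendsto.sub_const (A t x)
      simpa using this
    have h2 : (fun p : ℝ × F => ‖A p.1 x - A t x‖ * ‖p.2 - x‖)
        =o[𝓝 (t, x)] fun p => (1 : ℝ) * ‖p - (t, x)‖ := by
      refine h1.norm_left.mul_isBigO (Asymptotics.IsBigO.of_bound 1 ?_)
      filter_upwards with p
      have := norm_snd_le (p - (t, x))
      simpa using this
    simp only [one_mul] at h2
    refine Asymptotics.IsBigO.trans_isLittleO (Asymptotics.IsBigO.of_bound 1 ?_) h2.of_norm_right
    filter_upwards with p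
    rw [one_mul, Real.norm_of_nonneg (by positivity), ← sub_apply]
    exact ContinuousLinearMap.le_opNorm _ _
  refine ((e1.add e2).add e3).congr_left fun p => ?_
  simp only [add_apply, ContinuousLinearMap.smulRight_apply,
    ContinuousLinearMap.coe_fst', ContinuousLinearMap.comp_apply,
    ContinuousLinearMap.coe_snd', Prod.fst_sub, Prod.snd_sub]
  abel

/-- Local flows of smooth vector fields exist and are of class `C^k` for each finite `k`: the flow
of `f` together with its derivative is the flow of the variational system `(f(x), Df(x) ∘ A)`, so
the order of differentiability can be raised one by one. -/
theorem exists_isLocalFlow_contDiffOn (k : ℕ) : ∀ {F : Type u} [NormedAddCommGroup F]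
    [NormedSpace ℝ F] [CompleteSpace F] {f : F → F} {x₀ : F}, ContDiffAt ℝ ∞ f x₀ →
    ∃ (ε r : ℝ) (Φ : ℝ → F → F), 0 < ε ∧ 0 < r ∧ IsLocalFlow f x₀ ε r Φ ∧
      ContDiffOn ℝ k (fun p : ℝ × F => Φ p.1 p.2) (Ioo (-ε) ε ×ˢ ball x₀ r) := by
  induction k with
  | zero =>
    intro F _ _ _ f x₀ hf
    obtain ⟨ε, r, Φ, h1, h2, h3, h4⟩ := exists_isLocalFlow_continuousOn
      (f := f) (x₀ := x₀)
      (mod_cast contDiffAt_infty.1 hf 1)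
    exact ⟨ε, r, Φ, h1, h2, h3, by rw [Nat.cast_zero]; exact contDiffOn_zero.2 h4⟩
  | succ k ih =>
    intro F _ _ _ f x₀ hf
    obtain ⟨R, K, D, hR, hCk, hlip, hquad⟩ := exists_ball_quadratic_estimate hf k
    -- the variational system; its solution from `(x, 1)` is the flow with its derivative
    set V : F × (F →L[ℝ] F) → F × (F →L[ℝ] F) :=
      fun z => (f z.1, (fderiv ℝ f z.1).comp z.2) with hV
    have hVs : ContDiffAt ℝ ∞ V (x₀, 1) := by
      have h1 : ContDiffAt ℝ ∞ (fun z : F × (F →L[ℝ] F) => f z.1) (x₀, 1) :=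
        ContDiffAt.comp (x₀, 1) (f := Prod.fst) (g := f) hf contDiffAt_fst
      have h2 : ContDiffAt ℝ ∞ (fun z : F × (F →L[ℝ] F) => fderiv ℝ f z.1) (x₀, 1) :=
        ContDiffAt.comp (x₀, 1) (f := Prod.fst) (g := fderiv ℝ f)
          (hf.fderiv_right (m := ∞) (by exact_mod_cast le_rfl)) contDiffAt_fst
      exact h1.prodMk (h2.clm_comp contDiffAt_snd)
    obtain ⟨ε, r, Ψ, hε, hr, hΨ, hΨk⟩ := ih hVs
    have hcont : ContinuousAt (fun p : ℝ × F => Ψ p.1 (p.2, 1)) (0, x₀) := by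
      have h1 : ContinuousAt (fun p : ℝ × (F × (F →L[ℝ] F)) => Ψ p.1 p.2) (0, (x₀, 1)) :=
        hΨk.continuousOn.continuousAt ((isOpen_Ioo.prod isOpen_ball).mem_nhds
          ⟨⟨by linarith, hε⟩, mem_ball_self hr⟩)
      exact ContinuousAt.comp (f := fun p : ℝ × F => (p.1, (p.2, (1 : F →L[ℝ] F))))
        (x := (0, x₀)) h1 (by fun_prop)
    -- within `ρ` of `(x₀, 1)` the flow stays in the ball of the estimates and its derivative has
    -- norm at most `2`
    set ρ := min (R / 2) 1 with hρd
    have hρ : 0 < ρ := by positivity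
    have h00 : Ψ 0 (x₀, 1) = (x₀, 1) := (hΨ _ (mem_ball_self hr)).1
    have hnear : ∀ᶠ p : ℝ × F in 𝓝 (0, x₀), Ψ p.1 (p.2, 1) ∈
        ball ((x₀, 1) : F × (F →L[ℝ] F)) ρ := by
      have := hcont.tendsto
      simp only [h00] at this
      exact this (ball_mem_nhds _ hρ)
    obtain ⟨η, hη, hnear⟩ := Metric.eventually_nhds_iff_ball.1 hnear
    set ε' := min ε η
    set r' := min r η
    have hlift : ∀ x ∈ ball x₀ r', ((x, 1) : F × (F →L[ℝ] F)) ∈ ball (x₀, 1) r := by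
      intro x hx
      rw [mem_ball, Prod.dist_eq, dist_self]
      simpa [hr] using lt_of_lt_of_le hx (min_le_left _ _)
    have hε's : Ioo (-ε') ε' ⊆ Ioo (-ε) ε :=
      Ioo_subset_Ioo (neg_le_neg (min_le_left _ _)) (min_le_left _ _)
    have hnear' : ∀ x ∈ ball x₀ r', ∀ t ∈ Ioo (-ε') ε',
        Ψ t (x, 1) ∈ ball ((x₀, 1) : F × (F →L[ℝ] F)) ρ := by
      intro x hx t ht
      refine hnear (t, x) ?_
      rw [← ball_prod_same]
      refine ⟨?_, ball_subset_ball (min_le_right _ _) hx⟩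
      rw [Real.ball_eq_Ioo, zero_sub, zero_add]
      exact Ioo_subset_Ioo (neg_le_neg (min_le_right _ _)) (min_le_right _ _) ht
    have hsub : Ioo (-ε') ε' ×ˢ ball x₀ r' ⊆
        (fun p : ℝ × F => (p.1, (p.2, (1 : F →L[ℝ] F)))) ⁻¹' (Ioo (-ε) ε ×ˢ ball (x₀, 1) r) := by
      rintro ⟨t, x⟩ ⟨ht, hx⟩
      exact ⟨hε's ht, hlift x hx⟩
    have hΨ' : ContDiffOn ℝ k (fun p : ℝ × F => Ψ p.1 (p.2, 1)) (Ioo (-ε') ε' ×ˢ ball x₀ r') :=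
      hΨk.comp (f := fun p : ℝ × F => (p.1, (p.2, (1 : F →L[ℝ] F))))
        (by fun_prop) hsub
    have hflow : IsLocalFlow f x₀ ε' r' fun t x => (Ψ t (x, 1)).1 := by
      intro x hx
      refine ⟨by simp [(hΨ _ (hlift x hx)).1], fun t ht => ?_⟩
      exact ((hΨ _ (hlift x hx)).2 t (hε's ht)).fst
    have hd := fun (x : F) (hx : x ∈ ball x₀ r') (t : ℝ) (ht : t ∈ Ioo (-ε') ε') =>
      hasFDerivAt_of_variation (A := fun t x => (Ψ t (x, 1)).2) (ρ := ρ)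
      (hlip.mono (ball_subset_ball (by linarith [min_le_left (R / 2) 1])))
      (fun p hp q hq => hquad p (ball_subset_ball (by linarith [min_le_left (R / 2) 1]) hp)
        q (ball_subset_ball (by linarith [min_le_left (R / 2) 1]) hq))
      hflow (fun x hx => by simp [(hΨ _ (hlift x hx)).1])
      (fun x hx t ht => ((hΨ _ (hlift x hx)).2 t (hε's ht)).snd) hρ
      (fun x hx t ht => by
        have := hnear' x hx t ht
        rw [mem_ball, Prod.dist_eq] at this
        exact lt_of_le_of_lt (le_max_left _ _) this)
      (fun x hx t ht => by
        have := hnear' x hx t ht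
        rw [mem_ball, Prod.dist_eq] at this
        have h1 := lt_of_le_of_lt (le_max_right _ _) this
        rw [dist_eq_norm] at h1
        have h2 : ‖(1 : F →L[ℝ] F)‖ ≤ 1 := ContinuousLinearMap.norm_id_le
        calc ‖(Ψ t (x, 1)).2‖ = ‖((Ψ t (x, 1)).2 - 1) + 1‖ := by rw [sub_add_cancel]
          _ ≤ _ := norm_add_le _ _
          _ ≤ 2 := by linarith [min_le_right (R / 2) 1]) (hΨ'.snd.continuousOn) hx ht
    refine ⟨ε', r', fun t x => (Ψ t (x, 1)).1, by positivity, by positivity, hflow, ?_⟩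
    have hopen : IsOpen (Ioo (-ε') ε' ×ˢ ball x₀ r') := isOpen_Ioo.prod isOpen_ball
    -- the derivative of the flow is made of quantities that are `C^k` by induction
    rw [Nat.cast_succ, contDiffOn_succ_iff_fderiv_of_isOpen hopen]
    refine ⟨fun p hp => (hd p.2 hp.2 p.1 hp.1).differentiableAt.differentiableWithinAt, by simp, ?_⟩
    have hf1 : ContDiffOn ℝ k (fun p : ℝ × F => f (Ψ p.1 (p.2, 1)).1)
        (Ioo (-ε') ε' ×ˢ ball x₀ r') := by
      intro p hp
      have hb : (Ψ p.1 (p.2, 1)).1 ∈ ball x₀ R := by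
        have := hnear' p.2 hp.2 p.1 hp.1
        rw [mem_ball, Prod.dist_eq] at this
        rw [mem_ball]
        linarith [le_max_left (dist (Ψ p.1 (p.2, 1)).1 x₀) (dist (Ψ p.1 (p.2, 1)).2 1),
          min_le_left (R / 2) 1]
      exact (hCk _ hb).comp_contDiffWithinAt p (hΨ'.fst p hp)
    refine ContDiffOn.congr (f := fun p : ℝ × F =>
      (ContinuousLinearMap.fst ℝ ℝ F).smulRight (f (Ψ p.1 (p.2, 1)).1) +
        ((Ψ p.1 (p.2, 1)).2).comp (ContinuousLinearMap.snd ℝ ℝ F)) ?_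
      fun p hp => (hd p.2 hp.2 p.1 hp.1).fderiv
    exact ((contDiffOn_const).smulRight hf1).add (hΨ'.snd.clm_comp contDiffOn_const)

end ODE

/-! ### The Legendre transform on a fibre and in families -/

section Legendre

variable {n : ℕ}

/-- A Lagrangian on a single fibre, identified with the model space. -/
structure IsFibreLagrangian (g : E n → ℝ) : Prop where
  nonneg : ∀ w, 0 ≤ g w
  zero : g 0 = 0
  contDiff_one : ContDiff ℝ 1 g
  smooth : ∀ w ≠ 0, ContDiffAt ℝ ∞ g w
  convex : ∀ w ≠ 0, ∀ a ≠ 0, 0 < fderiv ℝ (fderiv ℝ g) w a a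
  superlinear : ∀ β : Dual n, BddAbove (range fun w => β w - g w)

/-- The Legendre dual function of `g`. -/
def legH (g : E n → ℝ) (ξ : Dual n) : ℝ := ⨆ w : E n, (ξ w - g w)

/-- The point where the supremum defining `legH g ξ` is attained. -/
def legT (g : E n → ℝ) (ξ : Dual n) : E n :=
  Classical.epsilon fun w : E n => legH g ξ = ξ w - g w

theorem one_add_one_le_infty : (1 : WithTop ℕ∞) + 1 ≤ ∞ := by
  rw [one_add_one_eq_two]
  exact WithTop.coe_le_coe.2 (le_top (a := (2 : ℕ∞)))

theorem strictMono_of_deriv_pos_off_point {ψ : ℝ → ℝ} (hc : Continuous ψ) (t₀ : ℝ)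
    (h : ∀ t ≠ t₀, 0 < deriv ψ t) : StrictMono ψ := by
  refine StrictMonoOn.Iic_union_Ici (a := t₀)
    (strictMonoOn_of_deriv_pos (convex_Iic t₀) hc.continuousOn fun t ht => ?_)
    (strictMonoOn_of_deriv_pos (convex_Ici t₀) hc.continuousOn fun t ht => ?_)
  · rw [interior_Iic] at ht; exact h t (ne_of_lt ht)
  · rw [interior_Ici] at ht; exact h t (ne_of_gt ht)

namespace IsFibreLagrangian

variable {g : E n → ℝ} (hg : IsFibreLagrangian g)
include hg

theorem hasFDerivAt (w : E n) : HasFDerivAt g (fderiv ℝ g w) w :=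
  (hg.contDiff_one.differentiable one_ne_zero w).hasFDerivAt

theorem fderiv_zero : fderiv ℝ g 0 = 0 := by
  have : IsLocalMin g 0 := Filter.Eventually.of_forall fun w => by
    rw [hg.zero]; exact hg.nonneg w
  exact this.fderiv_eq_zero

/-- Strict convexity: the graph lies strictly above its tangent planes. -/
theorem tangent_lt {w v : E n} (hvw : v ≠ w) : g w + fderiv ℝ g w (v - w) < g v := by
  set γ : ℝ → E n := fun t => w + t • (v - w) with hγ
  have hγd : ∀ t, HasDerivAt γ (v - w) t := fun t =>
    (((hasDerivAt_id t).smul_const (v - w)).const_add w).congr_deriv (one_smul _ _)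
  have hφ : ∀ t, HasDerivAt (fun t => g (γ t)) (fderiv ℝ g (γ t) (v - w)) t := fun t =>
    (hg.hasFDerivAt (γ t)).comp_hasDerivAt t (hγd t)
  -- the Hessian is unavailable at the origin, which the segment meets at most once
  obtain ⟨t₀, ht₀⟩ : ∃ t₀, ∀ t ≠ t₀, γ t ≠ 0 := by
    by_cases h : ∃ t₀, γ t₀ = 0
    · obtain ⟨t₀, h0⟩ := h
      refine ⟨t₀, fun t ht h1 => ht ?_⟩
      have h2 : (t - t₀) • (v - w) = 0 := by
        have : γ t - γ t₀ = (t - t₀) • (v - w) := by simp only [hγ]; module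
        rw [← this, h0, h1, sub_zero]
      rcases smul_eq_zero.1 h2 with h3 | h3
      · linarith
      · exact absurd (sub_eq_zero.1 h3) hvw
    · push Not at h
      exact ⟨0, fun t _ => h t⟩
  have hmono : StrictMono fun t => fderiv ℝ g (γ t) (v - w) := by
    refine strictMono_of_deriv_pos_off_point ?_ t₀ fun t ht => ?_
    · have h1 : Continuous (fderiv ℝ g) := hg.contDiff_one.continuous_fderiv one_ne_zero
      have h2 : Continuous γ := continuous_iff_continuousAt.2 fun t => (hγd t).continuousAt
      exact (h1.comp h2).clm_apply continuous_const
    · have h1 : DifferentiableAt ℝ (fderiv ℝ g) (γ t) :=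
        ((hg.smooth _ (ht₀ t ht)).fderiv_right (m := 1) one_add_one_le_infty).differentiableAt
          one_ne_zero
      have h2 : HasDerivAt (fun t => fderiv ℝ g (γ t) (v - w))
          (fderiv ℝ (fderiv ℝ g) (γ t) (v - w) (v - w)) t := by
        simpa using (h1.hasFDerivAt.comp_hasDerivAt t (hγd t)).clm_apply
          (hasDerivAt_const t (v - w))
      rw [h2.deriv]
      exact hg.convex _ (ht₀ t ht) _ (sub_ne_zero.2 hvw)
  obtain ⟨t, ht, htt⟩ := exists_hasDerivAt_eq_slope (fun t => g (γ t))
    (fun t => fderiv ℝ g (γ t) (v - w)) zero_lt_one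
    (continuousOn_of_forall_continuousAt fun t _ => (hφ t).continuousAt)
    (fun t _ => hφ t)
  have h1 := hmono ht.1
  simp only [htt] at h1
  simp only [hγ, zero_smul, add_zero, one_smul, sub_zero, div_one, add_sub_cancel] at h1
  linarith

theorem le_legH (ξ : Dual n) (w : E n) : ξ w - g w ≤ legH g ξ :=
  le_ciSup (hg.superlinear ξ) w

theorem legH_eq_of_fderiv_eq {ξ : Dual n} {w : E n} (h : fderiv ℝ g w = ξ) :
    legH g ξ = ξ w - g w := by
  refine le_antisymm (ciSup_le fun v => ?_) (hg.le_legH ξ w)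
  by_cases hv : v = w
  · rw [hv]
  · have := hg.tangent_lt hv
    rw [h, map_sub] at this
    linarith

/-- A linear function minus a Lagrangian has a maximum: by super-linearity for the covectors
`ξ ± dx^i`, it tends to `-∞` at infinity. -/
theorem exists_fderiv_eq (ξ : Dual n) : ∃ w, fderiv ℝ g w = ξ := by
  have hcoer : ∃ C, ∀ w : E n, ‖w‖ ≤ (n + 1) * (g w - ξ w) + C := by
    choose C hC using fun β => hg.superlinear β
    have hC' : ∀ β w, β w - g w ≤ C β := fun β w => hC β (mem_range_self w)
    refine ⟨C ξ + ∑ i : Fin n, max (C (ξ + basisCov i)) (C (ξ - basisCov i)), fun w => ?_⟩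
    have h1 : ∀ i : Fin n, |w i| ≤ (g w - ξ w) +
        max (C (ξ + basisCov i)) (C (ξ - basisCov i)) := by
      intro i
      have h2 := hC' (ξ + basisCov i) w
      have h3 := hC' (ξ - basisCov i) w
      have h4 : (basisCov i : Dual n) w = w i := rfl
      rw [add_apply, h4] at h2
      rw [sub_apply, h4] at h3
      rw [abs_le]
      constructor
      · linarith [le_max_right (C (ξ + basisCov i)) (C (ξ - basisCov i))]
      · linarith [le_max_left (C (ξ + basisCov i)) (C (ξ - basisCov i))]
    have h2 : ‖w‖ ≤ ∑ i : Fin n, |w i| := by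
      have h3 : w = ∑ i : Fin n, w i • EuclideanSpace.single i (1 : ℝ) := by
        ext j; simp [Pi.single_apply]
      calc ‖w‖ = ‖∑ i : Fin n, w i • EuclideanSpace.single i (1 : ℝ)‖ := by rw [← h3]
        _ ≤ _ := norm_sum_le _ _
        _ = _ := by simp [norm_smul]
    have h3 := h2.trans (Finset.sum_le_sum fun i _ => h1 i)
    rw [Finset.sum_add_distrib, Finset.sum_const, Finset.card_univ, Fintype.card_fin,
      nsmul_eq_mul] at h3
    have h4 := hC' ξ w
    linarith
  obtain ⟨C, hC⟩ := hcoer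
  have hcont : Continuous fun w => g w - ξ w := hg.contDiff_one.continuous.sub ξ.continuous
  have htend : Tendsto (fun w => g w - ξ w) (cocompact (E n)) atTop := by
    have h1 : Tendsto (fun w : E n => ((n : ℝ) + 1)⁻¹ * (‖w‖ - C)) (cocompact (E n)) atTop := by
      refine Tendsto.const_mul_atTop (by positivity) ?_
      exact tendsto_atTop_add_const_right _ _ tendsto_norm_cocompact_atTop
    refine tendsto_atTop_mono (fun w => ?_) h1
    rw [inv_mul_le_iff₀ (by positivity)]
    linarith [hC w]
  obtain ⟨w, hw⟩ := hcont.exists_forall_le htend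
  refine ⟨w, ?_⟩
  have h1 : IsLocalMin (fun w => g w - ξ w) w := Filter.Eventually.of_forall hw
  have h2 : HasFDerivAt (fun w => g w - ξ w) (fderiv ℝ g w - ξ) w :=
    (hg.hasFDerivAt w).sub ξ.hasFDerivAt
  exact sub_eq_zero.1 (h1.hasFDerivAt_eq_zero h2)

theorem fderiv_injective : Function.Injective (fderiv ℝ g) := by
  intro w v h
  by_contra hne
  have h1 := hg.tangent_lt (w := w) (v := v) (Ne.symm hne)
  have h2 := hg.tangent_lt (w := v) (v := w) hne
  rw [h] at h1
  rw [← neg_sub v w, map_neg] at h2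
  linarith

theorem eq_of_legH_eq {ξ : Dual n} {w v : E n} (hw : fderiv ℝ g w = ξ)
    (hv : legH g ξ = ξ v - g v) : v = w := by
  by_contra hne
  have h1 := hg.tangent_lt hne
  rw [hw, map_sub] at h1
  have h2 := hg.legH_eq_of_fderiv_eq hw
  linarith

theorem legH_eq (ξ : Dual n) : legH g ξ = ξ (legT g ξ) - g (legT g ξ) := by
  obtain ⟨w, hw⟩ := hg.exists_fderiv_eq ξ
  exact Classical.epsilon_spec (p := fun w : E n => legH g ξ = ξ w - g w)
    ⟨w, hg.legH_eq_of_fderiv_eq hw⟩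

theorem fderiv_legT (ξ : Dual n) : fderiv ℝ g (legT g ξ) = ξ := by
  obtain ⟨w, hw⟩ := hg.exists_fderiv_eq ξ
  rw [hg.eq_of_legH_eq hw (hg.legH_eq ξ), hw]

theorem legT_eq {ξ : Dual n} {w : E n} (h : fderiv ℝ g w = ξ) : legT g ξ = w :=
  hg.fderiv_injective (by rw [hg.fderiv_legT, h])

theorem legT_ne_zero {ξ : Dual n} (hξ : ξ ≠ 0) : legT g ξ ≠ 0 := by
  intro h
  have := hg.fderiv_legT ξ
  rw [h, hg.fderiv_zero] at this
  exact hξ this.symm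

theorem legH_nonneg (ξ : Dual n) : 0 ≤ legH g ξ := by
  have := hg.le_legH ξ 0
  simpa [hg.zero] using this

theorem legH_zero : legH g 0 = 0 := by
  rw [hg.legH_eq_of_fderiv_eq hg.fderiv_zero, hg.zero]; simp

theorem legH_pos {ξ : Dual n} (hξ : ξ ≠ 0) : 0 < legH g ξ := by
  refine lt_of_le_of_ne (hg.legH_nonneg ξ) fun h => hg.legT_ne_zero hξ ?_
  refine (hg.eq_of_legH_eq (hg.fderiv_legT ξ) (v := 0) ?_).symm
  rw [← h, hg.zero]; simp

/-- The Hamiltonian is strictly increasing along rays. -/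
theorem legH_smul_lt {ξ : Dual n} (hξ : ξ ≠ 0) {a b : ℝ} (ha : 0 < a) (hab : a < b) :
    legH g (a • ξ) < legH g (b • ξ) := by
  set w := legT g (a • ξ)
  have h1 : legH g (a • ξ) = a * ξ w - g w := hg.legH_eq (a • ξ)
  have h2 : b * ξ w - g w ≤ legH g (b • ξ) := hg.le_legH (b • ξ) w
  have h3 := hg.legH_pos (smul_ne_zero ha.ne' hξ)
  have h4 := hg.nonneg w
  have h5 : 0 < ξ w := by
    by_contra h
    push Not at h
    nlinarith
  nlinarith

theorem le_of_le_smul {s : ℝ} (hs : 0 ≤ s) (hs1 : s ≤ 1) (w : E n) : g (s • w) ≤ s * g w := by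
  have key : ∀ v, g (s • w) + fderiv ℝ g (s • w) (v - s • w) ≤ g v := by
    intro v
    by_cases hv : v = s • w
    · rw [hv]; simp
    · exact (hg.tangent_lt hv).le
  have h1 := key w
  have h2 := key 0
  rw [hg.zero] at h2
  simp only [map_sub, map_smul, map_zero, smul_eq_mul] at h1 h2
  nlinarith

end IsFibreLagrangian

/-- A smooth family of Lagrangians on fibres, over an open subset `U` of the model space. -/
structure IsFamilyLagrangian (U : Set (E n)) (l : E n × E n → ℝ) : Prop where
  isOpen : IsOpen U
  fibre : ∀ y ∈ U, IsFibreLagrangian fun w => l (y, w)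
  smooth : ∀ y ∈ U, ∀ w ≠ 0, ContDiffAt ℝ ∞ l (y, w)
  continuousAt : ∀ y ∈ U, ∀ w, ContinuousAt l (y, w)

/-- The Hamiltonian of a family of Lagrangians. -/
def famH (l : E n × E n → ℝ) (p : E n × Dual n) : ℝ := legH (fun w => l (p.1, w)) p.2

/-- The Legendre transform of a family of Lagrangians. -/
def famT (l : E n × E n → ℝ) (p : E n × Dual n) : E n := legT (fun w => l (p.1, w)) p.2

theorem IsFibreLagrangian.isFamilyLagrangian {g : E n → ℝ} (hg : IsFibreLagrangian g) :
    IsFamilyLagrangian univ fun p : E n × E n => g p.2 where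
  isOpen := isOpen_univ
  fibre _ _ := hg
  smooth _ _ w hw := ContDiffAt.comp (_, w) (f := Prod.snd) (g := g) (hg.smooth w hw) contDiffAt_snd
  continuousAt _ _ _ := (hg.contDiff_one.continuous.comp continuous_snd).continuousAt

namespace IsFamilyLagrangian

variable {U : Set (E n)} {l : E n × E n → ℝ} (hl : IsFamilyLagrangian U l)
include hl

theorem fderiv_fibre {y : E n} (hy : y ∈ U) {w : E n} (hw : w ≠ 0) :
    fderiv ℝ (fun w => l (y, w)) w = (fderiv ℝ l (y, w)).comp
      (ContinuousLinearMap.inr ℝ (E n) (E n)) := by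
  have h1 := ((hl.smooth y hy w hw).differentiableAt (by simp)).hasFDerivAt
  exact (h1.comp w (hasFDerivAt_prodMk_right y w)).fderiv

theorem contDiffAt_fibreDeriv {y : E n} (hy : y ∈ U) {w : E n} (hw : w ≠ 0) :
    ContDiffAt ℝ ∞ (fun p : E n × E n => fderiv ℝ (fun v => l (p.1, v)) p.2) (y, w) := by
  have h1 : ContDiffAt ℝ ∞ (fun p : E n × E n =>
      (fderiv ℝ l p).comp (ContinuousLinearMap.inr ℝ (E n) (E n))) (y, w) :=
    ((hl.smooth y hy w hw).fderiv_right (m := ∞) (by exact_mod_cast le_rfl)).clm_comp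
      contDiffAt_const
  refine h1.congr_of_eventuallyEq ?_
  filter_upwards [(hl.isOpen.prod isOpen_compl_singleton).mem_nhds
    (show (y, w) ∈ U ×ˢ ({0}ᶜ : Set (E n)) from ⟨hy, hw⟩)] with p hp
  exact hl.fderiv_fibre hp.1 hp.2

theorem hasFDerivAt_fibreDeriv {y : E n} (hy : y ∈ U) {w : E n} (hw : w ≠ 0) :
    HasFDerivAt (fderiv ℝ fun v => l (y, v)) (fderiv ℝ (fderiv ℝ fun v => l (y, v)) w) w :=
  (((hl.fibre y hy).smooth w hw).fderiv_right (m := 1)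
    one_add_one_le_infty).differentiableAt one_ne_zero |>.hasFDerivAt

/-- The Legendre transform is smooth off the zero section, by the implicit function theorem for the
equation `D_w l (y, w) = ξ`. -/
theorem contDiffAt_famT {p : E n × Dual n} (hp : p.1 ∈ U) (hξ : p.2 ≠ 0) :
    ContDiffAt ℝ ∞ (famT l) p := by
  obtain ⟨y, ξ⟩ := p
  have hg := hl.fibre y hp
  set w := famT l (y, ξ) with hw
  have hw0 : w ≠ 0 := hg.legT_ne_zero hξ
  set f : (E n × Dual n) × E n → Dual n :=
    fun q => fderiv ℝ (fun v => l (q.1.1, v)) q.2 - q.1.2 with hf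
  have hf1 : ContDiffAt ℝ ∞ (fun q : (E n × Dual n) × E n =>
      fderiv ℝ (fun v => l (q.1.1, v)) q.2) ((y, ξ), w) :=
    ContDiffAt.comp ((y, ξ), w) (f := fun q : (E n × Dual n) × E n => (q.1.1, q.2))
      (hl.contDiffAt_fibreDeriv hp hw0) (by fun_prop)
  have hfs : ContDiffAt ℝ ∞ f ((y, ξ), w) := hf1.sub (by fun_prop)
  have hpart : (fderiv ℝ f ((y, ξ), w)).comp (ContinuousLinearMap.inr ℝ (E n × Dual n) (E n)) =
      fderiv ℝ (fderiv ℝ fun v => l (y, v)) w := by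
    have h1 := (hfs.differentiableAt (by simp)).hasFDerivAt.comp w
      (hasFDerivAt_prodMk_right (y, ξ) w)
    exact h1.unique ((hl.hasFDerivAt_fibreDeriv hp hw0).sub_const ξ)
  have hinv : ((fderiv ℝ f ((y, ξ), w)).comp
      (ContinuousLinearMap.inr ℝ (E n × Dual n) (E n))).IsInvertible := by
    rw [hpart]
    set B := fderiv ℝ (fderiv ℝ fun v => l (y, v)) w
    have hinj : Function.Injective (B : E n →ₗ[ℝ] Dual n) := by
      rw [injective_iff_map_eq_zero]
      intro a ha
      by_contra hne
      have h1 := hg.convex w hw0 a hne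
      have h2 : B a = 0 := ha
      have h3 : (0 : ℝ) < B a a := h1
      rw [h2] at h3
      simp at h3
    have hfr : Module.finrank ℝ (E n) = Module.finrank ℝ (Dual n) := by
      rw [← LinearEquiv.finrank_eq (LinearMap.toContinuousLinearMap :
        (E n →ₗ[ℝ] ℝ) ≃ₗ[ℝ] Dual n)]
      exact (Subspace.dual_finrank_eq (K := ℝ) (V := E n)).symm
    set eq := (LinearEquiv.ofInjectiveOfFinrankEq (B : E n →ₗ[ℝ] Dual n) hinj
        hfr).toContinuousLinearEquiv
    exact ⟨eq, by ext1 a; rfl⟩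
  have h0 : f ((y, ξ), w) = 0 := by
    simp only [hf]
    exact sub_eq_zero.2 (hg.fderiv_legT ξ)
  refine (hfs.contDiffAt_implicitFunction (by simp) hinv).congr_of_eventuallyEq ?_
  filter_upwards [hfs.eventually_apply_implicitFunction (by simp) hinv,
    (hl.isOpen.preimage continuous_fst).mem_nhds hp] with q hq hqU
  rw [h0] at hq
  exact (hl.fibre q.1 hqU).legT_eq (sub_eq_zero.1 hq)

theorem famH_eq {p : E n × Dual n} (hp : p.1 ∈ U) :
    famH l p = p.2 (famT l p) - l (p.1, famT l p) := (hl.fibre p.1 hp).legH_eq p.2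

theorem contDiffAt_famH {p : E n × Dual n} (hp : p.1 ∈ U) (hξ : p.2 ≠ 0) :
    ContDiffAt ℝ ∞ (famH l) p := by
  have hT := hl.contDiffAt_famT hp hξ
  have h1 : ContDiffAt ℝ ∞ (fun q : E n × Dual n => q.2 (famT l q) - l (q.1, famT l q)) p :=
    (contDiffAt_snd.clm_apply hT).sub
      (ContDiffAt.comp p (f := fun q : E n × Dual n => (q.1, famT l q)) (g := l)
        (hl.smooth p.1 hp _ ((hl.fibre _ hp).legT_ne_zero hξ)) (contDiffAt_fst.prodMk hT))
  refine h1.congr_of_eventuallyEq ?_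
  filter_upwards [(hl.isOpen.preimage continuous_fst).mem_nhds hp] with q hq
  exact hl.famH_eq hq

/-- The fibre derivative of the Hamiltonian is the Legendre transform. -/
theorem fderiv_famH_vert {p : E n × Dual n} (hp : p.1 ∈ U) (hξ : p.2 ≠ 0) (β : Dual n) :
    fderiv ℝ (famH l) p (0, β) = β (famT l p) := by
  obtain ⟨y, ξ⟩ := p
  have hg := hl.fibre y hp
  have hH := ((hl.contDiffAt_famH hp hξ).differentiableAt (by simp)).hasFDerivAt
  have hT := ((hl.contDiffAt_famT hp hξ).differentiableAt (by simp)).hasFDerivAt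
  -- the function `q ↦ H(q) - q.2 (T p)` on the fibre has a minimum at `p`
  have h1 : IsLocalMin (fun ζ : Dual n => famH l (y, ζ) - ζ (famT l (y, ξ))) ξ := by
    refine Filter.Eventually.of_forall fun ζ => ?_
    have h2 := hg.le_legH ζ (legT (fun w => l (y, w)) ξ)
    have h3 := hg.legH_eq ξ
    change legH (fun w => l (y, w)) ξ - ξ (legT (fun w => l (y, w)) ξ) ≤
      legH (fun w => l (y, w)) ζ - ζ (legT (fun w => l (y, w)) ξ)
    linarith
  have h2 : HasFDerivAt (fun ζ : Dual n => famH l (y, ζ) - ζ (famT l (y, ξ)))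
      ((fderiv ℝ (famH l) (y, ξ)).comp (ContinuousLinearMap.inr ℝ (E n) (Dual n)) -
        ContinuousLinearMap.apply ℝ ℝ (famT l (y, ξ))) ξ :=
    (hH.comp ξ (hasFDerivAt_prodMk_right y ξ)).sub
      (ContinuousLinearMap.apply ℝ ℝ (famT l (y, ξ))).hasFDerivAt
  have h3 := congrArg (fun A : Dual n →L[ℝ] ℝ => A β) (h1.hasFDerivAt_eq_zero h2)
  simpa [sub_eq_zero] using h3

/-- The Legendre transform inverts the fibre derivative of the Lagrangian. -/
theorem hess_comp_fderiv_famT {p : E n × Dual n} (hp : p.1 ∈ U) (hξ : p.2 ≠ 0) (β : Dual n) :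
    fderiv ℝ (fderiv ℝ fun v => l (p.1, v)) (famT l p) (fderiv ℝ (famT l) p (0, β)) = β := by
  obtain ⟨y, ξ⟩ := p
  have hg := hl.fibre y hp
  have hT := ((hl.contDiffAt_famT hp hξ).differentiableAt (by simp)).hasFDerivAt
  have h1 := (hl.hasFDerivAt_fibreDeriv hp (hg.legT_ne_zero hξ)).comp ξ
    (hT.comp ξ (hasFDerivAt_prodMk_right y ξ))
  have h2 : ((fderiv ℝ fun v => l (y, v)) ∘ legT fun w => l (y, w)) = id := by
    funext ζ
    exact hg.fderiv_legT ζ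
  change HasFDerivAt ((fderiv ℝ fun v => l (y, v)) ∘ legT fun w => l (y, w)) _ ξ at h1
  rw [h2] at h1
  have h3 := congrArg (fun A : Dual n →L[ℝ] Dual n => A β) (h1.unique (hasFDerivAt_id ξ))
  simp only [ContinuousLinearMap.comp_apply, ContinuousLinearMap.inr_apply,
    ContinuousLinearMap.id_apply] at h3
  exact h3

/-- Near a point of the zero section the Hamiltonian is `o(‖ξ‖)`: by convexity, a positive lower
bound of the Lagrangian on a small sphere gives a linear lower bound outside the sphere. -/
theorem hasFDerivAt_famH_zero {y : E n} (hy : y ∈ U) :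
    HasFDerivAt (famH l) (0 : E n × Dual n →L[ℝ] ℝ) (y, 0) := by
  rw [hasFDerivAt_iff_isLittleO, Asymptotics.isLittleO_iff]
  intro r hr
  have h0 : famH l (y, 0) = 0 := (hl.fibre y hy).legH_zero
  -- the lower bound on the sphere of radius `r`, uniformly for base points near `y`
  obtain ⟨m, hm, hsph⟩ : ∃ m > 0, ∀ᶠ z in 𝓝 y, ∀ w ∈ Metric.sphere (0 : E n) r, m ≤ l (z, w) := by
    have hpos : ∀ w ∈ Metric.sphere (0 : E n) r, 0 < l (y, w) := by
      intro w hw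
      have hw0 : w ≠ 0 := by rintro rfl; simp at hw; linarith
      have h1 := (hl.fibre y hy).tangent_lt hw0
      rw [(hl.fibre y hy).fderiv_zero, (hl.fibre y hy).zero] at h1
      simpa using h1
    have hcomp : IsCompact (Metric.sphere (0 : E n) r) := isCompact_sphere 0 r
    obtain ⟨m, hm, hmin⟩ : ∃ m > 0, ∀ w ∈ Metric.sphere (0 : E n) r, m < l (y, w) := by
      rcases (Metric.sphere (0 : E n) r).eq_empty_or_nonempty with he | hne
      · exact ⟨1, one_pos, by simp [he]⟩
      · obtain ⟨w, hw, hmin⟩ := hcomp.exists_isMinOn hne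
          ((hl.fibre y hy).contDiff_one.continuous.continuousOn)
        refine ⟨l (y, w) / 2, half_pos (hpos w hw), fun v hv => ?_⟩
        have h1 : l (y, w) ≤ l (y, v) := hmin hv
        have h2 := hpos w hw
        linarith
    refine ⟨m, hm, hcomp.eventually_forall_of_forall_eventually fun w hw => ?_⟩
    exact ((hl.continuousAt y hy w).eventually (lt_mem_nhds (hmin w hw))).mono fun _ h => le_of_lt h
  have hn1 : ∀ᶠ q : E n × Dual n in 𝓝 (y, 0), q.1 ∈ U ∧
      ∀ w ∈ Metric.sphere (0 : E n) r, m ≤ l (q.1, w) :=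
    (continuous_fst.tendsto ((y, 0) : E n × Dual n)).eventually
      ((hl.isOpen.eventually_mem hy).and hsph)
  have hn2 : ∀ᶠ q : E n × Dual n in 𝓝 (y, 0), ‖q.2‖ ≤ m / r := by
    have h1 : Tendsto (fun q : E n × Dual n => ‖q.2‖) (𝓝 (y, 0)) (𝓝 0) := by
      have : Continuous fun q : E n × Dual n => ‖q.2‖ := by fun_prop
      simpa using this.tendsto (y, 0)
    exact (h1.eventually (gt_mem_nhds (show 0 < m / r by positivity))).mono fun _ h => le_of_lt h
  filter_upwards [hn1, hn2] with q hq hq2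
  have hg := hl.fibre q.1 hq.1
  have hle : famH l q ≤ r * ‖q.2‖ := by
    refine ciSup_le fun w => ?_
    have hqw : q.2 w ≤ ‖q.2‖ * ‖w‖ := (le_abs_self _).trans (q.2.le_opNorm w)
    have h0q : (0 : ℝ) ≤ r * ‖q.2‖ := by positivity
    rcases le_or_gt ‖w‖ r with hwr | hwr
    · have h1 := hg.nonneg w
      have h2 : ‖q.2‖ * ‖w‖ ≤ ‖q.2‖ * r := by gcongr
      linarith
    · have hw0 : 0 < ‖w‖ := hr.trans hwr
      have h1 := hg.le_of_le_smul (s := r / ‖w‖) (by positivity)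
        ((div_le_one hw0).2 hwr.le) w
      have h2 := hq.2 ((r / ‖w‖) • w) (by
        rw [mem_sphere_zero_iff_norm, norm_smul, Real.norm_of_nonneg (by positivity)]
        field_simp)
      have h3 := h2.trans h1
      rw [div_mul_eq_mul_div, le_div_iff₀ hw0] at h3
      rw [le_div_iff₀ hr] at hq2
      have h4 : r * (‖q.2‖ * ‖w‖) ≤ r * l (q.1, w) := by nlinarith
      have h5 := le_of_mul_le_mul_left h4 hr
      linarith
  rw [h0]
  simp only [sub_zero, zero_apply]
  have hnn : 0 ≤ famH l q := hg.legH_nonneg q.2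
  rw [Real.norm_of_nonneg hnn]
  refine hle.trans (mul_le_mul_of_nonneg_left ?_ hr.le)
  have := norm_snd_le (q - (y, 0))
  simpa using this

theorem differentiableAt_famH {p : E n × Dual n} (hp : p.1 ∈ U) :
    DifferentiableAt ℝ (famH l) p := by
  by_cases hξ : p.2 = 0
  · obtain ⟨y, ξ⟩ := p
    obtain rfl : ξ = 0 := hξ
    exact (hl.hasFDerivAt_famH_zero hp).differentiableAt
  · exact (hl.contDiffAt_famH hp hξ).differentiableAt (by simp)

end IsFamilyLagrangian

/-! ### Scaling covectors to a given energy -/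

namespace IsFibreLagrangian

variable {g : E n → ℝ} (hg : IsFibreLagrangian g)
include hg

theorem contDiffAt_legH {ξ : Dual n} (hξ : ξ ≠ 0) : ContDiffAt ℝ ∞ (legH g) ξ :=
  ContDiffAt.comp ξ (f := fun ζ : Dual n => ((0 : E n), ζ))
    (hg.isFamilyLagrangian.contDiffAt_famH (p := (0, ξ)) (mem_univ _) hξ) (by fun_prop)

theorem fderiv_legH {ξ : Dual n} (hξ : ξ ≠ 0) (β : Dual n) :
    fderiv ℝ (legH g) ξ β = β (legT g ξ) := by
  have h1 := hg.isFamilyLagrangian.fderiv_famH_vert (p := (0, ξ)) (mem_univ _) hξ β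
  have h2 := ((hg.isFamilyLagrangian.contDiffAt_famH (p := (0, ξ)) (mem_univ _)
    hξ).differentiableAt (by simp)).hasFDerivAt.comp ξ (hasFDerivAt_prodMk_right (0 : E n) ξ)
  have h3 : HasFDerivAt (legH g) _ ξ := h2
  rw [h3.fderiv]
  exact h1

theorem continuous_legH : Continuous (legH g) := by
  refine continuous_iff_continuousAt.2 fun ξ => ?_
  have h1 := (hg.isFamilyLagrangian.differentiableAt_famH (p := (0, ξ)) (mem_univ _)).continuousAt
  exact ContinuousAt.comp (f := fun ζ : Dual n => ((0 : E n), ζ)) (x := ξ) h1 (by fun_prop)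

theorem exists_scale {c : ℝ} (hc : 0 < c) {β : Dual n} (hβ : β ≠ 0) :
    ∃ a : ℝ, 0 < a ∧ legH g (a • β) = c := by
  have hcont : Continuous fun a : ℝ => legH g (a • β) := hg.continuous_legH.comp (by fun_prop)
  obtain ⟨w, hw⟩ : ∃ w, β w ≠ 0 := by
    by_contra h
    push Not at h
    exact hβ (by ext w; simpa using h w)
  -- testing the supremum on `v` shows that the Hamiltonian exceeds `c` far out on the ray
  obtain ⟨v, hv⟩ : ∃ v, β v = 1 := ⟨(β w)⁻¹ • w, by simp [hw]⟩
  have h1 : c ≤ legH g ((c + g v) • β) := by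
    have := hg.le_legH ((c + g v) • β) v
    rw [smul_apply, hv] at this
    simpa using this
  have h2 := hg.nonneg v
  have h0 : legH g ((0 : ℝ) • β) ≤ c := by rw [zero_smul, hg.legH_zero]; exact hc.le
  obtain ⟨a, ha, hac⟩ := intermediate_value_Icc (show (0 : ℝ) ≤ c + g v by linarith)
    hcont.continuousOn ⟨h0, h1⟩
  refine ⟨a, lt_of_le_of_ne ha.1 ?_, hac⟩
  rintro rfl
  simp only [zero_smul, hg.legH_zero] at hac
  exact hc.ne hac

theorem scale_unique {β : Dual n} (hβ : β ≠ 0) {a b : ℝ} (ha : 0 < a) (hb : 0 < b)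
    (h : legH g (a • β) = legH g (b • β)) : a = b := by
  rcases lt_trichotomy a b with h1 | h1 | h1
  · exact absurd h (hg.legH_smul_lt hβ ha h1).ne
  · exact h1
  · exact absurd h (hg.legH_smul_lt hβ hb h1).ne'

/-- The factor scaling a covector to the energy `c` depends smoothly on the covector. -/
theorem contDiffAt_scale {c : ℝ} {r : Dual n → ℝ}
    (hr : ∀ β ≠ 0, 0 < r β ∧ legH g (r β • β) = c) {β : Dual n} (hβ : β ≠ 0) :
    ContDiffAt ℝ ∞ r β := by
  obtain ⟨ha, hac⟩ := hr β hβ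
  have hne : r β • β ≠ 0 := smul_ne_zero ha.ne' hβ
  set f : Dual n × ℝ → ℝ := fun q => legH g (q.2 • q.1) with hf
  have hsm : ContDiffAt ℝ ∞ (fun q : Dual n × ℝ => q.2 • q.1) (β, r β) := by fun_prop
  have hfs : ContDiffAt ℝ ∞ f (β, r β) :=
    ContDiffAt.comp (β, r β) (g := legH g) (hg.contDiffAt_legH hne) hsm
  have hd : (fderiv ℝ f (β, r β)) (0, 1) = β (legT g (r β • β)) := by
    have h1 := (hfs.differentiableAt (by simp)).hasFDerivAt.comp_hasDerivAt (r β)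
      ((hasDerivAt_const (r β) β).prodMk (hasDerivAt_id (r β)))
    have h2 : HasDerivAt (fun a : ℝ => legH g (a • β)) (fderiv ℝ (legH g) (r β • β) β) (r β) :=
      HasFDerivAt.comp_hasDerivAt (f := fun a : ℝ => a • β) (r β)
        ((hg.contDiffAt_legH hne).differentiableAt (by simp)).hasFDerivAt
        (((hasDerivAt_id (r β)).smul_const β).congr_deriv (one_smul _ _))
    rw [hg.fderiv_legH hne] at h2
    exact h1.unique h2
  -- the radial derivative of the Hamiltonian is positive, so the implicit function theorem applies
  have hpos : 0 < β (legT g (r β • β)) := by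
    have h1 := hg.legH_eq (r β • β)
    have h2 := hg.legH_pos hne
    have h3 := hg.nonneg (legT g (r β • β))
    rw [h1, smul_apply, smul_eq_mul] at h2
    by_contra h
    push Not at h
    nlinarith
  have hinv : ((fderiv ℝ f (β, r β)).comp
      (ContinuousLinearMap.inr ℝ (Dual n) ℝ)).IsInvertible := by
    refine ⟨ContinuousLinearEquiv.unitsEquivAut ℝ (Units.mk0 _ hpos.ne'), ?_⟩
    ext
    simp [hd]
  refine (hfs.contDiffAt_implicitFunction (by simp) hinv).congr_of_eventuallyEq ?_
  have hcont := (hfs.contDiffAt_implicitFunction (by simp) hinv).continuousAt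
  have hat := hfs.implicitFunction_apply_self (by simp) hinv
  have hp : ∀ᶠ ζ in 𝓝 β, 0 < hfs.implicitFunction (by simp) hinv ζ := by
    refine hcont.eventually (lt_mem_nhds ?_)
    simp only at hat
    rw [hat]; exact ha
  filter_upwards [hfs.eventually_apply_implicitFunction (by simp) hinv, hp,
    isOpen_compl_singleton.mem_nhds hβ] with ζ h1 h2 h3
  refine hg.scale_unique h3 (hr ζ h3).1 h2 ?_
  rw [(hr ζ h3).2]
  have : f (β, r β) = c := hac
  rw [this] at h1
  exact h1.symm

end IsFibreLagrangian

end Legendre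

/-! ### Coordinates on the tangent and cotangent bundles -/

section Coordinates

variable {n : ℕ} {M : Type*} [TopologicalSpace M] [ChartedSpace (E n) M]
  [IsManifold 𝓘(ℝ, E n) ∞ M]

/-- The change of components of tangent vectors at `x`, from the preferred chart at `x₀` to the
preferred chart at `x₁`. -/
def tc (x₀ x₁ x : M) : E n →L[ℝ] E n := tangentCoordChange 𝓘(ℝ, E n) x₀ x₁ x

theorem tc_self {x₀ x : M} (h : x ∈ (chartAt (E n) x₀).source) (v : E n) : tc x₀ x₀ x v = v :=
  tangentCoordChange_self (by rwa [extChartAt_source])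

theorem tc_comp {x₀ x₁ x₂ x : M} (h₀ : x ∈ (chartAt (E n) x₀).source)
    (h₁ : x ∈ (chartAt (E n) x₁).source) (h₂ : x ∈ (chartAt (E n) x₂).source) (v : E n) :
    tc x₁ x₂ x (tc x₀ x₁ x v) = tc x₀ x₂ x v :=
  tangentCoordChange_comp (by simp only [extChartAt_source]; exact ⟨⟨h₀, h₁⟩, h₂⟩)

theorem mem_source_self (x : M) : x ∈ (chartAt (E n) x).source := mem_chart_source (E n) x

/-- The transition map between the preferred charts at `x₀` and `x₁`. -/
def trans (x₀ x₁ : M) : E n → E n := fun y => chartAt (E n) x₁ ((chartAt (E n) x₀).symm y)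

theorem hasFDerivAt_trans {x₀ x₁ x : M} (h₀ : x ∈ (chartAt (E n) x₀).source)
    (h₁ : x ∈ (chartAt (E n) x₁).source) :
    HasFDerivAt (trans x₀ x₁) (tc x₀ x₁ x) (chartAt (E n) x₀ x) := by
  have := hasFDerivWithinAt_tangentCoordChange (I := 𝓘(ℝ, E n)) (x := x₀) (y := x₁) (z := x)
    (by simp only [extChartAt_source]; exact ⟨h₀, h₁⟩)
  rw [ModelWithCorners.range_eq_univ, hasFDerivWithinAt_univ] at this
  exact this

theorem contDiffAt_trans {x₀ x₁ x : M} (h₀ : x ∈ (chartAt (E n) x₀).source)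
    (h₁ : x ∈ (chartAt (E n) x₁).source) :
    ContDiffAt ℝ ∞ (trans x₀ x₁) (chartAt (E n) x₀ x) := by
  have hx : (chartAt (E n) x₀).symm (chartAt (E n) x₀ x) = x := (chartAt (E n) x₀).left_inv h₀
  have h2 := (contMDiffOn_chart_symm (I := 𝓘(ℝ, E n)) (n := ∞) (x := x₀)).contMDiffAt
    ((chartAt (E n) x₀).open_target.mem_nhds ((chartAt (E n) x₀).map_source h₀))
  have h3 := (contMDiffOn_chart (I := 𝓘(ℝ, E n)) (n := ∞) (x := x₁)).contMDiffAt
    ((chartAt (E n) x₁).open_source.mem_nhds h₁)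
  rw [← hx] at h3
  exact (h3.comp _ h2).contDiffAt

/-- Coordinates on `T^*M`, induced by the preferred chart at `x₀`. -/
def toCot (x₀ : M) (q : CotangentBundle n M) : E n × Dual n :=
  (chartAt (E n) x₀ q.proj, (ccoord q).comp (tc x₀ q.proj q.proj))

/-- The covector with the given coordinates in the preferred chart at `x₀`. -/
def ofCot (x₀ : M) (p : E n × Dual n) : CotangentBundle n M :=
  covec ((chartAt (E n) x₀).symm p.1)
    (p.2.comp (tc ((chartAt (E n) x₀).symm p.1) x₀ ((chartAt (E n) x₀).symm p.1)))

/-- Coordinates on `TM`, induced by the preferred chart at `x₀`. -/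
def toTan (x₀ : M) (q : TangentBundle 𝓘(ℝ, E n) M) : E n × E n :=
  (chartAt (E n) x₀ q.proj, tc q.proj x₀ q.proj (tcoord q))

/-- The tangent vector with the given coordinates in the preferred chart at `x₀`. -/
def ofTan (x₀ : M) (p : E n × E n) : TangentBundle 𝓘(ℝ, E n) M :=
  tvec ((chartAt (E n) x₀).symm p.1)
    (tc x₀ ((chartAt (E n) x₀).symm p.1) ((chartAt (E n) x₀).symm p.1) p.2)

theorem symm_mem {x₀ : M} {y : E n} (hy : y ∈ (chartAt (E n) x₀).target) :
    (chartAt (E n) x₀).symm y ∈ (chartAt (E n) x₀).source := (chartAt (E n) x₀).map_target hy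

@[simp] theorem ccoord_covec (x : M) (β : Dual n) : ccoord (covec x β) = β := rfl
@[simp] theorem proj_covec (x : M) (β : Dual n) : (covec x β).proj = x := rfl
@[simp] theorem tcoord_tvec (x : M) (v : E n) : tcoord (tvec x v) = v := rfl
@[simp] theorem proj_tvec (x : M) (v : E n) : (tvec x v).proj = x := rfl
theorem covec_ccoord (q : CotangentBundle n M) : covec q.proj (ccoord q) = q := rfl

theorem toCot_self (q : CotangentBundle n M) :
    toCot q.proj q = (chartAt (E n) q.proj q.proj, ccoord q) := by
  ext1
  · rfl
  · ext v
    simp only [toCot, ContinuousLinearMap.comp_apply]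
    rw [tc_self (mem_source_self _)]

theorem toCot_covec_self (z : M) (β : Dual n) :
    toCot z (covec z β) = (chartAt (E n) z z, β) := toCot_self (covec z β)

theorem ofCot_toCot {x₀ : M} {q : CotangentBundle n M}
    (hq : q.proj ∈ (chartAt (E n) x₀).source) : ofCot x₀ (toCot x₀ q) = q := by
  have h1 : (chartAt (E n) x₀).symm (toCot x₀ q).1 = q.proj := (chartAt (E n) x₀).left_inv hq
  have h2 : ofCot x₀ (toCot x₀ q) = covec q.proj ((toCot x₀ q).2.comp (tc q.proj x₀ q.proj)) := by
    unfold ofCot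
    rw [h1]
  rw [h2]
  have h3 : (toCot x₀ q).2.comp (tc q.proj x₀ q.proj) = ccoord q := by
    ext v
    simp only [toCot, ContinuousLinearMap.comp_apply]
    rw [tc_comp (mem_source_self _) hq (mem_source_self _), tc_self (mem_source_self _)]
  rw [h3, covec_ccoord]

theorem toCot_ofCot {x₀ : M} {p : E n × Dual n} (hp : p.1 ∈ (chartAt (E n) x₀).target) :
    toCot x₀ (ofCot x₀ p) = p := by
  ext1
  · exact (chartAt (E n) x₀).right_inv hp
  · ext v
    simp only [toCot, ofCot, ContinuousLinearMap.comp_apply, ccoord_covec, proj_covec]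
    rw [tc_comp (symm_mem hp) (mem_source_self _) (symm_mem hp), tc_self (symm_mem hp)]

theorem toCot_ofCot_trans {x₀ x₁ : M} {p : E n × Dual n} (hp : p.1 ∈ (chartAt (E n) x₀).target)
    (hp' : (chartAt (E n) x₀).symm p.1 ∈ (chartAt (E n) x₁).source) :
    toCot x₁ (ofCot x₀ p) = (trans x₀ x₁ p.1, p.2.comp
      (tc x₁ x₀ ((chartAt (E n) x₀).symm p.1))) := by
  ext1
  · rfl
  · ext v
    simp only [toCot, ofCot, ContinuousLinearMap.comp_apply, ccoord_covec, proj_covec]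
    rw [tc_comp hp' (mem_source_self _) (symm_mem hp)]

theorem toTan_ofTan {x₀ : M} {p : E n × E n} (hp : p.1 ∈ (chartAt (E n) x₀).target) :
    toTan x₀ (ofTan x₀ p) = p := by
  ext1
  · exact (chartAt (E n) x₀).right_inv hp
  · simp only [toTan, ofTan, tcoord_tvec, proj_tvec]
    rw [tc_comp (symm_mem hp) (mem_source_self _) (symm_mem hp), tc_self (symm_mem hp)]

/-- Mathlib's charts of the cotangent bundle, a bundle of continuous linear maps into a trivial
bundle, are the coordinates `toCot`. -/
theorem extChartAt_cot (p q : CotangentBundle n M) (hq : q.proj ∈ (chartAt (E n) p.proj).source) :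
    extChartAt (cotModel n) p q = toCot p.proj q := by
  rw [extChartAt_coe, Function.comp_apply, hom_chart]
  ext1
  · rfl
  · unfold ContinuousLinearMap.inCoordinates
    ext w
    have h1 := TangentBundle.symmL_trivializationAt_eq_core (I := 𝓘(ℝ, E n)) hq
    have h2 := congrArg (fun A : E n →L[ℝ] E n => (ccoord q) (A w)) h1
    refine Eq.trans ?_ h2
    have h3 := Bundle.Trivial.continuousLinearMapAt_trivialization ℝ M ℝ q.proj
    have h4 := congrArg (fun A : ℝ →L[ℝ] ℝ => A ((ccoord q) (Bundle.Trivialization.symmL ℝ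
      (trivializationAt (E n) (TangentSpace 𝓘(ℝ, E n)) p.proj) q.proj w))) h3
    exact h4

theorem extChartAt_tan (p q : TangentBundle 𝓘(ℝ, E n) M) :
    extChartAt (𝓘(ℝ, E n).tangent) p q = toTan p.proj q := rfl

theorem extChartAt_cot_source (p : CotangentBundle n M) :
    (extChartAt (cotModel n) p).source = Bundle.TotalSpace.proj ⁻¹'
      (chartAt (E n) p.proj).source := by
  rw [FiberBundle.extChartAt]
  ext q
  simp only [PartialEquiv.trans_source, Bundle.Trivialization.mem_source, mem_inter_iff,
    mem_preimage,
    PartialEquiv.prod_source, PartialEquiv.refl_source, mem_prod, mem_univ, and_true,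
    extChartAt_source]
  rw [hom_trivializationAt_baseSet]
  exact ⟨fun h => h.1.1, fun h => ⟨⟨h, mem_univ _⟩, h⟩⟩

theorem extChartAt_cot_target (p : CotangentBundle n M) :
    (extChartAt (cotModel n) p).target = (chartAt (E n) p.proj).target ×ˢ univ := by
  ext q
  constructor
  · intro hq
    have h1 := (extChartAt (cotModel n) p).map_target hq
    rw [extChartAt_cot_source] at h1
    have h2 := (extChartAt (cotModel n) p).right_inv hq
    rw [extChartAt_cot _ _ h1] at h2
    rw [← h2]
    exact ⟨(chartAt (E n) p.proj).map_source h1, mem_univ _⟩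
  · rintro ⟨hq, -⟩
    have h1 : ofCot p.proj q ∈ (extChartAt (cotModel n) p).source := by
      rw [extChartAt_cot_source]; exact symm_mem hq
    have h2 := (extChartAt (cotModel n) p).map_source h1
    rwa [extChartAt_cot _ _ (symm_mem hq), toCot_ofCot hq] at h2

theorem extChartAt_cot_symm (p : CotangentBundle n M) {q : E n × Dual n}
    (hq : q.1 ∈ (chartAt (E n) p.proj).target) :
    (extChartAt (cotModel n) p).symm q = ofCot p.proj q := by
  have h1 : ofCot p.proj q ∈ (extChartAt (cotModel n) p).source := by
    rw [extChartAt_cot_source]; exact symm_mem hq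
  have h2 := (extChartAt (cotModel n) p).left_inv h1
  rwa [extChartAt_cot _ _ (symm_mem hq), toCot_ofCot hq] at h2

theorem extChartAt_tan_symm (p : TangentBundle 𝓘(ℝ, E n) M) {q : E n × E n}
    (hq : q.1 ∈ (chartAt (E n) p.proj).target) :
    q ∈ (extChartAt (𝓘(ℝ, E n).tangent) p).target ∧
    (extChartAt (𝓘(ℝ, E n).tangent) p).symm q = ofTan p.proj q := by
  have h1 : ofTan p.proj q ∈ (extChartAt (𝓘(ℝ, E n).tangent) p).source := by
    rw [extChartAt_source, TangentBundle.mem_chart_source_iff]; exact symm_mem hq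
  have h2 := (extChartAt (𝓘(ℝ, E n).tangent) p).left_inv h1
  have h3 := (extChartAt (𝓘(ℝ, E n).tangent) p).map_source h1
  rw [extChartAt_tan, toTan_ofTan hq] at h2 h3
  exact ⟨h3, h2⟩

theorem isOpen_cot_source (x₀ : M) :
    IsOpen (Bundle.TotalSpace.proj ⁻¹' (chartAt (E n) x₀).source : Set (CotangentBundle n M)) := by
  have := isOpen_extChartAt_source (I := cotModel n) (covec x₀ 0 : CotangentBundle n M)
  rwa [extChartAt_cot_source] at this

theorem contMDiffAt_toCot {x₀ : M} {q : CotangentBundle n M}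
    (hq : q.proj ∈ (chartAt (E n) x₀).source) :
    ContMDiffAt (cotModel n) 𝓘(ℝ, E n × Dual n) ∞ (toCot x₀) q := by
  have h := contMDiffOn_extChartAt (I := cotModel n) (n := ∞)
      (x := (covec x₀ 0 : CotangentBundle n M))
  have h1 := h.contMDiffAt (x := q) ((chartAt _
      (covec x₀ 0 : CotangentBundle n M)).open_source.mem_nhds
    (by rw [← extChartAt_source (cotModel n), extChartAt_cot_source]; exact hq))
  refine h1.congr_of_eventuallyEq ?_
  filter_upwards [(isOpen_cot_source x₀).mem_nhds hq] with r hr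
  exact (extChartAt_cot (covec x₀ 0) r hr).symm

theorem contMDiffAt_ofCot {x₀ : M} {p : E n × Dual n} (hp : p.1 ∈ (chartAt (E n) x₀).target) :
    ContMDiffAt 𝓘(ℝ, E n × Dual n) (cotModel n) ∞
      (ofCot x₀ : E n × Dual n → CotangentBundle n M) p := by
  have hmem : (chartAt (E n) x₀).target ×ˢ univ ∈ 𝓝 p :=
    ((chartAt (E n) x₀).open_target.prod isOpen_univ).mem_nhds ⟨hp, mem_univ _⟩
  have h := contMDiffOn_extChartAt_symm (I := cotModel n) (n := ∞)
      (covec x₀ 0 : CotangentBundle n M)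
  rw [extChartAt_cot_target] at h
  refine (h.contMDiffAt hmem).congr_of_eventuallyEq ?_
  filter_upwards [hmem] with r hr
  exact (extChartAt_cot_symm (covec x₀ 0) hr.1).symm

theorem contMDiffAt_ofTan {x₀ : M} {p : E n × E n} (hp : p.1 ∈ (chartAt (E n) x₀).target) :
    ContMDiffAt 𝓘(ℝ, E n × E n) (𝓘(ℝ, E n).tangent) ∞
      (ofTan x₀ : E n × E n → TangentBundle 𝓘(ℝ, E n) M) p := by
  have hmem : (chartAt (E n) x₀).target ×ˢ univ ∈ 𝓝 p :=
    ((chartAt (E n) x₀).open_target.prod isOpen_univ).mem_nhds ⟨hp, mem_univ _⟩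
  have h := (contMDiffOn_extChartAt_symm (I := 𝓘(ℝ, E n).tangent) (n := ∞)
    (tvec x₀ 0 : TangentBundle 𝓘(ℝ, E n) M)).mono
      (fun r (hr : r ∈ (chartAt (E n) x₀).target ×ˢ univ) =>
        (extChartAt_tan_symm (tvec x₀ 0) hr.1).1)
  refine (h.contMDiffAt hmem).congr_of_eventuallyEq ?_
  filter_upwards [hmem] with r hr
  exact (extChartAt_tan_symm (tvec x₀ 0) hr.1).2.symm

theorem contMDiffAt_toTan {x₀ : M} {q : TangentBundle 𝓘(ℝ, E n) M}
    (hq : q.proj ∈ (chartAt (E n) x₀).source) :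
    ContMDiffAt (𝓘(ℝ, E n).tangent) 𝓘(ℝ, E n × E n) ∞ (toTan x₀) q := by
  have h := contMDiffOn_extChartAt (I := 𝓘(ℝ, E n).tangent) (n := ∞)
    (x := (tvec x₀ 0 : TangentBundle 𝓘(ℝ, E n) M))
  exact h.contMDiffAt (x := q) ((chartAt _ (tvec x₀ 0 :
    TangentBundle 𝓘(ℝ, E n) M)).open_source.mem_nhds
    (by rw [TangentBundle.mem_chart_source_iff]; exact hq))

/-- The derivative of a function on `T^*M`, in the canonical coordinates of the preferred chart at
the base point. -/
def dcot {F : Type*} [NormedAddCommGroup F] [NormedSpace ℝ F] (f : CotangentBundle n M → F)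
    (q : CotangentBundle n M) : (E n × Dual n) →L[ℝ] F :=
  mfderiv (cotModel n) 𝓘(ℝ, F) f q

theorem hasFDerivAt_comp_ofCot {F : Type*} [NormedAddCommGroup F] [NormedSpace ℝ F]
    {f : CotangentBundle n M → F} {q : CotangentBundle n M}
    (hf : MDifferentiableAt (cotModel n) 𝓘(ℝ, F) f q) :
    HasFDerivAt (fun p => f (ofCot q.proj p)) (dcot f q) (toCot q.proj q) := by
  have h : HasFDerivWithinAt (writtenInExtChartAt (cotModel n) 𝓘(ℝ, F) q f) (dcot f q)
    (range (cotModel n)) (extChartAt (cotModel n) q q) := hf.hasMFDerivAt.2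
  rw [extChartAt_cot _ _ (mem_source_self _), ModelWithCorners.range_eq_univ,
    hasFDerivWithinAt_univ] at h
  refine HasFDerivAt.congr_of_eventuallyEq h ?_
  filter_upwards [(((chartAt (E n) q.proj).open_target.preimage continuous_fst).mem_nhds
    (show toCot q.proj q ∈ _ from (chartAt (E n) q.proj).map_source (mem_source_self _)))] with p hp
  have := extChartAt_cot_symm q (q := p) hp
  rw [writtenInExtChartAt, Function.comp_apply, Function.comp_apply, this]
  rfl

end Coordinates

/-! ### Hamiltonian vector fields in coordinates -/

section Symplectic

variable {n : ℕ}

/-- The Hamiltonian vector field on the model space of `T^*M`. -/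
def hamVec (h : E n × Dual n → ℝ) (p : E n × Dual n) : E n × Dual n :=
  (∑ i, fderiv ℝ h p (0, basisCov i) • basisVec i, -∑ i, fderiv ℝ h p (basisVec i, 0) • basisCov i)

theorem sum_coord_smul_basisVec (a : E n) : ∑ i, a i • (basisVec i : E n) = a := by
  ext j; simp [basisVec, Pi.single_apply]

theorem sum_apply_smul_basisCov (β : Dual n) : ∑ i, β (basisVec i) • (basisCov i : Dual n) = β := by
  ext a
  conv_rhs => rw [← sum_coord_smul_basisVec a, map_sum]
  rw [sum_apply]
  refine Finset.sum_congr rfl fun i _ => ?_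
  rw [smul_apply, map_smul, smul_eq_mul, smul_eq_mul, mul_comm]
  rfl

theorem apply_sum_smul_basisVec (T : Dual n →L[ℝ] ℝ) (β : Dual n) :
    β (∑ i, T (basisCov i) • basisVec i) = T β := by
  conv_rhs => rw [← sum_apply_smul_basisCov β, map_sum]
  rw [map_sum]
  refine Finset.sum_congr rfl fun i _ => ?_
  rw [map_smul, map_smul, smul_eq_mul, smul_eq_mul, mul_comm]

theorem sum_smul_basisCov_apply (S : Dual n) (a : E n) :
    (∑ i, S (basisVec i) • (basisCov i : Dual n)) a = S a := by
  rw [sum_apply_smul_basisCov]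

theorem apply_hamVec_fst (h : E n × Dual n → ℝ) (p : E n × Dual n) (β : Dual n) :
    β (hamVec h p).1 = fderiv ℝ h p (0, β) :=
  apply_sum_smul_basisVec ((fderiv ℝ h p).comp (ContinuousLinearMap.inr ℝ (E n) (Dual n))) β

theorem hamVec_snd_apply (h : E n × Dual n → ℝ) (p : E n × Dual n) (a : E n) :
    (hamVec h p).2 a = -fderiv ℝ h p (a, 0) := by
  have := sum_smul_basisCov_apply ((fderiv ℝ h p).comp (ContinuousLinearMap.inl ℝ (E n) (Dual n))) a
  simp only [hamVec, neg_apply]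
  exact congrArg Neg.neg this

theorem symp_hamVec (h : E n × Dual n → ℝ) (p w : E n × Dual n) :
    symp (hamVec h p) w = -fderiv ℝ h p w := by
  rw [symp, apply_hamVec_fst, hamVec_snd_apply]
  have : w = (w.1, 0) + (0, w.2) := by simp
  conv_rhs => rw [this, map_add]
  ring

theorem symp_antisymm (v w : E n × Dual n) : symp v w = -symp w v := by
  simp only [symp]; ring

theorem fderiv_hamVec (h : E n × Dual n → ℝ) (p : E n × Dual n) :
    fderiv ℝ h p (hamVec h p) = 0 := by
  have h1 := symp_hamVec h p (hamVec h p)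
  have h2 := symp_antisymm (hamVec h p) (hamVec h p)
  linarith

theorem eq_zero_of_symp {v : E n × Dual n} (h : ∀ w, symp v w = 0) : v = 0 := by
  have h2 : v.2 = 0 := by
    ext a
    have := h (a, 0)
    simpa [symp] using this
  have h1 : v.1 = 0 := by
    ext i
    have := h (0, basisCov i)
    simpa [symp, basisCov] using this
  exact Prod.ext h1 h2

theorem eq_of_symp {v v' : E n × Dual n} (h : ∀ w, symp v w = symp v' w) : v = v' := by
  rw [← sub_eq_zero]
  refine eq_zero_of_symp fun w => ?_
  have := h w
  simp only [symp, Prod.fst_sub, Prod.snd_sub, sub_apply, map_sub] at this ⊢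
  linarith

theorem surjective_of_symp {T : E n × Dual n →L[ℝ] E n × Dual n}
    (h : ∀ w w', symp (T w) (T w') = symp w w') : Function.Surjective T := by
  have hinj : Function.Injective (T : E n × Dual n →ₗ[ℝ] E n × Dual n) := by
    rw [injective_iff_map_eq_zero]
    intro v hv
    refine eq_zero_of_symp fun w => ?_
    have h1 : T v = 0 := hv
    rw [← h, h1]
    simp [symp]
  exact LinearMap.injective_iff_surjective.1 hinj

/-- The lift `(y, ξ) ↦ (θ(y), ξ ∘ Dθ(y)⁻¹)` of a change of coordinates to the cotangent bundle is
symplectic: this is the symmetry of the second derivative of the inverse map. -/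
theorem exists_symplectic_lift {θ η : E n → E n} {y : E n} (ξ : Dual n)
    (hθ : ContDiffAt ℝ ∞ θ y) (hη : ContDiffAt ℝ ∞ η (θ y))
    (hinv : ∀ᶠ z in 𝓝 y, η (θ z) = z) :
    ∃ T : E n × Dual n →L[ℝ] E n × Dual n,
      HasFDerivAt (fun p : E n × Dual n => (θ p.1, p.2.comp (fderiv ℝ η (θ p.1)))) T (y, ξ) ∧
      (∀ w w', symp (T w) (T w') = symp w w') ∧ ∀ w, (T w).1 = fderiv ℝ θ y w.1 := by
  have hθd := (hθ.differentiableAt (by simp)).hasFDerivAt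
  have hηd := (hη.differentiableAt (by simp)).hasFDerivAt
  have hη2 : HasFDerivAt (fderiv ℝ η) (fderiv ℝ (fderiv ℝ η) (θ y)) (θ y) :=
    ((hη.fderiv_right (m := 1) one_add_one_le_infty).differentiableAt one_ne_zero).hasFDerivAt
  have hsymm : IsSymmSndFDerivAt ℝ η (θ y) :=
    hη.isSymmSndFDerivAt (by
      rw [minSmoothness_of_isRCLikeNormedField]
      exact WithTop.coe_le_coe.2 (le_top (a := (2 : ℕ∞))))
  have h1 : HasFDerivAt (fun p : E n × Dual n => θ p.1)
      ((fderiv ℝ θ y).comp (ContinuousLinearMap.fst ℝ (E n) (Dual n))) (y, ξ) :=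
    HasFDerivAt.comp (y, ξ) (f := Prod.fst) hθd hasFDerivAt_fst
  have h2 := HasFDerivAt.comp (y, ξ) (f := fun p : E n × Dual n => θ p.1) hη2 h1
  have h3 := (hasFDerivAt_snd (𝕜 := ℝ) (p := ((y, ξ) : E n × Dual n))).clm_comp h2
  refine ⟨_, h1.prodMk h3, ?_, fun w => rfl⟩
  have hcomp : ∀ a, fderiv ℝ η (θ y) (fderiv ℝ θ y a) = a := by
    intro a
    have h4 := hηd.comp y hθd
    have h5 : HasFDerivAt (η ∘ θ) (ContinuousLinearMap.id ℝ (E n)) y :=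
      (hasFDerivAt_id y).congr_of_eventuallyEq hinv
    exact congrArg (fun A : E n →L[ℝ] E n => A a) (h4.unique h5)
  rintro ⟨a, β⟩ ⟨a', β'⟩
  simp only [symp, ContinuousLinearMap.prod_apply, ContinuousLinearMap.comp_apply,
    ContinuousLinearMap.coe_fst', ContinuousLinearMap.coe_snd', add_apply,
    ContinuousLinearMap.compL_apply, ContinuousLinearMap.flip_apply, Function.comp_apply, hcomp]
  -- the terms with the second derivative of `η` cancel by its symmetry
  rw [hsymm.eq (fderiv ℝ θ y a) (fderiv ℝ θ y a')]
  ring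

end Symplectic

section Field

variable {n : ℕ} {M : Type*} [TopologicalSpace M] [ChartedSpace (E n) M]
  [IsManifold 𝓘(ℝ, E n) ∞ M]

theorem trans_trans {x₀ x₁ x : M} (h₀ : x ∈ (chartAt (E n) x₀).source)
    (h₁ : x ∈ (chartAt (E n) x₁).source) :
    ∀ᶠ y in 𝓝 (chartAt (E n) x₀ x), y ∈ (chartAt (E n) x₀).target ∧
      (chartAt (E n) x₀).symm y ∈ (chartAt (E n) x₁).source ∧ trans x₁ x₀ (trans x₀ x₁ y) = y := by
  have h2 : (chartAt (E n) x₀).target ∈ 𝓝 (chartAt (E n) x₀ x) :=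
    (chartAt (E n) x₀).open_target.mem_nhds ((chartAt (E n) x₀).map_source h₀)
  have h3 : ∀ᶠ y in 𝓝 (chartAt (E n) x₀ x), (chartAt (E n) x₀).symm y ∈
      (chartAt (E n) x₁).source := by
    have h4 := (chartAt (E n) x₀).continuousAt_symm ((chartAt (E n) x₀).map_source h₀)
    refine h4.eventually ?_
    rw [(chartAt (E n) x₀).left_inv h₀]
    exact (chartAt (E n) x₁).open_source.mem_nhds h₁
  filter_upwards [h2, h3] with y hy hy'
  refine ⟨hy, hy', ?_⟩
  simp only [trans]
  rw [(chartAt (E n) x₁).left_inv hy', (chartAt (E n) x₀).right_inv hy]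

/-- Changes of canonical coordinates on `T^*M` have symplectic derivatives, and cover the changes of
coordinates on `TM`. -/
theorem exists_transition {x₀ x₁ : M} {q : CotangentBundle n M}
    (h₀ : q.proj ∈ (chartAt (E n) x₀).source) (h₁ : q.proj ∈ (chartAt (E n) x₁).source) :
    ∃ T : E n × Dual n →L[ℝ] E n × Dual n,
      HasFDerivAt (fun p => toCot x₁ (ofCot x₀ p)) T (toCot x₀ q) ∧
      (∀ w w', symp (T w) (T w') = symp w w') ∧ ∀ w, (T w).1 = tc x₀ x₁ q.proj w.1 := by
  have e1 : trans x₀ x₁ (chartAt (E n) x₀ q.proj) = chartAt (E n) x₁ q.proj := by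
    simp only [trans, (chartAt (E n) x₀).left_inv h₀]
  have hη := contDiffAt_trans (x₀ := x₁) (x₁ := x₀) h₁ h₀
  rw [← e1] at hη
  obtain ⟨T, hT, hs, hf⟩ := exists_symplectic_lift (toCot x₀ q).2 (contDiffAt_trans h₀ h₁) hη
    ((trans_trans h₀ h₁).mono fun y hy => hy.2.2)
  refine ⟨T, HasFDerivAt.congr_of_eventuallyEq (x := toCot x₀ q) hT ?_, hs, ?_⟩
  · have h2 := (continuous_fst.tendsto (toCot x₀ q)).eventually (trans_trans h₀ h₁)
    filter_upwards [h2] with p hp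
    rw [toCot_ofCot_trans hp.1 hp.2.1]
    have h3 := (hasFDerivAt_trans (x₀ := x₁) (x₁ := x₀) hp.2.1 (symm_mem hp.1)).fderiv
    have h4 : trans x₀ x₁ p.1 = chartAt (E n) x₁ ((chartAt (E n) x₀).symm p.1) := rfl
    rw [h4, h3]
  · intro w
    rw [hf, (hasFDerivAt_trans h₀ h₁).fderiv]

/-- A function on `T^*M` in the coordinates induced by the preferred chart at `x₀`. -/
def locH (H : CotangentBundle n M → ℝ) (x₀ : M) (p : E n × Dual n) : ℝ := H (ofCot x₀ p)

theorem mdifferentiableAt_of_locH {H : CotangentBundle n M → ℝ} {x₀ : M} {q : CotangentBundle n M}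
    (h₀ : q.proj ∈ (chartAt (E n) x₀).source)
    (h : DifferentiableAt ℝ (locH H x₀) (toCot x₀ q)) :
    MDifferentiableAt (cotModel n) 𝓘(ℝ, ℝ) H q := by
  have h1 : MDifferentiableAt (cotModel n) 𝓘(ℝ, ℝ) (fun r => locH H x₀ (toCot x₀ r)) q :=
    h.mdifferentiableAt.comp q ((contMDiffAt_toCot h₀).mdifferentiableAt (by simp))
  refine h1.congr_of_eventuallyEq ?_
  filter_upwards [(isOpen_cot_source x₀).mem_nhds h₀] with r hr
  simp only [locH]
  rw [ofCot_toCot hr]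

/-- The Hamiltonian vector field, as a pair of coordinates. -/
def hamV (H : CotangentBundle n M → ℝ) (q : CotangentBundle n M) : E n × Dual n := hamField H q

/-- Changes of coordinates of `T^*M` are symplectic, so they preserve Hamiltonian vector fields. -/
theorem transition_hamV {H : CotangentBundle n M → ℝ} {x₀ : M} {q : CotangentBundle n M}
    (h₀ : q.proj ∈ (chartAt (E n) x₀).source)
    (h : DifferentiableAt ℝ (locH H x₀) (toCot x₀ q))
    {T : E n × Dual n →L[ℝ] E n × Dual n}
    (hT : HasFDerivAt (fun p => toCot x₀ (ofCot q.proj p)) T (toCot q.proj q))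
    (hs : ∀ w w', symp (T w) (T w') = symp w w') :
    T (hamV H q) = hamVec (locH H x₀) (toCot x₀ q) := by
  have hq := hasFDerivAt_comp_ofCot (mdifferentiableAt_of_locH h₀ h)
  have e0 : dHam H q = dcot H q := rfl
  have e1 : hamV H q = hamVec (locH H q.proj) (toCot q.proj q) := by
    have h1 : fderiv ℝ (locH H q.proj) (toCot q.proj q) = dHam H q := hq.fderiv
    unfold hamV hamField hamVec
    rw [h1]
  have e2 : fderiv ℝ (locH H q.proj) (toCot q.proj q) =
      (fderiv ℝ (locH H x₀) (toCot x₀ q)).comp T := by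
    refine HasFDerivAt.fderiv ?_
    have h2 : toCot x₀ (ofCot q.proj (toCot q.proj q)) = toCot x₀ q := by
      rw [ofCot_toCot (mem_source_self _)]
    have h3 : HasFDerivAt (locH H x₀) (fderiv ℝ (locH H x₀) (toCot x₀ q))
        (toCot x₀ (ofCot q.proj (toCot q.proj q))) := by rw [h2]; exact h.hasFDerivAt
    refine (HasFDerivAt.comp (toCot q.proj q) (f := fun p => toCot x₀ (ofCot q.proj p)) h3
      hT).congr_of_eventuallyEq ?_
    have h4 := (continuous_fst.tendsto (toCot q.proj q)).eventually
      (trans_trans (mem_source_self q.proj) h₀)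
    filter_upwards [h4] with p hp
    simp only [locH, Function.comp_apply]
    rw [ofCot_toCot]
    exact hp.2.1
  -- both sides are determined by pairing with `ω`, which `T` preserves
  refine eq_of_symp fun w => ?_
  obtain ⟨v, rfl⟩ := surjective_of_symp hs w
  rw [hs, e1, symp_hamVec, symp_hamVec, e2]
  rfl

/-- Integral curves of the Hamiltonian vector field solve Hamilton's equations in coordinates. -/
theorem hasDerivWithinAt_toCot {H : CotangentBundle n M → ℝ} {x₀ : M} {γ : ℝ → CotangentBundle n M}
    {s : Set ℝ} {t : ℝ}
    (hγ : HasMFDerivWithinAt 𝓘(ℝ, ℝ) (cotModel n) γ s t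
      ((1 : ℝ →L[ℝ] ℝ).smulRight (hamField H (γ t))))
    (h₀ : (γ t).proj ∈ (chartAt (E n) x₀).source)
    (h : DifferentiableAt ℝ (locH H x₀) (toCot x₀ (γ t))) :
    HasDerivWithinAt (fun t => toCot x₀ (γ t)) (hamVec (locH H x₀) (toCot x₀ (γ t))) s t := by
  obtain ⟨T, hT, hs, -⟩ := exists_transition (mem_source_self (γ t).proj) h₀
  rw [← transition_hamV h₀ h hT hs]
  have h1 : HasFDerivWithinAt (writtenInExtChartAt 𝓘(ℝ, ℝ) (cotModel n) t γ)
      ((1 : ℝ →L[ℝ] ℝ).smulRight (hamV H (γ t)))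
      ((extChartAt 𝓘(ℝ, ℝ) t).symm ⁻¹' s ∩ range 𝓘(ℝ, ℝ)) (extChartAt 𝓘(ℝ, ℝ) t t) := hγ.2
  simp only [mfld_simps] at h1
  have hev : ∀ᶠ τ in 𝓝[s] t, (γ τ).proj ∈ (chartAt (E n) (γ t).proj).source ∧
      (γ τ).proj ∈ (chartAt (E n) x₀).source :=
    (hγ.1.eventually ((isOpen_cot_source (γ t).proj).mem_nhds (mem_source_self _))).and
      (hγ.1.eventually ((isOpen_cot_source x₀).mem_nhds h₀))
  have h2 : HasFDerivWithinAt (fun τ => toCot (γ t).proj (γ τ))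
      ((1 : ℝ →L[ℝ] ℝ).smulRight (hamV H (γ t))) s t := by
    refine h1.congr_of_eventuallyEq ?_ ?_
    · filter_upwards [hev] with τ hτ
      exact (extChartAt_cot (γ t) (γ τ) hτ.1).symm
    · exact (extChartAt_cot (γ t) (γ t) (mem_source_self _)).symm
  have h3 : HasFDerivWithinAt (fun τ => toCot x₀ (ofCot (γ t).proj (toCot (γ t).proj (γ τ))))
      (T.comp ((1 : ℝ →L[ℝ] ℝ).smulRight (hamV H (γ t)))) s t :=
    HasFDerivAt.comp_hasFDerivWithinAt t (f := fun τ => toCot (γ t).proj (γ τ))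
      (g := fun p => toCot x₀ (ofCot (γ t).proj p)) hT h2
  have h4 : HasFDerivWithinAt (fun τ => toCot x₀ (γ τ))
      (T.comp ((1 : ℝ →L[ℝ] ℝ).smulRight (hamV H (γ t)))) s t := by
    refine h3.congr_of_eventuallyEq ?_ ?_
    · filter_upwards [hev] with τ hτ
      rw [ofCot_toCot hτ.1]
    · rw [ofCot_toCot (mem_source_self _)]
  have h5 := h4.hasDerivWithinAt
  simpa using h5

/-- Solutions of Hamilton's equations in coordinates are integral curves. -/
theorem hasMFDerivAt_ofCot {H : CotangentBundle n M → ℝ} {x₀ : M} {p : ℝ → E n × Dual n} {t : ℝ}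
    (hp : HasDerivAt p (hamVec (locH H x₀) (p t)) t)
    (h₀ : (p t).1 ∈ (chartAt (E n) x₀).target)
    (h : DifferentiableAt ℝ (locH H x₀) (p t)) :
    HasMFDerivAt 𝓘(ℝ, ℝ) (cotModel n) (fun t => ofCot x₀ (p t)) t
      ((1 : ℝ →L[ℝ] ℝ).smulRight (hamField H (ofCot x₀ (p t)))) := by
  set q : CotangentBundle n M := ofCot x₀ (p t) with hq
  have hqs : q.proj ∈ (chartAt (E n) x₀).source := symm_mem h₀
  have hpt : toCot x₀ q = p t := toCot_ofCot h₀
  obtain ⟨T, hT, hs, -⟩ := exists_transition (mem_source_self q.proj) hqs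
  obtain ⟨S, hS, -, -⟩ := exists_transition hqs (mem_source_self q.proj)
  have hTh := transition_hamV (H := H) hqs (by rw [hpt]; exact h) hT hs
  have hST : ∀ w, S (T w) = w := by
    intro w
    have e : toCot x₀ (ofCot q.proj (toCot q.proj q)) = toCot x₀ q := by
      rw [ofCot_toCot (mem_source_self _)]
    rw [← e] at hS
    have h1 := HasFDerivAt.comp (toCot q.proj q) (g := fun p => toCot q.proj (ofCot x₀ p))
      (f := fun p => toCot x₀ (ofCot q.proj p)) hS hT
    have h2 : HasFDerivAt ((fun p => toCot q.proj (ofCot x₀ p)) ∘ fun p =>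
        toCot x₀ (ofCot q.proj p))
        (ContinuousLinearMap.id ℝ (E n × Dual n)) (toCot q.proj q) := by
      refine (hasFDerivAt_id _).congr_of_eventuallyEq ?_
      have h4 := (continuous_fst.tendsto (toCot q.proj q)).eventually
        (trans_trans (mem_source_self q.proj) hqs)
      filter_upwards [h4] with p hp
      simp only [Function.comp_apply, id]
      rw [ofCot_toCot (x₀ := x₀) hp.2.1, toCot_ofCot hp.1]
    exact congrArg (fun A : E n × Dual n →L[ℝ] E n × Dual n => A w) (h1.unique h2)
  have hc : ContinuousAt (fun t => ofCot x₀ (p t)) t :=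
    ContinuousAt.comp (f := p) (contMDiffAt_ofCot h₀).continuousAt hp.continuousAt
  refine ⟨hc, ?_⟩
  have key : HasFDerivAt (fun τ => toCot q.proj (ofCot x₀ (p τ)))
      ((1 : ℝ →L[ℝ] ℝ).smulRight (hamV H q)) t := by
    rw [hpt] at hS
    have h1 : HasFDerivAt (fun τ => toCot q.proj (ofCot x₀ (p τ)))
      (S.comp ((1 : ℝ →L[ℝ] ℝ).smulRight (hamVec (locH H x₀) (p t)))) t :=
      HasFDerivAt.comp t (f := p) hS hp.hasFDerivAt
    convert h1 using 1
    rw [hpt] at hTh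
    refine ContinuousLinearMap.ext fun a => ?_
    simp only [ContinuousLinearMap.comp_apply, ContinuousLinearMap.smulRight_apply, map_smul, ← hTh,
      hST]
  have key2 : HasFDerivAt (writtenInExtChartAt 𝓘(ℝ, ℝ) (cotModel n) t (fun t => ofCot x₀ (p t)))
      ((1 : ℝ →L[ℝ] ℝ).smulRight (hamV H q)) t := by
    refine key.congr_of_eventuallyEq ?_
    filter_upwards [hc.eventually ((isOpen_cot_source q.proj).mem_nhds
      (mem_source_self _))] with τ hτ
    exact extChartAt_cot q _ hτ
  exact key2.hasFDerivWithinAt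

end Field

/-! ### The Hamiltonian of a Lagrangian on a manifold -/

section LinearChange

variable {n : ℕ} {g : E n → ℝ} {D D' : E n →L[ℝ] E n}

theorem dual_comp_ne_zero (hDD' : ∀ w, D (D' w) = w) {ξ : Dual n} (hξ : ξ ≠ 0) :
    ξ.comp D ≠ 0 := by
  intro h
  refine hξ (ContinuousLinearMap.ext fun w => ?_)
  have := congrArg (fun A : Dual n => A (D' w)) h
  simpa [hDD'] using this

namespace IsFibreLagrangian

theorem differentiableAt_fderiv (hg : IsFibreLagrangian g) {w : E n} (hw : w ≠ 0) :
    DifferentiableAt ℝ (fderiv ℝ g) w :=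
  ((hg.smooth w hw).fderiv_right (m := 1) one_add_one_le_infty).differentiableAt one_ne_zero

theorem fderiv_comp_linear (hg : IsFibreLagrangian g) :
    fderiv ℝ (fun w => g (D w)) = fun w => (fderiv ℝ g (D w)).comp D := by
  funext w
  exact ((hg.hasFDerivAt (D w)).comp w D.hasFDerivAt).fderiv

theorem hess_comp_linear (hg : IsFibreLagrangian g) {w : E n} (hw : D w ≠ 0) (a b : E n) :
    fderiv ℝ (fderiv ℝ fun w => g (D w)) w a b = fderiv ℝ (fderiv ℝ g) (D w) (D a) (D b) := by
  rw [hg.fderiv_comp_linear]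
  have h1 : HasFDerivAt (fun w => fderiv ℝ g (D w)) ((fderiv ℝ (fderiv ℝ g) (D w)).comp D) w :=
    (hg.differentiableAt_fderiv hw).hasFDerivAt.comp w D.hasFDerivAt
  have h2 := h1.clm_comp (hasFDerivAt_const D w)
  rw [h2.fderiv]
  simp

theorem comp_linear (hg : IsFibreLagrangian g) (hD'D : ∀ w, D' (D w) = w) :
    IsFibreLagrangian fun w => g (D w) where
  nonneg _ := hg.nonneg _
  zero := by simp [hg.zero]
  contDiff_one := hg.contDiff_one.comp D.contDiff
  smooth w hw := by
    have hDw : D w ≠ 0 := fun h => hw (by rw [← hD'D w, h, map_zero])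
    exact (hg.smooth _ hDw).comp w D.contDiff.contDiffAt
  convex w hw a ha := by
    have hD : ∀ w ≠ 0, D w ≠ 0 := fun w hw h => hw (by rw [← hD'D w, h, map_zero])
    rw [hg.hess_comp_linear (hD w hw)]
    exact hg.convex _ (hD w hw) _ (hD a ha)
  superlinear β := by
    obtain ⟨C, hC⟩ := hg.superlinear (β.comp D')
    refine ⟨C, ?_⟩
    rintro _ ⟨w, rfl⟩
    have := hC (mem_range_self (D w))
    simpa [hD'D] using this

theorem legT_comp_linear (hg : IsFibreLagrangian g) (hD'D : ∀ w, D' (D w) = w)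
    (hDD' : ∀ w, D (D' w) = w) (ξ : Dual n) :
    legT (fun w => g (D w)) ξ = D' (legT g (ξ.comp D')) := by
  refine (hg.comp_linear hD'D).legT_eq ?_
  rw [hg.fderiv_comp_linear]
  simp only [hDD']
  rw [hg.fderiv_legT]
  ext w
  simp [hD'D]

theorem legH_comp_linear (hg : IsFibreLagrangian g) (hD'D : ∀ w, D' (D w) = w)
    (hDD' : ∀ w, D (D' w) = w) (ξ : Dual n) :
    legH (fun w => g (D w)) ξ = legH g (ξ.comp D') := by
  rw [(hg.comp_linear hD'D).legH_eq, hg.legT_comp_linear hD'D hDD', hg.legH_eq]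
  simp [hDD']

end IsFibreLagrangian

end LinearChange

section OnManifold

variable {n : ℕ} {M : Type*} [TopologicalSpace M] [ChartedSpace (E n) M]
  [IsManifold 𝓘(ℝ, E n) ∞ M] {L : TangentBundle 𝓘(ℝ, E n) M → ℝ}

/-- A Lagrangian in the coordinates of `TM` induced by the preferred chart at `x₀`. -/
def locL (L : TangentBundle 𝓘(ℝ, E n) M → ℝ) (x₀ : M) (p : E n × E n) : ℝ := L (ofTan x₀ p)

/-- The restriction of a Lagrangian to a tangent space. -/
def fibreL (L : TangentBundle 𝓘(ℝ, E n) M → ℝ) (x : M) (w : E n) : ℝ := L (tvec x w)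

theorem tc_symm {x₀ x₁ x : M} (h₀ : x ∈ (chartAt (E n) x₀).source)
    (h₁ : x ∈ (chartAt (E n) x₁).source) (v : E n) : tc x₁ x₀ x (tc x₀ x₁ x v) = v := by
  rw [tc_comp h₀ h₁ h₀, tc_self h₀]

theorem ofTan_self (x : M) (w : E n) : ofTan x (chartAt (E n) x x, w) = tvec x w := by
  have : ofTan x (chartAt (E n) x x, w) = tvec x (tc x x x w) := by
    simp only [ofTan, (chartAt (E n) x).left_inv (mem_source_self x)]
  rw [this, tc_self (mem_source_self x)]

namespace IsLagrangian

variable (hL : IsLagrangian L)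
include hL

theorem contDiffAt_one_locL {x₀ : M} {p : E n × E n} (hp : p.1 ∈ (chartAt (E n) x₀).target) :
    ContDiffAt ℝ 1 (locL L x₀) p :=
  ((hL.contMDiff_one _).comp p ((contMDiffAt_ofTan hp).of_le
    (WithTop.coe_le_coe.2 (le_top (a := (1 : ℕ∞)))))).contDiffAt

theorem isOpen_ne_zero : IsOpen {v : TangentBundle 𝓘(ℝ, E n) M | tcoord v ≠ 0} := by
  rw [isOpen_iff_mem_nhds]
  intro v hv
  have h0 : v.proj ∈ (chartAt (E n) v.proj).source := mem_source_self _
  have h1 := (contMDiffAt_toTan h0).continuousAt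
  have h2 : (toTan v.proj v).2 ≠ 0 := by
    simp only [toTan]
    rw [tc_self h0]; exact hv
  have h3 : ∀ᶠ u in 𝓝 v, (toTan v.proj u).2 ≠ 0 :=
    (continuousAt_snd.comp h1).eventually_ne h2
  filter_upwards [h3] with u hu
  intro hu0
  refine hu ?_
  simp only [toTan]
  rw [hu0, map_zero]

theorem contDiffAt_locL {x₀ : M} {p : E n × E n} (hp : p.1 ∈ (chartAt (E n) x₀).target)
    (hw : p.2 ≠ 0) : ContDiffAt ℝ ∞ (locL L x₀) p := by
  have h1 : tcoord (ofTan x₀ p) ≠ 0 := by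
    intro h
    refine hw ?_
    have := tc_symm (symm_mem hp) (mem_source_self _) p.2
    simp only [ofTan, tcoord_tvec] at h
    rw [h, map_zero] at this
    exact this.symm
  exact ((hL.smooth.contMDiffAt (hL.isOpen_ne_zero.mem_nhds h1)).comp p
    (contMDiffAt_ofTan hp)).contDiffAt

theorem fibreL_eq (x : M) : fibreL L x = fun w => locL L x (chartAt (E n) x x, w) := by
  funext w
  simp only [fibreL, locL, ofTan_self]

theorem isFibreLagrangian (x : M) : IsFibreLagrangian (fibreL L x) where
  nonneg w := hL.nonneg _
  zero := hL.zero_section x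
  contDiff_one := by
    rw [hL.fibreL_eq, contDiff_iff_contDiffAt]
    intro w
    exact ContDiffAt.comp w (f := fun w : E n => (chartAt (E n) x x, w)) (g := locL L x)
      (hL.contDiffAt_one_locL ((chartAt (E n) x).map_source (mem_source_self x))) (by fun_prop)
  smooth w hw := by
    rw [hL.fibreL_eq]
    exact ContDiffAt.comp w (f := fun w : E n => (chartAt (E n) x x, w)) (g := locL L x)
      (hL.contDiffAt_locL ((chartAt (E n) x).map_source (mem_source_self x)) hw) (by fun_prop)
  convex w hw a ha := hL.convex (tvec x w) hw a ha
  superlinear β := hL.superlinear x β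

theorem isFamilyLagrangian (x₀ : M) :
    IsFamilyLagrangian (chartAt (E n) x₀).target (locL L x₀) where
  isOpen := (chartAt (E n) x₀).open_target
  fibre y hy := (hL.isFibreLagrangian ((chartAt (E n) x₀).symm y)).comp_linear
    (D := tc x₀ ((chartAt (E n) x₀).symm y) ((chartAt (E n) x₀).symm y))
    (D' := tc ((chartAt (E n) x₀).symm y) x₀ ((chartAt (E n) x₀).symm y))
    (tc_symm (symm_mem hy) (mem_source_self _))
  smooth _ hy _ hw := hL.contDiffAt_locL hy hw
  continuousAt y hy w := (hL.contDiffAt_one_locL (p := (y, w)) hy).continuousAt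

/-- The Hamiltonian in canonical coordinates is the Hamiltonian of the Lagrangian in coordinates. -/
theorem locH_eq {x₀ : M} {p : E n × Dual n} (hp : p.1 ∈ (chartAt (E n) x₀).target) :
    locH (hamiltonian L) x₀ p = famH (locL L x₀) p :=
  ((hL.isFibreLagrangian ((chartAt (E n) x₀).symm p.1)).legH_comp_linear
    (D := tc x₀ ((chartAt (E n) x₀).symm p.1) ((chartAt (E n) x₀).symm p.1))
    (D' := tc ((chartAt (E n) x₀).symm p.1) x₀ ((chartAt (E n) x₀).symm p.1))
    (tc_symm (symm_mem hp) (mem_source_self _)) (tc_symm (mem_source_self _) (symm_mem hp))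
    p.2).symm

theorem famT_eq {x₀ : M} {p : E n × Dual n} (hp : p.1 ∈ (chartAt (E n) x₀).target) :
    famT (locL L x₀) p = tc ((chartAt (E n) x₀).symm p.1) x₀ ((chartAt (E n) x₀).symm p.1)
      (tcoord (legendre L (ofCot x₀ p))) :=
  (hL.isFibreLagrangian ((chartAt (E n) x₀).symm p.1)).legT_comp_linear
    (D := tc x₀ ((chartAt (E n) x₀).symm p.1) ((chartAt (E n) x₀).symm p.1))
    (D' := tc ((chartAt (E n) x₀).symm p.1) x₀ ((chartAt (E n) x₀).symm p.1))
    (tc_symm (symm_mem hp) (mem_source_self _)) (tc_symm (mem_source_self _) (symm_mem hp))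
    p.2

theorem ofTan_famT {x₀ : M} {p : E n × Dual n} (hp : p.1 ∈ (chartAt (E n) x₀).target) :
    ofTan x₀ (p.1, famT (locL L x₀) p) = legendre L (ofCot x₀ p) := by
  simp only [ofTan]
  rw [hL.famT_eq hp, tc_symm (mem_source_self _) (symm_mem hp)]
  rfl

theorem famT_toCot {x₀ : M} {q : CotangentBundle n M} (hq : q.proj ∈ (chartAt (E n) x₀).source) :
    famT (locL L x₀) (toCot x₀ q) = tc q.proj x₀ q.proj (tcoord (legendre L q)) := by
  rw [hL.famT_eq ((chartAt (E n) x₀).map_source hq), ofCot_toCot hq]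
  simp only [toCot, (chartAt (E n) x₀).left_inv hq]

theorem locH_eventuallyEq {x₀ : M} {p : E n × Dual n} (hp : p.1 ∈ (chartAt (E n) x₀).target) :
    locH (hamiltonian L) x₀ =ᶠ[𝓝 p] famH (locL L x₀) := by
  filter_upwards [((chartAt (E n) x₀).open_target.preimage continuous_fst).mem_nhds
    (show p ∈ Prod.fst ⁻¹' _ from hp)] with r hr
  exact hL.locH_eq hr

theorem differentiableAt_locH {x₀ : M} {p : E n × Dual n} (hp : p.1 ∈ (chartAt (E n) x₀).target) :
    DifferentiableAt ℝ (locH (hamiltonian L) x₀) p :=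
  ((hL.isFamilyLagrangian x₀).differentiableAt_famH hp).congr_of_eventuallyEq
    (hL.locH_eventuallyEq hp)

theorem contDiffAt_locH {x₀ : M} {p : E n × Dual n} (hp : p.1 ∈ (chartAt (E n) x₀).target)
    (hξ : p.2 ≠ 0) : ContDiffAt ℝ ∞ (locH (hamiltonian L) x₀) p :=
  ((hL.isFamilyLagrangian x₀).contDiffAt_famH hp hξ).congr_of_eventuallyEq
    (hL.locH_eventuallyEq hp)

/-- The horizontal part of the Hamiltonian vector field is the Legendre transform. -/
theorem hamVec_locH_fst {x₀ : M} {p : E n × Dual n} (hp : p.1 ∈ (chartAt (E n) x₀).target)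
    (hξ : p.2 ≠ 0) : (hamVec (locH (hamiltonian L) x₀) p).1 = famT (locL L x₀) p := by
  ext i
  have h1 := apply_hamVec_fst (locH (hamiltonian L) x₀) p (basisCov i)
  rw [(hL.locH_eventuallyEq hp).fderiv_eq, (hL.isFamilyLagrangian x₀).fderiv_famH_vert hp hξ] at h1
  exact h1

theorem contDiffAt_hamVec {x₀ : M} {p : E n × Dual n} (hp : p.1 ∈ (chartAt (E n) x₀).target)
    (hξ : p.2 ≠ 0) : ContDiffAt ℝ ∞ (hamVec (locH (hamiltonian L) x₀)) p := by
  have h1 : ContDiffAt ℝ ∞ (fderiv ℝ (locH (hamiltonian L) x₀)) p :=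
    (hL.contDiffAt_locH hp hξ).fderiv_right (m := ∞) (by exact_mod_cast le_rfl)
  have h2 : ∀ v, ContDiffAt ℝ ∞ (fun p => fderiv ℝ (locH (hamiltonian L) x₀) p v) p :=
    fun v => h1.clm_apply contDiffAt_const
  exact (ContDiffAt.sum fun i _ => (h2 _).smul contDiffAt_const).prodMk
    (ContDiffAt.sum fun i _ => (h2 _).smul contDiffAt_const).neg

theorem hamiltonian_pos {q : CotangentBundle n M} (hq : ccoord q ≠ 0) : 0 < hamiltonian L q :=
  (hL.isFibreLagrangian q.proj).legH_pos hq

theorem hamiltonian_eq_zero {q : CotangentBundle n M} (hq : ccoord q = 0) :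
    hamiltonian L q = 0 := by
  have := (hL.isFibreLagrangian q.proj).legH_zero
  rw [← hq] at this
  exact this

theorem ccoord_ne_zero_iff {q : CotangentBundle n M} : ccoord q ≠ 0 ↔ 0 < hamiltonian L q :=
  ⟨hL.hamiltonian_pos, fun h h0 => h.ne' (hL.hamiltonian_eq_zero h0)⟩

end IsLagrangian

theorem toCot_snd_eq_zero_iff {x₀ : M} {q : CotangentBundle n M}
    (hq : q.proj ∈ (chartAt (E n) x₀).source) : (toCot x₀ q).2 = 0 ↔ ccoord q = 0 := by
  simp only [toCot]
  constructor
  · intro h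
    by_contra h0
    exact dual_comp_ne_zero (D := tc x₀ q.proj q.proj) (D' := tc q.proj x₀ q.proj)
      (tc_symm (mem_source_self _) hq) h0 h
  · intro h
    rw [h, ContinuousLinearMap.zero_comp]

end OnManifold

/-! ### The Hamiltonian flow -/

section Flow

variable {n : ℕ} {M : Type*} [TopologicalSpace M] [ChartedSpace (E n) M]
  [IsManifold 𝓘(ℝ, E n) ∞ M]

/-- `γ` satisfies Hamilton's equations at the time `t`. -/
def HamAt (H : CotangentBundle n M → ℝ) (γ : ℝ → CotangentBundle n M) (t : ℝ) : Prop :=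
  HasMFDerivAt 𝓘(ℝ, ℝ) (cotModel n) γ t ((1 : ℝ →L[ℝ] ℝ).smulRight (hamField H (γ t)))

theorem HamAt.congr {H : CotangentBundle n M → ℝ} {γ γ' : ℝ → CotangentBundle n M} {t : ℝ}
    (h : HamAt H γ t) (he : γ' =ᶠ[𝓝 t] γ) : HamAt H γ' t := by
  have e : hamV H (γ t) = hamV H (γ' t) := by rw [he.eq_of_nhds]
  exact (HasMFDerivAt.congr_of_eventuallyEq h he).congr_mfderiv
    (congrArg (fun v : E n × Dual n => (1 : ℝ →L[ℝ] ℝ).smulRight v) e)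

theorem HamAt.comp_add {H : CotangentBundle n M → ℝ} {γ : ℝ → CotangentBundle n M} {s t : ℝ}
    (h : HamAt H γ (t + s)) : HamAt H (fun τ => γ (τ + s)) t := by
  have h1 : HasMFDerivAt 𝓘(ℝ, ℝ) 𝓘(ℝ, ℝ) (fun τ : ℝ => τ + s) t (1 : ℝ →L[ℝ] ℝ) :=
    ((hasFDerivAt_id t).add_const s).hasMFDerivAt
  have h2 := HasMFDerivAt.comp t (f := fun τ : ℝ => τ + s) h h1
  exact h2

theorem isMIntegralCurveOn_of_hamAt {H : CotangentBundle n M → ℝ} {γ : ℝ → CotangentBundle n M}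
    {s : Set ℝ} (h : ∀ t ∈ s, HamAt H γ t) :
    IsMIntegralCurveOn (I := cotModel n) γ (hamField H) s :=
  fun t ht => (h t ht).hasMFDerivWithinAt

theorem hamAt_of_isMIntegralCurveOn {H : CotangentBundle n M → ℝ} {γ : ℝ → CotangentBundle n M}
    {s : Set ℝ} (h : IsMIntegralCurveOn (I := cotModel n) γ (hamField H) s) {t : ℝ} (ht : s ∈ 𝓝 t) :
    HamAt H γ t :=
  (h t (mem_of_mem_nhds ht)).hasMFDerivAt ht

theorem HamAt.continuousAt {H : CotangentBundle n M → ℝ} {γ : ℝ → CotangentBundle n M} {t : ℝ}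
    (h : HamAt H γ t) : ContinuousAt γ t := h.1

theorem HamAt.eventually_source {H : CotangentBundle n M → ℝ} {γ : ℝ → CotangentBundle n M} {t : ℝ}
    (h : HamAt H γ t) {x₀ : M} (h₀ : (γ t).proj ∈ (chartAt (E n) x₀).source) :
    ∀ᶠ τ in 𝓝 t, (γ τ).proj ∈ (chartAt (E n) x₀).source :=
  h.continuousAt.eventually ((isOpen_cot_source x₀).mem_nhds h₀)

variable {L : TangentBundle 𝓘(ℝ, E n) M → ℝ} (hL : IsLagrangian L)
include hL

theorem HamAt.hasDerivAt_toCot {γ : ℝ → CotangentBundle n M} {t : ℝ}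
    (h : HamAt (hamiltonian L) γ t) {x₀ : M} (h₀ : (γ t).proj ∈ (chartAt (E n) x₀).source) :
    HasDerivAt (fun τ => toCot x₀ (γ τ)) (hamVec (locH (hamiltonian L) x₀) (toCot x₀ (γ t))) t := by
  rw [← hasDerivWithinAt_univ]
  exact hasDerivWithinAt_toCot (HasMFDerivAt.hasMFDerivWithinAt h) h₀
    (hL.differentiableAt_locH ((chartAt (E n) x₀).map_source h₀))

theorem hamAt_ofCot {x₀ : M} {p : ℝ → E n × Dual n} {t : ℝ}
    (hp : HasDerivAt p (hamVec (locH (hamiltonian L) x₀) (p t)) t)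
    (h₀ : (p t).1 ∈ (chartAt (E n) x₀).target) :
    HamAt (hamiltonian L) (fun t => ofCot x₀ (p t)) t :=
  hasMFDerivAt_ofCot hp h₀ (hL.differentiableAt_locH h₀)

theorem HamAt.hasDerivAt_hamiltonian {γ : ℝ → CotangentBundle n M} {t : ℝ}
    (h : HamAt (hamiltonian L) γ t) : HasDerivAt (fun τ => hamiltonian L (γ τ)) 0 t := by
  have h₀ := mem_source_self (n := n) (γ t).proj
  have h1 := (hL.differentiableAt_locH (p := toCot (γ t).proj (γ t))
    ((chartAt (E n) (γ t).proj).map_source h₀)).hasFDerivAt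
  have h2 := HasFDerivAt.comp_hasDerivAt t (f := fun τ => toCot (γ t).proj (γ τ)) h1
    (h.hasDerivAt_toCot hL h₀)
  rw [fderiv_hamVec] at h2
  refine h2.congr_of_eventuallyEq ?_
  filter_upwards [h.eventually_source h₀] with τ hτ
  simp only [locH, Function.comp_apply]
  rw [ofCot_toCot hτ]

/-- The Hamiltonian is constant along its integral curves. -/
theorem hamiltonian_const {γ : ℝ → CotangentBundle n M} {s : Set ℝ} (hs : IsOpen s)
    (hsc : IsPreconnected s) (h : ∀ t ∈ s, HamAt (hamiltonian L) γ t) {t t' : ℝ} (ht : t ∈ s)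
    (ht' : t' ∈ s) : hamiltonian L (γ t) = hamiltonian L (γ t') :=
  hs.is_const_of_deriv_eq_zero hsc
    (fun τ hτ => ((h τ hτ).hasDerivAt_hamiltonian hL).differentiableAt.differentiableWithinAt)
    (fun τ hτ => ((h τ hτ).hasDerivAt_hamiltonian hL).deriv) ht ht'

theorem continuous_hamiltonian : Continuous (hamiltonian L) := by
  rw [continuous_iff_continuousAt]
  intro q
  have h₀ := mem_source_self (n := n) q.proj
  have h1 := (hL.differentiableAt_locH (p := toCot q.proj q)
    ((chartAt (E n) q.proj).map_source h₀)).continuousAt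
  have h2 := ContinuousAt.comp (f := toCot q.proj) h1 (contMDiffAt_toCot h₀).continuousAt
  refine h2.congr ?_
  filter_upwards [(isOpen_cot_source q.proj).mem_nhds h₀] with r hr
  simp only [locH, Function.comp_apply]
  rw [ofCot_toCot hr]

theorem isOpen_ccoord_ne_zero : IsOpen {q : CotangentBundle n M | ccoord q ≠ 0} := by
  simp only [hL.ccoord_ne_zero_iff]
  exact isOpen_lt continuous_const (continuous_hamiltonian hL)

theorem eventuallyEq_of_hamAt {γ γ' : ℝ → CotangentBundle n M} {t : ℝ}
    (h : ∀ᶠ τ in 𝓝 t, HamAt (hamiltonian L) γ τ) (h' : ∀ᶠ τ in 𝓝 t, HamAt (hamiltonian L) γ' τ)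
    (he : γ t = γ' t) (h0 : ccoord (γ t) ≠ 0) : γ =ᶠ[𝓝 t] γ' := by
  set x₀ := (γ t).proj with hx₀
  have hs : (γ t).proj ∈ (chartAt (E n) x₀).source := mem_source_self _
  have hs' : (γ' t).proj ∈ (chartAt (E n) x₀).source := he ▸ hs
  have hv : ContDiffAt ℝ 1 (hamVec (locH (hamiltonian L) x₀)) (toCot x₀ (γ t)) :=
    (hL.contDiffAt_hamVec ((chartAt (E n) x₀).map_source hs)
      (by rwa [Ne, toCot_snd_eq_zero_iff hs])).of_le (WithTop.coe_le_coe.2 (le_top (a := (1 : ℕ∞))))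
  obtain ⟨C, V, hV, hC⟩ := hv.exists_lipschitzOnWith
  have e1 := h.self_of_nhds.eventually_source hs
  have e2 := h'.self_of_nhds.eventually_source hs'
  have key : (fun τ => toCot x₀ (γ τ)) =ᶠ[𝓝 t] fun τ => toCot x₀ (γ' τ) := by
    refine ODE_solution_unique_of_eventually (v := fun _ => hamVec (locH (hamiltonian L) x₀))
      (s := fun _ => V) (K := C) (Eventually.of_forall fun _ => hC) ?_ ?_ (by rw [he])
    · filter_upwards [h, e1, (h.self_of_nhds.hasDerivAt_toCot hL hs).continuousAt hV]
        with τ h1 h2 h3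
      exact ⟨h1.hasDerivAt_toCot hL h2, h3⟩
    · rw [he] at hV
      filter_upwards [h', e2, (h'.self_of_nhds.hasDerivAt_toCot hL hs').continuousAt hV]
        with τ h1 h2 h3
      exact ⟨h1.hasDerivAt_toCot hL h2, h3⟩
  filter_upwards [key, e1, e2] with τ h1 h2 h3
  rw [← ofCot_toCot h2, h1, ofCot_toCot h3]

omit hL in
theorem t2Space_cotangentBundle [T2Space M] : T2Space (CotangentBundle n M) := by
  rw [t2_iff_nhds]
  intro q q' hne
  have hcont : Continuous (Bundle.TotalSpace.proj : CotangentBundle n M → M) :=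
    FiberBundle.continuous_proj (Dual n) (CotangentSpace n M)
  have hp : q.proj = q'.proj := tendsto_nhds_unique' hne
    (hcont.continuousAt.mono_left inf_le_left) (hcont.continuousAt.mono_left inf_le_right)
  have h1 : q.proj ∈ (chartAt (E n) q.proj).source := mem_source_self _
  have h2 : q'.proj ∈ (chartAt (E n) q.proj).source := hp ▸ h1
  have hc := tendsto_nhds_unique' hne
    ((contMDiffAt_toCot h1).continuousAt.mono_left inf_le_left)
    ((contMDiffAt_toCot h2).continuousAt.mono_left inf_le_right)
  rw [← ofCot_toCot h1, hc, ofCot_toCot h2]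

/-- Uniqueness of integral curves off the zero section. The Hamiltonian vector field is only known
to be continuous at the zero section, which an integral curve of positive energy never meets. -/
theorem eqOn_of_hamAt [T2Space M] {γ γ' : ℝ → CotangentBundle n M} {s : Set ℝ} (hs : IsOpen s)
    (hsc : IsPreconnected s) (h : ∀ t ∈ s, HamAt (hamiltonian L) γ t)
    (h' : ∀ t ∈ s, HamAt (hamiltonian L) γ' t) {t₀ : ℝ} (ht₀ : t₀ ∈ s) (he : γ t₀ = γ' t₀)
    (h0 : ccoord (γ t₀) ≠ 0) : EqOn γ γ' s := by
  have := t2Space_cotangentBundle (n := n) (M := M)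
  have hne : ∀ t ∈ s, ccoord (γ t) ≠ 0 := by
    intro t ht
    rw [hL.ccoord_ne_zero_iff, hamiltonian_const hL hs hsc h ht ht₀, ← hL.ccoord_ne_zero_iff]
    exact h0
  have hsub : s ⊆ {t | t ∈ s ∧ γ =ᶠ[𝓝 t] γ'} := by
    refine hsc.subset_of_closure_inter_subset ?_ ⟨t₀, ht₀, ht₀, ?_⟩ ?_
    · rw [isOpen_iff_mem_nhds]
      rintro t ⟨ht, hte⟩
      filter_upwards [hs.mem_nhds ht, hte.eventuallyEq_nhds] with τ h1 h2
      exact ⟨h1, h2⟩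
    · exact eventuallyEq_of_hamAt hL (eventually_of_mem (hs.mem_nhds ht₀) h)
          (eventually_of_mem (hs.mem_nhds ht₀) h') he h0
    · rintro t ⟨htc, ht⟩
      refine ⟨ht, eventuallyEq_of_hamAt hL (eventually_of_mem (hs.mem_nhds ht) h)
        (eventually_of_mem (hs.mem_nhds ht) h') ?_ (hne t ht)⟩
      have hfr : ∃ᶠ τ in 𝓝 t, γ τ = γ' τ :=
        (mem_closure_iff_frequently.1 htc).mono fun τ hτ => hτ.2.eq_of_nhds
      by_contra hcon
      obtain ⟨U, V, hU, hV, h1, h2, hd⟩ := t2_separation hcon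
      obtain ⟨τ, h3, h4, h5⟩ := (hfr.and_eventually
        (((h t ht).continuousAt.eventually (hU.mem_nhds h1)).and
        ((h' t ht).continuousAt.eventually (hV.mem_nhds h2)))).exists
      exact Set.disjoint_left.1 hd h4 (h3 ▸ h5)
  exact fun t ht => (hsub ht).2.eq_of_nhds

/-- The chosen flow agrees with every integral curve that starts at the same nonzero covector. -/
theorem flow_eq [T2Space M] {γ : ℝ → CotangentBundle n M} {α : CotangentBundle n M}
    (hα : ccoord α ≠ 0) (hγ : γ 0 = α) {a b t : ℝ} (h0 : (0 : ℝ) ∈ Ioo a b) (ht : t ∈ Ioo a b)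
    (h : ∀ τ ∈ Ioo a b, HamAt (hamiltonian L) γ τ) : flow (hamiltonian L) t α = γ t := by
  have hex : ∃ γ : ℝ → CotangentBundle n M, γ 0 = α ∧ ∃ a b : ℝ, (0 : ℝ) ∈ Ioo a b ∧ t ∈ Ioo a b ∧
      IsMIntegralCurveOn (I := cotModel n) γ (hamField (hamiltonian L)) (Ioo a b) :=
    ⟨γ, hγ, a, b, h0, ht, isMIntegralCurveOn_of_hamAt h⟩
  rw [flow, dif_pos hex]
  obtain ⟨h1, a', b', h2, h3, h4⟩ := hex.choose_spec
  refine eqOn_of_hamAt hL (s := Ioo a b ∩ Ioo a' b') (isOpen_Ioo.inter isOpen_Ioo) ?_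
    (fun τ hτ => hamAt_of_isMIntegralCurveOn h4 (isOpen_Ioo.mem_nhds hτ.2)) (fun τ hτ => h τ hτ.1)
    (t₀ := 0) ⟨h0, h2⟩ (by rw [h1, hγ]) (by rw [h1]; exact hα) ⟨ht, h3⟩
  rw [Ioo_inter_Ioo]
  exact isPreconnected_Ioo

/-- The forward integral curves extend a little backwards. -/
theorem exists_forward_curve (hc : ForwardComplete (hamiltonian L)) {α : CotangentBundle n M}
    {g : ℝ → CotangentBundle n M} {ε : ℝ} (hε : 0 < ε) (hg0 : g 0 = α)
    (hg : ∀ t ∈ Ioo (-ε) ε, HamAt (hamiltonian L) g t) :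
    ∃ γ : ℝ → CotangentBundle n M, γ 0 = α ∧ ∀ t ∈ Ioi (-ε), HamAt (hamiltonian L) γ t := by
  obtain ⟨f, hf0, hf⟩ := hc α
  -- glue the two curves at the time `0`, where their one-sided derivatives agree
  set γ : ℝ → CotangentBundle n M := fun t => if t < 0 then g t else f t with hγ
  have hγ0 : γ 0 = α := by simp [hγ, hf0]
  have hneg : EqOn γ g (Iic 0) := by
    intro t ht
    rcases eq_or_lt_of_le (show t ≤ 0 from ht) with rfl | h
    · rw [hγ0, hg0]
    · simp [hγ, h]
  have hpos : EqOn γ f (Ici 0) := by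
    intro t ht
    have : ¬ t < 0 := not_lt.2 ht
    simp [hγ, this]
  refine ⟨γ, hγ0, fun t ht => ?_⟩
  rcases lt_trichotomy t 0 with h | h | h
  · refine (hg t ⟨ht, h.trans hε⟩).congr ?_
    filter_upwards [Iio_mem_nhds h] with τ hτ
    exact hneg (le_of_lt (show τ < 0 from hτ))
  · subst h
    have e1 : hamV (hamiltonian L) (f 0) = hamV (hamiltonian L) (γ 0) := by rw [hγ0, hf0]
    have e2 : hamV (hamiltonian L) (g 0) = hamV (hamiltonian L) (γ 0) := by rw [hγ0, hg0]
    have h1 := ((hf 0 self_mem_Ici).congr_of_eventuallyEq (f₁ := γ) hpos.eventuallyEq_nhdsWithin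
      (hpos self_mem_Ici)).congr_mfderiv
      (congrArg (fun v : E n × Dual n => (1 : ℝ →L[ℝ] ℝ).smulRight v) e1)
    have h2 := ((HasMFDerivAt.hasMFDerivWithinAt (s := Iic 0)
      (hg 0 ⟨by linarith, hε⟩)).congr_of_eventuallyEq (f₁ := γ)
      hneg.eventuallyEq_nhdsWithin (hneg self_mem_Iic)).congr_mfderiv
      (congrArg (fun v : E n × Dual n => (1 : ℝ →L[ℝ] ℝ).smulRight v) e2)
    have h3 := h2.union h1
    rw [Iic_union_Ici] at h3
    exact hasMFDerivWithinAt_univ.1 h3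
  · refine (hamAt_of_isMIntegralCurveOn hf (Ici_mem_nhds h)).congr ?_
    filter_upwards [Ioi_mem_nhds h] with τ hτ
    exact hpos (le_of_lt (show 0 < τ from hτ))

end Flow

/-! ### Smoothness of the Hamiltonian flow -/

section FlowSmooth

variable {n : ℕ} {M : Type*} [TopologicalSpace M] [ChartedSpace (E n) M]
  [IsManifold 𝓘(ℝ, E n) ∞ M]

/-- The Hamiltonian flow is of class `C^k`, jointly in time and in the initial covector, at the time
`t` and the covector `α`. -/
def FlowSmoothAt (H : CotangentBundle n M → ℝ) (k : WithTop ℕ∞) (t : ℝ) (α : CotangentBundle n M) :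
    Prop :=
  ContMDiffAt (𝓘(ℝ, ℝ).prod (cotModel n)) (cotModel n) k
    (fun p : ℝ × CotangentBundle n M => flow H p.1 p.2) (t, α)

/-- The nonzero covector `α` has an integral curve defined on `(-ε, ∞)`. -/
structure HasFlow (H : CotangentBundle n M → ℝ) (ε : ℝ) (α : CotangentBundle n M) : Prop where
  pos : 0 < ε
  ne_zero : ccoord α ≠ 0
  hamAt : ∀ t, -ε < t → HamAt H (fun τ => flow H τ α) t

theorem flow_zero (H : CotangentBundle n M → ℝ) (α : CotangentBundle n M) : flow H 0 α = α := by
  unfold flow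
  split_ifs with h
  · exact h.choose_spec.1
  · rfl

variable {L : TangentBundle 𝓘(ℝ, E n) M → ℝ} (hL : IsLagrangian L)
include hL

/-- Near a nonzero covector the flow is defined and of class `C^k` for small times: in coordinates
it is the local flow of a smooth vector field. -/
theorem exists_local_flow [T2Space M] (k : ℕ) {α₀ : CotangentBundle n M} (h0 : ccoord α₀ ≠ 0) :
    ∃ ε > 0, ∀ᶠ α in 𝓝 α₀, ccoord α ≠ 0 ∧
      (∃ g : ℝ → CotangentBundle n M, g 0 = α ∧ ∀ t ∈ Ioo (-ε) ε, HamAt (hamiltonian L) g t) ∧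
      ∀ t ∈ Ioo (-ε) ε, FlowSmoothAt (hamiltonian L) k t α := by
  set x₀ := α₀.proj with hx₀
  have hs : α₀.proj ∈ (chartAt (E n) x₀).source := mem_source_self _
  set p₀ := toCot x₀ α₀ with hp₀
  have hp1 : p₀.1 ∈ (chartAt (E n) x₀).target := (chartAt (E n) x₀).map_source hs
  have hp2 : p₀.2 ≠ 0 := by rwa [Ne, toCot_snd_eq_zero_iff hs]
  obtain ⟨ε, r, Φ, hε, hr, hΦ, hsm⟩ := exists_isLocalFlow_contDiffOn k
    (hL.contDiffAt_hamVec hp1 hp2)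
  set G : Set (E n × Dual n) := {p | p.1 ∈ (chartAt (E n) x₀).target ∧ p.2 ≠ 0} with hG
  have hGo : IsOpen G := ((chartAt (E n) x₀).open_target.preimage continuous_fst).inter
    (isOpen_ne_fun continuous_snd continuous_const)
  have hdom : IsOpen (Ioo (-ε) ε ×ˢ Metric.ball p₀ r) := isOpen_Ioo.prod Metric.isOpen_ball
  have hmem : ((0 : ℝ), p₀) ∈ Ioo (-ε) ε ×ˢ Metric.ball p₀ r :=
    ⟨⟨by linarith, hε⟩, Metric.mem_ball_self hr⟩
  have hev : ∀ᶠ q : ℝ × (E n × Dual n) in 𝓝 (0, p₀),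
      Φ q.1 q.2 ∈ G ∧ q ∈ Ioo (-ε) ε ×ˢ Metric.ball p₀ r := by
    refine ((hsm.continuousOn.continuousAt (hdom.mem_nhds hmem)).eventually
      (hGo.mem_nhds ?_)).and (hdom.mem_nhds hmem)
    have := (hΦ p₀ hmem.2).1
    simp only [this]
    exact ⟨hp1, hp2⟩
  rw [nhds_prod_eq] at hev
  obtain ⟨U, hU, V, hV, hUV⟩ := Filter.eventually_prod_iff.1 hev
  obtain ⟨δ, hδ, hδU⟩ := Metric.eventually_nhds_iff.1 hU
  have hδU' : ∀ t ∈ Ioo (-δ) δ, U t := fun t ht => hδU (by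
    rw [Real.dist_eq, sub_zero, abs_lt]; exact ht)
  have hnear : ∀ᶠ α in 𝓝 α₀, α.proj ∈ (chartAt (E n) x₀).source ∧ V (toCot x₀ α) ∧ ccoord α ≠ 0 :=
    ((isOpen_cot_source x₀).eventually_mem hs).and
      (((contMDiffAt_toCot hs).continuousAt.eventually hV).and
        ((isOpen_ccoord_ne_zero hL).eventually_mem h0))
  have hcurve : ∀ α : CotangentBundle n M, α.proj ∈ (chartAt (E n) x₀).source → V (toCot x₀ α) →
      ∀ t ∈ Ioo (-δ) δ, HamAt (hamiltonian L) (fun t => ofCot x₀ (Φ t (toCot x₀ α))) t := by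
    intro α h1 h2 t ht
    obtain ⟨h3, h4⟩ := hUV (hδU' t ht) h2
    exact hamAt_ofCot hL ((hΦ _ h4.2).2 t h4.1) h3.1
  have hzero : ∀ α : CotangentBundle n M, α.proj ∈ (chartAt (E n) x₀).source → V (toCot x₀ α) →
      ofCot x₀ (Φ 0 (toCot x₀ α)) = α := by
    intro α h1 h2
    rw [(hΦ _ (hUV (hδU' 0 ⟨by linarith, hδ⟩) h2).2.2).1, ofCot_toCot h1]
  have hflow : ∀ α : CotangentBundle n M, α.proj ∈ (chartAt (E n) x₀).source → V (toCot x₀ α) →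
      ccoord α ≠ 0 → ∀ t ∈ Ioo (-δ) δ,
        flow (hamiltonian L) t α = ofCot x₀ (Φ t (toCot x₀ α)) := fun α h1 h2 h3 t ht =>
    flow_eq hL h3 (hzero α h1 h2) ⟨by linarith, hδ⟩ ht (hcurve α h1 h2)
  refine ⟨δ, hδ, ?_⟩
  filter_upwards [hnear.eventually_nhds] with α hα
  obtain ⟨h1, h2, h3⟩ := hα.self_of_nhds
  refine ⟨h3, ⟨_, hzero α h1 h2, hcurve α h1 h2⟩, fun t ht => ?_⟩
  obtain ⟨h4, h5⟩ := hUV (hδU' t ht) h2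
  have c1 : ContMDiffAt (𝓘(ℝ, ℝ).prod (cotModel n)) 𝓘(ℝ, ℝ × (E n × Dual n)) k
      (fun p : ℝ × CotangentBundle n M => (p.1, toCot x₀ p.2)) (t, α) :=
    contMDiffAt_fst.prodMk_space
      (ContMDiffAt.comp (t, α) (f := Prod.snd) (g := toCot x₀)
        ((contMDiffAt_toCot h1).of_le (WithTop.coe_le_coe.2 le_top)) contMDiffAt_snd)
  have c2 : ContMDiffAt 𝓘(ℝ, ℝ × (E n × Dual n)) 𝓘(ℝ, E n × Dual n) k
      (fun q : ℝ × (E n × Dual n) => Φ q.1 q.2) (t, toCot x₀ α) :=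
    (hsm.contDiffAt (hdom.mem_nhds h5)).contMDiffAt
  have c3 : ContMDiffAt 𝓘(ℝ, E n × Dual n) (cotModel n) k
      (ofCot x₀ : E n × Dual n → CotangentBundle n M) (Φ t (toCot x₀ α)) :=
    (contMDiffAt_ofCot h4.1).of_le (WithTop.coe_le_coe.2 le_top)
  have c4 := ContMDiffAt.comp (t, α)
    (f := fun p : ℝ × CotangentBundle n M => (p.1, toCot x₀ p.2))
    (g := fun q : ℝ × (E n × Dual n) => Φ q.1 q.2) c2 c1
  have c5 := ContMDiffAt.comp (t, α) (g := ofCot x₀)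
    (f := fun p : ℝ × CotangentBundle n M => Φ p.1 (toCot x₀ p.2)) c3 c4
  refine c5.congr_of_eventuallyEq ?_
  have hev2 : ∀ᶠ p : ℝ × CotangentBundle n M in 𝓝 (t, α), p.1 ∈ Ioo (-δ) δ ∧
      (p.2.proj ∈ (chartAt (E n) x₀).source ∧ V (toCot x₀ p.2) ∧ ccoord p.2 ≠ 0) :=
    ((continuousAt_fst (p := (t, α))).eventually (isOpen_Ioo.mem_nhds ht)).and
      (Tendsto.eventually (continuousAt_snd (p := (t, α))) hα :)
  filter_upwards [hev2] with p hp
  exact hflow p.2 hp.2.1 hp.2.2.1 hp.2.2.2 p.1 hp.1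

theorem hasFlow_of_curve [T2Space M] (hc : ForwardComplete (hamiltonian L))
    {α : CotangentBundle n M} {g : ℝ → CotangentBundle n M} {ε : ℝ} (hε : 0 < ε)
    (hα : ccoord α ≠ 0) (hg0 : g 0 = α) (hg : ∀ t ∈ Ioo (-ε) ε, HamAt (hamiltonian L) g t) :
    HasFlow (hamiltonian L) ε α := by
  obtain ⟨γ, hγ0, hγ⟩ := exists_forward_curve hL hc hε hg0 hg
  refine ⟨hε, hα, fun t ht => (hγ t ht).congr ?_⟩
  filter_upwards [Ioi_mem_nhds ht] with τ hτ
  refine flow_eq hL hα hγ0 (a := -ε) (b := max τ 0 + 1) ⟨by linarith, ?_⟩ ⟨hτ, ?_⟩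
    fun s hs => hγ s hs.1
  · linarith [le_max_right τ 0]
  · linarith [le_max_left τ 0]

namespace HasFlow

variable {ε : ℝ} {α : CotangentBundle n M} (h : HasFlow (hamiltonian L) ε α)
include h

theorem hamiltonian_flow {t : ℝ} (ht : -ε < t) :
    hamiltonian L (flow (hamiltonian L) t α) = hamiltonian L α := by
  have := hamiltonian_const hL (γ := fun τ => flow (hamiltonian L) τ α) isOpen_Ioi
    isPreconnected_Ioi h.hamAt ht (show -ε < 0 by linarith [h.pos])
  simpa only [flow_zero] using this

theorem ccoord_flow_ne_zero {t : ℝ} (ht : -ε < t) : ccoord (flow (hamiltonian L) t α) ≠ 0 := by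
  rw [hL.ccoord_ne_zero_iff, h.hamiltonian_flow hL ht, ← hL.ccoord_ne_zero_iff]
  exact h.ne_zero

/-- The group law of the flow. -/
theorem flow_flow [T2Space M] {s t : ℝ} (ht : -ε < t) (hst : -ε < s + t) :
    flow (hamiltonian L) s (flow (hamiltonian L) t α) = flow (hamiltonian L) (s + t) α := by
  refine flow_eq hL (γ := fun τ => flow (hamiltonian L) (τ + t) α) (h.ccoord_flow_ne_zero hL ht)
    (by simp) (a := -ε - t) (b := max s 0 + 1) ⟨by linarith, ?_⟩ ⟨by linarith, ?_⟩ ?_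
  · linarith [le_max_right s 0]
  · linarith [le_max_left s 0]
  · intro τ hτ
    exact (h.hamAt (τ + t) (by linarith [hτ.1])).comp_add

end HasFlow

/-- The flow is `C^k` along the whole integral curve: the set of times where it is `C^k` is open,
and closed by the group law and the local flow at a limit point. -/
theorem flowSmoothAt_of_hasFlow [T2Space M] (k : ℕ) {ε : ℝ} {α : CotangentBundle n M}
    (hα : ∀ᶠ β in 𝓝 α, HasFlow (hamiltonian L) ε β) {t : ℝ} (ht : -ε < t) :
    FlowSmoothAt (hamiltonian L) k t α := by
  have hα' := hα.self_of_nhds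
  have hsub : Ioi (-ε) ⊆ {t | -ε < t ∧ FlowSmoothAt (hamiltonian L) k t α} := by
    refine isPreconnected_Ioi.subset_of_closure_inter_subset ?_ ⟨0, ?_, ?_, ?_⟩ ?_
    · rw [isOpen_iff_mem_nhds]
      rintro s ⟨hs, hs'⟩
      have h1 : ∀ᶠ p in 𝓝 (s, α), FlowSmoothAt (hamiltonian L) k p.1 p.2 := by
        have : ContMDiffAt (𝓘(ℝ, ℝ).prod (cotModel n)) (cotModel n) k
          (fun p : ℝ × CotangentBundle n M => flow (hamiltonian L) p.1 p.2) (s, α) := hs'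
        exact (contMDiffAt_iff_contMDiffAt_nhds (by simp)).1 this
      have h2 : Tendsto (fun τ : ℝ => (τ, α)) (𝓝 s) (𝓝 (s, α)) :=
        (Continuous.prodMk_left α).tendsto s
      exact Filter.Eventually.and (Ioi_mem_nhds hs : ∀ᶠ τ in 𝓝 s, τ ∈ Ioi (-ε)) (h2.eventually h1)
    · exact show -ε < 0 by linarith [hα'.pos]
    · linarith [hα'.pos]
    · obtain ⟨δ, hδ, hev⟩ := exists_local_flow hL k hα'.ne_zero
      exact hev.self_of_nhds.2.2 0 ⟨by linarith, hδ⟩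
    · rintro s ⟨hsc, hs⟩
      refine ⟨hs, ?_⟩
      obtain ⟨δ, hδ, hev⟩ := exists_local_flow hL k (hα'.ccoord_flow_ne_zero hL hs)
      have hfr := mem_closure_iff_frequently.1 hsc
      have hdist : ∀ᶠ r in 𝓝 s, s - r ∈ Ioo (-δ) δ := by
        have : ContinuousAt (fun r : ℝ => s - r) s := by fun_prop
        exact this.eventually (isOpen_Ioo.mem_nhds (by simpa using hδ))
      -- `r` is a time of smoothness so close to the limit `s` that the local flow joins them
      obtain ⟨r, ⟨hr, hrs⟩, hr2, hr3⟩ := (hfr.and_eventually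
        (hdist.and ((hα'.hamAt s hs).continuousAt.eventually hev))).exists
      have c1 : ContMDiffAt (cotModel n) (cotModel n) k (flow (hamiltonian L) r) α :=
        ContMDiffAt.comp α (f := fun β : CotangentBundle n M => (r, β))
          (g := fun p : ℝ × CotangentBundle n M => flow (hamiltonian L) p.1 p.2) hrs
          (contMDiffAt_const.prodMk contMDiffAt_id)
      have c2 : ContMDiffAt (𝓘(ℝ, ℝ).prod (cotModel n)) (𝓘(ℝ, ℝ).prod (cotModel n)) k
          (fun p : ℝ × CotangentBundle n M => (p.1 - r, flow (hamiltonian L) r p.2)) (s, α) := by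
        refine ContMDiffAt.prodMk ?_ (ContMDiffAt.comp (s, α) (f := Prod.snd)
          (g := flow (hamiltonian L) r) c1 contMDiffAt_snd)
        have h5 : ContMDiff 𝓘(ℝ, ℝ) 𝓘(ℝ, ℝ) k (fun τ : ℝ => τ - r) :=
          (contDiff_id.sub contDiff_const).contMDiff
        exact ContMDiffAt.comp (s, α) (f := Prod.fst) (g := fun τ : ℝ => τ - r) (h5 s)
          contMDiffAt_fst
      have c3 := ContMDiffAt.comp (s, α)
        (f := fun p : ℝ × CotangentBundle n M => (p.1 - r, flow (hamiltonian L) r p.2))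
        (g := fun p : ℝ × CotangentBundle n M => flow (hamiltonian L) p.1 p.2)
        (hr3.2.2 (s - r) hr2) c2
      refine ContMDiffAt.congr_of_eventuallyEq c3 ?_
      have hev2 : ∀ᶠ p : ℝ × CotangentBundle n M in 𝓝 (s, α), -ε < p.1 ∧
          HasFlow (hamiltonian L) ε p.2 :=
        (continuousAt_fst.eventually (Ioi_mem_nhds hs)).and (continuousAt_snd.eventually hα)
      filter_upwards [hev2] with p hp
      simp only [Function.comp_apply]
      rw [hp.2.flow_flow hL hr (by linarith [hp.1])]
      simp
  exact (hsub ht).2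

/-- Near a nonzero covector, the flow is defined and smooth for all times larger than some negative
time. -/
theorem exists_hasFlow [T2Space M] (hc : ForwardComplete (hamiltonian L))
    {α₀ : CotangentBundle n M} (h0 : ccoord α₀ ≠ 0) :
    ∃ ε > 0, ∀ᶠ α in 𝓝 α₀, HasFlow (hamiltonian L) ε α ∧
      ∀ t, -ε < t → FlowSmoothAt (hamiltonian L) ∞ t α := by
  obtain ⟨ε, hε, hev⟩ := exists_local_flow hL 0 h0
  have hev' : ∀ᶠ α in 𝓝 α₀, HasFlow (hamiltonian L) ε α := by
    filter_upwards [hev] with α hα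
    obtain ⟨h1, ⟨g, hg0, hg⟩, -⟩ := hα
    exact hasFlow_of_curve hL hc hε h1 hg0 hg
  refine ⟨ε, hε, ?_⟩
  filter_upwards [hev'.eventually_nhds] with α hα
  refine ⟨hα.self_of_nhds, fun t ht => contMDiffAt_infty.2 fun k => ?_⟩
  exact flowSmoothAt_of_hasFlow hL k hα ht

end FlowSmooth

/-! ### The exponential map -/

section InverseFunction

theorem bijective_isEquiv {V W : Type*} [NormedAddCommGroup V] [NormedSpace ℝ V]
    [NormedAddCommGroup W] [NormedSpace ℝ W] [FiniteDimensional ℝ V] {A : V →L[ℝ] W}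
    (hA : Function.Bijective A) : ∃ e : V ≃L[ℝ] W, (e : V →L[ℝ] W) = A := by
  have : FiniteDimensional ℝ W := Module.Finite.of_surjective (A : V →ₗ[ℝ] W) hA.2
  refine ⟨(LinearEquiv.ofBijective (A : V →ₗ[ℝ] W) hA).toContinuousLinearEquiv, ?_⟩
  ext v
  rfl

/-- Inverse function theorem: a local inverse, and regularity at nearby points. -/
theorem exists_local_inverse {V W : Type*} [NormedAddCommGroup V] [NormedSpace ℝ V]
    [NormedAddCommGroup W] [NormedSpace ℝ W] [FiniteDimensional ℝ V] {φ : V → W} {v : V}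
    (hφ : ContDiffAt ℝ ∞ φ v) (hb : Function.Bijective (fderiv ℝ φ v)) :
    ∃ e : OpenPartialHomeomorph V W, v ∈ e.source ∧ (∀ x ∈ e.source, e x = φ x) ∧
      ContDiffAt ℝ ∞ e.symm (φ v) ∧ ∀ᶠ x in 𝓝 v, Function.Bijective (fderiv ℝ φ x) := by
  have hc : CompleteSpace V := FiniteDimensional.complete ℝ V
  obtain ⟨A, hA⟩ := bijective_isEquiv hb
  have hd : HasFDerivAt φ (A : V →L[ℝ] W) v := by
    rw [hA]; exact (hφ.differentiableAt (by simp)).hasFDerivAt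
  refine ⟨hφ.toOpenPartialHomeomorph φ hd (by simp),
    hφ.mem_toOpenPartialHomeomorph_source hd (by simp), fun x _ => rfl,
      hφ.to_localInverse hd (by simp), ?_⟩
  have hcont : ContinuousAt (fderiv ℝ φ) v :=
    (hφ.fderiv_right (m := 0) (by simp)).continuousAt
  have hn := A.nhds
  rw [hA] at hn
  filter_upwards [hcont hn] with x hx
  obtain ⟨B, hB⟩ := hx
  rw [← hB]
  exact B.bijective

end InverseFunction

section Exp

variable {n : ℕ} {M : Type*} [TopologicalSpace M] [ChartedSpace (E n) M]
  [IsManifold 𝓘(ℝ, E n) ∞ M]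

/-- The derivative of a map to `M`, in the preferred chart at its value. -/
def dman {F : Type*} [NormedAddCommGroup F] [NormedSpace ℝ F] (f : F → M) (b : F) : F →L[ℝ] E n :=
  mfderiv 𝓘(ℝ, F) 𝓘(ℝ, E n) f b

theorem hasFDerivAt_chart_comp {F : Type*} [NormedAddCommGroup F] [NormedSpace ℝ F] {f : F → M}
    {b : F} (hf : MDifferentiableAt 𝓘(ℝ, F) 𝓘(ℝ, E n) f b) {x₀ : M}
    (h₀ : f b ∈ (chartAt (E n) x₀).source) :
    HasFDerivAt (fun b => chartAt (E n) x₀ (f b)) ((tc (f b) x₀ (f b)).comp (dman f b)) b := by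
  have h1 : HasFDerivWithinAt (writtenInExtChartAt 𝓘(ℝ, F) 𝓘(ℝ, E n) b f) (dman f b)
      (range 𝓘(ℝ, F)) (extChartAt 𝓘(ℝ, F) b b) := hf.hasMFDerivAt.2
  simp only [mfld_simps, hasFDerivWithinAt_univ] at h1
  have h2 : HasFDerivAt (fun b' => chartAt (E n) (f b) (f b')) (dman f b) b := h1
  have h3 := HasFDerivAt.comp b (f := fun b' => chartAt (E n) (f b) (f b'))
    (hasFDerivAt_trans (mem_source_self (n := n) (f b)) h₀) h2
  refine h3.congr_of_eventuallyEq ?_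
  filter_upwards [hf.continuousAt.eventually ((chartAt (E n) (f b)).open_source.mem_nhds
    (mem_source_self (n := n) _))] with b' hb'
  simp only [Function.comp_apply, trans]
  rw [(chartAt (E n) (f b)).left_inv hb']

theorem tc_bijective {x₀ x₁ x : M} (h₀ : x ∈ (chartAt (E n) x₀).source)
    (h₁ : x ∈ (chartAt (E n) x₁).source) : Function.Bijective (tc (n := n) x₀ x₁ x) :=
  Function.bijective_iff_has_inverse.2 ⟨tc x₁ x₀ x, tc_symm h₀ h₁, tc_symm h₁ h₀⟩

/-- Invertibility of the differential of a map to `M` can be tested in any chart. -/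
theorem bijective_dman_iff {F : Type*} [NormedAddCommGroup F] [NormedSpace ℝ F] {f : F → M}
    {b : F} (hf : MDifferentiableAt 𝓘(ℝ, F) 𝓘(ℝ, E n) f b) {x₀ : M}
    (h₀ : f b ∈ (chartAt (E n) x₀).source) :
    Function.Bijective (fderiv ℝ (fun b => chartAt (E n) x₀ (f b)) b) ↔
      Function.Bijective (dman (n := n) f b) := by
  rw [(hasFDerivAt_chart_comp hf h₀).fderiv, ContinuousLinearMap.coe_comp,
    (tc_bijective (mem_source_self _) h₀).of_comp_iff']

theorem contDiffAt_chart_comp {F : Type*} [NormedAddCommGroup F] [NormedSpace ℝ F] {f : F → M}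
    {b : F} (hf : ContMDiffAt 𝓘(ℝ, F) 𝓘(ℝ, E n) ∞ f b) {x₀ : M}
    (h₀ : f b ∈ (chartAt (E n) x₀).source) :
    ContDiffAt ℝ ∞ (fun b => chartAt (E n) x₀ (f b)) b :=
  (((contMDiffOn_chart (I := 𝓘(ℝ, E n)) (n := ∞) (x := x₀)).contMDiffAt
    ((chartAt (E n) x₀).open_source.mem_nhds h₀)).comp b hf).contDiffAt

theorem contMDiffAt_covec (z : M) (β : Dual n) :
    ContMDiffAt 𝓘(ℝ, Dual n) (cotModel n) ∞ (covec z : Dual n → CotangentBundle n M) β := by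
  have h1 : (covec z : Dual n → CotangentBundle n M) =
      fun β => ofCot z (chartAt (E n) z z, β) := by
    funext β
    have h2 := ofCot_toCot (x₀ := z) (q := covec z β) (mem_source_self z)
    rw [toCot_covec_self] at h2
    exact h2.symm
  rw [h1]
  exact ContMDiffAt.comp β (f := fun β : Dual n => (chartAt (E n) z z, β)) (g := ofCot z)
    (contMDiffAt_ofCot ((chartAt (E n) z).map_source (mem_source_self z)))
    (contDiffAt_const.prodMk contDiffAt_id).contMDiffAt

theorem contMDiffAt_cotangent_proj (q : CotangentBundle n M) :
    ContMDiffAt (cotModel n) 𝓘(ℝ, E n) ∞ (Bundle.TotalSpace.proj : CotangentBundle n M → M) q := by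
  have h0 := mem_source_self (n := n) q.proj
  have h1 : ContMDiffAt (cotModel n) 𝓘(ℝ, E n) ∞ (fun r : CotangentBundle n M =>
      (toCot q.proj r).1) q :=
    ContMDiffAt.comp q (f := toCot q.proj) (g := Prod.fst) contDiffAt_fst.contMDiffAt
      (contMDiffAt_toCot h0)
  have h2 := ContMDiffAt.comp q (f := fun r : CotangentBundle n M => (toCot q.proj r).1)
    (g := (chartAt (E n) q.proj).symm)
    ((contMDiffOn_chart_symm (I := 𝓘(ℝ, E n)) (n := ∞) (x := q.proj)).contMDiffAt
    ((chartAt (E n) q.proj).open_target.mem_nhds ((chartAt (E n) q.proj).map_source h0))) h1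
  refine h2.congr_of_eventuallyEq ?_
  filter_upwards [(isOpen_cot_source q.proj).mem_nhds h0] with r hr
  exact ((chartAt (E n) q.proj).left_inv hr).symm

/-- The covector `Φ_{1/a}(aβ)`, `H(aβ) = c`, whose base point is `exp_z^c(β)`. -/
def expCov (L : TangentBundle 𝓘(ℝ, E n) M → ℝ) (c : ℝ) (z : M) (β : Dual n) :
    CotangentBundle n M :=
  flow (hamiltonian L) (scale L c z β)⁻¹ (covec z (scale L c z β • β))

theorem expMap_eq {L : TangentBundle 𝓘(ℝ, E n) M → ℝ} {c : ℝ} {z : M} {β : Dual n} (hβ : β ≠ 0) :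
    expMap L c z β = (expCov L c z β).proj := by
  rw [expMap, if_neg hβ]; rfl

theorem expMap_eventuallyEq (L : TangentBundle 𝓘(ℝ, E n) M → ℝ) (c : ℝ) (z : M) {β : Dual n}
    (hβ : β ≠ 0) : expMap L c z =ᶠ[𝓝 β] fun b => (expCov L c z b).proj := by
  filter_upwards [isOpen_ne.mem_nhds hβ] with b hb using expMap_eq hb

variable {L : TangentBundle 𝓘(ℝ, E n) M → ℝ} (hL : IsLagrangian L) {c : ℝ} (hc0 : 0 < c) {z : M}
include hL hc0

theorem scale_spec {β : Dual n} (hβ : β ≠ 0) :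
    0 < scale L c z β ∧ hamiltonian L (covec z (scale L c z β • β)) = c :=
  Classical.epsilon_spec (p := fun a : ℝ => 0 < a ∧ hamiltonian L (covec z (a • β)) = c)
    ((hL.isFibreLagrangian z).exists_scale hc0 hβ)

theorem scale_eq {β : Dual n} (hβ : β ≠ 0) {a : ℝ} (ha : 0 < a)
    (h : hamiltonian L (covec z (a • β)) = c) : scale L c z β = a := by
  obtain ⟨h1, h2⟩ := scale_spec hL hc0 (z := z) hβ
  exact (hL.isFibreLagrangian z).scale_unique hβ h1 ha (h2.trans h.symm)

theorem scale_smul {β : Dual n} (hβ : β ≠ 0) {t : ℝ} (ht : 0 < t) :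
    scale L c z (t • β) = scale L c z β / t := by
  obtain ⟨h1, h2⟩ := scale_spec hL hc0 (z := z) hβ
  refine scale_eq hL hc0 (smul_ne_zero ht.ne' hβ) (div_pos h1 ht) ?_
  rw [smul_smul, div_mul_cancel₀ _ ht.ne', h2]

theorem ne_zero_of_level {α : Dual n} (hα : hamiltonian L (covec z α) = c) : α ≠ 0 := by
  have : ccoord (covec z α) ≠ 0 := hL.ccoord_ne_zero_iff.2 (hα ▸ hc0)
  exact this

/-- On the ray through a covector `α` of energy `c`, the scale at `tα` is `1/t`; hence
`exp_z^c(tα) = π(Φ_t(α))`. -/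
theorem scale_level {α : Dual n} (hα : hamiltonian L (covec z α) = c) {t : ℝ} (ht : 0 < t) :
    scale L c z (t • α) = t⁻¹ := by
  have h0 := ne_zero_of_level hL hc0 hα
  rw [scale_smul hL hc0 h0 ht, scale_eq hL hc0 h0 one_pos (by rw [one_smul]; exact hα), one_div]

theorem expCov_level {α : Dual n} (hα : hamiltonian L (covec z α) = c) {t : ℝ} (ht : 0 < t) :
    expCov L c z (t • α) = flow (hamiltonian L) t (covec z α) := by
  rw [expCov, scale_level hL hc0 hα ht, inv_inv, smul_smul, inv_mul_cancel₀ ht.ne', one_smul]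

theorem expMap_level {α : Dual n} (hα : hamiltonian L (covec z α) = c) {t : ℝ} (ht : 0 < t) :
    expMap L c z (t • α) = curve L z α t := by
  rw [expMap_eq (smul_ne_zero ht.ne' (ne_zero_of_level hL hc0 hα)), expCov_level hL hc0 hα ht]; rfl

theorem contDiffAt_scale {β : Dual n} (hβ : β ≠ 0) : ContDiffAt ℝ ∞ (scale L c z) β :=
  (hL.isFibreLagrangian z).contDiffAt_scale (fun _ hb => scale_spec hL hc0 hb) hβ

variable [T2Space M] (hc : ForwardComplete (hamiltonian L))
include hc

theorem hamiltonian_expCov {β : Dual n} (hβ : β ≠ 0) : hamiltonian L (expCov L c z β) = c := by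
  obtain ⟨h1, h2⟩ := scale_spec hL hc0 (z := z) hβ
  obtain ⟨ε, hε, hev⟩ := exists_hasFlow hL hc (α₀ := covec z (scale L c z β • β))
    (smul_ne_zero h1.ne' hβ)
  rw [expCov, hev.self_of_nhds.1.hamiltonian_flow hL (by linarith [inv_pos.2 h1]), h2]

theorem ccoord_expCov_ne_zero {β : Dual n} (hβ : β ≠ 0) : ccoord (expCov L c z β) ≠ 0 := by
  rw [hL.ccoord_ne_zero_iff, hamiltonian_expCov hL hc0 hc hβ]
  exact hc0

/-- The covectors on the rescaled integral curves through the fibre at `z` depend smoothly on the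
parameters. -/
theorem contMDiffAt_flow_scale {β : Dual n} (hβ : β ≠ 0) {s : ℝ} (hs : 0 ≤ s) :
    ContMDiffAt 𝓘(ℝ, ℝ × Dual n) (cotModel n) ∞ (fun p : ℝ × Dual n =>
      flow (hamiltonian L) (p.1 * (scale L c z p.2)⁻¹) (covec z (scale L c z p.2 • p.2)))
        (s, β) := by
  obtain ⟨h1, h2⟩ := scale_spec hL hc0 (z := z) hβ
  obtain ⟨ε, hε, hev⟩ := exists_hasFlow hL hc (α₀ := covec z (scale L c z β • β))
    (smul_ne_zero h1.ne' hβ)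
  have h3 : FlowSmoothAt (hamiltonian L) ∞ (s * (scale L c z β)⁻¹) (covec z (scale L c z β • β)) :=
    hev.self_of_nhds.2 _ (by have := mul_nonneg hs (inv_pos.2 h1).le; linarith)
  have hsc : ContDiffAt ℝ ∞ (fun p : ℝ × Dual n => scale L c z p.2) (s, β) :=
    ContDiffAt.comp (s, β) (f := Prod.snd) (g := scale L c z) (contDiffAt_scale hL hc0 hβ)
      contDiffAt_snd
  have h4 : ContMDiffAt 𝓘(ℝ, ℝ × Dual n) 𝓘(ℝ, ℝ) ∞
      (fun p : ℝ × Dual n => p.1 * (scale L c z p.2)⁻¹) (s, β) :=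
    (contDiffAt_fst.mul (hsc.inv h1.ne')).contMDiffAt
  have h5 : ContMDiffAt 𝓘(ℝ, ℝ × Dual n) (cotModel n) ∞
      (fun p : ℝ × Dual n => (covec z (scale L c z p.2 • p.2) : CotangentBundle n M)) (s, β) :=
    ContMDiffAt.comp (s, β) (f := fun p : ℝ × Dual n => scale L c z p.2 • p.2) (g := covec z)
      (contMDiffAt_covec z _) (hsc.smul contDiffAt_snd).contMDiffAt
  exact ContMDiffAt.comp (s, β) (f := fun p : ℝ × Dual n => (p.1 * (scale L c z p.2)⁻¹,
      (covec z (scale L c z p.2 • p.2) : CotangentBundle n M)))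
    (g := fun p : ℝ × CotangentBundle n M => flow (hamiltonian L) p.1 p.2) h3 (h4.prodMk h5)

theorem contMDiffAt_expCov {β : Dual n} (hβ : β ≠ 0) :
    ContMDiffAt 𝓘(ℝ, Dual n) (cotModel n) ∞ (expCov L c z) β := by
  have h1 := ContMDiffAt.comp β (f := fun b : Dual n => ((1 : ℝ), b))
    (g := fun p : ℝ × Dual n =>
      flow (hamiltonian L) (p.1 * (scale L c z p.2)⁻¹) (covec z (scale L c z p.2 • p.2)))
    (contMDiffAt_flow_scale hL hc0 hc hβ zero_le_one)
    (contDiffAt_const.prodMk contDiffAt_id).contMDiffAt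
  refine h1.congr_of_eventuallyEq (Eventually.of_forall fun b => ?_)
  simp [expCov]

theorem contMDiffAt_expMap {β : Dual n} (hβ : β ≠ 0) :
    ContMDiffAt 𝓘(ℝ, Dual n) 𝓘(ℝ, E n) ∞ (expMap L c z) β :=
  ((contMDiffAt_cotangent_proj _).comp β (contMDiffAt_expCov hL hc0 hc hβ)).congr_of_eventuallyEq
    (expMap_eventuallyEq L c z hβ)

/-- The flow preserves the rays: with `aβ` of energy `c`, the covector over `exp_z^c(β)` is
`Φ_{1/a}(aβ)`, and `Φ_s` moves it to `Φ_{s+1/a}(aβ)`, the covector belonging to `(1 + sa) β`. -/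
theorem flow_expCov {β : Dual n} (hβ : β ≠ 0) {s : ℝ} (hs : 0 < 1 + s * scale L c z β) :
    flow (hamiltonian L) s (expCov L c z β) = expCov L c z ((1 + s * scale L c z β) • β) := by
  obtain ⟨h1, h2⟩ := scale_spec hL hc0 (z := z) hβ
  obtain ⟨ε, hε, hev⟩ := exists_hasFlow hL hc (α₀ := covec z (scale L c z β • β))
    (smul_ne_zero h1.ne' hβ)
  have h3 := inv_pos.2 h1
  have e1 : s + (scale L c z β)⁻¹ = (1 + s * scale L c z β) * (scale L c z β)⁻¹ := by
    field_simp
    ring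
  have h4 : 0 < s + (scale L c z β)⁻¹ := by rw [e1]; positivity
  rw [expCov, hev.self_of_nhds.1.flow_flow hL (by linarith) (by linarith), expCov,
    scale_smul hL hc0 hβ hs, smul_smul, div_mul_cancel₀ _ hs.ne', inv_div, e1]
  rfl

/-- Around a regular point of the exponential map, its local inverse. -/
theorem exists_expMap_inverse {β : Dual n} (hβ : β ≠ 0) (hreg : ExpRegularAt L c z β) {x₀ : M}
    (h₀ : expMap L c z β ∈ (chartAt (E n) x₀).source) :
    ∃ e : OpenPartialHomeomorph (Dual n) (E n), β ∈ e.source ∧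
      (∀ b ∈ e.source, e b = chartAt (E n) x₀ (expMap L c z b) ∧ b ≠ 0 ∧ ExpRegularAt L c z b ∧
        expMap L c z b ∈ (chartAt (E n) x₀).source) ∧
      ContDiffAt ℝ ∞ e.symm (chartAt (E n) x₀ (expMap L c z β)) := by
  have hsm := contMDiffAt_expMap hL hc0 hc (z := z) hβ
  have hφ := contDiffAt_chart_comp hsm h₀
  have hd := (bijective_dman_iff (hsm.mdifferentiableAt (by simp)) h₀).2 hreg
  obtain ⟨e, he1, he2, he3, he4⟩ := exists_local_inverse hφ hd
  have hev : ∀ᶠ b in 𝓝 β, b ≠ 0 ∧ ExpRegularAt L c z b ∧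
      expMap L c z b ∈ (chartAt (E n) x₀).source := by
    filter_upwards [he4, isOpen_ne.mem_nhds hβ, hsm.continuousAt.eventually
      ((chartAt (E n) x₀).open_source.mem_nhds h₀)] with b hb1 hb2 hb3
    exact ⟨hb2, (bijective_dman_iff ((contMDiffAt_expMap hL hc0 hc (z := z) hb2).mdifferentiableAt
      (by simp)) hb3).1 hb1, hb3⟩
  obtain ⟨U, hU, hUo, hβU⟩ := eventually_nhds_iff.1 hev
  refine ⟨e.restrOpen U hUo, ⟨he1, hβU⟩, fun b hb => ⟨he2 b hb.1, hU b hb.2⟩, he3⟩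

theorem exists_isRegularDomain {β : Dual n} (hβ : β ≠ 0) (hreg : ExpRegularAt L c z β) :
    ∃ W, IsRegularDomain L c z W ∧ β ∈ W := by
  obtain ⟨e, h1, h2, -⟩ := exists_expMap_inverse hL hc0 hc hβ hreg (x₀ := expMap L c z β)
    (mem_source_self _)
  refine ⟨e.source, ⟨e.open_source, fun h0 => (h2 0 h0).2.1 rfl, fun b hb b' hb' h => ?_,
    fun b hb => (h2 b hb).2.2.1⟩, h1⟩
  refine e.injOn hb hb' ?_
  rw [(h2 b hb).1, (h2 b' hb').1, h]

omit hL hc0 hc [T2Space M] in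
theorem regularAt_of_lt_cutTime {α : Dual n} {t : ℝ} (ht : 0 < t)
    (h : (t : EReal) < cutTime L c z α) : ExpRegularAt L c z (t • α) := by
  obtain ⟨_, ⟨T, ⟨hT, hT'⟩, rfl⟩, htT⟩ := lt_sSup_iff.1 h
  exact (hT' t ⟨ht, EReal.coe_lt_coe_iff.1 htT⟩).1

theorem expMap_eq_curve_of_lt_cutTime {α : Dual n} (hα : hamiltonian L (covec z α) = c) {t : ℝ}
    (ht : 0 < t) (h : (t : EReal) < cutTime L c z α) :
    expMap L c z (t • α) = curve L z α t ∧ ∃ W, IsRegularDomain L c z W ∧ t • α ∈ W :=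
  ⟨expMap_level hL hc0 hα ht, exists_isRegularDomain hL hc0 hc
    (smul_ne_zero ht.ne' (ne_zero_of_level hL hc0 hα)) (regularAt_of_lt_cutTime ht h)⟩

end Exp

/-! ### The first variation of the action -/

section Parametric

variable {F : Type*} [NormedAddCommGroup F] [NormedSpace ℝ F]

/-- Differentiation under the integral over `[0, 1]`. -/
theorem hasFDerivAt_integral_of_contDiffAt [FiniteDimensional ℝ F] {A : ℝ × F → ℝ} {β : F}
    (hA : ∀ s ∈ Icc (0 : ℝ) 1, ContDiffAt ℝ ∞ A (s, β)) :
    IntervalIntegrable (fun s => (fderiv ℝ A (s, β)).comp (ContinuousLinearMap.inr ℝ ℝ F))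
        volume 0 1 ∧
      HasFDerivAt (fun b => ∫ s in (0 : ℝ)..1, A (s, b))
        (∫ s in (0 : ℝ)..1, (fderiv ℝ A (s, β)).comp (ContinuousLinearMap.inr ℝ ℝ F)) β := by
  have hI : Set.uIoc (0 : ℝ) 1 ⊆ Icc 0 1 := by
    rw [uIoc_of_le zero_le_one]; exact Ioc_subset_Icc_self
  have hsub : ∀ b : F, Continuous fun s : ℝ => (s, b) := fun b => by fun_prop
  have hcd : ∀ s ∈ Icc (0 : ℝ) 1, ContinuousAt (fderiv ℝ A) (s, β) := fun s hs =>
    ((hA s hs).fderiv_right (m := 0) (by simp)).continuousAt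
  have hc1 : ContinuousOn (fun s : ℝ => fderiv ℝ A (s, β)) (Icc 0 1) := fun s hs =>
    (ContinuousAt.comp (f := fun s : ℝ => (s, β)) (hcd s hs)
      (hsub β).continuousAt).continuousWithinAt
  have hc2 : ContinuousOn (fun s : ℝ => (fderiv ℝ A (s, β)).comp (ContinuousLinearMap.inr ℝ ℝ F))
      (Icc 0 1) := hc1.clm_comp continuousOn_const
  obtain ⟨C, hC⟩ := isCompact_Icc.exists_bound_of_continuousOn hc1
  -- by compactness of `[0, 1]`, one bound on the derivative serves all `s` and all `b` near `β`
  have hev : ∀ᶠ b in 𝓝 β, ∀ s ∈ Icc (0 : ℝ) 1, ‖fderiv ℝ A (s, b)‖ ≤ C + 1 ∧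
      DifferentiableAt ℝ A (s, b) := by
    refine isCompact_Icc.eventually_forall_of_forall_eventually fun s hs => ?_
    have h1 : ∀ᶠ p in 𝓝 (s, β), ‖fderiv ℝ A p‖ < C + 1 :=
      (hcd s hs).norm.eventually_lt continuousAt_const (by linarith [hC s hs])
    have h2 : ∀ᶠ p in 𝓝 (s, β), ContDiffAt ℝ 1 A p :=
      ((hA s hs).of_le (WithTop.coe_le_coe.2 (le_top (a := (1 : ℕ∞))))).eventually (by simp)
    have h3 : ∀ᶠ p in 𝓝 (s, β), ‖fderiv ℝ A p‖ ≤ C + 1 ∧ DifferentiableAt ℝ A p := by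
      filter_upwards [h1, h2] with p hp1 hp2
      exact ⟨hp1.le, hp2.differentiableAt one_ne_zero⟩
    exact (continuous_swap.tendsto (β, s)).eventually h3
  have hcont : ∀ b : F, (∀ s ∈ Icc (0 : ℝ) 1, DifferentiableAt ℝ A (s, b)) →
      ContinuousOn (fun s : ℝ => A (s, b)) (Icc 0 1) := fun b hb s hs =>
    (ContinuousAt.comp (f := fun s : ℝ => (s, b)) (hb s hs).continuousAt
      (hsub b).continuousAt).continuousWithinAt
  refine ⟨(hc2.mono (by rw [uIcc_of_le zero_le_one])).intervalIntegrable, ?_⟩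
  refine (intervalIntegral.hasFDerivAt_integral_of_dominated_of_fderiv_le
    (F := fun b s => A (s, b)) (bound := fun _ => (C + 1) * ‖ContinuousLinearMap.inr ℝ ℝ F‖)
    (F' := fun b s => (fderiv ℝ A (s, b)).comp (ContinuousLinearMap.inr ℝ ℝ F))
    (s := {b | ∀ s ∈ Icc (0 : ℝ) 1, ‖fderiv ℝ A (s, b)‖ ≤ C + 1 ∧ DifferentiableAt ℝ A (s, b)})
    hev ?_ ?_ ?_ ?_ ?_ ?_)
  · filter_upwards [hev] with b hb
    exact ((hcont b fun s hs => (hb s hs).2).aestronglyMeasurable measurableSet_Icc).mono_measure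
      (Measure.restrict_mono hI le_rfl)
  · exact ((hcont β fun s hs => (hev.self_of_nhds s hs).2).mono
      (by rw [uIcc_of_le zero_le_one])).intervalIntegrable
  · exact (hc2.aestronglyMeasurable measurableSet_Icc).mono_measure
      (Measure.restrict_mono hI le_rfl)
  · refine Eventually.of_forall fun s hs b hb => ?_
    exact (ContinuousLinearMap.opNorm_comp_le _ _).trans
      (mul_le_mul_of_nonneg_right (hb s (hI hs)).1 (norm_nonneg _))
  · exact intervalIntegrable_const
  · refine Eventually.of_forall fun s hs b hb => ?_
    exact (hb s (hI hs)).2.hasFDerivAt.comp b (hasFDerivAt_prodMk_right s b)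

end Parametric

section Variation

variable {n : ℕ} {F : Type*} [NormedAddCommGroup F] [NormedSpace ℝ F]

/-- The first variation formula. For a family `Q = (x, ξ)` of (rescaled) integral curves of a
Hamiltonian `h`, all on one energy level, `∂_v (ξ(∂_s x)) = ∂_s (ξ(∂_v x))`: the difference of the
two sides is `ω(∂_v Q, ∂_s Q) = r dh(∂_v Q)`, which vanishes because `h` is constant. -/
theorem hasDerivAt_canonical_form {Q : ℝ × F → E n × Dual n} {s : ℝ} {b : F}
    (hQ : ContDiffAt ℝ ∞ Q (s, b)) {A : ℝ × F → ℝ}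
    (hA : A =ᶠ[𝓝 (s, b)] fun q => (Q q).2 (fderiv ℝ Q q (1, 0)).1) {r : ℝ} {h : E n × Dual n → ℝ}
    (hs : fderiv ℝ Q (s, b) (1, 0) = r • hamVec h (Q (s, b))) (hd : DifferentiableAt ℝ h (Q (s, b)))
    {c : ℝ} (hconst : (fun q => h (Q q)) =ᶠ[𝓝 (s, b)] fun _ => c) (v : F) :
    ContDiffAt ℝ ∞ A (s, b) ∧
    HasDerivAt (fun τ => (Q (τ, b)).2 (fderiv ℝ Q (τ, b) (0, v)).1)
      (fderiv ℝ A (s, b) (0, v)) s := by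
  have hQ1 : ContDiffAt ℝ ∞ (fderiv ℝ Q) (s, b) :=
    hQ.fderiv_right (m := ∞) (by exact_mod_cast le_rfl)
  have hQd := (hQ.differentiableAt (by simp)).hasFDerivAt
  have hQ1d := (hQ1.differentiableAt (by simp)).hasFDerivAt
  have hsymm : IsSymmSndFDerivAt ℝ Q (s, b) := hQ.isSymmSndFDerivAt (by
      rw [minSmoothness_of_isRCLikeNormedField]
      exact WithTop.coe_le_coe.2 (le_top (a := (2 : ℕ∞))))
  have key : ∀ w : ℝ × F, HasFDerivAt (fun q => (Q q).2 (fderiv ℝ Q q w).1) _ (s, b) := fun w =>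
    (hQd.snd).clm_apply ((hQ1d.clm_apply (hasFDerivAt_const w (s, b))).fst)
  have hAs : ContDiffAt ℝ ∞ A (s, b) := by
    refine ContDiffAt.congr_of_eventuallyEq ?_ hA
    exact (contDiffAt_snd.comp _ hQ).clm_apply
      (contDiffAt_fst.comp _ (hQ1.clm_apply contDiffAt_const))
  refine ⟨hAs, ?_⟩
  -- Leibniz rule on both sides; the second-order terms agree by symmetry (`h7`), the first-order
  -- terms because `∂_s Q` is a multiple of the Hamiltonian vector field (`h8`)
  have h1 : fderiv ℝ A (s, b) (0, v) = (fderiv ℝ Q (s, b) (0, v)).2 (fderiv ℝ Q (s, b) (1, 0)).1 +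
      (Q (s, b)).2 (fderiv ℝ (fderiv ℝ Q) (s, b) (0, v) (1, 0)).1 := by
    rw [((key (1, 0)).congr_of_eventuallyEq hA).fderiv]
    simp [add_comm]
  have h2 := (key (0, v)).comp_hasDerivAt s ((hasDerivAt_id s).prodMk (hasDerivAt_const s b))
  refine h2.congr_deriv ?_
  have h3 : fderiv ℝ h (Q (s, b)) (fderiv ℝ Q (s, b) (0, v)) = 0 := by
    have h4 : HasFDerivAt (fun q => h (Q q)) ((fderiv ℝ h (Q (s, b))).comp (fderiv ℝ Q (s, b)))
      (s, b) := hd.hasFDerivAt.comp (s, b) hQd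
    have h5 : HasFDerivAt (fun q => h (Q q)) (0 : ℝ × F →L[ℝ] ℝ) (s, b) :=
      (hasFDerivAt_const c (s, b)).congr_of_eventuallyEq hconst
    exact congrArg (fun T : ℝ × F →L[ℝ] ℝ => T (0, v)) (h4.unique h5)
  have h6 := symp_hamVec h (Q (s, b)) (fderiv ℝ Q (s, b) (0, v))
  rw [h3, neg_zero, symp] at h6
  have h7 := hsymm.eq (0, v) (1, 0)
  have h8 : (fderiv ℝ Q (s, b) (1, 0)).2 (fderiv ℝ Q (s, b) (0, v)).1 =
      (fderiv ℝ Q (s, b) (0, v)).2 (fderiv ℝ Q (s, b) (1, 0)).1 := by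
    rw [hs]
    simp only [Prod.smul_fst, Prod.smul_snd, map_smul, smul_apply, smul_eq_mul]
    linear_combination r * h6
  rw [h1, h7]
  simp
  linarith

end Variation

section Potential

variable {n : ℕ} {M : Type*} [TopologicalSpace M] [ChartedSpace (E n) M]
  [IsManifold 𝓘(ℝ, E n) ∞ M]

/-- The integral curves issuing from the fibre at `z`, parametrized by `[0, 1]` in such a way that
`radial L c z (1, β)` lies above `exp_z^c(β)`. -/
def radial (L : TangentBundle 𝓘(ℝ, E n) M → ℝ) (c : ℝ) (z : M) (p : ℝ × Dual n) :
    CotangentBundle n M :=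
  flow (hamiltonian L) (p.1 * (scale L c z p.2)⁻¹) (covec z (scale L c z p.2 • p.2))

variable {L : TangentBundle 𝓘(ℝ, E n) M → ℝ} (hL : IsLagrangian L) {c : ℝ} {z : M}
include hL

/-- The Legendre identity `L(τ^*(α)) = α(τ^*(α)) - H(α)`, in which `τ^*(α)` is the horizontal part
of the Hamiltonian vector field. -/
theorem lagrangian_legendre {x₀ : M} {q : CotangentBundle n M}
    (hq : q.proj ∈ (chartAt (E n) x₀).source) (h0 : ccoord q ≠ 0) :
    L (legendre L q) = (toCot x₀ q).2 (hamVec (locH (hamiltonian L) x₀) (toCot x₀ q)).1 -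
      hamiltonian L q := by
  have h1 : hamiltonian L q = ccoord q (tcoord (legendre L q)) - L (legendre L q) :=
    (hL.isFibreLagrangian q.proj).legH_eq (ccoord q)
  rw [hL.hamVec_locH_fst ((chartAt (E n) x₀).map_source hq) (by rwa [Ne, toCot_snd_eq_zero_iff hq]),
    hL.famT_toCot hq]
  simp only [toCot, ContinuousLinearMap.comp_apply]
  rw [tc_symm (mem_source_self _) hq]
  linarith

variable (hc0 : 0 < c) [T2Space M] (hc : ForwardComplete (hamiltonian L))
include hc0 hc

/-- The curves `s ↦ radial L c z (s, b)`, for `b` near `β`, lie on the energy level `c` and solve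
Hamilton's equations with speed `1/a`, in a chart around a given point of the curve of `β`. -/
theorem radial_eventually {β : Dual n} (hβ : β ≠ 0) {s : ℝ} (hs : 0 ≤ s) {x₀ : M}
    (h₀ : (radial L c z (s, β)).proj ∈ (chartAt (E n) x₀).source) :
    ∀ᶠ p : ℝ × Dual n in 𝓝 (s, β), p.2 ≠ 0 ∧ (radial L c z p).proj ∈ (chartAt (E n) x₀).source ∧
      hamiltonian L (radial L c z p) = c ∧
      ContMDiffAt 𝓘(ℝ, ℝ × Dual n) (cotModel n) 1 (radial L c z) p ∧
      HasDerivAt (fun τ => toCot x₀ (radial L c z (τ, p.2)))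
        ((scale L c z p.2)⁻¹ • hamVec (locH (hamiltonian L) x₀) (toCot x₀ (radial L c z p)))
          p.1 := by
  obtain ⟨h1, h2⟩ := scale_spec hL hc0 (z := z) hβ
  obtain ⟨ε, hε, hev⟩ := exists_hasFlow hL hc (α₀ := covec z (scale L c z β • β))
    (smul_ne_zero h1.ne' hβ)
  have hsm := contMDiffAt_flow_scale hL hc0 hc (z := z) hβ hs
  have e1 : ∀ᶠ p : ℝ × Dual n in 𝓝 (s, β), (radial L c z p).proj ∈ (chartAt (E n) x₀).source :=
    hsm.continuousAt.eventually ((isOpen_cot_source x₀).mem_nhds h₀)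
  have e2 : ∀ᶠ p : ℝ × Dual n in 𝓝 (s, β),
      ContMDiffAt 𝓘(ℝ, ℝ × Dual n) (cotModel n) 1 (radial L c z) p :=
    (contMDiffAt_iff_contMDiffAt_nhds (by simp)).1
      (hsm.of_le (WithTop.coe_le_coe.2 (le_top (a := (1 : ℕ∞)))))
  have hsc := (contDiffAt_scale hL hc0 (z := z) hβ).continuousAt
  have e3 : ∀ᶠ p : ℝ × Dual n in 𝓝 (s, β),
      HasFlow (hamiltonian L) ε (covec z (scale L c z p.2 • p.2)) := by
    have h3 : ContinuousAt (fun b : Dual n =>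
        (covec z (scale L c z b • b) : CotangentBundle n M)) β :=
      ContinuousAt.comp (f := fun b : Dual n => scale L c z b • b) (g := covec z)
        (contMDiffAt_covec z _).continuousAt (hsc.smul continuousAt_id)
    have h4 := h3.eventually hev
    exact ((continuous_snd.tendsto (s, β)).eventually h4).mono fun p hp => hp.1
  have e4 : ∀ᶠ p : ℝ × Dual n in 𝓝 (s, β), -ε < p.1 * (scale L c z p.2)⁻¹ := by
    have h3 : ContinuousAt (fun p : ℝ × Dual n => p.1 * (scale L c z p.2)⁻¹) (s, β) :=
      continuousAt_fst.mul (ContinuousAt.inv₀ (ContinuousAt.comp (f := Prod.snd) (x := (s, β))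
        hsc continuousAt_snd) h1.ne')
    refine continuousAt_const.eventually_lt h3 ?_
    have := mul_nonneg hs (inv_pos.2 h1).le
    show -ε < s * (scale L c z β)⁻¹
    linarith
  have e5 : ∀ᶠ p : ℝ × Dual n in 𝓝 (s, β), p.2 ≠ 0 :=
    (continuous_snd.tendsto (s, β)).eventually (isOpen_ne.mem_nhds hβ)
  filter_upwards [e1, e2, e3, e4, e5] with p h1 h2 h3 h4 h5
  refine ⟨h5, h1, ?_, h2, ?_⟩
  · rw [radial, h3.hamiltonian_flow hL h4, (scale_spec hL hc0 h5).2]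
  · have h6 := (h3.hamAt _ h4).hasDerivAt_toCot hL h1
    have h7 : HasDerivAt (fun τ : ℝ => τ * (scale L c z p.2)⁻¹) (scale L c z p.2)⁻¹ p.1 := by
      simpa using (hasDerivAt_id p.1).mul_const (scale L c z p.2)⁻¹
    exact HasDerivAt.scomp p.1 (h := fun τ : ℝ => τ * (scale L c z p.2)⁻¹) h6 h7

/-- First variation along the curves `radial`: the variation of the integrand `(c + L) / a` of
`u_z^c` is the derivative of the canonical one-form on the variation field. -/
theorem hasDerivAt_radial {β : Dual n} (hβ : β ≠ 0) {s : ℝ} (hs : 0 ≤ s) (v : Dual n) :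
    ContDiffAt ℝ ∞ (fun p : ℝ × Dual n =>
      (scale L c z p.2)⁻¹ * (c + L (legendre L (radial L c z p)))) (s, β) ∧
    HasDerivAt (fun τ => ccoord (radial L c z (τ, β))
        (dman (n := n) (fun p => (radial L c z p).proj) (τ, β) (0, v)))
      (fderiv ℝ (fun p : ℝ × Dual n =>
        (scale L c z p.2)⁻¹ * (c + L (legendre L (radial L c z p)))) (s, β) (0, v)) s := by
  set x₀ := (radial L c z (s, β)).proj with hx₀
  have h₀ : (radial L c z (s, β)).proj ∈ (chartAt (E n) x₀).source := mem_source_self _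
  have hsm : ContMDiffAt 𝓘(ℝ, ℝ × Dual n) (cotModel n) ∞ (radial L c z) (s, β) :=
    contMDiffAt_flow_scale hL hc0 hc (z := z) hβ hs
  have hQ : ContDiffAt ℝ ∞ (fun p => toCot x₀ (radial L c z p)) (s, β) :=
    (ContMDiffAt.comp (s, β) (f := radial L c z) (g := toCot x₀) (contMDiffAt_toCot h₀)
      hsm).contDiffAt
  have hev := radial_eventually hL hc0 hc hβ hs h₀
  have hQd : ∀ᶠ p in 𝓝 (s, β), DifferentiableAt ℝ (fun p => toCot x₀ (radial L c z p)) p :=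
    (((hQ.of_le (WithTop.coe_le_coe.2 (le_top (a := (1 : ℕ∞))))).eventually (by simp))).mono
      fun p hp => hp.differentiableAt one_ne_zero
  have hds : ∀ᶠ p in 𝓝 (s, β), fderiv ℝ (fun p => toCot x₀ (radial L c z p)) p (1, 0) =
      (scale L c z p.2)⁻¹ • hamVec (locH (hamiltonian L) x₀) (toCot x₀ (radial L c z p)) := by
    filter_upwards [hev, hQd] with p hp hpd
    have h1 := hpd.hasFDerivAt.comp_hasDerivAt p.1
      ((hasDerivAt_id p.1).prodMk (hasDerivAt_const p.1 p.2))
    exact h1.unique hp.2.2.2.2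
  have hA : (fun p : ℝ × Dual n => (scale L c z p.2)⁻¹ * (c + L (legendre L (radial L c z p))))
      =ᶠ[𝓝 (s, β)] fun q => (toCot x₀ (radial L c z q)).2
        (fderiv ℝ (fun p => toCot x₀ (radial L c z p)) q (1, 0)).1 := by
    filter_upwards [hev, hds] with p hp hpd
    have h1 : ccoord (radial L c z p) ≠ 0 := by
      rw [hL.ccoord_ne_zero_iff, hp.2.2.1]; exact hc0
    rw [lagrangian_legendre hL hp.2.1 h1, hp.2.2.1, hpd]
    simp
  have hH : (fun p => locH (hamiltonian L) x₀ (toCot x₀ (radial L c z p))) =ᶠ[𝓝 (s, β)]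
      fun _ => c := by
    filter_upwards [hev] with p hp
    simp only [locH]
    rw [ofCot_toCot hp.2.1, hp.2.2.1]
  obtain ⟨k1, k2⟩ := hasDerivAt_canonical_form hQ hA hds.self_of_nhds
    (hL.differentiableAt_locH ((chartAt (E n) x₀).map_source h₀)) hH v
  refine ⟨k1, k2.congr_of_eventuallyEq ?_⟩
  have hsub : Tendsto (fun τ : ℝ => (τ, β)) (𝓝 s) (𝓝 (s, β)) :=
    (Continuous.prodMk_left β).tendsto s
  filter_upwards [hsub.eventually hev, hsub.eventually hQd] with τ hτ hτd
  have h1 : MDifferentiableAt 𝓘(ℝ, ℝ × Dual n) 𝓘(ℝ, E n) (fun p => (radial L c z p).proj) (τ, β) :=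
    ((contMDiffAt_cotangent_proj _).mdifferentiableAt (by simp)).comp _
      (hτ.2.2.2.1.mdifferentiableAt one_ne_zero)
  have h2 := hasFDerivAt_chart_comp h1 hτ.2.1
  have h3 := h2.unique hτd.hasFDerivAt.fst
  have h4 := congrArg (fun T : ℝ × Dual n →L[ℝ] E n => T (0, v)) h3
  simp only [ContinuousLinearMap.comp_apply] at h4
  have h5 : (fderiv ℝ (fun p => toCot x₀ (radial L c z p)) (τ, β) (0, v)).1 =
    tc (radial L c z (τ, β)).proj x₀ (radial L c z (τ, β)).proj
      (dman (fun p => (radial L c z p).proj) (τ, β) (0, v)) := h4.symm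
  rw [h5]
  simp only [toCot, ContinuousLinearMap.comp_apply]
  rw [tc_symm (mem_source_self _) hτ.2.1]

omit hc hc0 [T2Space M] hL in
theorem expCov_eq_radial (β : Dual n) : expCov L c z β = radial L c z (1, β) := by
  simp [expCov, radial]

/-- The differential of the pull-back of `u_z^c` is the pull-back of the canonical one-form. -/
theorem hasFDerivAt_potential {β : Dual n} (hβ : β ≠ 0) :
    HasFDerivAt (potential L c z)
      ((ccoord (expCov L c z β)).comp (dman (n := n) (expMap L c z) β)) β := by
  -- the integrand after the substitution that makes `[0, 1]` the domain of integration
  set A : ℝ × Dual n → ℝ := fun p =>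
    (scale L c z p.2)⁻¹ * (c + L (legendre L (radial L c z p))) with hA
  have hAs : ∀ b : Dual n, b ≠ 0 → ∀ s ∈ Icc (0 : ℝ) 1, ContDiffAt ℝ ∞ A (s, b) :=
    fun b hb s hs => (hasDerivAt_radial hL hc0 hc hb hs.1 0).1
  have hpot : ∀ b : Dual n, b ≠ 0 → potential L c z b = ∫ s in (0 : ℝ)..1, A (s, b) := by
    intro b hb
    have hr := (scale_spec hL hc0 (z := z) hb).1
    have h1 : IntervalIntegrable (fun s => A (s, b)) volume 0 1 := by
      refine ContinuousOn.intervalIntegrable fun s hs => ?_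
      rw [uIcc_of_le zero_le_one] at hs
      exact (ContinuousAt.comp (f := fun s : ℝ => (s, b)) (hAs b hb s hs).continuousAt
        (Continuous.prodMk_left b).continuousAt).continuousWithinAt
    have h2 : (fun s => A (s, b)) = fun s => (scale L c z b)⁻¹ * c + (scale L c z b)⁻¹ *
        L (legendre L (radial L c z (s, b))) := by
      funext s; simp only [hA]; ring
    have h3 : IntervalIntegrable (fun s => (scale L c z b)⁻¹ *
        L (legendre L (radial L c z (s, b)))) volume 0 1 := by
      have := h1.sub (intervalIntegrable_const (c := (scale L c z b)⁻¹ * c))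
      refine this.congr ?_
      intro s _
      simp only [hA]; ring
    rw [h2, intervalIntegral.integral_add intervalIntegrable_const h3,
      intervalIntegral.integral_const_mul]
    have h4 := intervalIntegral.smul_integral_comp_mul_right (a := 0) (b := 1)
      (fun s => L (legendre L (flow (hamiltonian L) s (covec z (scale L c z b • b)))))
      (scale L c z b)⁻¹
    simp only [smul_eq_mul, zero_mul, one_mul] at h4
    rw [potential, ← h4]
    simp [radial, mul_comm]
  obtain ⟨h1, h2⟩ := hasFDerivAt_integral_of_contDiffAt (hAs β hβ)
  have h3 := h2.congr_of_eventuallyEq (show potential L c z =ᶠ[𝓝 β] _ from by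
    filter_upwards [isOpen_ne.mem_nhds hβ] with b hb using hpot b hb)
  refine h3.congr_fderiv ?_
  refine ContinuousLinearMap.ext fun v => ?_
  rw [ContinuousLinearMap.intervalIntegral_apply h1]
  simp only [ContinuousLinearMap.comp_apply, ContinuousLinearMap.inr_apply]
  have h4 : IntervalIntegrable (fun s => fderiv ℝ A (s, β) (0, v)) volume 0 1 := by
    refine ContinuousOn.intervalIntegrable fun s hs => ?_
    rw [uIcc_of_le zero_le_one] at hs
    have h5 : ContinuousAt (fderiv ℝ A) (s, β) :=
      ((hAs β hβ s hs).fderiv_right (m := 0) (by simp)).continuousAt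
    exact ((ContinuousAt.comp (f := fun s : ℝ => (s, β)) h5
        (Continuous.prodMk_left β).continuousAt).clm_apply continuousAt_const).continuousWithinAt
  -- the derivative of the integrand is a total derivative, which leaves the boundary terms
  rw [intervalIntegral.integral_eq_sub_of_hasDerivAt (fun s hs => ?_) h4]
  rotate_left
  · exact fun τ => ccoord (radial L c z (τ, β))
        (dman (n := n) (fun p => (radial L c z p).proj) (τ, β) (0, v))
  · rw [uIcc_of_le zero_le_one] at hs
    exact (hasDerivAt_radial hL hc0 hc hβ hs.1 v).2
  have hmd : ∀ s : ℝ, 0 ≤ s → MDifferentiableAt 𝓘(ℝ, ℝ × Dual n) 𝓘(ℝ, E n)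
      (fun p => (radial L c z p).proj) (s, β) := fun s hs =>
    ((contMDiffAt_cotangent_proj _).mdifferentiableAt (by simp)).comp _
      ((contMDiffAt_flow_scale hL hc0 hc (z := z) hβ hs).mdifferentiableAt (by simp))
  have hchain : ∀ s : ℝ, 0 ≤ s → HasFDerivAt
      (fun b => chartAt (E n) (radial L c z (s, β)).proj (radial L c z (s, b)).proj)
      ((dman (n := n) (fun p => (radial L c z p).proj) (s, β)).comp
        (ContinuousLinearMap.inr ℝ ℝ (Dual n))) β := by
    intro s hs
    have h6 := hasFDerivAt_chart_comp (hmd s hs) (mem_source_self (n := n) _)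
    have h7 := HasFDerivAt.comp β (f := fun b : Dual n => (s, b)) h6 (hasFDerivAt_prodMk_right s β)
    refine h7.congr_fderiv ?_
    refine ContinuousLinearMap.ext fun w => ?_
    simp only [ContinuousLinearMap.comp_apply]
    rw [tc_self (mem_source_self _)]
  -- all curves start at `z`, so the boundary term at `s = 0` vanishes
  have hzero : dman (n := n) (fun p => (radial L c z p).proj) (0, β) (0, v) = 0 := by
    have h6 := hchain 0 le_rfl
    have h7 : ∀ b : Dual n, (radial L c z (0, b)).proj = z := fun b => by
      simp [radial, flow_zero]
    simp only [h7] at h6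
    have h8 := h6.unique (hasFDerivAt_const _ β)
    exact congrArg (fun T : Dual n →L[ℝ] E n => T v) h8
  have hone : dman (n := n) (fun p => (radial L c z p).proj) (1, β) (0, v) =
      dman (n := n) (expMap L c z) β v := by
    have h6 := hchain 1 zero_le_one
    have h7 := hasFDerivAt_chart_comp ((contMDiffAt_expMap hL hc0 hc (z := z) hβ).mdifferentiableAt
      (by simp)) (mem_source_self (n := n) _)
    have h8 := h7.congr_of_eventuallyEq
      (show (fun b => chartAt (E n) (radial L c z (1, β)).proj (radial L c z (1, b)).proj)
        =ᶠ[𝓝 β] _ from by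
        filter_upwards [expMap_eventuallyEq L c z hβ] with b hb
        rw [← expCov_eq_radial, ← expCov_eq_radial, hb, expMap_eq hβ])
    have h9 := congrArg (fun T : Dual n →L[ℝ] E n => T v) (h6.unique h8)
    simp only [ContinuousLinearMap.comp_apply] at h9
    rw [tc_self (mem_source_self _)] at h9
    exact h9
  rw [hzero, hone, map_zero, sub_zero, expCov_eq_radial]

end Potential

/-! ### The function `u_z^c` -/

/-- A function with a smooth derivative is smooth. -/
theorem contDiffAt_of_hasFDerivAt {F G : Type*} [NormedAddCommGroup F] [NormedSpace ℝ F]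
    [NormedAddCommGroup G] [NormedSpace ℝ G] {f : F → G} {f' : F → F →L[ℝ] G} {x : F}
    (hf : ∀ᶠ y in 𝓝 x, HasFDerivAt f (f' y) y) (hf' : ContDiffAt ℝ ∞ f' x) :
    ContDiffAt ℝ ∞ f x := by
  rw [contDiffAt_infty]
  intro k
  refine ContDiffAt.of_le (n := (k : WithTop ℕ∞) + 1) ?_ (by
    exact_mod_cast Nat.le_succ k)
  rw [contDiffAt_succ_iff_hasFDerivAt]
  exact ⟨f', ⟨_, hf, fun y hy => hy⟩, contDiffAt_infty.1 hf' k⟩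

section UFun

variable {n : ℕ} {M : Type*} [TopologicalSpace M] [ChartedSpace (E n) M]
  [IsManifold 𝓘(ℝ, E n) ∞ M]

theorem contMDiffAt_of_symm {u : M → ℝ} {x₀ x : M} (hx : x ∈ (chartAt (E n) x₀).source)
    (h : ContDiffAt ℝ ∞ (fun y => u ((chartAt (E n) x₀).symm y)) (chartAt (E n) x₀ x)) :
    ContMDiffAt 𝓘(ℝ, E n) 𝓘(ℝ, ℝ) ∞ u x := by
  have h1 := ContMDiffAt.comp x (f := chartAt (E n) x₀) h.contMDiffAt
    ((contMDiffOn_chart (I := 𝓘(ℝ, E n)) (n := ∞) (x := x₀)).contMDiffAt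
      ((chartAt (E n) x₀).open_source.mem_nhds hx))
  refine h1.congr_of_eventuallyEq ?_
  filter_upwards [(chartAt (E n) x₀).open_source.mem_nhds hx] with x' hx'
  simp only [Function.comp_apply]
  rw [(chartAt (E n) x₀).left_inv hx']

theorem hasFDerivAt_symm {u : M → ℝ} {x : M} (h : MDifferentiableAt 𝓘(ℝ, E n) 𝓘(ℝ, ℝ) u x) :
    HasFDerivAt (fun y => u ((chartAt (E n) x).symm y)) (ccoord (dform u x))
      (chartAt (E n) x x) := by
  have h1 : HasFDerivWithinAt (writtenInExtChartAt 𝓘(ℝ, E n) 𝓘(ℝ, ℝ) x u) (ccoord (dform u x))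
      (range 𝓘(ℝ, E n)) (extChartAt 𝓘(ℝ, E n) x x) := h.hasMFDerivAt.2
  simp only [mfld_simps, hasFDerivWithinAt_univ] at h1
  exact h1

variable {L : TangentBundle 𝓘(ℝ, E n) M → ℝ} {c : ℝ} {z : M} {W : Set (Dual n)}

namespace IsRegularDomain

theorem ne_zero (hW : IsRegularDomain L c z W) {β : Dual n} (hβ : β ∈ W) : β ≠ 0 :=
  fun h => hW.zero_notMem (h ▸ hβ)

theorem uFun_expMap (hW : IsRegularDomain L c z W) {β : Dual n} (hβ : β ∈ W) :
    uFun L c z W (expMap L c z β) = potential L c z β := by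
  rw [uFun, hW.injOn.leftInvOn_invFunOn hβ]

theorem mono (hW : IsRegularDomain L c z W) {V : Set (Dual n)} (hV : IsOpen V) :
    IsRegularDomain L c z (W ∩ V) :=
  ⟨hW.isOpen.inter hV, fun h => hW.zero_notMem h.1, hW.injOn.mono inter_subset_left,
    fun b hb => hW.regular b hb.1⟩

variable (hW : IsRegularDomain L c z W) (hL : IsLagrangian L) (hc0 : 0 < c) [T2Space M]
  (hc : ForwardComplete (hamiltonian L))
include hW hL hc0 hc

/-- In a chart, a local inverse `σ` of the exponential map expresses the differential of `u_z^c`. -/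
theorem exists_inverse {β : Dual n} (hβ : β ∈ W) {x₀ : M}
    (h₀ : expMap L c z β ∈ (chartAt (E n) x₀).source) :
    ∃ σ : E n → Dual n, ContDiffAt ℝ ∞ σ (chartAt (E n) x₀ (expMap L c z β)) ∧
      σ (chartAt (E n) x₀ (expMap L c z β)) = β ∧
      ∀ᶠ y in 𝓝 (chartAt (E n) x₀ (expMap L c z β)), y ∈ (chartAt (E n) x₀).target ∧ σ y ∈ W ∧
        expMap L c z (σ y) = (chartAt (E n) x₀).symm y ∧
        HasFDerivAt (fun y => uFun L c z W ((chartAt (E n) x₀).symm y))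
          (toCot x₀ (expCov L c z (σ y))).2 y := by
  obtain ⟨e, he1, he2, he3⟩ := exists_expMap_inverse hL hc0 hc (hW.ne_zero hβ) (hW.regular β hβ) h₀
  have hσ0 : e.symm (chartAt (E n) x₀ (expMap L c z β)) = β := by
    rw [← (he2 β he1).1, e.left_inv he1]
  have hO : IsOpen (e.target ∩ e.symm ⁻¹' W) := e.isOpen_inter_preimage_symm hW.isOpen
  have hmem : chartAt (E n) x₀ (expMap L c z β) ∈ e.target ∩ e.symm ⁻¹' W := by
    refine ⟨?_, ?_⟩
    · rw [← (he2 β he1).1]; exact e.map_source he1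
    · rw [mem_preimage, hσ0]; exact hβ
  have hval : ∀ y ∈ e.target ∩ e.symm ⁻¹' W, y ∈ (chartAt (E n) x₀).target ∧
      expMap L c z (e.symm y) = (chartAt (E n) x₀).symm y := by
    intro y hy
    obtain ⟨h1, -, -, h2⟩ := he2 _ (e.map_target hy.1)
    rw [e.right_inv hy.1] at h1
    constructor
    · rw [h1]; exact (chartAt (E n) x₀).map_source h2
    · rw [← (chartAt (E n) x₀).left_inv h2, ← h1]
  have hdiff : ∀ᶠ y in 𝓝 (chartAt (E n) x₀ (expMap L c z β)), ContDiffAt ℝ 1 e.symm y :=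
    (he3.of_le (WithTop.coe_le_coe.2 (le_top (a := (1 : ℕ∞))))).eventually (by simp)
  refine ⟨e.symm, he3, hσ0, ?_⟩
  filter_upwards [hO.mem_nhds hmem, hdiff] with y hy hyd
  obtain ⟨h1, h2⟩ := hval y hy
  refine ⟨h1, hy.2, h2, ?_⟩
  have hb0 : e.symm y ≠ 0 := hW.ne_zero hy.2
  have hσ := (hyd.differentiableAt one_ne_zero).hasFDerivAt
  have hbs : expMap L c z (e.symm y) ∈ (chartAt (E n) x₀).source := by
    rw [h2]; exact symm_mem h1
  -- by the first variation, `d(u ∘ exp) = ξ ∘ d exp` with `ξ` the covector over the end point;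
  -- composition with the inverse `σ` of `exp` leaves `ξ`, in the coordinates of the chart
  have k1 := (hasFDerivAt_potential hL hc0 hc (z := z) hb0).comp y hσ
  have k2 := (hasFDerivAt_chart_comp ((contMDiffAt_expMap hL hc0 hc (z := z)
    hb0).mdifferentiableAt (by simp)) hbs).comp y hσ
  have k3 : HasFDerivAt (fun b => chartAt (E n) x₀ (expMap L c z (e.symm b)))
      (ContinuousLinearMap.id ℝ (E n)) y := by
    refine (hasFDerivAt_id y).congr_of_eventuallyEq ?_
    filter_upwards [hO.mem_nhds hy] with y' hy'
    rw [(hval y' hy').2, (chartAt (E n) x₀).right_inv (hval y' hy').1]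
    rfl
  have k4 := k2.unique k3
  refine (k1.congr_of_eventuallyEq ?_).congr_fderiv ?_
  · filter_upwards [hO.mem_nhds hy] with y' hy'
    rw [← (hval y' hy').2, hW.uFun_expMap hy'.2]
    rfl
  · refine ContinuousLinearMap.ext fun v => ?_
    have k5 := congrArg (fun T : E n →L[ℝ] E n =>
      tc x₀ (expMap L c z (e.symm y)) (expMap L c z (e.symm y)) (T v)) k4
    simp only [ContinuousLinearMap.comp_apply, ContinuousLinearMap.id_apply] at k5
    rw [tc_symm (mem_source_self _) hbs] at k5
    simp only [ContinuousLinearMap.comp_apply, toCot]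
    rw [k5, ← expMap_eq hb0]

theorem contDiffAt_uFun_symm {β : Dual n} (hβ : β ∈ W) {x₀ : M}
    (h₀ : expMap L c z β ∈ (chartAt (E n) x₀).source) :
    ContDiffAt ℝ ∞ (fun y => uFun L c z W ((chartAt (E n) x₀).symm y))
      (chartAt (E n) x₀ (expMap L c z β)) := by
  obtain ⟨σ, h1, h2, h3⟩ := hW.exists_inverse hL hc0 hc hβ h₀
  refine contDiffAt_of_hasFDerivAt (h3.mono fun y hy => hy.2.2.2) ?_
  have hb0 := hW.ne_zero hβ
  have hs : (expCov L c z β).proj ∈ (chartAt (E n) x₀).source := by rwa [← expMap_eq hb0]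
  have h4 : ContDiffAt ℝ ∞ (fun b => toCot x₀ (expCov L c z b)) β :=
    (ContMDiffAt.comp β (f := expCov L c z) (g := toCot x₀) (contMDiffAt_toCot hs)
      (contMDiffAt_expCov hL hc0 hc hb0)).contDiffAt
  rw [← h2] at h4
  exact contDiffAt_snd.comp _ (h4.comp _ h1)

theorem contMDiffAt_uFun {β : Dual n} (hβ : β ∈ W) :
    ContMDiffAt 𝓘(ℝ, E n) 𝓘(ℝ, ℝ) ∞ (uFun L c z W) (expMap L c z β) :=
  contMDiffAt_of_symm (mem_source_self _)
    (hW.contDiffAt_uFun_symm hL hc0 hc hβ (mem_source_self _))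

/-- `du_z^c` at `exp_z^c(β)` is the covector `Φ_{1/a}(aβ)` lying over this point. -/
theorem dform_uFun {β : Dual n} (hβ : β ∈ W) :
    dform (uFun L c z W) (expMap L c z β) = expCov L c z β := by
  have h1 := hasFDerivAt_symm ((hW.contMDiffAt_uFun hL hc0 hc hβ).mdifferentiableAt (by simp))
  obtain ⟨σ, h2, h3, h4⟩ := hW.exists_inverse hL hc0 hc hβ (mem_source_self _)
  have h5 := h1.unique h4.self_of_nhds.2.2.2
  rw [h3] at h5
  have h6 := expMap_eq (L := L) (c := c) (z := z) (hW.ne_zero hβ)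
  rw [h6, toCot_self, ← h6] at h5
  have h7 : dform (n := n) (uFun L c z W) (expMap L c z β) = covec (expMap L c z β)
    (ccoord (dform (n := n) (uFun L c z W) (expMap L c z β))) := rfl
  rw [h7, h5, h6]
  rfl

theorem image_mem_nhds {β : Dual n} (hβ : β ∈ W) :
    expMap L c z '' W ∈ 𝓝 (expMap L c z β) := by
  obtain ⟨σ, -, -, h⟩ := hW.exists_inverse hL hc0 hc hβ
    (mem_source_self (n := n) (expMap L c z β))
  have h1 := (chartAt (E n) (expMap L c z β)).continuousAt
    (mem_source_self (n := n) (expMap L c z β))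
  filter_upwards [h1.eventually h, (chartAt (E n) (expMap L c z β)).open_source.mem_nhds
    (mem_source_self (n := n) _)] with x hx hx'
  rw [(chartAt (E n) (expMap L c z β)).left_inv hx'] at hx
  exact ⟨_, hx.2.1, hx.2.2.1⟩

/-- Near `exp_z^c(β)`, the function `u_z^c` does not depend on the regular domain. -/
theorem uFun_eventuallyEq {V : Set (Dual n)} (hV : IsRegularDomain L c z V) {β : Dual n}
    (hβ : β ∈ W) (hβ' : β ∈ V) : uFun L c z W =ᶠ[𝓝 (expMap L c z β)] uFun L c z V := by
  filter_upwards [(hW.mono hV.isOpen).image_mem_nhds hL hc0 hc ⟨hβ, hβ'⟩] with x hx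
  obtain ⟨b, hb, rfl⟩ := hx
  rw [hW.uFun_expMap hb.1, hV.uFun_expMap hb.2]

end IsRegularDomain

omit [IsManifold 𝓘(ℝ, E n) ∞ M] in
theorem potential_level [IsManifold 𝓘(ℝ, E n) ∞ M] (hL : IsLagrangian L) (hc0 : 0 < c)
    {α : Dual n} (hα : hamiltonian L (covec z α) = c)
    {t : ℝ} (ht : 0 < t) : potential L c z (t • α) = c * t + ∫ s in (0 : ℝ)..t,
      L (legendre L (flow (hamiltonian L) s (covec z α))) := by
  rw [potential, scale_level hL hc0 hα ht, inv_inv, smul_smul, inv_mul_cancel₀ ht.ne', one_smul]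

theorem contMDiffOn_uFun [T2Space M] (hL : IsLagrangian L) (hc0 : 0 < c)
    (hc : ForwardComplete (hamiltonian L)) (hW : IsRegularDomain L c z W) :
    ContMDiffOn 𝓘(ℝ, E n) 𝓘(ℝ, ℝ) ∞ (uFun L c z W) (expMap L c z '' W) ∧
      ∀ α : Dual n, hamiltonian L (covec z α) = c → ∀ t : ℝ, 0 < t → t • α ∈ W →
        dform (uFun L c z W) (curve L z α t) = flow (hamiltonian L) t (covec z α) ∧
        uFun L c z W (curve L z α t) = c * t + ∫ s in (0 : ℝ)..t,
          L (legendre L (flow (hamiltonian L) s (covec z α))) := by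
  refine ⟨?_, fun α hα t ht htW => ⟨?_, ?_⟩⟩
  · rintro _ ⟨β, hβ, rfl⟩
    exact (hW.contMDiffAt_uFun hL hc0 hc hβ).contMDiffWithinAt
  · rw [← expMap_level hL hc0 hα ht, hW.dform_uFun hL hc0 hc htW, expCov_level hL hc0 hα ht]
  · rw [← expMap_level hL hc0 hα ht, hW.uFun_expMap htW, potential_level hL hc0 hα ht]

end UFun

/-! ### Derivatives of determinants -/

section Determinant

variable {n : ℕ}

/-- Jacobi's formula at an invertible matrix. -/
theorem hasDerivAt_det {ι : Type*} [Fintype ι] [DecidableEq ι] {A : ℝ → Matrix ι ι ℝ}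
    {A' B : Matrix ι ι ℝ} {t : ℝ} (hA : ∀ i j, HasDerivAt (fun s => A s i j) (A' i j) t)
    (hB : A t * B = 1) :
    HasDerivAt (fun s => (A s).det) ((A t).det * (B * A').trace) t := by
  have hB' : B * A t = 1 := mul_eq_one_comm.1 hB
  -- the determinant as a function of the entries
  set D : (ι → ι → ℝ) → ℝ := fun a => (Matrix.of a).det with hD
  have hDd : Differentiable ℝ D := by
    simp only [hD, Matrix.det_apply, Matrix.of_apply]
    fun_prop
  -- at the identity, the derivative is the linear coefficient of `det (1 + r C)`
  have key : ∀ C : Matrix ι ι ℝ, fderiv ℝ D (fun i j => (1 : Matrix ι ι ℝ) i j) (fun i j => C i j) =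
      C.trace := by
    intro C
    have h1 : HasDerivAt (fun r : ℝ => (fun i j => (1 : Matrix ι ι ℝ) i j) + r • fun i j => C i j)
        (fun i j => C i j) 0 := by
      simpa using ((hasDerivAt_id (0 : ℝ)).smul_const (fun i j => C i j)).const_add
        (fun i j => (1 : Matrix ι ι ℝ) i j)
    have h2 := (hDd ((fun i j => (1 : Matrix ι ι ℝ) i j) + (0 : ℝ) • fun i j => C i j)).hasFDerivAt
      |>.comp_hasDerivAt (0 : ℝ) h1
    have h3 : (D ∘ fun r : ℝ => (fun i j => (1 : Matrix ι ι ℝ) i j) + r • fun i j => C i j) =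
        fun r : ℝ => 1 + C.trace * r +
          (Matrix.det (1 + (Polynomial.X : Polynomial ℝ) • C.map Polynomial.C)).divX.divX.eval r *
            r ^ 2 := by
      funext r
      have h4 := Matrix.det_one_add_smul r C
      rw [← h4]
      rfl
    rw [h3, zero_smul, add_zero] at h2
    have h5 : HasDerivAt (fun r : ℝ => 1 + C.trace * r +
        (Matrix.det (1 + (Polynomial.X : Polynomial ℝ) • C.map Polynomial.C)).divX.divX.eval r *
          r ^ 2)
        (C.trace * 1 + (Polynomial.eval 0 (Polynomial.derivative
          (Matrix.det (1 + (Polynomial.X : Polynomial ℝ) • C.map Polynomial.C)).divX.divX) * 0 ^ 2 +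
          (Matrix.det (1 + (Polynomial.X : Polynomial ℝ) • C.map Polynomial.C)).divX.divX.eval 0 *
            (((2 : ℕ) : ℝ) * 0 ^ (2 - 1) * 1))) 0 :=
      (((hasDerivAt_id (0 : ℝ)).const_mul C.trace).const_add 1).add
        ((Polynomial.hasDerivAt _ 0).mul ((hasDerivAt_id (0 : ℝ)).pow 2))
    have h6 := h2.unique h5
    simpa using h6
  -- in general, factor out `A t`
  have hE : ∀ s, (A s).det = (A t).det * D (fun i j => (B * A s) i j) := by
    intro s
    have h1 : A s = A t * (B * A s) := by rw [← Matrix.mul_assoc, hB, Matrix.one_mul]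
    conv_lhs => rw [h1, Matrix.det_mul]
    rfl
  have h2 : HasDerivAt (fun s => (fun i j => (B * A s) i j)) (fun i j => (B * A') i j) t := by
    refine hasDerivAt_pi.2 fun i => hasDerivAt_pi.2 fun j => ?_
    simp only [Matrix.mul_apply]
    exact HasDerivAt.fun_sum fun k _ => (hA k j).const_mul (B i k)
  have h3 := (hDd _).hasFDerivAt.comp_hasDerivAt t h2
  rw [hB', key] at h3
  have h4 := h3.const_mul (A t).det
  refine h4.congr_of_eventuallyEq (Eventually.of_forall fun s => ?_)
  exact hE s

/-- The matrix of a linear map, in the standard basis. -/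
def opMat (A : E n →L[ℝ] E n) : Matrix (Fin n) (Fin n) ℝ := Matrix.of fun i j => A (basisVec j) i

/-- The trace of a linear map. -/
def opTr (A : E n →L[ℝ] E n) : ℝ := ∑ i, A (basisVec i) i

theorem opTr_eq (A : E n →L[ℝ] E n) : opTr A = (opMat A).trace := rfl

theorem opMat_comp (A B : E n →L[ℝ] E n) : opMat (A.comp B) = opMat A * opMat B := by
  ext i j
  simp only [opMat, Matrix.of_apply, Matrix.mul_apply, ContinuousLinearMap.comp_apply]
  conv_lhs => rw [← sum_coord_smul_basisVec (B (basisVec j)), map_sum]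
  simp [mul_comm]

theorem opMat_one : opMat (ContinuousLinearMap.id ℝ (E n)) = 1 := by
  ext i j
  simp [opMat, basisVec, Matrix.one_apply]

theorem opTr_comp_comm (A B : E n →L[ℝ] E n) : opTr (A.comp B) = opTr (B.comp A) := by
  rw [opTr_eq, opTr_eq, opMat_comp, opMat_comp, Matrix.trace_mul_comm]

theorem opTr_add (A B : E n →L[ℝ] E n) : opTr (A + B) = opTr A + opTr B := by
  simp [opTr, Finset.sum_add_distrib]

theorem det_eq_opMat (A : E n →L[ℝ] E n) : A.det = (opMat A).det := by
  have h1 : opMat A = LinearMap.toMatrix (EuclideanSpace.basisFun (Fin n) ℝ).toBasis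
      (EuclideanSpace.basisFun (Fin n) ℝ).toBasis (A : E n →ₗ[ℝ] E n) := by
    ext i j
    simp [opMat, basisVec, LinearMap.toMatrix_apply]
  rw [h1, LinearMap.det_toMatrix]

theorem det_ne_zero_of_comp {A B : E n →L[ℝ] E n} (h : ∀ w, A (B w) = w) : A.det ≠ 0 := by
  have h1 : A.comp B = ContinuousLinearMap.id ℝ (E n) := by
    ext1 w; exact h w
  have h2 : (opMat A).det * (opMat B).det = 1 := by
    rw [← Matrix.det_mul, ← opMat_comp, h1, opMat_one, Matrix.det_one]
  rw [det_eq_opMat]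
  exact left_ne_zero_of_mul_eq_one h2

/-- The logarithmic form of Jacobi's formula. The sign of the determinant plays no role, as
`Real.log x = log |x|`. -/
theorem hasDerivAt_log_det {A : ℝ → E n →L[ℝ] E n} {A' B : E n →L[ℝ] E n} {t : ℝ}
    (hA : HasDerivAt A A' t) (hB : ∀ w, A t (B w) = w) :
    HasDerivAt (fun s => Real.log (A s).det) (opTr (B.comp A')) t := by
  have h1 : (A t).comp B = ContinuousLinearMap.id ℝ (E n) := by
    ext1 w; exact hB w
  have h2 := hasDerivAt_det (A := fun s => opMat (A s)) (A' := opMat A') (B := opMat B) (t := t)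
    (fun i j => by
      have h3 := hA.clm_apply (hasDerivAt_const t (basisVec j))
      rw [map_zero, add_zero] at h3
      have h4 := (basisCov i : Dual n).hasFDerivAt.comp_hasDerivAt t h3
      exact h4) (by rw [← opMat_comp, h1, opMat_one])
  have h3 : (opMat (A t)).det ≠ 0 := by
    rw [← det_eq_opMat]; exact det_ne_zero_of_comp hB
  have h4 := h2.log h3
  rw [← opMat_comp, mul_div_cancel_left₀ _ h3, ← opTr_eq] at h4
  simpa only [det_eq_opMat] using h4

end Determinant

/-! ### Densities and divergences in charts -/

section Density

/-- Continuous densities that have the same integral over small open sets agree; one inequality. -/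
theorem le_of_lintegral_eq {n : ℕ} {f g : E n → ℝ} {y : E n} (hf : ContinuousAt f y)
    (hg : ContinuousAt g y) (hg0 : 0 ≤ g y) {U : Set (E n)} (hU : U ∈ 𝓝 y)
    (h : ∀ B ⊆ U, IsOpen B → ∫⁻ z in B, ENNReal.ofReal (f z) = ∫⁻ z in B, ENNReal.ofReal (g z)) :
    f y ≤ g y := by
  by_contra hlt
  push Not at hlt
  obtain ⟨b, hb1, hb2⟩ := exists_between hlt
  obtain ⟨a, ha1, ha2⟩ := exists_between hb1
  have hev : ∀ᶠ z in 𝓝 y, b < f z ∧ g z < a ∧ z ∈ U :=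
    (continuousAt_const.eventually_lt hf hb2).and
      ((hg.eventually_lt continuousAt_const ha1).and hU)
  obtain ⟨r, hr, hball⟩ := Metric.eventually_nhds_iff_ball.1 hev
  have h1 := h (Metric.ball y r) (fun z hz => (hball z hz).2.2) Metric.isOpen_ball
  have h2 : ENNReal.ofReal b * volume (Metric.ball y r) ≤
      ∫⁻ z in Metric.ball y r, ENNReal.ofReal (f z) := by
    rw [← setLIntegral_const]
    exact setLIntegral_mono' measurableSet_ball fun z hz =>
      ENNReal.ofReal_le_ofReal (hball z hz).1.le
  have h3 : ∫⁻ z in Metric.ball y r, ENNReal.ofReal (g z) ≤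
      ENNReal.ofReal a * volume (Metric.ball y r) := by
    rw [← setLIntegral_const]
    exact setLIntegral_mono' measurableSet_ball fun z hz =>
      ENNReal.ofReal_le_ofReal (hball z hz).2.1.le
  rw [h1] at h2
  have h4 : ENNReal.ofReal b ≤ ENNReal.ofReal a :=
    (ENNReal.mul_le_mul_iff_left (Metric.measure_ball_pos volume y hr).ne'
      measure_ball_lt_top.ne).1 (h2.trans h3)
  have h5 := (ENNReal.ofReal_le_ofReal_iff (by linarith)).1 h4
  linarith

variable {n : ℕ} {M : Type*} [TopologicalSpace M] [ChartedSpace (E n) M]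
  [IsManifold 𝓘(ℝ, E n) ∞ M]

section Transition

variable {e e' : OpenPartialHomeomorph M (E n)}

theorem isOpen_transition_dom : IsOpen (e.target ∩ e.symm ⁻¹' e'.source) :=
  e.isOpen_inter_preimage_symm e'.open_source

theorem mem_transition_dom {x : M} (hx : x ∈ e.source) (hx' : x ∈ e'.source) :
    e x ∈ e.target ∩ e.symm ⁻¹' e'.source :=
  ⟨e.map_source hx, by rw [mem_preimage, e.left_inv hx]; exact hx'⟩

theorem contDiffAt_transition (he : e ∈ IsManifold.maximalAtlas 𝓘(ℝ, E n) ∞ M)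
    (he' : e' ∈ IsManifold.maximalAtlas 𝓘(ℝ, E n) ∞ M) {y : E n}
    (hy : y ∈ e.target ∩ e.symm ⁻¹' e'.source) :
    ContDiffAt ℝ ∞ (fun y => e' (e.symm y)) y := by
  have h1 := (contMDiffOn_symm_of_mem_maximalAtlas he).contMDiffAt (e.open_target.mem_nhds hy.1)
  have h2 := (contMDiffOn_of_mem_maximalAtlas he').contMDiffAt (e'.open_source.mem_nhds hy.2)
  exact (h2.comp y h1).contDiffAt

theorem transition_inverse {y : E n} (hy : y ∈ e.target ∩ e.symm ⁻¹' e'.source) :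
    e (e'.symm (e' (e.symm y))) = y := by
  rw [e'.left_inv hy.2, e.right_inv hy.1]

theorem fderiv_transition_inverse (he : e ∈ IsManifold.maximalAtlas 𝓘(ℝ, E n) ∞ M)
    (he' : e' ∈ IsManifold.maximalAtlas 𝓘(ℝ, E n) ∞ M) {y : E n}
    (hy : y ∈ e.target ∩ e.symm ⁻¹' e'.source) (w : E n) :
    fderiv ℝ (fun y => e (e'.symm y)) (e' (e.symm y)) (fderiv ℝ (fun y => e' (e.symm y)) y w) =
      w := by
  have hy' : e' (e.symm y) ∈ e'.target ∩ e'.symm ⁻¹' e.source :=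
    mem_transition_dom hy.2 (e.map_target hy.1)
  have h1 := ((contDiffAt_transition he' he hy').differentiableAt (by simp)).hasFDerivAt.comp y
    ((contDiffAt_transition he he' hy).differentiableAt (by simp)).hasFDerivAt
  have h2 : HasFDerivAt ((fun y => e (e'.symm y)) ∘ fun y => e' (e.symm y))
      (ContinuousLinearMap.id ℝ (E n)) y := by
    refine (hasFDerivAt_id y).congr_of_eventuallyEq ?_
    filter_upwards [isOpen_transition_dom.mem_nhds hy] with y' hy'
    exact transition_inverse hy'
  exact congrArg (fun T : E n →L[ℝ] E n => T w) (h1.unique h2)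

theorem fderiv_transition_inverse' (he : e ∈ IsManifold.maximalAtlas 𝓘(ℝ, E n) ∞ M)
    (he' : e' ∈ IsManifold.maximalAtlas 𝓘(ℝ, E n) ∞ M) {y : E n}
    (hy : y ∈ e.target ∩ e.symm ⁻¹' e'.source) (w : E n) :
    fderiv ℝ (fun y => e' (e.symm y)) y (fderiv ℝ (fun y => e (e'.symm y)) (e' (e.symm y)) w) =
      w := by
  have hy' : e' (e.symm y) ∈ e'.target ∩ e'.symm ⁻¹' e.source :=
    mem_transition_dom hy.2 (e.map_target hy.1)
  have := fderiv_transition_inverse he' he hy' w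
  rwa [transition_inverse hy] at this

variable [MeasurableSpace M] [BorelSpace M] {m : Measure M}

omit [BorelSpace M] in
theorem isLogDensity_logDensity (hm : IsSmoothMeasure n m) {e : OpenPartialHomeomorph M (E n)}
    (he : e ∈ IsManifold.maximalAtlas 𝓘(ℝ, E n) ∞ M) : IsLogDensity m e (logDensity m e) :=
  Classical.epsilon_spec (hm e he)

omit [BorelSpace M] in
theorem contDiffAt_logDensity (hm : IsSmoothMeasure n m) {e : OpenPartialHomeomorph M (E n)}
    (he : e ∈ IsManifold.maximalAtlas 𝓘(ℝ, E n) ∞ M) {y : E n} (hy : y ∈ e.target) :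
    ContDiffAt ℝ ∞ (logDensity m e) y :=
  (isLogDensity_logDensity hm he).1.contDiffAt (e.open_target.mem_nhds hy)

/-- The change of variables formula for densities. -/
theorem exp_logDensity (hm : IsSmoothMeasure n m) (he : e ∈ IsManifold.maximalAtlas 𝓘(ℝ, E n) ∞ M)
    (he' : e' ∈ IsManifold.maximalAtlas 𝓘(ℝ, E n) ∞ M) {y : E n}
    (hy : y ∈ e.target ∩ e.symm ⁻¹' e'.source) :
    Real.exp (-logDensity m e y) = |(fderiv ℝ (fun y => e' (e.symm y)) y).det| *
      Real.exp (-logDensity m e' (e' (e.symm y))) := by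
  set θ : E n → E n := fun y => e' (e.symm y) with hθ
  have hy' : θ y ∈ e'.target := e'.map_source hy.2
  have hθy := contDiffAt_transition he he' hy
  have c1 : ContinuousAt (fun z => Real.exp (-logDensity m e z)) y :=
    (contDiffAt_logDensity hm he hy.1).continuousAt.neg.rexp
  have c2 : ContinuousAt (fun z => |(fderiv ℝ θ z).det| * Real.exp (-logDensity m e' (θ z))) y := by
    refine ContinuousAt.mul (ContinuousAt.abs ?_) (ContinuousAt.rexp (ContinuousAt.neg ?_))
    · exact ContinuousLinearMap.continuous_det.continuousAt.comp
        (hθy.fderiv_right (m := 0) (by simp)).continuousAt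
    · exact ContinuousAt.comp (f := θ) (contDiffAt_logDensity hm he' hy').continuousAt
        hθy.continuousAt
  have key : ∀ B ⊆ e.target ∩ e.symm ⁻¹' e'.source, IsOpen B →
      ∫⁻ z in B, ENNReal.ofReal (Real.exp (-logDensity m e z)) =
      ∫⁻ z in B, ENNReal.ofReal (|(fderiv ℝ θ z).det| * Real.exp (-logDensity m e' (θ z))) := by
    intro B hB hBo
    have i0 : e.symm '' B = e.source ∩ e ⁻¹' B :=
      e.symm.image_eq_target_inter_inv_preimage (fun z hz => (hB hz).1)
    have i1 : IsOpen (e.symm '' B) := by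
      rw [i0]; exact e.isOpen_inter_preimage hBo
    have i2 : e '' (e.symm '' B) = B := by
      rw [image_image]
      exact (image_congr fun z hz => e.right_inv (hB hz).1).trans (image_id' B)
    have i3 : e' '' (e.symm '' B) = θ '' B := by rw [image_image]
    have j1 := (isLogDensity_logDensity hm he).2 (e.symm '' B) i1.measurableSet
      (by rw [i0]; exact inter_subset_left)
    have j2 := (isLogDensity_logDensity hm he').2 (e.symm '' B) i1.measurableSet
      (by rintro _ ⟨z, hz, rfl⟩; exact (hB hz).2)
    rw [i2] at j1
    rw [i3, lintegral_image_eq_lintegral_abs_det_fderiv_mul volume hBo.measurableSet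
      (f' := fderiv ℝ θ) (fun z hz => ((contDiffAt_transition he he'
        (hB hz)).differentiableAt (by simp)).hasFDerivAt.hasFDerivWithinAt) ?_] at j2
    · rw [← j1, j2]
      refine lintegral_congr fun z => ?_
      rw [ENNReal.ofReal_mul (abs_nonneg _)]
    · intro z hz z' hz' h
      rw [← transition_inverse (hB hz), ← transition_inverse (hB hz')]
      exact congrArg _ (congrArg _ h)
  exact le_antisymm
    (le_of_lintegral_eq c1 c2 (by positivity) (isOpen_transition_dom.mem_nhds hy) key)
    (le_of_lintegral_eq c2 c1 (by positivity) (isOpen_transition_dom.mem_nhds hy)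
      fun B hB hBo => (key B hB hBo).symm)

/-- The logarithm of the change of variables formula. The absolute value of the Jacobian
determinant is implicit, as `Real.log x = log |x|`. -/
theorem logDensity_eq (hm : IsSmoothMeasure n m) (he : e ∈ IsManifold.maximalAtlas 𝓘(ℝ, E n) ∞ M)
    (he' : e' ∈ IsManifold.maximalAtlas 𝓘(ℝ, E n) ∞ M) {y : E n}
    (hy : y ∈ e.target ∩ e.symm ⁻¹' e'.source) :
    logDensity m e y = logDensity m e' (e' (e.symm y)) -
      Real.log (fderiv ℝ (fun y => e' (e.symm y)) y).det := by
  have h1 := congrArg Real.log (exp_logDensity hm he he' hy)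
  have h2 : (fderiv ℝ (fun y => e' (e.symm y)) y).det ≠ 0 :=
    det_ne_zero_of_comp (fderiv_transition_inverse' he he' hy)
  rw [Real.log_mul (abs_ne_zero.2 h2) (Real.exp_pos _).ne', Real.log_exp, Real.log_exp,
    Real.log_abs] at h1
  linarith

end Transition

end Density

/-! ### Coordinate invariance of the divergence and of the weight -/

section Euclid

variable {n : ℕ}

/-- The divergence of a vector field with respect to `e^{-ς} dx` on the model space. -/
def divE (s : E n → ℝ) (X : E n → E n) (y : E n) : ℝ := opTr (fderiv ℝ X y) - fderiv ℝ s y (X y)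

theorem divE_congr {s : E n → ℝ} {X X' : E n → E n} {y : E n} (h : X =ᶠ[𝓝 y] X') :
    divE s X y = divE s X' y := by
  rw [divE, divE, h.fderiv_eq, h.eq_of_nhds]

/-- Invariance of the divergence: the second derivatives of the change of coordinates `θ` in the
trace and in the density cancel. -/
theorem divE_transition {θ η : E n → E n} {X X' : E n → E n} {s s' : E n → ℝ} {y : E n}
    (hθ : ContDiffAt ℝ ∞ θ y) (hη : DifferentiableAt ℝ η (θ y))
    (hηθ : ∀ w, fderiv ℝ η (θ y) (fderiv ℝ θ y w) = w)
    (hθη : ∀ w, fderiv ℝ θ y (fderiv ℝ η (θ y) w) = w)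
    (hηy : η (θ y) = y)
    (hX : DifferentiableAt ℝ X y)
    (hX' : ∀ᶠ z in 𝓝 (θ y), X' z = fderiv ℝ θ (η z) (X (η z)))
    (hs' : DifferentiableAt ℝ s' (θ y))
    (hs : ∀ᶠ z in 𝓝 y, s z = s' (θ z) - Real.log (fderiv ℝ θ z).det)
    (hsd : DifferentiableAt ℝ s y) :
    divE s X y = divE s' X' (θ y) := by
  have hθd := (hθ.differentiableAt (by simp)).hasFDerivAt
  have hθ2 : HasFDerivAt (fderiv ℝ θ) (fderiv ℝ (fderiv ℝ θ) y) y :=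
    ((hθ.fderiv_right (m := 1) one_add_one_le_infty).differentiableAt one_ne_zero).hasFDerivAt
  have hsymm : IsSymmSndFDerivAt ℝ θ y := hθ.isSymmSndFDerivAt (by
      rw [minSmoothness_of_isRCLikeNormedField]
      exact WithTop.coe_le_coe.2 (le_top (a := (2 : ℕ∞))))
  set T := fderiv ℝ η (θ y)
  have g1 : HasFDerivAt (fun z => fderiv ℝ θ z (X z)) ((fderiv ℝ θ y).comp (fderiv ℝ X y) +
      (fderiv ℝ (fderiv ℝ θ) y).flip (X y)) y := hθ2.clm_apply hX.hasFDerivAt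
  rw [← hηy] at g1
  have g2 : HasFDerivAt X' _ (θ y) := (g1.comp (θ y) hη.hasFDerivAt).congr_of_eventuallyEq hX'
  rw [hηy] at g2
  -- with `T = (Dθ)⁻¹`, the trace of `DX'` exceeds that of `DX` by `tr (T D²θ(·, X))`
  have e1 : opTr (fderiv ℝ X' (θ y)) =
      opTr (fderiv ℝ X y) + opTr (T.comp ((fderiv ℝ (fderiv ℝ θ) y).flip (X y))) := by
    rw [g2.fderiv, opTr_comp_comm, ContinuousLinearMap.comp_add, opTr_add]
    congr 2
    ext1 w
    simp only [ContinuousLinearMap.comp_apply]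
    rw [hηθ]
  have e2 : X' (θ y) = fderiv ℝ θ y (X y) := by rw [hX'.self_of_nhds, hηy]
  have hline : HasDerivAt (fun r : ℝ => y + r • X y) (X y) 0 := by
    simpa using ((hasDerivAt_id (0 : ℝ)).smul_const (X y)).const_add y
  have hy0 : y + (0 : ℝ) • X y = y := by simp
  have hlim : Tendsto (fun r : ℝ => y + r • X y) (𝓝 0) (𝓝 y) := by
    have := hline.continuousAt.tendsto
    rwa [hy0] at this
  have d1 : HasDerivAt (fun r : ℝ => s (y + r • X y)) (fderiv ℝ s y (X y)) 0 := by
    have := hsd.hasFDerivAt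
    rw [← hy0] at this
    have h1 := this.comp_hasDerivAt (0 : ℝ) hline
    rw [hy0] at h1
    exact h1
  have d2 : HasDerivAt (fun r : ℝ => s' (θ (y + r • X y)))
      (fderiv ℝ s' (θ y) (fderiv ℝ θ y (X y))) 0 := by
    have := hs'.hasFDerivAt.comp y hθd
    rw [← hy0] at this
    have h1 := this.comp_hasDerivAt (0 : ℝ) hline
    rw [hy0] at h1
    exact h1
  -- and the derivative of `log det Dθ` along `X` is `tr (T D²θ(X, ·))`
  have d3 : HasDerivAt (fun r : ℝ => Real.log (fderiv ℝ θ (y + r • X y)).det)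
      (opTr (T.comp (fderiv ℝ (fderiv ℝ θ) y (X y)))) 0 := by
    refine hasDerivAt_log_det (A := fun r : ℝ => fderiv ℝ θ (y + r • X y)) ?_ (by
      intro w; simp only [hy0]; exact hθη w)
    have := hθ2
    rw [← hy0] at this
    have h1 := this.comp_hasDerivAt (0 : ℝ) hline
    rw [hy0] at h1
    exact h1
  have d4 := (d2.sub d3).congr_of_eventuallyEq (f₁ := fun r : ℝ => s (y + r • X y))
    (by filter_upwards [hlim.eventually hs] with r hr using hr)
  have e3 := d1.unique d4
  have e4 : (fderiv ℝ (fderiv ℝ θ) y).flip (X y) = fderiv ℝ (fderiv ℝ θ) y (X y) := by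
    ext1 w
    exact hsymm.eq w (X y)
  rw [divE, divE, e1, e2, e3, e4]
  ring

end Euclid

section Charts

variable {n : ℕ} {M : Type*} [TopologicalSpace M] [ChartedSpace (E n) M]
  [IsManifold 𝓘(ℝ, E n) ∞ M]

/-- The components of a vector field in a chart, as a function on the model space. -/
def compIn (e : OpenPartialHomeomorph M (E n)) (V : ∀ x : M, TangentSpace 𝓘(ℝ, E n) x)
    (y : E n) : E n := components e V (e.symm y)

/-- The components of a vector field transform by the differential of the change of coordinates. -/
theorem components_transition {e e' : OpenPartialHomeomorph M (E n)}
    (he : e ∈ IsManifold.maximalAtlas 𝓘(ℝ, E n) ∞ M)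
    (he' : e' ∈ IsManifold.maximalAtlas 𝓘(ℝ, E n) ∞ M) (V : ∀ x : M, TangentSpace 𝓘(ℝ, E n) x)
    {x : M} (hx : x ∈ e.source) (hx' : x ∈ e'.source) :
    components e' V x = fderiv ℝ (fun y => e' (e.symm y)) (e x) (components e V x) := by
  have h1 := contDiffAt_transition he he' (mem_transition_dom hx hx')
  have h2 := (h1.differentiableAt (by simp)).hasFDerivAt.hasMFDerivAt
  have h3 := (((contMDiffOn_of_mem_maximalAtlas he).contMDiffAt
    (e.open_source.mem_nhds hx)).mdifferentiableAt (by simp)).hasMFDerivAt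
  have h4 := HasMFDerivAt.comp x h2 h3
  have h5 := h4.congr_of_eventuallyEq (f₁ := e') (by
    filter_upwards [e.open_source.mem_nhds hx] with x' hx'
    simp only [Function.comp_apply]
    rw [e.left_inv hx'])
  have h6 := h5.mfderiv
  exact congrArg (fun T : E n →L[ℝ] E n => T (V x)) h6

theorem components_chartAt (x₀ : M) (V : ∀ x : M, TangentSpace 𝓘(ℝ, E n) x) {x : M}
    (hx : x ∈ (chartAt (E n) x₀).source) : components (chartAt (E n) x₀) V x =
      tc x x₀ x (show E n from V x) := by
  have h := mfderiv_chartAt_eq_tangentCoordChange (I := 𝓘(ℝ, E n)) (x := x) (y := x₀) hx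
  exact congrArg (fun T : E n →L[ℝ] E n => T (V x)) h

variable [MeasurableSpace M] {m : Measure M}

theorem divergence_eq (V : ∀ x : M, TangentSpace 𝓘(ℝ, E n) x) (x : M) :
    divergence m V x = divE (logDensity m (chartAt (E n) x)) (compIn (chartAt (E n) x) V)
      (chartAt (E n) x x) := by
  have h1 : compIn (chartAt (E n) x) V (chartAt (E n) x x) = components (chartAt (E n) x) V x := by
    rw [compIn, (chartAt (E n) x).left_inv (mem_source_self _)]
  rw [divergence, Finset.sum_sub_distrib, divE, h1]
  congr 1
  conv_rhs => rw [← sum_coord_smul_basisVec (components (chartAt (E n) x) V x), map_sum]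
  simp

variable [BorelSpace M]

theorem divE_chart_change (hm : IsSmoothMeasure n m) {e e' : OpenPartialHomeomorph M (E n)}
    (he : e ∈ IsManifold.maximalAtlas 𝓘(ℝ, E n) ∞ M)
    (he' : e' ∈ IsManifold.maximalAtlas 𝓘(ℝ, E n) ∞ M) (V : ∀ x : M, TangentSpace 𝓘(ℝ, E n) x)
    {x : M} (hx : x ∈ e.source) (hx' : x ∈ e'.source)
    (hV : DifferentiableAt ℝ (compIn e V) (e x)) :
    divE (logDensity m e) (compIn e V) (e x) = divE (logDensity m e') (compIn e' V) (e' x) := by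
  have hy := mem_transition_dom hx hx'
  have hθx : e' (e.symm (e x)) = e' x := by rw [e.left_inv hx]
  have h := divE_transition (θ := fun y => e' (e.symm y)) (η := fun y => e (e'.symm y))
    (X := compIn e V) (X' := compIn e' V) (s := logDensity m e) (s' := logDensity m e') (y := e x)
    (contDiffAt_transition he he' hy)
    ((contDiffAt_transition he' he (by rw [hθx]; exact mem_transition_dom hx' hx)).differentiableAt
      (by simp))
    (fderiv_transition_inverse he he' hy) (fderiv_transition_inverse' he he' hy)
    (transition_inverse hy) hV ?_
    ((contDiffAt_logDensity hm he' (e'.map_source hy.2)).differentiableAt (by simp)) ?_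
    ((contDiffAt_logDensity hm he hy.1).differentiableAt (by simp))
  · rw [hθx] at h
    exact h
  · rw [hθx]
    filter_upwards [isOpen_transition_dom.mem_nhds (mem_transition_dom hx' hx)] with z hz
    simp only [compIn]
    rw [components_transition he he' V hz.2 (e'.map_target hz.1), e.left_inv hz.2]
  · filter_upwards [isOpen_transition_dom.mem_nhds hy] with z hz
    exact logDensity_eq hm he he' hz

/-- The divergence, which is defined by the preferred charts, can be computed in any chart of the
maximal atlas. -/
theorem divergence_eq_chart (hm : IsSmoothMeasure n m) {e : OpenPartialHomeomorph M (E n)}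
    (he : e ∈ IsManifold.maximalAtlas 𝓘(ℝ, E n) ∞ M) (V : ∀ x : M, TangentSpace 𝓘(ℝ, E n) x)
    {x : M} (hx : x ∈ e.source) (hV : DifferentiableAt ℝ (compIn e V) (e x)) :
    divergence m V x = divE (logDensity m e) (compIn e V) (e x) := by
  rw [divergence_eq, divE_chart_change hm he (IsManifold.chart_mem_maximalAtlas x) V hx
    (mem_source_self x) hV]

variable {L : TangentBundle 𝓘(ℝ, E n) M → ℝ}

/-- The matrix of the fibrewise Hessian of a Lagrangian on the model space. -/
def hessMat (g : E n → ℝ) (w : E n) : Matrix (Fin n) (Fin n) ℝ :=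
  Matrix.of fun i j => fderiv ℝ (fderiv ℝ g) w (basisVec i) (basisVec j)

/-- The Hessian matrix transforms by congruence under linear substitutions. -/
theorem hessMat_comp_linear {g : E n → ℝ} (hg : IsFibreLagrangian g) {D : E n →L[ℝ] E n} {w : E n}
    (hw : D w ≠ 0) :
    hessMat (fun w => g (D w)) w = (opMat D).transpose * hessMat g (D w) * opMat D := by
  ext i j
  have h1 : ∀ b : E n, fderiv ℝ (fderiv ℝ g) (D w) (D (basisVec i)) b =
      ∑ k, D (basisVec i) k * fderiv ℝ (fderiv ℝ g) (D w) (basisVec k) b := by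
    intro b
    conv_lhs => rw [← sum_coord_smul_basisVec (D (basisVec i)), map_sum]
    simp
  have h2 : ∀ a : E n, fderiv ℝ (fderiv ℝ g) (D w) a (D (basisVec j)) =
      ∑ k, D (basisVec j) k * fderiv ℝ (fderiv ℝ g) (D w) a (basisVec k) := by
    intro a
    conv_lhs => rw [← sum_coord_smul_basisVec (D (basisVec j)), map_sum]
    simp
  simp only [hessMat, Matrix.of_apply, Matrix.mul_apply, Matrix.transpose_apply, opMat]
  rw [hg.hess_comp_linear hw, h2]
  refine Finset.sum_congr rfl fun k _ => ?_
  rw [h1, mul_comm]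

/-- The weight `ψ` in the coordinates of the preferred chart at `x₀`. It does not depend on the
chart: the Jacobian determinant of the change of coordinates enters the density, and its square the
determinant of the Hessian, so that the two contributions cancel. -/
theorem weight_eq (hm : IsSmoothMeasure n m) (hL : IsLagrangian L) {x₀ : M}
    {v : TangentBundle 𝓘(ℝ, E n) M} (hv : tcoord v ≠ 0) (h₀ : v.proj ∈ (chartAt (E n) x₀).source)
    (hdet : ∀ w ≠ 0, (hessMat (fibreL L v.proj) w).det ≠ 0) :
    weight m L v = logDensity m (chartAt (E n) x₀) (chartAt (E n) x₀ v.proj) +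
      Real.log (hessMat (fun w => locL L x₀ (chartAt (E n) x₀ v.proj, w)) (toTan x₀ v).2).det /
        2 := by
  set x := v.proj
  have hx := mem_source_self (n := n) x
  have h1 : weight m L v = logDensity m (chartAt (E n) x) (chartAt (E n) x x) +
      Real.log (hessMat (fibreL L x) (tcoord v)).det / 2 := rfl
  have h2 := logDensity_eq hm (IsManifold.chart_mem_maximalAtlas x₀ : chartAt (E n) x₀ ∈
    IsManifold.maximalAtlas 𝓘(ℝ, E n) ∞ M) (IsManifold.chart_mem_maximalAtlas x)
    (mem_transition_dom h₀ hx)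
  rw [(chartAt (E n) x₀).left_inv h₀] at h2
  have h3 : fderiv ℝ (fun y => chartAt (E n) x ((chartAt (E n) x₀).symm y)) (chartAt (E n) x₀ x) =
      tc x₀ x x := (hasFDerivAt_trans h₀ hx).fderiv
  rw [h3] at h2
  have h4 : (fun w => locL L x₀ (chartAt (E n) x₀ x, w)) = fun w => fibreL L x (tc x₀ x x w) := by
    funext w
    simp only [locL, ofTan, fibreL]
    rw [(chartAt (E n) x₀).left_inv h₀]
  have h5 : tc x₀ x x (toTan x₀ v).2 = tcoord v := tc_symm hx h₀ _
  have h6 : (opMat (tc (n := n) x₀ x x)).det ≠ 0 := by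
    rw [← det_eq_opMat]
    exact det_ne_zero_of_comp (tc_symm hx h₀)
  rw [h1, h4, hessMat_comp_linear (hL.isFibreLagrangian x) (by rw [h5]; exact hv), h5, h2,
    Matrix.det_mul, Matrix.det_mul, Matrix.det_transpose, det_eq_opMat,
    Real.log_mul (mul_ne_zero h6 (hdet _ hv)) h6, Real.log_mul h6 (hdet _ hv)]
  ring

end Charts

/-! ### Canonical frames -/

section Frames

variable {n : ℕ}

/-- A family of symplectic maps (the differentials of the Hamiltonian flow along an integral curve,
in coordinates), whose infinitesimal generator maps the vertical vector `(0, a)` to a vector with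
horizontal part `Q a`, for a positive definite form `Q`. -/
structure IsJacobiFamily (ε : ℝ) (G : ℝ → (E n × Dual n) →L[ℝ] (E n × Dual n))
    (Q : ℝ → Dual n →L[ℝ] E n) : Prop where
  pos : 0 < ε
  contDiffOn : ContDiffOn ℝ ∞ G (Ioo (-ε) ε)
  symp_map : ∀ s ∈ Ioo (-ε) ε, ∀ v w, symp (G s v) (G s w) = symp v w
  zero : G 0 = ContinuousLinearMap.id ℝ _
  deriv_fst : ∀ s ∈ Ioo (-ε) ε, ∀ w, (G s w).1 = 0 → (deriv G s w).1 = Q s (G s w).2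
  symm : ∀ s ∈ Ioo (-ε) ε, ∀ a b : Dual n, a (Q s b) = b (Q s a)
  posDef : ∀ s ∈ Ioo (-ε) ε, ∀ a : Dual n, a ≠ 0 → 0 < a (Q s a)

/-- Canonical frames with respect to a family of symplectic maps. -/
structure IsOrthFrame (ε : ℝ) (G : ℝ → (E n × Dual n) →L[ℝ] (E n × Dual n))
    (e : Fin n → ℝ → E n × Dual n) : Prop where
  smooth : ∀ i, ContDiffOn ℝ ∞ (e i) (Ioo (-ε) ε)
  mem : ∀ i, ∀ t ∈ Ioo (-ε) ε, (G t (e i t)).1 = 0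
  orthonormal : ∀ i j, ∀ t ∈ Ioo (-ε) ε, symp (deriv (e i) t) (e j t) = if i = j then 1 else 0
  second : ∀ i, ∀ t ∈ Ioo (-ε) ε, (G t (deriv (deriv (e i)) t)).1 = 0

/-- A positive definite form on the space of covectors has an orthonormal basis. -/
theorem exists_orthonormal {Q : Dual n →L[ℝ] E n} (hs : ∀ a b : Dual n, a (Q b) = b (Q a))
    (hp : ∀ a : Dual n, a ≠ 0 → 0 < a (Q a)) :
    ∃ a : Fin n → Dual n, ∀ i j, a j (Q (a i)) = if i = j then 1 else 0 := by
  set B : LinearMap.BilinForm ℝ (Dual n) :=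
    LinearMap.mk₂ ℝ (fun a b : Dual n => b (Q a)) (by simp) (by simp) (by simp) (by simp) with hB
  have hBapp : ∀ a b, B a b = b (Q a) := fun a b => rfl
  have hsymm : LinearMap.IsSymm B := ⟨fun a b => by
    simp only [hBapp, RingHom.id_apply]; exact hs b a⟩
  obtain ⟨v, hv⟩ := LinearMap.BilinForm.exists_orthogonal_basis (B := B) hsymm
  have hfr : Module.finrank ℝ (Dual n) = n := by
    have h1 : Module.finrank ℝ (Dual n) = Module.finrank ℝ (E n →ₗ[ℝ] ℝ) :=
      (LinearMap.toContinuousLinearMap (𝕜 := ℝ) (E := E n) (F' := ℝ)).finrank_eq.symm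
    rw [h1, Module.finrank_linearMap]
    simp
  set w : Fin n → Dual n := fun i => v (Fin.cast hfr.symm i) with hw
  have hpos : ∀ i, 0 < w i (Q (w i)) := fun i => hp _ (v.ne_zero _)
  refine ⟨fun i => (√(w i (Q (w i))))⁻¹ • w i, fun i j => ?_⟩
  split_ifs with hij
  · subst hij
    have h1 := Real.sq_sqrt (hpos i).le
    have h2 := (Real.sqrt_pos.2 (hpos i)).ne'
    simp only [map_smul, smul_apply, smul_eq_mul]
    field_simp
    linarith
  · have h1 : w j (Q (w i)) = 0 := by
      have := hv (i := Fin.cast hfr.symm i) (j := Fin.cast hfr.symm j) (by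
        intro h; exact hij (Fin.cast_injective _ h))
      exact this
    simp [h1]

/-- A finite orthonormal family of `n` covectors spans: the Fourier expansion. -/
theorem fourier_expansion {Q : Dual n →L[ℝ] E n}
    (hp : ∀ a : Dual n, a ≠ 0 → 0 < a (Q a)) {a : Fin n → Dual n}
    (ha : ∀ i j, a j (Q (a i)) = if i = j then 1 else 0) (b : Dual n) :
    b = ∑ i, b (Q (a i)) • a i := by
  have hfr : Module.finrank ℝ (Dual n) = n := by
    have h1 : Module.finrank ℝ (Dual n) = Module.finrank ℝ (E n →ₗ[ℝ] ℝ) :=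
      (LinearMap.toContinuousLinearMap (𝕜 := ℝ) (E := E n) (F' := ℝ)).finrank_eq.symm
    rw [h1, Module.finrank_linearMap]
    simp
  have hli : LinearIndependent ℝ a := by
    rw [Fintype.linearIndependent_iff]
    intro g hg i
    have h1 := congrArg (fun c : Dual n => c (Q (a i))) hg
    simpa [sum_apply, ha] using h1
  have hspan := hli.span_eq_top_of_card_eq_finrank' (by rw [hfr, Fintype.card_fin])
  set b' := b - ∑ i, b (Q (a i)) • a i with hb'
  have h0 : ∀ j, b' (Q (a j)) = 0 := by
    intro j
    simp [hb', sum_apply, ha]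
  have h1 : ∀ c : Dual n, b' (Q c) = 0 := by
    intro c
    have hc : c ∈ Submodule.span ℝ (range a) := hspan ▸ Submodule.mem_top
    induction hc using Submodule.span_induction with
    | mem x hx => obtain ⟨j, rfl⟩ := hx; exact h0 j
    | zero => simp
    | add x y _ _ hx hy => rw [map_add, map_add, hx, hy, add_zero]
    | smul r x _ hx => rw [map_smul, map_smul, hx, smul_zero]
  by_contra hne
  have h2 : b' ≠ 0 := fun h => hne (sub_eq_zero.1 h)
  exact (hp b' h2).ne' (h1 b')

namespace IsJacobiFamily

variable {ε : ℝ} {G : ℝ → (E n × Dual n) →L[ℝ] (E n × Dual n)} {Q : ℝ → Dual n →L[ℝ] E n}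
  (hG : IsJacobiFamily ε G Q)
include hG

theorem hasDerivAt {s : ℝ} (hs : s ∈ Ioo (-ε) ε) : HasDerivAt G (deriv G s) s :=
  ((hG.contDiffOn.contDiffAt (isOpen_Ioo.mem_nhds hs)).differentiableAt (by simp)).hasDerivAt

theorem mono {δ : ℝ} (hδ : 0 < δ) (h : δ ≤ ε) : IsJacobiFamily δ G Q := by
  have hsub : Ioo (-δ) δ ⊆ Ioo (-ε) ε := Ioo_subset_Ioo (by linarith) h
  exact ⟨hδ, hG.contDiffOn.mono hsub, fun s hs => hG.symp_map s (hsub hs), hG.zero,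
    fun s hs => hG.deriv_fst s (hsub hs), fun s hs => hG.symm s (hsub hs),
    fun s hs => hG.posDef s (hsub hs)⟩

/-- The spaces of the Jacobi curve are isotropic, since the vertical space is. -/
theorem isotropic {s : ℝ} (hs : s ∈ Ioo (-ε) ε) {v w : E n × Dual n} (hv : (G s v).1 = 0)
    (hw : (G s w).1 = 0) : symp v w = 0 := by
  rw [← hG.symp_map s hs, symp, hv, hw]; simp

/-- The derivative of a curve `e(t)` in the Jacobi curve, modulo the space of the Jacobi curve. -/
theorem fst_deriv {e : ℝ → E n × Dual n} {e' : E n × Dual n} {s : ℝ} (hs : s ∈ Ioo (-ε) ε)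
    (he : HasDerivAt e e' s) (hmem : ∀ᶠ t in 𝓝 s, (G t (e t)).1 = 0) :
    (G s e').1 = -Q s (G s (e s)).2 := by
  have h1 := ((ContinuousLinearMap.fst ℝ (E n) (Dual n)).hasFDerivAt.comp_hasDerivAt s
    ((hG.hasDerivAt hs).clm_apply he))
  have h2 : HasDerivAt (fun t => (G t (e t)).1) 0 s :=
    (hasDerivAt_const s (0 : E n)).congr_of_eventuallyEq hmem
  have h3 := h1.unique h2
  rw [ContinuousLinearMap.coe_fst', Prod.fst_add, hG.deriv_fst s hs _ hmem.self_of_nhds] at h3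
  rw [eq_neg_iff_add_eq_zero, add_comm]
  exact h3

theorem symp_deriv {e : ℝ → E n × Dual n} {e' w : E n × Dual n} {s : ℝ} (hs : s ∈ Ioo (-ε) ε)
    (he : HasDerivAt e e' s) (hmem : ∀ᶠ t in 𝓝 s, (G t (e t)).1 = 0) (hw : (G s w).1 = 0) :
    symp e' w = (G s w).2 (Q s (G s (e s)).2) := by
  rw [← hG.symp_map s hs, symp, hw, hG.fst_deriv hs he hmem]
  simp

theorem bijective {s : ℝ} (hs : s ∈ Ioo (-ε) ε) : Function.Bijective (G s) := by
  have h1 := surjective_of_symp (hG.symp_map s hs)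
  exact ⟨LinearMap.injective_iff_surjective (f := (G s : E n × Dual n →ₗ[ℝ] E n × Dual n)).2 h1, h1⟩

theorem bijective_form {s : ℝ} (hs : s ∈ Ioo (-ε) ε) : Function.Bijective (Q s) := by
  have hinj : Function.Injective (Q s : Dual n →ₗ[ℝ] E n) := by
    rw [injective_iff_map_eq_zero]
    intro a ha
    by_contra h0
    have h1 := hG.posDef s hs a h0
    have h2 : Q s a = 0 := ha
    rw [h2, map_zero] at h1
    exact lt_irrefl _ h1
  have hfr : Module.finrank ℝ (Dual n) = Module.finrank ℝ (E n) := by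
    have h1 : Module.finrank ℝ (Dual n) = Module.finrank ℝ (E n →ₗ[ℝ] ℝ) :=
      (LinearMap.toContinuousLinearMap (𝕜 := ℝ) (E := E n) (F' := ℝ)).finrank_eq.symm
    rw [h1, Module.finrank_linearMap]
    simp
  exact ⟨hinj, (LinearMap.injective_iff_surjective_of_finrank_eq_finrank hfr).1 hinj⟩

end IsJacobiFamily

theorem contDiffAt_clm_inverse {V W : Type*} [NormedAddCommGroup V] [NormedSpace ℝ V]
    [NormedAddCommGroup W] [NormedSpace ℝ W] [FiniteDimensional ℝ V] {A : ℝ → V →L[ℝ] W} {s : ℝ}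
    (hA : ContDiffAt ℝ ∞ A s) (hb : Function.Bijective (A s)) :
    ContDiffAt ℝ ∞ (fun t => (A t).inverse) s := by
  have hc : CompleteSpace V := FiniteDimensional.complete ℝ V
  obtain ⟨e, he⟩ := bijective_isEquiv hb
  have h1 := contDiffAt_map_inverse (𝕜 := ℝ) (n := ∞) e
  rw [he] at h1
  exact h1.comp s hA

theorem apply_clm_inverse {V W : Type*} [NormedAddCommGroup V] [NormedSpace ℝ V]
    [NormedAddCommGroup W] [NormedSpace ℝ W] [FiniteDimensional ℝ V] {A : V →L[ℝ] W}
    (hb : Function.Bijective A) (w : W) : A (A.inverse w) = w := by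
  obtain ⟨e, rfl⟩ := bijective_isEquiv hb
  rw [ContinuousLinearMap.inverse_equiv]
  exact e.apply_symm_apply w

/-- Bootstrapping: a solution of `A' = F(s, A)` is smooth if `F(s, ·)` preserves regularity. -/
theorem contDiffOn_infty_of_deriv_eq {V : Type*} [NormedAddCommGroup V] [NormedSpace ℝ V]
    {A : ℝ → V} {F : ℝ → V → V} {I : Set ℝ} (hI : IsOpen I)
    (hF : ∀ k : ℕ, ContDiffOn ℝ k A I → ContDiffOn ℝ k (fun s => F s (A s)) I)
    (hA : ∀ s ∈ I, HasDerivAt A (F s (A s)) s) : ContDiffOn ℝ ∞ A I := by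
  rw [contDiffOn_infty]
  intro k
  induction k with
  | zero =>
    rw [Nat.cast_zero, contDiffOn_zero]
    exact fun s hs => (hA s hs).continuousAt.continuousWithinAt
  | succ k ih =>
    have := (contDiffOn_succ_iff_deriv_of_isOpen (n := k) (f := A) (𝕜 := ℝ) hI).2
      ⟨fun s hs => (hA s hs).differentiableAt.differentiableWithinAt, by simp,
        (hF k ih).congr fun s hs => (hA s hs).deriv⟩
    exact_mod_cast this

theorem hasDerivAt_fst {V W : Type*} [NormedAddCommGroup V] [NormedSpace ℝ V]
    [NormedAddCommGroup W] [NormedSpace ℝ W] {f : ℝ → V × W} {f' : V × W} {t : ℝ}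
    (h : HasDerivAt f f' t) : HasDerivAt (fun s => (f s).1) f'.1 t :=
  (ContinuousLinearMap.fst ℝ V W).hasFDerivAt.comp_hasDerivAt t h

theorem hasDerivAt_snd {V W : Type*} [NormedAddCommGroup V] [NormedSpace ℝ V]
    [NormedAddCommGroup W] [NormedSpace ℝ W] {f : ℝ → V × W} {f' : V × W} {t : ℝ}
    (h : HasDerivAt f f' t) : HasDerivAt (fun s => (f s).2) f'.2 t :=
  (ContinuousLinearMap.snd ℝ V W).hasFDerivAt.comp_hasDerivAt t h

theorem hasDerivAt_symp {n : ℕ} {v w : ℝ → E n × Dual n} {v' w' : E n × Dual n} {t : ℝ}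
    (hv : HasDerivAt v v' t) (hw : HasDerivAt w w' t) :
    HasDerivAt (fun s => symp (v s) (w s)) (symp v' (w t) + symp (v t) w') t := by
  refine (((hasDerivAt_snd hv).clm_apply (hasDerivAt_fst hw)).sub
    ((hasDerivAt_snd hw).clm_apply (hasDerivAt_fst hv))).congr_deriv ?_
  simp only [symp]
  ring

/-- Local solutions of linear differential equations in a space of operators. -/
theorem exists_linear_ode {V : Type*} [NormedAddCommGroup V] [NormedSpace ℝ V]
    [FiniteDimensional ℝ V] {C : ℝ → V →L[ℝ] V} {ε : ℝ} (hε : 0 < ε)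
    (hC : ContDiffOn ℝ ∞ C (Ioo (-ε) ε)) :
    ∃ δ > 0, δ ≤ ε ∧ ∃ A : ℝ → V →L[ℝ] V, A 0 = ContinuousLinearMap.id ℝ V ∧
      ContDiffOn ℝ ∞ A (Ioo (-δ) δ) ∧ ∀ s ∈ Ioo (-δ) δ, HasDerivAt A ((C s).comp (A s)) s := by
  have hcV : CompleteSpace V := FiniteDimensional.complete ℝ V
  -- the equation made autonomous: the first component is time
  set f : ℝ × (V →L[ℝ] V) → ℝ × (V →L[ℝ] V) := fun p => (1, (C p.1).comp p.2) with hf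
  set x₀ : ℝ × (V →L[ℝ] V) := (0, ContinuousLinearMap.id ℝ V) with hx₀
  have h0 : (0 : ℝ) ∈ Ioo (-ε) ε := ⟨by linarith, hε⟩
  have hC0 : ContDiffAt ℝ 1 C x₀.1 :=
    (hC.contDiffAt (isOpen_Ioo.mem_nhds h0)).of_le (WithTop.coe_le_coe.2 (le_top (a := (1 : ℕ∞))))
  have hfs : ContDiffAt ℝ 1 f x₀ :=
    contDiffAt_const.prodMk ((ContDiffAt.comp x₀ (f := Prod.fst) hC0 contDiffAt_fst).clm_comp
      contDiffAt_snd)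
  obtain ⟨δ, r, Φ, hδ, hr, hΦ, -⟩ := exists_isLocalFlow_continuousOn hfs
  obtain ⟨h1, h2⟩ := hΦ x₀ (Metric.mem_ball_self hr)
  have hd : ∀ s ∈ Ioo (-δ) δ, HasDerivAt (fun t => (Φ t x₀).1) 1 s ∧
      HasDerivAt (fun t => (Φ t x₀).2) ((C (Φ s x₀).1).comp (Φ s x₀).2) s := fun s hs =>
    ⟨hasDerivAt_fst (h2 s hs), hasDerivAt_snd (h2 s hs)⟩
  have ht : ∀ s ∈ Ioo (-δ) δ, (Φ s x₀).1 = s := by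
    intro s hs
    have h3 := isOpen_Ioo.is_const_of_deriv_eq_zero (f := fun t => (Φ t x₀).1 - t)
        isPreconnected_Ioo
      (fun t ht => (((hd t ht).1.sub (hasDerivAt_id t)).differentiableAt).differentiableWithinAt)
      (fun t ht => by
        have := ((hd t ht).1.sub (hasDerivAt_id t)).deriv
        rw [sub_self] at this
        exact this) hs (show (0 : ℝ) ∈ Ioo (-δ) δ from ⟨by linarith, hδ⟩)
    have e0 : (Φ 0 x₀).1 = 0 := by rw [h1]
    simp only [e0, sub_zero] at h3
    linarith
  have hsub1 : Ioo (-min δ ε) (min δ ε) ⊆ Ioo (-δ) δ :=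
    Ioo_subset_Ioo (by linarith [min_le_left δ ε]) (min_le_left _ _)
  have hsub2 : Ioo (-min δ ε) (min δ ε) ⊆ Ioo (-ε) ε :=
    Ioo_subset_Ioo (by linarith [min_le_right δ ε]) (min_le_right _ _)
  have hA : ∀ s ∈ Ioo (-min δ ε) (min δ ε), HasDerivAt (fun t => (Φ t x₀).2)
      ((C s).comp (Φ s x₀).2) s := by
    intro s hs
    have := (hd s (hsub1 hs)).2
    rwa [ht s (hsub1 hs)] at this
  refine ⟨min δ ε, lt_min hδ hε, min_le_right _ _, fun t => (Φ t x₀).2,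
    by show (Φ 0 x₀).2 = _; rw [h1], ?_, hA⟩
  exact contDiffOn_infty_of_deriv_eq (F := fun s A => (C s).comp A) isOpen_Ioo
    (fun k hk => ((contDiffOn_infty.1 hC k).mono hsub2).clm_comp hk) hA

/-- The parametrization `a ↦ G_s⁻¹ (0, a)` of the Jacobi curve. -/
def jacobiParam {n : ℕ} (G : ℝ → (E n × Dual n) →L[ℝ] (E n × Dual n)) (s : ℝ) :
    Dual n →L[ℝ] (E n × Dual n) :=
  (G s).inverse.comp (ContinuousLinearMap.inr ℝ (E n) (Dual n))

/-- The coefficient operator `C = ½ Q⁻¹ (G Γ'')₁` of the linear equation `a' = C a` satisfied by the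
components of a canonical frame `Γ a`, where `Γ` is `jacobiParam`: modulo the Jacobi curve, the
second derivative of `Γ a` is `Γ'' a + 2 Γ' a'`, and `(G Γ' b)₁ = -Q b`. -/
def frameCoeff {n : ℕ} (G : ℝ → (E n × Dual n) →L[ℝ] (E n × Dual n)) (Q : ℝ → Dual n →L[ℝ] E n)
    (s : ℝ) : Dual n →L[ℝ] Dual n :=
  (1 / 2 : ℝ) • (Q s).inverse.comp
    (((ContinuousLinearMap.fst ℝ (E n) (Dual n)).comp (G s)).comp (deriv (deriv (jacobiParam G)) s))

namespace IsJacobiFamily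

variable {ε : ℝ} {G : ℝ → (E n × Dual n) →L[ℝ] (E n × Dual n)} {Q : ℝ → Dual n →L[ℝ] E n}
  (hG : IsJacobiFamily ε G Q)
include hG

theorem contDiffOn_jacobiParam : ContDiffOn ℝ ∞ (jacobiParam G) (Ioo (-ε) ε) := fun _s hs =>
  ((contDiffAt_clm_inverse (hG.contDiffOn.contDiffAt (isOpen_Ioo.mem_nhds hs))
    (hG.bijective hs)).clm_comp contDiffAt_const).contDiffWithinAt

theorem contDiffOn_deriv_jacobiParam : ContDiffOn ℝ ∞ (deriv (jacobiParam G)) (Ioo (-ε) ε) :=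
  ((contDiffOn_infty_iff_deriv_of_isOpen isOpen_Ioo).1 hG.contDiffOn_jacobiParam).2

theorem contDiffOn_deriv_deriv_jacobiParam :
    ContDiffOn ℝ ∞ (deriv (deriv (jacobiParam G))) (Ioo (-ε) ε) :=
  ((contDiffOn_infty_iff_deriv_of_isOpen isOpen_Ioo).1 hG.contDiffOn_deriv_jacobiParam).2

theorem hasDerivAt_jacobiParam {s : ℝ} (hs : s ∈ Ioo (-ε) ε) :
    HasDerivAt (jacobiParam G) (deriv (jacobiParam G) s) s :=
  ((hG.contDiffOn_jacobiParam.contDiffAt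
    (isOpen_Ioo.mem_nhds hs)).differentiableAt (by simp)).hasDerivAt

theorem hasDerivAt_deriv_jacobiParam {s : ℝ} (hs : s ∈ Ioo (-ε) ε) :
    HasDerivAt (deriv (jacobiParam G)) (deriv (deriv (jacobiParam G)) s) s :=
  ((hG.contDiffOn_deriv_jacobiParam.contDiffAt
    (isOpen_Ioo.mem_nhds hs)).differentiableAt (by simp)).hasDerivAt

theorem apply_jacobiParam {s : ℝ} (hs : s ∈ Ioo (-ε) ε) (a : Dual n) :
    G s (jacobiParam G s a) = (0, a) :=
  apply_clm_inverse (hG.bijective hs) _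

theorem fst_deriv_jacobiParam {s : ℝ} (hs : s ∈ Ioo (-ε) ε) (a : Dual n) :
    (G s (deriv (jacobiParam G) s a)).1 = -Q s a := by
  have h1 : HasDerivAt (fun t => jacobiParam G t a) (deriv (jacobiParam G) s a) s := by
    simpa using (hG.hasDerivAt_jacobiParam hs).clm_apply (hasDerivAt_const s a)
  have h2 := hG.fst_deriv hs h1 (by
    filter_upwards [isOpen_Ioo.mem_nhds hs] with t ht
    rw [hG.apply_jacobiParam ht])
  rw [hG.apply_jacobiParam hs] at h2
  exact h2

/-- The form `Q` is smooth, since it is determined by `G`: `Q a = -(G Γ' a)₁`. -/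
theorem contDiffOn_form : ContDiffOn ℝ ∞ Q (Ioo (-ε) ε) := by
  have h1 : ContDiffOn ℝ ∞ (fun s => -((ContinuousLinearMap.fst ℝ (E n) (Dual n)).comp
      ((G s).comp (deriv (jacobiParam G) s)))) (Ioo (-ε) ε) :=
    (contDiffOn_const.clm_comp (hG.contDiffOn.clm_comp hG.contDiffOn_deriv_jacobiParam)).neg
  refine h1.congr fun s hs => ?_
  refine ContinuousLinearMap.ext fun a => ?_
  have := hG.fst_deriv_jacobiParam hs a
  simp [this]

theorem contDiffOn_frameCoeff : ContDiffOn ℝ ∞ (frameCoeff G Q) (Ioo (-ε) ε) := by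
  refine ContDiffOn.const_smul _ (ContDiffOn.clm_comp (fun s hs => ?_)
    ((contDiffOn_const.clm_comp hG.contDiffOn).clm_comp hG.contDiffOn_deriv_deriv_jacobiParam))
  exact (contDiffAt_clm_inverse (hG.contDiffOn_form.contDiffAt (isOpen_Ioo.mem_nhds hs))
    (hG.bijective_form hs)).contDiffWithinAt

theorem form_frameCoeff {s : ℝ} (hs : s ∈ Ioo (-ε) ε) (a : Dual n) :
    Q s (frameCoeff G Q s a) = (1 / 2 : ℝ) • (G s (deriv (deriv (jacobiParam G)) s a)).1 := by
  simp only [frameCoeff, smul_apply, map_smul, ContinuousLinearMap.comp_apply]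
  rw [apply_clm_inverse (hG.bijective_form hs)]
  rfl

end IsJacobiFamily

/-- Canonical frames exist: `e_i = Γ a_i`, where `Γ` parametrizes the Jacobi curve and `a_i` solves
the linear equation that makes the second derivatives `ë_i` tangent to the Jacobi curve. The frame
stays orthonormal because the derivative `ω(ė_i, ė_j)` of its Gram matrix is both symmetric and
antisymmetric. -/
theorem IsJacobiFamily.exists_orthFrame {ε : ℝ} {G : ℝ → (E n × Dual n) →L[ℝ] (E n × Dual n)}
    {Q : ℝ → Dual n →L[ℝ] E n} (hG : IsJacobiFamily ε G Q) :
    ∃ δ > 0, δ ≤ ε ∧ ∃ e, IsOrthFrame δ G e := by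
  have h0I : (0 : ℝ) ∈ Ioo (-ε) ε := ⟨by linarith [hG.pos], hG.pos⟩
  obtain ⟨δ, hδ, hδε, A, hA0, hAs, hAd⟩ := exists_linear_ode hG.pos hG.contDiffOn_frameCoeff
  have hsub : Ioo (-δ) δ ⊆ Ioo (-ε) ε := Ioo_subset_Ioo (by linarith) hδε
  have h0δ : (0 : ℝ) ∈ Ioo (-δ) δ := ⟨by linarith, hδ⟩
  obtain ⟨a₀, ha₀⟩ := exists_orthonormal (hG.symm 0 h0I) (hG.posDef 0 h0I)
  set e : Fin n → ℝ → E n × Dual n := fun i s => jacobiParam G s (A s (a₀ i)) with he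
  have hes : ∀ i, ContDiffOn ℝ ∞ (e i) (Ioo (-δ) δ) := fun i =>
    (hG.contDiffOn_jacobiParam.mono hsub).clm_apply (hAs.clm_apply contDiffOn_const)
  have hmem : ∀ i, ∀ t ∈ Ioo (-δ) δ, (G t (e i t)).1 = 0 := fun i t ht => by
    simp only [he]; rw [hG.apply_jacobiParam (hsub ht)]
  have hAd1 : ∀ i, ∀ t ∈ Ioo (-δ) δ,
      HasDerivAt (fun s => A s (a₀ i)) (frameCoeff G Q t (A t (a₀ i))) t := by
    intro i t ht
    simpa using (hAd t ht).clm_apply (hasDerivAt_const t (a₀ i))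
  have hed : ∀ i, ∀ t ∈ Ioo (-δ) δ, HasDerivAt (e i)
      (deriv (jacobiParam G) t (A t (a₀ i)) +
        jacobiParam G t (frameCoeff G Q t (A t (a₀ i)))) t := fun i t ht =>
    (hG.hasDerivAt_jacobiParam (hsub ht)).clm_apply (hAd1 i t ht)
  have hCd : ∀ t ∈ Ioo (-δ) δ, HasDerivAt (frameCoeff G Q) (deriv (frameCoeff G Q) t) t :=
    fun t ht => ((hG.contDiffOn_frameCoeff.contDiffAt
      (isOpen_Ioo.mem_nhds (hsub ht))).differentiableAt (by simp)).hasDerivAt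
  have hsecond : ∀ i, ∀ t ∈ Ioo (-δ) δ, (G t (deriv (deriv (e i)) t)).1 = 0 := by
    intro i t ht
    have h1 : deriv (e i) =ᶠ[𝓝 t] fun s => deriv (jacobiParam G) s (A s (a₀ i)) +
        jacobiParam G s (frameCoeff G Q s (A s (a₀ i))) := by
      filter_upwards [isOpen_Ioo.mem_nhds ht] with s hs using (hed i s hs).deriv
    have h2 := ((hG.hasDerivAt_deriv_jacobiParam (hsub ht)).clm_apply (hAd1 i t ht)).add
      ((hG.hasDerivAt_jacobiParam (hsub ht)).clm_apply ((hCd t ht).clm_apply (hAd1 i t ht)))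
    rw [(h2.congr_of_eventuallyEq h1).deriv]
    simp only [map_add, Prod.fst_add]
    rw [hG.fst_deriv_jacobiParam (hsub ht), hG.form_frameCoeff (hsub ht),
      hG.apply_jacobiParam (hsub ht), hG.apply_jacobiParam (hsub ht)]
    simp only [add_zero]
    module
  refine ⟨δ, hδ, hδε, e, hes, hmem, ?_, hsecond⟩
  have hed' : ∀ i, ∀ t ∈ Ioo (-δ) δ, HasDerivAt (e i) (deriv (e i) t) t := fun i t ht =>
    (hed i t ht).differentiableAt.hasDerivAt
  have hed2 : ∀ i, ∀ t ∈ Ioo (-δ) δ, HasDerivAt (deriv (e i)) (deriv (deriv (e i)) t) t :=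
    fun i t ht => ((((contDiffOn_infty_iff_deriv_of_isOpen isOpen_Ioo).1 (hes i)).2.contDiffAt
      (isOpen_Ioo.mem_nhds ht)).differentiableAt (by simp)).hasDerivAt
  have hform : ∀ i j, ∀ t ∈ Ioo (-δ) δ, symp (deriv (e i) t) (e j t) =
      (A t (a₀ j)) (Q t (A t (a₀ i))) := by
    intro i j t ht
    rw [hG.symp_deriv (hsub ht) (hed' i t ht) (by
      filter_upwards [isOpen_Ioo.mem_nhds ht] with s hs using hmem i s hs) (hmem j t ht)]
    simp only [he]
    rw [hG.apply_jacobiParam (hsub ht), hG.apply_jacobiParam (hsub ht)]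
  have hD : ∀ i j, ∀ t ∈ Ioo (-δ) δ, HasDerivAt (fun s => symp (deriv (e i) s) (e j s))
      (symp (deriv (e i) t) (deriv (e j) t)) t := by
    intro i j t ht
    have a1 := hed2 i t ht
    have a2 := hed' j t ht
    refine (hasDerivAt_symp a1 a2).congr_deriv ?_
    rw [hG.isotropic (hsub ht) (hsecond i t ht) (hmem j t ht), zero_add]
  have hD0 : ∀ i j, ∀ t ∈ Ioo (-δ) δ, symp (deriv (e i) t) (deriv (e j) t) = 0 := by
    intro i j t ht
    have h1 : (fun s => symp (deriv (e i) s) (e j s)) =ᶠ[𝓝 t]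
        fun s => symp (deriv (e j) s) (e i s) := by
      filter_upwards [isOpen_Ioo.mem_nhds ht] with s hs
      rw [hform i j s hs, hform j i s hs, hG.symm s (hsub hs)]
    have h2 := ((hD j i t ht).congr_of_eventuallyEq h1).unique (hD i j t ht)
    have h3 := symp_antisymm (deriv (e i) t) (deriv (e j) t)
    linarith
  intro i j t ht
  have h1 := isOpen_Ioo.is_const_of_deriv_eq_zero (f := fun s => symp (deriv (e i) s) (e j s))
    isPreconnected_Ioo (fun s hs => (hD i j s hs).differentiableAt.differentiableWithinAt)
    (fun s hs => by rw [(hD i j s hs).deriv, hD0 i j s hs]; rfl) ht h0δ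
  rw [h1, hform i j 0 h0δ, hA0]
  exact ha₀ i j

end Frames

/-! ### The Riccati inequality -/

section Riccati

variable {n : ℕ}

theorem opTr_neg (A : E n →L[ℝ] E n) : opTr (-A) = -opTr A := by
  simp [opTr]

theorem hasDerivAt_opTr {A : ℝ → E n →L[ℝ] E n} {A' : E n →L[ℝ] E n} {t : ℝ}
    (hA : HasDerivAt A A' t) : HasDerivAt (fun s => opTr (A s)) (opTr A') t := by
  simp only [opTr]
  refine HasDerivAt.fun_sum fun i _ => ?_
  have h1 : HasDerivAt (fun s => A s (basisVec i)) (A' (basisVec i)) t := by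
    simpa using hA.clm_apply (hasDerivAt_const t (basisVec i))
  exact (basisCov i : Dual n).hasFDerivAt.comp_hasDerivAt t h1

theorem bijective_of_det_ne_zero {A : E n →L[ℝ] E n} (h : A.det ≠ 0) : Function.Bijective A :=
  (LinearMap.equivOfDetNeZero (A : E n →ₗ[ℝ] E n) h).bijective

/-- `(tr B)² ≤ n tr B²` for symmetric `B`, by the Cauchy–Schwarz inequality on the diagonal. -/
theorem sq_opTr_le {B : E n →L[ℝ] E n} (hB : ∀ i j, B (basisVec j) i = B (basisVec i) j) :
    opTr B ^ 2 ≤ n * opTr (B.comp B) := by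
  have h1 : opTr (B.comp B) = ∑ i, ∑ j, (B (basisVec j) i) ^ 2 := by
    rw [opTr_eq, opMat_comp, Matrix.trace]
    refine Finset.sum_congr rfl fun i _ => ?_
    rw [Matrix.diag_apply, Matrix.mul_apply]
    refine Finset.sum_congr rfl fun j _ => ?_
    simp only [opMat, Matrix.of_apply]
    rw [hB j i, sq]
  have h2 : ∑ i, (B (basisVec i) i) ^ 2 ≤ ∑ i, ∑ j, (B (basisVec j) i) ^ 2 :=
    Finset.sum_le_sum fun i _ => Finset.single_le_sum (f := fun j => (B (basisVec j) i) ^ 2)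
      (fun j _ => sq_nonneg _) (Finset.mem_univ i)
  have h3 := sq_sum_le_card_mul_sum_sq (s := (Finset.univ : Finset (Fin n)))
    (f := fun i => B (basisVec i) i)
  rw [Finset.card_univ, Fintype.card_fin] at h3
  rw [h1, opTr]
  exact h3.trans (mul_le_mul_of_nonneg_left h2 (Nat.cast_nonneg n))

/-- The second derivative of `log det K` for a solution of `K'' = M K`, in terms of `K' K⁻¹`. -/
theorem hasDerivAt_log_det_deriv {K K₁ : ℝ → E n →L[ℝ] E n} {K₂ M : E n →L[ℝ] E n}
    (hK : ContDiffAt ℝ ∞ K 0) (hK1 : ∀ᶠ s in 𝓝 0, HasDerivAt K (K₁ s) s)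
    (hK2 : HasDerivAt K₁ K₂ 0) (hM : K₂ = M.comp (K 0))
    (hb : ∀ᶠ s in 𝓝 0, Function.Bijective (K s)) :
    (∀ᶠ s in 𝓝 0, HasDerivAt (fun s => Real.log (K s).det)
      (opTr ((K s).inverse.comp (K₁ s))) s) ∧
    HasDerivAt (fun s => opTr ((K s).inverse.comp (K₁ s)))
      (opTr M - opTr (((K₁ 0).comp (K 0).inverse).comp ((K₁ 0).comp (K 0).inverse))) 0 ∧
    opTr ((K 0).inverse.comp (K₁ 0)) = opTr ((K₁ 0).comp (K 0).inverse) := by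
  refine ⟨?_, ?_, opTr_comp_comm _ _⟩
  · filter_upwards [hK1, hb] with s h1 h2
    exact hasDerivAt_log_det h1 (apply_clm_inverse h2)
  · have hX := ((contDiffAt_clm_inverse hK hb.self_of_nhds).differentiableAt (by simp)).hasDerivAt
    set X := fun s => (K s).inverse with hXdef
    set X' := deriv X 0 with hX'
    have h1 : ∀ᶠ s in 𝓝 0, (K s).comp (X s) = ContinuousLinearMap.id ℝ (E n) := by
      filter_upwards [hb] with s hs
      exact ContinuousLinearMap.ext fun w => apply_clm_inverse hs w
    have hleft : (X 0).comp (K 0) = ContinuousLinearMap.id ℝ (E n) :=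
      ContinuousLinearMap.ext fun w => hb.self_of_nhds.1 (apply_clm_inverse hb.self_of_nhds _)
    have h2 := (hK1.self_of_nhds.clm_comp hX).unique
      ((hasDerivAt_const (0 : ℝ) (ContinuousLinearMap.id ℝ (E n))).congr_of_eventuallyEq h1)
    have h3 : X' = -((X 0).comp ((K₁ 0).comp (X 0))) := by
      have h4 : (K 0).comp X' = -((K₁ 0).comp (X 0)) := by
        rw [eq_neg_iff_add_eq_zero, add_comm]; exact h2
      calc X' = ((X 0).comp (K 0)).comp X' := by rw [hleft]; rfl
        _ = (X 0).comp ((K 0).comp X') := rfl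
        _ = _ := by rw [h4, ContinuousLinearMap.comp_neg]
    refine (hasDerivAt_opTr (hX.clm_comp hK2)).congr_deriv ?_
    have e1 : opTr ((X 0).comp K₂) = opTr M := by
      rw [hM, opTr_comp_comm]
      congr 1
      calc (M.comp (K 0)).comp (X 0) = M.comp ((K 0).comp (X 0)) := rfl
        _ = M := by rw [h1.self_of_nhds]; rfl
    have e2 : opTr (X'.comp (K₁ 0)) =
        -opTr (((K₁ 0).comp (X 0)).comp ((K₁ 0).comp (X 0))) := by
      rw [h3, ContinuousLinearMap.neg_comp, opTr_neg]
      congr 1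
      exact opTr_comp_comm (X 0) (((K₁ 0).comp (X 0)).comp (K₁ 0))
    rw [opTr_add, e1, e2]
    ring

/-- The operator `x ↦ (ω(v_i, (x, S x)))_i`, for a symmetric form `S`. With a canonical frame for
`v` it expresses the horizontal part of the differential of the flow on the graph of `S` in the
frame. -/
def pairOp (S : E n →L[ℝ] Dual n) (v : Fin n → E n × Dual n) : E n →L[ℝ] E n :=
  ∑ i, ((v i).2 - S (v i).1).smulRight (basisVec i)

theorem pairOp_apply {S : E n →L[ℝ] Dual n} (hS : ∀ a b, S a b = S b a)
    (v : Fin n → E n × Dual n) (x : E n) (i : Fin n) :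
    pairOp S v x i = symp (v i) (x, S x) := by
  have h1 : pairOp S v x i = ∑ j, ((v j).2 - S (v j).1) x * (basisVec j : E n) i := by
    simp [pairOp, sum_apply]
  rw [h1, Finset.sum_eq_single i]
  · simp [basisVec, symp, hS]
  · intro j _ hj
    simp [basisVec, hj.symm]
  · simp

theorem hasDerivAt_pairOp {S : E n →L[ℝ] Dual n} {v : Fin n → ℝ → E n × Dual n}
    {v' : Fin n → E n × Dual n} {t : ℝ} (hv : ∀ i, HasDerivAt (v i) (v' i) t) :
    HasDerivAt (fun s => pairOp S fun i => v i s) (pairOp S v') t := by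
  refine HasDerivAt.fun_sum fun i _ => ?_
  have h1 := (hasDerivAt_snd (hv i)).sub (S.hasFDerivAt.comp_hasDerivAt t (hasDerivAt_fst (hv i)))
  exact ((ContinuousLinearMap.smulRightL ℝ (E n) (E n)).flip
    (basisVec i)).hasFDerivAt.comp_hasDerivAt t h1

theorem contDiffAt_pairOp {S : E n →L[ℝ] Dual n} {v : Fin n → ℝ → E n × Dual n} {t : ℝ}
    (hv : ∀ i, ContDiffAt ℝ ∞ (v i) t) : ContDiffAt ℝ ∞ (fun s => pairOp S fun i => v i s) t := by
  refine ContDiffAt.sum fun i _ => ?_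
  have h1 : ContDiffAt ℝ ∞ (fun s => (v i s).2 - S (v i s).1) t :=
    (contDiffAt_snd.comp t (hv i)).sub (S.contDiff.contDiffAt.comp t (contDiffAt_fst.comp t (hv i)))
  exact ((ContinuousLinearMap.smulRightL ℝ (E n) (E n)).flip
    (basisVec i)).contDiff.contDiffAt.comp t h1

namespace IsOrthFrame

variable {ε : ℝ} {G : ℝ → (E n × Dual n) →L[ℝ] (E n × Dual n)} {Q : ℝ → Dual n →L[ℝ] E n}
  {e : Fin n → ℝ → E n × Dual n}

theorem hasDerivAt (he : IsOrthFrame ε G e) (i : Fin n) {t : ℝ} (ht : t ∈ Ioo (-ε) ε) :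
    HasDerivAt (e i) (deriv (e i) t) t :=
  (((he.smooth i).contDiffAt (isOpen_Ioo.mem_nhds ht)).differentiableAt (by simp)).hasDerivAt

theorem hasDerivAt_deriv (he : IsOrthFrame ε G e) (i : Fin n) {t : ℝ} (ht : t ∈ Ioo (-ε) ε) :
    HasDerivAt (deriv (e i)) (deriv (deriv (e i)) t) t :=
  ((((contDiffOn_infty_iff_deriv_of_isOpen isOpen_Ioo).1 (he.smooth i)).2.contDiffAt
    (isOpen_Ioo.mem_nhds ht)).differentiableAt (by simp)).hasDerivAt

theorem form (he : IsOrthFrame ε G e) (hG : IsJacobiFamily ε G Q) {t : ℝ} (ht : t ∈ Ioo (-ε) ε)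
    (i j : Fin n) : (G t (e j t)).2 (Q t (G t (e i t)).2) = if i = j then 1 else 0 := by
  rw [← he.orthonormal i j t ht, hG.symp_deriv ht (he.hasDerivAt i ht) (by
    filter_upwards [isOpen_Ioo.mem_nhds ht] with s hs using he.mem i s hs) (he.mem j t ht)]

/-- The expansion of a vector of the Jacobi curve in a canonical frame. -/
theorem expansion (he : IsOrthFrame ε G e) (hG : IsJacobiFamily ε G Q) {t : ℝ}
    (ht : t ∈ Ioo (-ε) ε) {w : E n × Dual n} (hw : (G t w).1 = 0) :
    w = ∑ j, symp (deriv (e j) t) w • e j t := by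
  have h1 := fourier_expansion (hG.posDef t ht) (a := fun i => (G t (e i t)).2)
    (fun i j => he.form hG ht i j) (G t w).2
  refine (hG.bijective ht).1 (Prod.ext ?_ ?_)
  · rw [hw, map_sum, Prod.fst_sum]
    simp [he.mem _ t ht]
  · rw [map_sum, Prod.snd_sum]
    refine h1.trans (Finset.sum_congr rfl fun j _ => ?_)
    rw [map_smul, Prod.smul_snd, hG.symp_deriv ht (he.hasDerivAt j ht) (by
      filter_upwards [isOpen_Ioo.mem_nhds ht] with s hs using he.mem j s hs) hw]

/-- The derivatives `ė_i` of a canonical frame span an isotropic space. -/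
theorem symp_deriv_deriv (he : IsOrthFrame ε G e) (hG : IsJacobiFamily ε G Q) {t : ℝ}
    (ht : t ∈ Ioo (-ε) ε) (i j : Fin n) : symp (deriv (e i) t) (deriv (e j) t) = 0 := by
  have h1 := (hasDerivAt_symp (he.hasDerivAt_deriv i ht) (he.hasDerivAt j ht)).unique
    ((hasDerivAt_const t (if i = j then (1 : ℝ) else 0)).congr_of_eventuallyEq (by
      filter_upwards [isOpen_Ioo.mem_nhds ht] with s hs using he.orthonormal i j s hs))
  rwa [hG.isotropic ht (he.second i t ht) (he.mem j t ht), zero_add] at h1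

end IsOrthFrame

theorem symp_sub_left (u v w : E n × Dual n) : symp (u - v) w = symp u w - symp v w := by
  simp only [symp, Prod.fst_sub, Prod.snd_sub, sub_apply, map_sub]; ring

theorem symp_sub_right (u v w : E n × Dual n) : symp w (u - v) = symp w u - symp w v := by
  simp only [symp, Prod.fst_sub, Prod.snd_sub, sub_apply, map_sub]; ring

theorem symp_sum_left {ι : Type*} (s : Finset ι) (r : ι → ℝ) (v : ι → E n × Dual n)
    (w : E n × Dual n) : symp (∑ i ∈ s, r i • v i) w = ∑ i ∈ s, r i * symp (v i) w := by
  classical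
  induction s using Finset.induction_on with
  | empty => simp [symp]
  | insert a s ha ih =>
    rw [Finset.sum_insert ha, Finset.sum_insert ha, ← ih]
    simp only [symp, Prod.fst_add, Prod.snd_add, add_apply, map_add, Prod.smul_fst, Prod.smul_snd,
      smul_apply, map_smul, smul_eq_mul]
    ring

theorem symp_sum_right {ι : Type*} (s : Finset ι) (r : ι → ℝ) (v : ι → E n × Dual n)
    (w : E n × Dual n) : symp w (∑ i ∈ s, r i • v i) = ∑ i ∈ s, r i * symp w (v i) := by
  rw [symp_antisymm, symp_sum_left, ← Finset.sum_neg_distrib]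
  refine Finset.sum_congr rfl fun i _ => ?_
  rw [symp_antisymm w]; ring

/-- The operator `K' K⁻¹` of a Lagrangian graph in a canonical frame is symmetric: the vectors
`ė_i - ∑ B_ij e_j` are tangent to the graph. -/
theorem IsOrthFrame.symm_of_pairOp {ε : ℝ} {G : ℝ → (E n × Dual n) →L[ℝ] (E n × Dual n)}
    {Q : ℝ → Dual n →L[ℝ] E n} {e : Fin n → ℝ → E n × Dual n} (he : IsOrthFrame ε G e)
    (hG : IsJacobiFamily ε G Q) {S : E n →L[ℝ] Dual n} (hS : ∀ a b, S a b = S b a) {t : ℝ}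
    (ht : t ∈ Ioo (-ε) ε) {B : E n →L[ℝ] E n}
    (hB : (pairOp S fun i => deriv (e i) t) = B.comp (pairOp S fun i => e i t)) (i j : Fin n) :
    B (basisVec j) i = B (basisVec i) j := by
  set f : Fin n → E n × Dual n :=
    fun i => deriv (e i) t - ∑ j, B (basisVec j) i • e j t with hf
  have h1 : ∀ i x, symp (f i) (x, S x) = 0 := by
    intro i x
    have h2 := congrArg (fun A : E n →L[ℝ] E n => A x i) hB
    simp only [ContinuousLinearMap.comp_apply] at h2
    rw [pairOp_apply hS, ← sum_coord_smul_basisVec (pairOp S (fun i => e i t) x), map_sum] at h2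
    rw [hf, symp_sub_left, h2, symp_sum_left, sub_eq_zero]
    simp only [map_smul, pairOp_apply hS]
    simp [mul_comm]
  -- a vector `ω`-orthogonal to the graph of `S` lies in it, as the graph is Lagrangian
  have h2 : ∀ i x, (f i).2 x = S (f i).1 x := by
    intro i x
    have := h1 i x
    simp only [symp] at this
    rw [hS]
    linarith
  have h3 : symp (f i) (f j) = 0 := by
    rw [symp, h2, h2, hS, sub_self]
  rw [hf, symp_sub_left, symp_sub_right, symp_sub_right, symp_sum_left, symp_sum_right,
    symp_sum_right, he.symp_deriv_deriv hG ht] at h3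
  have h4 : ∀ k l, symp (e k t) (e l t) = 0 := fun k l =>
    hG.isotropic ht (he.mem k t ht) (he.mem l t ht)
  have h5 : ∀ k l, symp (e k t) (deriv (e l) t) = -(if l = k then 1 else 0) := fun k l => by
    rw [symp_antisymm, he.orthonormal l k t ht]
  have h6 : ∑ k, B (basisVec k) j * symp (∑ l, B (basisVec l) i • e l t) (e k t) = 0 :=
    Finset.sum_eq_zero fun k _ => by
      rw [symp_sum_left]; simp [h4]
  rw [h6] at h3
  simp [h5, he.orthonormal _ _ t ht] at h3
  linarith

/-- The density factors: in a canonical frame, `log det K = log det J + ½ log det Q⁻¹`. In matrices,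
`K = A J`, where the rows of `A` are the vertical parts of the frame; orthonormality says
`A Q Aᵀ = 1`, so that `det Q⁻¹ = (det A)²`. -/
theorem IsOrthFrame.log_det_pairOp {ε : ℝ} {G : ℝ → (E n × Dual n) →L[ℝ] (E n × Dual n)}
    {Q : ℝ → Dual n →L[ℝ] E n} {e : Fin n → ℝ → E n × Dual n} (he : IsOrthFrame ε G e)
    (hG : IsJacobiFamily ε G Q) {S : E n →L[ℝ] Dual n} (hS : ∀ a b, S a b = S b a) {t : ℝ}
    (ht : t ∈ Ioo (-ε) ε) {F : E n →L[ℝ] Dual n} (hF : ∀ b, F (Q t b) = b)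
    {J : E n →L[ℝ] E n} (hJ : ∀ x, J x = (G t (x, S x)).1) (hJ0 : J.det ≠ 0) :
    (pairOp S fun i => e i t).det ≠ 0 ∧
    Real.log (pairOp S fun i => e i t).det = Real.log J.det +
      Real.log (Matrix.of fun i j : Fin n => F (basisVec i) (basisVec j)).det / 2 := by
  set A : Matrix (Fin n) (Fin n) ℝ := Matrix.of fun i j => (G t (e i t)).2 (basisVec j) with hA
  set q : Matrix (Fin n) (Fin n) ℝ := Matrix.of fun i j => (Q t (basisCov j)) i with hq
  set f : Matrix (Fin n) (Fin n) ℝ := Matrix.of fun i j : Fin n => F (basisVec i) (basisVec j)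
  have h1 : opMat (pairOp S fun i => e i t) = A * opMat J := by
    ext i j
    have h2 : pairOp S (fun i => e i t) (basisVec j) i = (G t (e i t)).2 (J (basisVec j)) := by
      rw [pairOp_apply hS, ← hG.symp_map t ht, symp, he.mem i t ht, ← hJ]; simp
    simp only [opMat, Matrix.of_apply, Matrix.mul_apply, hA]
    rw [h2]
    conv_lhs => rw [← sum_coord_smul_basisVec (J (basisVec j)), map_sum]
    simp [mul_comm]
  have h2 : f.transpose * q = 1 := by
    ext i j
    have h3 : F (Q t (basisCov j)) (basisVec i) = (basisCov j : Dual n) (basisVec i) := by rw [hF]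
    rw [← sum_coord_smul_basisVec (Q t (basisCov j)), map_sum, sum_apply] at h3
    simp only [Matrix.mul_apply, Matrix.transpose_apply, f, q, Matrix.of_apply, Matrix.one_apply]
    simp only [map_smul, smul_apply, smul_eq_mul] at h3
    rw [Finset.sum_congr rfl (fun k _ => mul_comm _ _), h3]
    simp [basisCov, basisVec, eq_comm]
  have h3 : A * q * A.transpose = 1 := by
    ext i j
    have h4 := he.form hG ht j i
    have h5 : Q t (G t (e j t)).2 = ∑ l, (G t (e j t)).2 (basisVec l) • Q t (basisCov l) := by
      conv_lhs => rw [← sum_apply_smul_basisCov (G t (e j t)).2, map_sum]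
      simp
    have h6 : ∀ l, (G t (e i t)).2 (Q t (basisCov l)) = (A * q) i l := fun l => by
      conv_lhs => rw [← sum_coord_smul_basisVec (Q t (basisCov l)), map_sum]
      simp [Matrix.mul_apply, hA, hq, mul_comm]
    rw [h5, map_sum] at h4
    simp only [map_smul, h6, smul_eq_mul] at h4
    rw [Matrix.mul_apply, Matrix.one_apply]
    simp only [eq_comm (a := i)]
    rw [← h4]
    simp [hA, mul_comm]
  have d2 := congrArg Matrix.det h2
  have d3 := congrArg Matrix.det h3
  rw [Matrix.det_mul, Matrix.det_transpose, Matrix.det_one] at d2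
  rw [Matrix.det_mul, Matrix.det_mul, Matrix.det_transpose, Matrix.det_one] at d3
  have hA0 : A.det ≠ 0 := fun h => by rw [h] at d3; simp at d3
  have hq0 : q.det ≠ 0 := fun h => by rw [h] at d2; simp at d2
  have hf2 : f.det = A.det ^ 2 := by
    have : f.det * q.det = A.det ^ 2 * q.det := by rw [d2]; linear_combination -d3
    exact mul_right_cancel₀ hq0 this
  have hdet : (pairOp S fun i => e i t).det = A.det * J.det := by
    rw [det_eq_opMat, h1, Matrix.det_mul, det_eq_opMat]
  refine ⟨hdet ▸ mul_ne_zero hA0 hJ0, ?_⟩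
  rw [hdet, Real.log_mul hA0 hJ0, hf2, Real.log_pow]
  push_cast
  ring

/-- The Riccati inequality along the flow. Let `J` be the horizontal part of the differential of the
flow on the graph of the symmetric form `S`. The derivative `g` of `log det J + ½ log det Q⁻¹`
satisfies `g' = tr (ω(ė_i, ë_j)) - β` with `g² ≤ n β`: it is the trace of `B = K' K⁻¹`, where
`K'' = M K` at time `0` because the `ë_i` are combinations of the `e_j`, and `β = tr B²` with `B`
symmetric. -/
theorem IsOrthFrame.riccati {ε : ℝ} {G : ℝ → (E n × Dual n) →L[ℝ] (E n × Dual n)}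
    {Q : ℝ → Dual n →L[ℝ] E n} {e : Fin n → ℝ → E n × Dual n} (he : IsOrthFrame ε G e)
    (hG : IsJacobiFamily ε G Q) {S : E n →L[ℝ] Dual n} (hS : ∀ a b, S a b = S b a)
    {F : ℝ → E n →L[ℝ] Dual n} (hF : ∀ t ∈ Ioo (-ε) ε, ∀ b, F t (Q t b) = b)
    {J : ℝ → E n →L[ℝ] E n} (hJ : ∀ t x, J t x = (G t (x, S x)).1)
    (hJ0 : ∀ᶠ t in 𝓝 0, (J t).det ≠ 0) :
    ∃ (g : ℝ → ℝ) (β : ℝ), (∀ᶠ t in 𝓝 0, HasDerivAt (fun s => Real.log (J s).det +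
        Real.log (Matrix.of fun i j : Fin n => F s (basisVec i) (basisVec j)).det / 2) (g t) t) ∧
      HasDerivAt g (∑ i, symp (deriv (e i) 0) (deriv (deriv (e i)) 0) - β) 0 ∧
      g 0 ^ 2 ≤ n * β := by
  have hI : ∀ᶠ t in 𝓝 (0 : ℝ), t ∈ Ioo (-ε) ε :=
    isOpen_Ioo.eventually_mem (show (0 : ℝ) ∈ Ioo (-ε) ε from ⟨by linarith [hG.pos], hG.pos⟩)
  have h0 := hI.self_of_nhds
  set K : ℝ → E n →L[ℝ] E n := fun s => pairOp S fun i => e i s with hK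
  set K₁ : ℝ → E n →L[ℝ] E n := fun s => pairOp S fun i => deriv (e i) s with hK₁
  set M : E n →L[ℝ] E n := ∑ l, (∑ i, symp (deriv (e l) 0) (deriv (deriv (e i)) 0) •
    (basisCov l : Dual n).smulRight (basisVec i)) with hM
  have hlog : ∀ᶠ t in 𝓝 (0 : ℝ), (K t).det ≠ 0 ∧ Real.log (K t).det = Real.log (J t).det +
      Real.log (Matrix.of fun i j : Fin n => F t (basisVec i) (basisVec j)).det / 2 := by
    filter_upwards [hI, hJ0] with t ht hJt
    exact he.log_det_pairOp hG hS ht (hF t ht) (hJ t) hJt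
  have hMapp : ∀ v i, M v i = ∑ l, symp (deriv (e l) 0) (deriv (deriv (e i)) 0) * v l := by
    intro v i
    simp only [hM, sum_apply, smul_apply, ContinuousLinearMap.smulRight_apply,
      PiLp.smul_apply, WithLp.ofLp_sum, Finset.sum_apply, smul_eq_mul]
    refine Finset.sum_congr rfl fun l _ => ?_
    rw [Finset.sum_eq_single i]
    · simp [basisVec, basisCov]
    · intro j _ hj
      simp [basisVec, hj.symm]
    · simp
  have hbij : ∀ᶠ t in 𝓝 (0 : ℝ), Function.Bijective (K t) :=
    hlog.mono fun t ht => bijective_of_det_ne_zero ht.1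
  obtain ⟨r1, r2, r3⟩ := hasDerivAt_log_det_deriv (K := K) (K₁ := K₁)
    (K₂ := pairOp S fun i => deriv (deriv (e i)) 0) (M := M)
    (contDiffAt_pairOp fun i => (he.smooth i).contDiffAt (isOpen_Ioo.mem_nhds h0))
    (hI.mono fun t ht => hasDerivAt_pairOp fun i => he.hasDerivAt i ht)
    (hasDerivAt_pairOp fun i => he.hasDerivAt_deriv i h0)
    (by
      refine ContinuousLinearMap.ext fun x => ?_
      refine PiLp.ext fun i => ?_
      rw [ContinuousLinearMap.comp_apply, hMapp, pairOp_apply hS]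
      conv_lhs => rw [he.expansion hG h0 (he.second i 0 h0)]
      rw [symp_sum_left]
      simp only [hK, pairOp_apply hS]) hbij
  set B := (K₁ 0).comp (K 0).inverse with hB
  have hBK : K₁ 0 = B.comp (K 0) := by
    refine ContinuousLinearMap.ext fun x => ?_
    simp only [hB, ContinuousLinearMap.comp_apply]
    congr 1
    exact (hbij.self_of_nhds.1 (apply_clm_inverse hbij.self_of_nhds _)).symm
  have htr : opTr M = ∑ i, symp (deriv (e i) 0) (deriv (deriv (e i)) 0) := by
    refine Finset.sum_congr rfl fun i _ => ?_
    rw [hMapp]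
    simp [basisVec]
  refine ⟨_, opTr (B.comp B), ?_, htr ▸ r2, ?_⟩
  · have hl2 := hlog.eventually_nhds
    filter_upwards [r1, hl2] with t h1 h2
    refine h1.congr_of_eventuallyEq ?_
    filter_upwards [h2] with s hs using hs.2.symm
  · simp only
    rw [r3]
    exact sq_opTr_le (he.symm_of_pairOp hG hS h0 hBK)

end Riccati

/-! ### The linearized Hamiltonian flow in coordinates -/

section LinearizedFlow

variable {n : ℕ} {h : E n × Dual n → ℝ}

theorem contDiffAt_hamVec {p : E n × Dual n} (hh : ContDiffAt ℝ ∞ h p) :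
    ContDiffAt ℝ ∞ (hamVec h) p := by
  have h1 : ContDiffAt ℝ ∞ (fderiv ℝ h) p := hh.fderiv_right (m := ∞) (by exact_mod_cast le_rfl)
  have h2 : ∀ v, ContDiffAt ℝ ∞ (fun p => fderiv ℝ h p v) p :=
    fun v => h1.clm_apply contDiffAt_const
  exact (ContDiffAt.sum fun i _ => (h2 _).smul contDiffAt_const).prodMk
    (ContDiffAt.sum fun i _ => (h2 _).smul contDiffAt_const).neg

/-- The linearization `DX` of a Hamiltonian vector field is `ω`-dual to the Hessian of `h`; its
symmetry makes `DX` infinitesimally symplectic. -/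
theorem symp_fderiv_hamVec {p : E n × Dual n} (hh : ContDiffAt ℝ ∞ h p) (a b : E n × Dual n) :
    symp (fderiv ℝ (hamVec h) p a) b = -fderiv ℝ (fderiv ℝ h) p a b := by
  have h1 := ((contDiffAt_hamVec hh).differentiableAt (by simp)).hasFDerivAt
  have h2 := ((hh.fderiv_right (m := ∞) (by exact_mod_cast le_rfl)).differentiableAt
    (by simp)).hasFDerivAt
  set A : (E n × Dual n) →L[ℝ] ℝ := (ContinuousLinearMap.apply ℝ ℝ b.1).comp
    (ContinuousLinearMap.snd ℝ (E n) (Dual n)) -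
      b.2.comp (ContinuousLinearMap.fst ℝ (E n) (Dual n)) with hA
  have h3 : HasFDerivAt (fun q => A (hamVec h q)) (A.comp (fderiv ℝ (hamVec h) p)) p :=
    A.hasFDerivAt.comp p h1
  have h4 : HasFDerivAt (fun q => -fderiv ℝ h q b)
      (-((ContinuousLinearMap.apply ℝ ℝ b).comp (fderiv ℝ (fderiv ℝ h) p))) p :=
    ((ContinuousLinearMap.apply ℝ ℝ b).hasFDerivAt.comp p h2).neg
  have h5 : (fun q => A (hamVec h q)) = fun q => -fderiv ℝ h q b := by
    funext q
    exact symp_hamVec h q b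
  rw [h5] at h3
  exact congrArg (fun B : (E n × Dual n) →L[ℝ] ℝ => B a) (h3.unique h4)

theorem symp_fderiv_hamVec_symm {p : E n × Dual n} (hh : ContDiffAt ℝ ∞ h p)
    (a b : E n × Dual n) :
    symp (fderiv ℝ (hamVec h) p a) b = symp (fderiv ℝ (hamVec h) p b) a := by
  have hsymm : IsSymmSndFDerivAt ℝ h p := hh.isSymmSndFDerivAt (by
    rw [minSmoothness_of_isRCLikeNormedField]
    exact WithTop.coe_le_coe.2 (le_top (a := (2 : ℕ∞))))
  rw [symp_fderiv_hamVec hh, symp_fderiv_hamVec hh, hsymm a b]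

/-- `φ` is the flow of the Hamiltonian vector field of `h`, in a neighbourhood of the integral curve
`s ↦ φ (s, p₀)`, `|s| < ε`. -/
structure IsHamFlow (h : E n × Dual n → ℝ) (φ : ℝ × (E n × Dual n) → E n × Dual n)
    (p₀ : E n × Dual n) (ε : ℝ) : Prop where
  pos : 0 < ε
  smooth : ∀ s ∈ Ioo (-ε) ε, ContDiffAt ℝ ∞ φ (s, p₀)
  hamEq : ∀ s ∈ Ioo (-ε) ε, ∀ᶠ r in 𝓝 (s, p₀),
    HasDerivAt (fun τ => φ (τ, r.2)) (hamVec h (φ r)) r.1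
  zero : ∀ᶠ p in 𝓝 p₀, φ (0, p) = p
  ham : ∀ s ∈ Ioo (-ε) ε, ContDiffAt ℝ ∞ h (φ (s, p₀))

/-- The differential at `p₀` of the flow at time `s`. -/
def flowDiff (φ : ℝ × (E n × Dual n) → E n × Dual n) (p₀ : E n × Dual n) (s : ℝ) :
    (E n × Dual n) →L[ℝ] (E n × Dual n) :=
  (fderiv ℝ φ (s, p₀)).comp (ContinuousLinearMap.inr ℝ ℝ (E n × Dual n))

/-- The fibrewise Hessian of `h` along the integral curve. -/
def vertForm (h : E n × Dual n → ℝ) (φ : ℝ × (E n × Dual n) → E n × Dual n) (p₀ : E n × Dual n)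
    (s : ℝ) : Dual n →L[ℝ] E n :=
  (ContinuousLinearMap.fst ℝ (E n) (Dual n)).comp ((fderiv ℝ (hamVec h) (φ (s, p₀))).comp
    (ContinuousLinearMap.inr ℝ (E n) (Dual n)))

namespace IsHamFlow

variable {φ : ℝ × (E n × Dual n) → E n × Dual n} {p₀ : E n × Dual n} {ε : ℝ}
  (hφ : IsHamFlow h φ p₀ ε)
include hφ

theorem hasFDerivAt_flow {s : ℝ} (hs : s ∈ Ioo (-ε) ε) :
    HasFDerivAt (fun p => φ (s, p)) (flowDiff φ p₀ s) p₀ :=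
  HasFDerivAt.comp p₀ (g := φ) (((hφ.smooth s hs).differentiableAt (by simp)).hasFDerivAt)
    (hasFDerivAt_prodMk_right s p₀)

theorem flow_zero : φ (0, p₀) = p₀ := hφ.zero.self_of_nhds

theorem hasDerivAt_curve {s : ℝ} (hs : s ∈ Ioo (-ε) ε) :
    HasDerivAt (fun τ => φ (τ, p₀)) (hamVec h (φ (s, p₀))) s :=
  (hφ.hamEq s hs).self_of_nhds

theorem contDiffAt_flowDiff {s : ℝ} (hs : s ∈ Ioo (-ε) ε) :
    ContDiffAt ℝ ∞ (flowDiff φ p₀) s := by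
  have h1 : ContDiffAt ℝ ∞ (fderiv ℝ φ) (s, p₀) :=
    (hφ.smooth s hs).fderiv_right (m := ∞) (by exact_mod_cast le_rfl)
  exact ContDiffAt.clm_comp (ContDiffAt.comp s (f := fun τ : ℝ => (τ, p₀)) h1
    (contDiffAt_id.prodMk contDiffAt_const)) contDiffAt_const

/-- The linearized equation `G' = DX(φ) G`. -/
theorem hasDerivAt_flowDiff {s : ℝ} (hs : s ∈ Ioo (-ε) ε) :
    HasDerivAt (flowDiff φ p₀) ((fderiv ℝ (hamVec h) (φ (s, p₀))).comp (flowDiff φ p₀ s)) s := by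
  have hd := ((hφ.contDiffAt_flowDiff hs).differentiableAt (by simp)).hasDerivAt
  refine hd.congr_deriv (ContinuousLinearMap.ext fun v => ?_)
  have hD := (((hφ.smooth s hs).fderiv_right (m := ∞) (by exact_mod_cast le_rfl)).differentiableAt
    (by simp)).hasFDerivAt
  have hsymm : IsSymmSndFDerivAt ℝ φ (s, p₀) := (hφ.smooth s hs).isSymmSndFDerivAt (by
    rw [minSmoothness_of_isRCLikeNormedField]
    exact WithTop.coe_le_coe.2 (le_top (a := (2 : ℕ∞))))
  -- the time derivative of the space derivative is the space derivative of the time derivative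
  have h1 : deriv (flowDiff φ p₀) s v = fderiv ℝ (fderiv ℝ φ) (s, p₀) (1, 0) (0, v) := by
    have a1 : HasDerivAt (fun τ => flowDiff φ p₀ τ v) (deriv (flowDiff φ p₀) s v) s := by
      simpa using hd.clm_apply (hasDerivAt_const s v)
    have a2 : HasDerivAt (fun τ : ℝ => fderiv ℝ φ (τ, p₀))
        (fderiv ℝ (fderiv ℝ φ) (s, p₀) (1, 0)) s :=
      HasFDerivAt.comp_hasDerivAt s (f := fun τ : ℝ => (τ, p₀)) hD
        ((hasDerivAt_id s).prodMk (hasDerivAt_const s p₀))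
    have a3 : HasDerivAt (fun τ : ℝ => fderiv ℝ φ (τ, p₀) (0, v))
        (fderiv ℝ (fderiv ℝ φ) (s, p₀) (1, 0) (0, v)) s := by
      simpa using a2.clm_apply (hasDerivAt_const s ((0 : ℝ), v))
    exact a1.unique a3
  have h2 : fderiv ℝ (fderiv ℝ φ) (s, p₀) (0, v) (1, 0) =
      fderiv ℝ (hamVec h) (φ (s, p₀)) (fderiv ℝ φ (s, p₀) (0, v)) := by
    have a1 : HasFDerivAt (fun r => fderiv ℝ φ r ((1 : ℝ), (0 : E n × Dual n)))
        ((ContinuousLinearMap.apply ℝ _ ((1 : ℝ), (0 : E n × Dual n))).comp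
          (fderiv ℝ (fderiv ℝ φ) (s, p₀))) (s, p₀) :=
      HasFDerivAt.comp (s, p₀) (g := ContinuousLinearMap.apply ℝ (E n × Dual n)
        ((1 : ℝ), (0 : E n × Dual n))) (f := fderiv ℝ φ) (ContinuousLinearMap.hasFDerivAt _) hD
    have a2 : (fun r => fderiv ℝ φ r ((1 : ℝ), (0 : E n × Dual n))) =ᶠ[𝓝 (s, p₀)]
        fun r => hamVec h (φ r) := by
      filter_upwards [hφ.hamEq s hs, ((hφ.smooth s hs).of_le
        (WithTop.coe_le_coe.2 (le_top (a := (1 : ℕ∞))))).eventually (by simp)] with r b1 b2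
      have b3 : HasDerivAt (fun τ => φ (τ, r.2)) (fderiv ℝ φ r (1, 0)) r.1 :=
        HasFDerivAt.comp_hasDerivAt r.1 (f := fun τ : ℝ => (τ, r.2))
          (b2.differentiableAt (by simp)).hasFDerivAt
          ((hasDerivAt_id r.1).prodMk (hasDerivAt_const r.1 r.2))
      exact b3.unique b1
    have a3 : HasFDerivAt (fun r => hamVec h (φ r))
        ((fderiv ℝ (hamVec h) (φ (s, p₀))).comp (fderiv ℝ φ (s, p₀))) (s, p₀) :=
      HasFDerivAt.comp (s, p₀) (((contDiffAt_hamVec (hφ.ham s hs)).differentiableAt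
        (by simp)).hasFDerivAt) ((hφ.smooth s hs).differentiableAt (by simp)).hasFDerivAt
    exact congrArg (fun B : (ℝ × (E n × Dual n)) →L[ℝ] (E n × Dual n) => B (0, v))
      ((a1.congr_of_eventuallyEq a2.symm).unique a3)
  rw [h1, hsymm, h2]
  rfl

theorem deriv_flowDiff {s : ℝ} (hs : s ∈ Ioo (-ε) ε) :
    deriv (flowDiff φ p₀) s = (fderiv ℝ (hamVec h) (φ (s, p₀))).comp (flowDiff φ p₀ s) :=
  HasDerivAt.unique (((hφ.contDiffAt_flowDiff hs).differentiableAt (by simp)).hasDerivAt)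
    (hφ.hasDerivAt_flowDiff hs)

theorem flowDiff_zero : flowDiff φ p₀ 0 = ContinuousLinearMap.id ℝ _ :=
  (hφ.hasFDerivAt_flow ⟨by linarith [hφ.pos], hφ.pos⟩).unique
    ((hasFDerivAt_id p₀).congr_of_eventuallyEq hφ.zero)

/-- The flow is symplectic: `ω(G v, G w)` has zero derivative by the linearized equation. -/
theorem symp_flowDiff {s : ℝ} (hs : s ∈ Ioo (-ε) ε) (v w : E n × Dual n) :
    symp (flowDiff φ p₀ s v) (flowDiff φ p₀ s w) = symp v w := by
  have hd : ∀ t ∈ Ioo (-ε) ε, HasDerivAt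
      (fun τ => symp (flowDiff φ p₀ τ v) (flowDiff φ p₀ τ w)) 0 t := by
    intro t ht
    have h1 : ∀ v, HasDerivAt (fun τ => flowDiff φ p₀ τ v)
        (fderiv ℝ (hamVec h) (φ (t, p₀)) (flowDiff φ p₀ t v)) t := fun v => by
      simpa using (hφ.hasDerivAt_flowDiff ht).clm_apply (hasDerivAt_const t v)
    refine (hasDerivAt_symp (h1 v) (h1 w)).congr_deriv ?_
    rw [symp_fderiv_hamVec_symm (hφ.ham t ht), symp_antisymm (flowDiff φ p₀ t v)]
    ring
  have h2 := isOpen_Ioo.is_const_of_deriv_eq_zero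
    (f := fun τ => symp (flowDiff φ p₀ τ v) (flowDiff φ p₀ τ w)) isPreconnected_Ioo
    (fun t ht => (hd t ht).differentiableAt.differentiableWithinAt)
    (fun t ht => (hd t ht).deriv) hs (show (0 : ℝ) ∈ Ioo (-ε) ε from ⟨by linarith [hφ.pos], hφ.pos⟩)
  rw [h2, hφ.flowDiff_zero]
  rfl

theorem isJacobiFamily
    (hpos : ∀ s ∈ Ioo (-ε) ε, ∀ a : Dual n, a ≠ 0 → 0 < a (vertForm h φ p₀ s a)) :
    IsJacobiFamily ε (flowDiff φ p₀) (vertForm h φ p₀) where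
  pos := hφ.pos
  contDiffOn s hs := (hφ.contDiffAt_flowDiff hs).contDiffWithinAt
  symp_map s hs := hφ.symp_flowDiff hs
  zero := hφ.flowDiff_zero
  deriv_fst s hs w hw := by
    have h1 : flowDiff φ p₀ s w = (0, (flowDiff φ p₀ s w).2) := Prod.ext hw rfl
    rw [hφ.deriv_flowDiff hs, ContinuousLinearMap.comp_apply, h1]
    rfl
  symm s hs a b := by
    have h1 := symp_fderiv_hamVec_symm (hφ.ham s hs) (0, a) (0, b)
    simp only [symp, map_zero, zero_sub] at h1
    exact (neg_injective h1).symm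
  posDef := hpos

end IsHamFlow

/-- The differential of the flow maps an invariant graph `ξ = θ(y)` along itself, and its horizontal
part `J` solves `J' = DV J`, where `V` is the horizontal part of the Hamiltonian vector field on
the graph. -/
theorem IsHamFlow.hasDerivAt_graph {φ : ℝ × (E n × Dual n) → E n × Dual n} {y₀ : E n}
    {θ : E n → Dual n} {ε : ℝ} (hφ : IsHamFlow h φ (y₀, θ y₀) ε) (hθ : ContDiffAt ℝ ∞ θ y₀)
    (hinv : ∀ᶠ r : ℝ × E n in 𝓝 (0, y₀),
      (φ (r.1, (r.2, θ r.2))).2 = θ (φ (r.1, (r.2, θ r.2))).1) :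
    ∀ᶠ s in 𝓝 (0 : ℝ), s ∈ Ioo (-ε) ε ∧ φ (s, (y₀, θ y₀)) = ((φ (s, (y₀, θ y₀))).1,
        θ (φ (s, (y₀, θ y₀))).1) ∧ ContDiffAt ℝ 1 θ (φ (s, (y₀, θ y₀))).1 ∧
      HasDerivAt (fun s => (ContinuousLinearMap.fst ℝ (E n) (Dual n)).comp
          ((flowDiff φ (y₀, θ y₀) s).comp ((ContinuousLinearMap.id ℝ (E n)).prod (fderiv ℝ θ y₀))))
        ((fderiv ℝ (fun y => (hamVec h (y, θ y)).1) (φ (s, (y₀, θ y₀))).1).comp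
          ((ContinuousLinearMap.fst ℝ (E n) (Dual n)).comp ((flowDiff φ (y₀, θ y₀) s).comp
            ((ContinuousLinearMap.id ℝ (E n)).prod (fderiv ℝ θ y₀))))) s := by
  set p₀ : E n × Dual n := (y₀, θ y₀) with hp₀
  have h0 : (0 : ℝ) ∈ Ioo (-ε) ε := ⟨by linarith [hφ.pos], hφ.pos⟩
  have hc : ContinuousAt (fun s : ℝ => (φ (s, p₀)).1) 0 :=
    continuousAt_fst.comp (hφ.hasDerivAt_curve h0).continuousAt
  have hc0 : (φ (0, p₀)).1 = y₀ := by rw [hφ.flow_zero]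
  have hθ1 : ContDiffAt ℝ 1 θ y₀ := hθ.of_le (WithTop.coe_le_coe.2 (le_top (a := (1 : ℕ∞))))
  have hθ' : ∀ᶠ s in 𝓝 (0 : ℝ), ContDiffAt ℝ 1 θ (φ (s, p₀)).1 := by
    have h1 : ∀ᶠ y in 𝓝 (φ (0, p₀)).1, ContDiffAt ℝ 1 θ y := by
      rw [hc0]
      exact hθ1.eventually (by simp)
    exact hc.eventually h1
  filter_upwards [isOpen_Ioo.eventually_mem h0, hθ', hinv.curry_nhds] with s hs hθs hi
  have hi0 := hi.self_of_nhds
  set ys := (φ (s, p₀)).1 with hys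
  have hp : φ (s, p₀) = (ys, θ ys) := Prod.ext rfl hi0
  refine ⟨hs, hp, hθs, ?_⟩
  set Γ : E n → E n × Dual n := fun y => (y, θ y) with hΓ
  have hΓd : ∀ {y}, ContDiffAt ℝ 1 θ y →
      HasFDerivAt Γ ((ContinuousLinearMap.id ℝ (E n)).prod (fderiv ℝ θ y)) y := fun hy =>
    (hasFDerivAt_id _).prodMk (hy.differentiableAt (by simp)).hasFDerivAt
  set J := (ContinuousLinearMap.fst ℝ (E n) (Dual n)).comp ((flowDiff φ p₀ s).comp
    ((ContinuousLinearMap.id ℝ (E n)).prod (fderiv ℝ θ y₀))) with hJ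
  have hflow : HasFDerivAt (fun y => φ (s, Γ y))
      ((flowDiff φ p₀ s).comp ((ContinuousLinearMap.id ℝ (E n)).prod (fderiv ℝ θ y₀))) y₀ :=
    HasFDerivAt.comp y₀ (g := fun p => φ (s, p)) (f := Γ) (hφ.hasFDerivAt_flow hs) (hΓd hθ1)
  have hY : HasFDerivAt (fun y => (φ (s, Γ y)).1) J y₀ := hflow.fst
  have hΓY : HasFDerivAt (fun y => Γ (φ (s, Γ y)).1)
      (((ContinuousLinearMap.id ℝ (E n)).prod (fderiv ℝ θ ys)).comp J) y₀ :=
    HasFDerivAt.comp y₀ (g := Γ) (f := fun y => (φ (s, Γ y)).1) (hΓd hθs) hY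
  -- by invariance, the differential of the flow maps tangent vectors of the graph to such vectors
  have hkey : (flowDiff φ p₀ s).comp ((ContinuousLinearMap.id ℝ (E n)).prod (fderiv ℝ θ y₀)) =
      ((ContinuousLinearMap.id ℝ (E n)).prod (fderiv ℝ θ ys)).comp J := by
    refine hflow.unique (hΓY.congr_of_eventuallyEq ?_)
    filter_upwards [hi] with y hy
    exact Prod.ext rfl hy
  have hX := ((contDiffAt_hamVec (hφ.ham s hs)).differentiableAt (by simp)).hasFDerivAt
  have hV : HasFDerivAt (fun y => (hamVec h (y, θ y)).1)
      ((ContinuousLinearMap.fst ℝ (E n) (Dual n)).comp ((fderiv ℝ (hamVec h) (φ (s, p₀))).comp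
        ((ContinuousLinearMap.id ℝ (E n)).prod (fderiv ℝ θ ys)))) ys := by
    rw [hp] at hX ⊢
    exact (HasFDerivAt.comp ys (g := hamVec h) (f := Γ) hX (hΓd hθs)).fst
  rw [hV.fderiv]
  have h1 := (hasDerivAt_const s (ContinuousLinearMap.fst ℝ (E n) (Dual n))).clm_comp
    ((hφ.hasDerivAt_flowDiff hs).clm_comp (hasDerivAt_const s
      ((ContinuousLinearMap.id ℝ (E n)).prod (fderiv ℝ θ y₀))))
  refine h1.congr_deriv ?_
  simp only [ContinuousLinearMap.comp_zero, ContinuousLinearMap.zero_comp, add_zero, zero_add]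
  rw [ContinuousLinearMap.comp_assoc, hkey]
  rfl

end LinearizedFlow

/-! ### The Ricci curvature in coordinates -/

section Ricci

variable {n : ℕ} {M : Type*} [TopologicalSpace M] [ChartedSpace (E n) M]
  [IsManifold 𝓘(ℝ, E n) ∞ M] {L : TangentBundle 𝓘(ℝ, E n) M → ℝ}

/-- The Hamiltonian flow in the bundle chart over the preferred chart at `x₀`. -/
def cotFlow (L : TangentBundle 𝓘(ℝ, E n) M → ℝ) (x₀ : M) (r : ℝ × (E n × Dual n)) : E n × Dual n :=
  toCot x₀ (flow (hamiltonian L) r.1 (ofCot x₀ r.2))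

/-- The fibrewise Hessian of the Lagrangian at the Legendre transform of a covector, in
coordinates. -/
def legHess (L : TangentBundle 𝓘(ℝ, E n) M → ℝ) (x₀ : M) (p : E n × Dual n) : E n →L[ℝ] Dual n :=
  fderiv ℝ (fderiv ℝ fun v => locL L x₀ (p.1, v)) (famT (locL L x₀) p)

/-- The conditions under which the flow along the integral curve of `q₀`, for times in `(-ε, ε)`, is
computed in the preferred chart at `x₀`. -/
structure IsCotFlow (L : TangentBundle 𝓘(ℝ, E n) M → ℝ) (x₀ : M) (q₀ : CotangentBundle n M)
    (ε : ℝ) : Prop where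
  isHamFlow : IsHamFlow (locH (hamiltonian L) x₀) (cotFlow L x₀) (toCot x₀ q₀) ε
  mem_source : ∀ s ∈ Ioo (-ε) ε, (flow (hamiltonian L) s q₀).proj ∈ (chartAt (E n) x₀).source
  ne_zero : ∀ s ∈ Ioo (-ε) ε, ccoord (flow (hamiltonian L) s q₀) ≠ 0
  smoothAt : ∀ s ∈ Ioo (-ε) ε, FlowSmoothAt (hamiltonian L) ∞ s q₀

theorem contDiffAt_cotFlow {x₀ : M} {q₀ : CotangentBundle n M}
    (h₀ : q₀.proj ∈ (chartAt (E n) x₀).source) {s : ℝ}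
    (hs : (flow (hamiltonian L) s q₀).proj ∈ (chartAt (E n) x₀).source)
    (hsm : FlowSmoothAt (hamiltonian L) ∞ s q₀) :
    ContDiffAt ℝ ∞ (cotFlow L x₀) (s, toCot x₀ q₀) := by
  have ht : (toCot x₀ q₀).1 ∈ (chartAt (E n) x₀).target := (chartAt (E n) x₀).map_source h₀
  have hq : ofCot x₀ (toCot x₀ q₀) = q₀ := ofCot_toCot h₀
  have h1 : ContMDiffAt 𝓘(ℝ, ℝ × (E n × Dual n)) (𝓘(ℝ, ℝ).prod (cotModel n)) ∞
      (fun r : ℝ × (E n × Dual n) => (r.1, (ofCot x₀ r.2 : CotangentBundle n M)))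
        (s, toCot x₀ q₀) :=
    (contDiffAt_fst.contMDiffAt).prodMk (ContMDiffAt.comp (s, toCot x₀ q₀)
      (g := (ofCot x₀ : E n × Dual n → CotangentBundle n M)) (f := Prod.snd)
      (contMDiffAt_ofCot ht) contDiffAt_snd.contMDiffAt)
  have h2 : ContMDiffAt (𝓘(ℝ, ℝ).prod (cotModel n)) (cotModel n) ∞
      (fun p : ℝ × CotangentBundle n M => flow (hamiltonian L) p.1 p.2)
      (s, ofCot x₀ (toCot x₀ q₀)) := by rw [hq]; exact hsm
  have h3 : ContMDiffAt (cotModel n) 𝓘(ℝ, E n × Dual n) ∞ (toCot x₀)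
      (flow (hamiltonian L) s (ofCot x₀ (toCot x₀ q₀))) := by rw [hq]; exact contMDiffAt_toCot hs
  exact contMDiffAt_iff_contDiffAt.1 (ContMDiffAt.comp (s, toCot x₀ q₀) (g := toCot x₀)
    (f := fun r : ℝ × (E n × Dual n) => flow (hamiltonian L) r.1 (ofCot x₀ r.2)) h3
    (ContMDiffAt.comp (s, toCot x₀ q₀)
      (g := fun p : ℝ × CotangentBundle n M => flow (hamiltonian L) p.1 p.2)
      (f := fun r : ℝ × (E n × Dual n) => (r.1, ofCot x₀ r.2)) h2 h1))

/-- For small times the flow line of a nonzero covector stays in the chart, with all the smoothness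
needed. -/
theorem exists_isCotFlow (hL : IsLagrangian L) [T2Space M]
    (hc : ForwardComplete (hamiltonian L)) {x₀ : M} {q₀ : CotangentBundle n M}
    (h₀ : q₀.proj ∈ (chartAt (E n) x₀).source) (h0 : ccoord q₀ ≠ 0) :
    ∃ ε > 0, IsCotFlow L x₀ q₀ ε := by
  obtain ⟨ε₀, hε₀, hev⟩ := exists_hasFlow hL hc h0
  set p₀ := toCot x₀ q₀ with hp₀
  have hq : ofCot x₀ p₀ = q₀ := ofCot_toCot h₀
  have ht : p₀.1 ∈ (chartAt (E n) x₀).target := (chartAt (E n) x₀).map_source h₀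
  have hof : ContinuousAt (ofCot x₀ : E n × Dual n → CotangentBundle n M) p₀ :=
    (contMDiffAt_ofCot ht).continuousAt
  have hev' : ∀ᶠ r : ℝ × (E n × Dual n) in 𝓝 (0, p₀), HasFlow (hamiltonian L) ε₀ (ofCot x₀ r.2) ∧
      ∀ t, -ε₀ < t → FlowSmoothAt (hamiltonian L) ∞ t (ofCot x₀ r.2) :=
    (hof.comp (x := ((0 : ℝ), p₀)) continuousAt_snd).eventually (hq ▸ hev)
  have hsrc : ∀ᶠ r : ℝ × (E n × Dual n) in 𝓝 (0, p₀),
      (flow (hamiltonian L) r.1 (ofCot x₀ r.2)).proj ∈ (chartAt (E n) x₀).source := by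
    have h1 : ContinuousAt (fun p : ℝ × CotangentBundle n M => flow (hamiltonian L) p.1 p.2)
        (0, ofCot x₀ p₀) := by
      rw [hq]
      exact (hev.self_of_nhds.2 0 (by linarith)).continuousAt
    have h2 : ContinuousAt (fun r : ℝ × (E n × Dual n) =>
        flow (hamiltonian L) r.1 (ofCot x₀ r.2)) (0, p₀) :=
      ContinuousAt.comp (x := ((0 : ℝ), p₀))
        (f := fun r : ℝ × (E n × Dual n) => (r.1, ofCot x₀ r.2)) h1
        (continuousAt_fst.prodMk (ContinuousAt.comp (x := ((0 : ℝ), p₀))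
          (g := (ofCot x₀ : E n × Dual n → CotangentBundle n M)) (f := Prod.snd) hof
          continuousAt_snd))
    have h3 : flow (hamiltonian L) 0 (ofCot x₀ p₀) ∈
        (Bundle.TotalSpace.proj ⁻¹' (chartAt (E n) x₀).source : Set (CotangentBundle n M)) := by
      rw [hq, flow_zero]
      exact h₀
    exact h2.eventually ((isOpen_cot_source x₀).eventually_mem h3)
  have htgt : ∀ᶠ r : ℝ × (E n × Dual n) in 𝓝 (0, p₀), r.2.1 ∈ (chartAt (E n) x₀).target :=
    (continuous_fst.comp continuous_snd).continuousAt.eventually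
      ((chartAt (E n) x₀).open_target.eventually_mem ht)
  have hpos : ∀ᶠ r : ℝ × (E n × Dual n) in 𝓝 (0, p₀), -ε₀ < r.1 :=
    continuousAt_fst.eventually (lt_mem_nhds (by simpa using hε₀))
  have hall := (((hev'.and hsrc).and htgt).and hpos).eventually_nhds
  have hall' : ∀ᶠ s : ℝ in 𝓝 0, ∀ᶠ r : ℝ × (E n × Dual n) in 𝓝 (s, p₀),
      (((HasFlow (hamiltonian L) ε₀ (ofCot x₀ r.2) ∧
      ∀ t, -ε₀ < t → FlowSmoothAt (hamiltonian L) ∞ t (ofCot x₀ r.2)) ∧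
      (flow (hamiltonian L) r.1 (ofCot x₀ r.2)).proj ∈ (chartAt (E n) x₀).source) ∧
      r.2.1 ∈ (chartAt (E n) x₀).target) ∧ -ε₀ < r.1 :=
    (Continuous.prodMk continuous_id continuous_const).continuousAt.eventually
      (f := fun s : ℝ => (s, p₀)) hall
  obtain ⟨ε, hε, hball⟩ := Metric.eventually_nhds_iff.1 hall'
  have hmem : ∀ s ∈ Ioo (-ε) ε, dist s 0 < ε := fun s hs => by
    rw [Real.dist_eq, sub_zero, abs_lt]; exact hs
  have hsm : ∀ s ∈ Ioo (-ε) ε, FlowSmoothAt (hamiltonian L) ∞ s q₀ := fun s hs => by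
    have := (hball (hmem s hs)).self_of_nhds
    rw [← hq]
    exact this.1.1.1.2 s this.2
  have hso : ∀ s ∈ Ioo (-ε) ε, (flow (hamiltonian L) s q₀).proj ∈ (chartAt (E n) x₀).source :=
    fun s hs => by
      have := (hball (hmem s hs)).self_of_nhds.1.1.2
      rwa [hq] at this
  have hne : ∀ s ∈ Ioo (-ε) ε, ccoord (flow (hamiltonian L) s q₀) ≠ 0 := fun s hs => by
    have := (hball (hmem s hs)).self_of_nhds
    have h1 := this.1.1.1.1.ccoord_flow_ne_zero hL this.2
    rwa [hq] at h1
  refine ⟨ε, hε, ⟨hε, fun s hs => contDiffAt_cotFlow h₀ (hso s hs) (hsm s hs), fun s hs => ?_, ?_,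
    fun s hs => ?_⟩, hso, hne, hsm⟩
  · filter_upwards [hball (hmem s hs)] with r hr
    exact HamAt.hasDerivAt_toCot hL (hr.1.1.1.1.hamAt r.1 hr.2) hr.1.1.2
  · filter_upwards [continuousAt_fst.eventually
      ((chartAt (E n) x₀).open_target.eventually_mem ht)] with p hp
    rw [cotFlow, flow_zero]
    exact toCot_ofCot hp
  · have h1 : cotFlow L x₀ (s, p₀) = toCot x₀ (flow (hamiltonian L) s q₀) := by
      rw [cotFlow, hq]
    rw [h1]
    exact hL.contDiffAt_locH ((chartAt (E n) x₀).map_source (hso s hs))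
      (fun h => hne s hs ((toCot_snd_eq_zero_iff (hso s hs)).1 h))

/-- The fibrewise Hessians of `L` and `H` at corresponding points are inverse to each other. -/
theorem IsLagrangian.legHess_fderiv_famT (hL : IsLagrangian L) {x₀ : M} {p : E n × Dual n}
    (hp : p.1 ∈ (chartAt (E n) x₀).target) (hξ : p.2 ≠ 0) (b : Dual n) :
    legHess L x₀ p (fderiv ℝ (hamVec (locH (hamiltonian L) x₀)) p (0, b)).1 = b := by
  have h1 : (fun p => (hamVec (locH (hamiltonian L) x₀) p).1) =ᶠ[𝓝 p] famT (locL L x₀) := by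
    filter_upwards [continuousAt_fst.eventually
      ((chartAt (E n) x₀).open_target.eventually_mem hp),
      continuousAt_snd.eventually (isOpen_ne.eventually_mem hξ)] with r h1 h2
    exact hL.hamVec_locH_fst h1 h2
  have h2 := (((hL.contDiffAt_hamVec hp hξ).differentiableAt
    (by simp)).hasFDerivAt).fst
  have h3 := h2.congr_of_eventuallyEq h1.symm
  have h4 := congrArg (fun A : (E n × Dual n) →L[ℝ] E n => A (0, b)) h3.fderiv
  have h5 := (hL.isFamilyLagrangian x₀).hess_comp_fderiv_famT hp hξ b
  rw [h4] at h5
  exact h5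

theorem IsLagrangian.legHess_pos (hL : IsLagrangian L) {x₀ : M} {p : E n × Dual n}
    (hp : p.1 ∈ (chartAt (E n) x₀).target) (hξ : p.2 ≠ 0) {w : E n} (hw : w ≠ 0) :
    0 < legHess L x₀ p w w :=
  ((hL.isFamilyLagrangian x₀).fibre p.1 hp).convex _
    (((hL.isFamilyLagrangian x₀).fibre p.1 hp).legT_ne_zero hξ) w hw

/-- A vector in the kernel of the Hessian matrix would contradict positive definiteness. -/
theorem det_hessMat_ne_zero {g : E n → ℝ} (hg : IsFibreLagrangian g) {w : E n} (hw : w ≠ 0) :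
    (hessMat g w).det ≠ 0 := by
  intro h
  obtain ⟨v, hv, hv0⟩ := Matrix.exists_mulVec_eq_zero_iff.2 h
  set a : E n := ∑ i, v i • (basisVec i : E n) with ha
  have hai : ∀ i, a i = v i := by
    intro i
    simp [ha, basisVec, Pi.single_apply]
  have ha0 : a ≠ 0 := fun h0 => hv (funext fun i => by rw [← hai i, h0]; rfl)
  have h1 : ∀ i, fderiv ℝ (fderiv ℝ g) w (basisVec i) a = 0 := by
    intro i
    have h2 := congrFun hv0 i
    rw [ha, map_sum]
    simp only [Matrix.mulVec, dotProduct, hessMat, Matrix.of_apply, Pi.zero_apply] at h2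
    simpa [mul_comm] using h2
  have h2 := hg.convex w hw a ha0
  have h3 : fderiv ℝ (fderiv ℝ g) w a a = ∑ i, v i • fderiv ℝ (fderiv ℝ g) w (basisVec i) a := by
    have h4 : ∀ b : E n, fderiv ℝ (fderiv ℝ g) w (∑ i, v i • (basisVec i : E n)) b =
        ∑ i, v i • fderiv ℝ (fderiv ℝ g) w (basisVec i) b := fun b => by
      rw [map_sum, sum_apply]; simp
    exact h4 a
  rw [h3] at h2
  simp [h1] at h2

namespace IsCotFlow

variable {x₀ : M} {q₀ : CotangentBundle n M} {ε : ℝ} (hF : IsCotFlow L x₀ q₀ ε)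
  (h₀ : q₀.proj ∈ (chartAt (E n) x₀).source)
include hF

theorem pos : 0 < ε := hF.isHamFlow.pos

include h₀ in
theorem cotFlow_eq (s : ℝ) :
    cotFlow L x₀ (s, toCot x₀ q₀) = toCot x₀ (flow (hamiltonian L) s q₀) := by
  rw [cotFlow, ofCot_toCot h₀]

include h₀ in
theorem fst_mem {s : ℝ} (hs : s ∈ Ioo (-ε) ε) :
    (cotFlow L x₀ (s, toCot x₀ q₀)).1 ∈ (chartAt (E n) x₀).target := by
  rw [hF.cotFlow_eq h₀]
  exact (chartAt (E n) x₀).map_source (hF.mem_source s hs)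

include h₀ in
theorem snd_ne_zero {s : ℝ} (hs : s ∈ Ioo (-ε) ε) : (cotFlow L x₀ (s, toCot x₀ q₀)).2 ≠ 0 := by
  rw [hF.cotFlow_eq h₀]
  exact fun h => hF.ne_zero s hs ((toCot_snd_eq_zero_iff (hF.mem_source s hs)).1 h)

include h₀ in
theorem legHess_vertForm (hL : IsLagrangian L) {s : ℝ} (hs : s ∈ Ioo (-ε) ε) (b : Dual n) :
    legHess L x₀ (cotFlow L x₀ (s, toCot x₀ q₀))
      (vertForm (locH (hamiltonian L) x₀) (cotFlow L x₀) (toCot x₀ q₀) s b) = b :=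
  hL.legHess_fderiv_famT (hF.fst_mem h₀ hs) (hF.snd_ne_zero h₀ hs) b

include h₀ in
theorem isJacobiFamily (hL : IsLagrangian L) :
    IsJacobiFamily ε (flowDiff (cotFlow L x₀) (toCot x₀ q₀))
      (vertForm (locH (hamiltonian L) x₀) (cotFlow L x₀) (toCot x₀ q₀)) := by
  refine hF.isHamFlow.isJacobiFamily fun s hs a ha => ?_
  have h1 := hF.legHess_vertForm h₀ hL hs a
  set w := vertForm (locH (hamiltonian L) x₀) (cotFlow L x₀) (toCot x₀ q₀) s a
  have hw : w ≠ 0 := fun h => ha (by rw [← h1, h, map_zero])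
  have h2 := hL.legHess_pos (hF.fst_mem h₀ hs) (hF.snd_ne_zero h₀ hs) hw
  rwa [h1] at h2

end IsCotFlow

/-- The Jacobi curve in coordinates. -/
theorem mem_jacobi_iff {q₀ : CotangentBundle n M} {ε : ℝ} (hF : IsCotFlow L q₀.proj q₀ ε) {s : ℝ}
    (hs : s ∈ Ioo (-ε) ε) (w : E n × Dual n) :
    w ∈ jacobi (hamiltonian L) q₀ s ↔
      (flowDiff (cotFlow L q₀.proj) (toCot q₀.proj q₀) s w).1 = 0 := by
  set x₀ := q₀.proj with hx₀
  have h₀ : q₀.proj ∈ (chartAt (E n) x₀).source := mem_source_self _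
  set qs := flow (hamiltonian L) s q₀ with hqs
  have hfl : MDifferentiableAt (cotModel n) (cotModel n) (flow (hamiltonian L) s) q₀ := by
    have h1 : MDifferentiableAt (𝓘(ℝ, ℝ).prod (cotModel n)) (cotModel n)
        (fun p : ℝ × CotangentBundle n M => flow (hamiltonian L) p.1 p.2) (s, q₀) :=
      ContMDiffAt.mdifferentiableAt (hF.smoothAt s hs) (by simp)
    exact MDifferentiableAt.comp q₀ (f := fun q => (s, q))
      (g := fun p : ℝ × CotangentBundle n M => flow (hamiltonian L) p.1 p.2) h1
      (mdifferentiableAt_const.prodMk mdifferentiableAt_id)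
  have hto : MDifferentiableAt (cotModel n) 𝓘(ℝ, E n × Dual n) (toCot x₀) qs :=
    (contMDiffAt_toCot (hF.mem_source s hs)).mdifferentiableAt (by simp)
  have hcomp : MDifferentiableAt (cotModel n) 𝓘(ℝ, E n × Dual n)
      (fun q => toCot x₀ (flow (hamiltonian L) s q)) q₀ := MDifferentiableAt.comp q₀ hto hfl
  obtain ⟨T, hT, -, hT1⟩ := exists_transition (mem_source_self (n := n) qs.proj)
    (hF.mem_source s hs)
  have h1 : flowDiff (cotFlow L x₀) (toCot x₀ q₀) s =
      dcot (fun q => toCot x₀ (flow (hamiltonian L) s q)) q₀ :=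
    (hF.isHamFlow.hasFDerivAt_flow hs).unique (hasFDerivAt_comp_ofCot hcomp)
  have h2 : dcot (fun q => toCot x₀ (flow (hamiltonian L) s q)) q₀ =
      (dcot (toCot x₀) qs).comp (dflow (hamiltonian L) s q₀) :=
    mfderiv_comp (g := toCot x₀) (f := flow (hamiltonian L) s) q₀ hto hfl
  have h3 : dcot (toCot x₀) qs = T := (hasFDerivAt_comp_ofCot hto).unique hT
  have h4 : (flowDiff (cotFlow L x₀) (toCot x₀ q₀) s w).1 =
      tc qs.proj x₀ qs.proj (dflow (hamiltonian L) s q₀ w).1 := by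
    rw [h1, h2, h3, ContinuousLinearMap.comp_apply, hT1]
  rw [h4]
  have h5 : w ∈ jacobi (hamiltonian L) q₀ s ↔ (dflow (hamiltonian L) s q₀ w).1 = 0 := Iff.rfl
  rw [h5]
  constructor
  · intro h; rw [h, map_zero]
  · intro h
    exact (tc_bijective (mem_source_self (n := n) qs.proj) (hF.mem_source s hs)).1
      (h.trans (map_zero _).symm)

/-- `Ric^H` is minus the trace of `(ω(ė_i, ë_j))` for a canonical frame: in the basis `e_i`, the
components of a vector `w` of the Jacobi curve are `ω(ė_i, w)`. -/
theorem exists_frame_ricci (hL : IsLagrangian L) {q₀ : CotangentBundle n M} {ε : ℝ}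
    (hF : IsCotFlow L q₀.proj q₀ ε) :
    ∃ δ > 0, δ ≤ ε ∧ ∃ e, IsOrthFrame δ (flowDiff (cotFlow L q₀.proj) (toCot q₀.proj q₀)) e ∧
      ricci (hamiltonian L) q₀ = -∑ i, symp (deriv (e i) 0) (deriv (deriv (e i)) 0) := by
  have hG := hF.isJacobiFamily (mem_source_self _) hL
  set G := flowDiff (cotFlow L q₀.proj) (toCot q₀.proj q₀) with hGdef
  -- a curvature operator exists, so the chosen one has the defining property
  have hex : ∃ R, IsCurvatureOperator (hamiltonian L) q₀ R := by
    obtain ⟨δ, hδ, hδε, e, he⟩ := hG.exists_orthFrame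
    have h0 : (0 : ℝ) ∈ Ioo (-δ) δ := ⟨by linarith, hδ⟩
    have hsub : Ioo (-δ) δ ⊆ Ioo (-ε) ε := Ioo_subset_Ioo (by linarith) hδε
    set f : (E n × Dual n) →ₗ[ℝ] (E n × Dual n) := -∑ i,
      (LinearMap.mk (AddHom.mk (fun w => symp (deriv (e i) 0) w) (fun u v => by
        simp only [symp, Prod.fst_add, Prod.snd_add, add_apply, map_add]; ring)) (fun r u => by
        simp only [symp, Prod.smul_fst, Prod.smul_snd, smul_apply, map_smul, smul_eq_mul,
          RingHom.id_apply]
        ring) : (E n × Dual n) →ₗ[ℝ] ℝ).smulRight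
        (deriv (deriv (e i)) 0) with hf
    have hfapp : ∀ w, f w = -∑ i, symp (deriv (e i) 0) w • deriv (deriv (e i)) 0 := by
      intro w
      rw [hf, LinearMap.neg_apply, LinearMap.sum_apply]
      rfl
    have hmem : ∀ w, f w ∈ jacobi (hamiltonian L) q₀ 0 := by
      intro w
      rw [hfapp]
      exact Submodule.neg_mem _ (Submodule.sum_mem _ fun i _ => Submodule.smul_mem _ _
        ((mem_jacobi_iff hF (hsub h0) _).2 (he.second i 0 h0)))
    refine ⟨(f.domRestrict _).codRestrict _ fun w => hmem w, δ, e, hδ,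
      ⟨he.smooth, fun i t ht => (mem_jacobi_iff hF (hsub ht) _).2 (he.mem i t ht), he.orthonormal,
        fun i t ht => (mem_jacobi_iff hF (hsub ht) _).2 (he.second i t ht)⟩, fun i h => ?_⟩
    show f (e i 0) = _
    rw [hfapp]
    simp [he.orthonormal _ i 0 h0]
  obtain ⟨ε', e, hε', hcf, hR⟩ := Classical.epsilon_spec hex
  set R := Classical.epsilon (IsCurvatureOperator (hamiltonian L) q₀) with hRdef
  set δ := min ε ε' with hδ
  have hδ0 : 0 < δ := lt_min hF.pos hε'
  have hs1 : Ioo (-δ) δ ⊆ Ioo (-ε) ε :=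
    Ioo_subset_Ioo (by linarith [min_le_left ε ε']) (min_le_left _ _)
  have hs2 : Ioo (-δ) δ ⊆ Ioo (-ε') ε' :=
    Ioo_subset_Ioo (by linarith [min_le_right ε ε']) (min_le_right _ _)
  have he : IsOrthFrame δ G e := ⟨fun i => (hcf.smooth i).mono hs2,
    fun i t ht => (mem_jacobi_iff hF (hs1 ht) _).1 (hcf.mem i t (hs2 ht)),
    fun i j t ht => hcf.orthonormal i j t (hs2 ht),
    fun i t ht => (mem_jacobi_iff hF (hs1 ht) _).1 (hcf.second i t (hs2 ht))⟩
  have h0 : (0 : ℝ) ∈ Ioo (-δ) δ := ⟨by linarith, hδ0⟩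
  refine ⟨δ, hδ0, min_le_left _ _, e, he, ?_⟩
  have hcc : ccoord q₀ ≠ 0 := by
    have := hF.ne_zero 0 (hs1 h0)
    rwa [flow_zero] at this
  rw [ricci, if_neg hcc, ← hRdef]
  -- the operator is the sum of the rank-one operators `w ↦ ω(ė_i, w) R e_i`
  set φ : Fin n → jacobi (hamiltonian L) q₀ 0 →ₗ[ℝ] ℝ := fun i =>
    LinearMap.mk (AddHom.mk (fun w : jacobi (hamiltonian L) q₀ 0 => symp (deriv (e i) 0) w)
      (fun u v => by
      simp only [symp, Submodule.coe_add, Prod.fst_add, Prod.snd_add, add_apply, map_add]; ring))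
      (fun r u => by
        simp only [symp, Submodule.coe_smul, Prod.smul_fst, Prod.smul_snd, smul_apply, map_smul,
          smul_eq_mul, RingHom.id_apply]
        ring) with hφ
  have hmem : ∀ i, e i 0 ∈ jacobi (hamiltonian L) q₀ 0 := fun i => hcf.mem i 0 (hs2 h0)
  have hsum : R = ∑ i, (φ i).smulRight (R ⟨e i 0, hmem i⟩) := by
    refine LinearMap.ext fun w => ?_
    have h1 : w = ∑ i, φ i w • (⟨e i 0, hmem i⟩ : jacobi (hamiltonian L) q₀ 0) := by
      refine Subtype.ext ?_
      rw [Submodule.coe_sum]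
      exact he.expansion (hG.mono hδ0 (min_le_left _ _)) h0 ((mem_jacobi_iff hF (hs1 h0) _).1 w.2)
    conv_lhs => rw [h1, map_sum]
    rw [LinearMap.sum_apply]
    exact Finset.sum_congr rfl fun i _ => map_smul _ _ _
  rw [hsum, map_sum, ← Finset.sum_neg_distrib]
  refine Finset.sum_congr rfl fun i _ => ?_
  have hfree : Module.Free ℝ (jacobi (hamiltonian L) q₀ 0) :=
    Module.Free.of_divisionRing ℝ (jacobi (hamiltonian L) q₀ 0)
  have hfin : Module.Finite ℝ (jacobi (hamiltonian L) q₀ 0) :=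
    FiniteDimensional.finiteDimensional_submodule (jacobi (hamiltonian L) q₀ 0)
  refine (LinearMap.trace_smulRight (R := ℝ) (M := jacobi (hamiltonian L) q₀ 0) (φ i) _).trans ?_
  show symp (deriv (e i) 0) (R ⟨e i 0, hmem i⟩ : jacobi (hamiltonian L) q₀ 0) = _
  rw [hR i (hmem i)]
  simp only [symp, Prod.fst_neg, Prod.snd_neg, neg_apply, map_neg]
  ring

end Ricci

/-! ### The Laplacian along the flow -/

section LaplacianAlong

variable {n : ℕ} {M : Type*} [TopologicalSpace M] [ChartedSpace (E n) M]
  [IsManifold 𝓘(ℝ, E n) ∞ M] {L : TangentBundle 𝓘(ℝ, E n) M → ℝ} {c : ℝ} {z : M}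
  {W : Set (Dual n)}

/-- The differential of `u_z^c` in the preferred chart at `x₀`, as a map between model spaces. -/
def uGrad (L : TangentBundle 𝓘(ℝ, E n) M → ℝ) (c : ℝ) (z : M) (W : Set (Dual n)) (x₀ : M) :
    E n → Dual n :=
  fderiv ℝ fun y => uFun L c z W ((chartAt (E n) x₀).symm y)

namespace IsRegularDomain

variable (hW : IsRegularDomain L c z W) (hL : IsLagrangian L) (hc0 : 0 < c) [T2Space M]
  (hc : ForwardComplete (hamiltonian L))
include hW hL hc0 hc

theorem contDiffAt_uGrad {β : Dual n} (hβ : β ∈ W) {x₀ : M}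
    (h₀ : expMap L c z β ∈ (chartAt (E n) x₀).source) :
    ContDiffAt ℝ ∞ (uGrad L c z W x₀) (chartAt (E n) x₀ (expMap L c z β)) :=
  (hW.contDiffAt_uFun_symm hL hc0 hc hβ h₀).fderiv_right (m := ∞) (by exact_mod_cast le_rfl)

theorem uGrad_symm {β : Dual n} (hβ : β ∈ W) {x₀ : M}
    (h₀ : expMap L c z β ∈ (chartAt (E n) x₀).source) (a b : E n) :
    fderiv ℝ (uGrad L c z W x₀) (chartAt (E n) x₀ (expMap L c z β)) a b =
      fderiv ℝ (uGrad L c z W x₀) (chartAt (E n) x₀ (expMap L c z β)) b a :=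
  ((hW.contDiffAt_uFun_symm hL hc0 hc hβ h₀).isSymmSndFDerivAt (by
    rw [minSmoothness_of_isRCLikeNormedField]
    exact WithTop.coe_le_coe.2 (le_top (a := (2 : ℕ∞))))) a b

/-- In a chart, the covectors `Φ_t(α)` form the graph of `du_z^c`. -/
theorem exists_graph {β : Dual n} (hβ : β ∈ W) {x₀ : M}
    (h₀ : expMap L c z β ∈ (chartAt (E n) x₀).source) :
    ∃ σ : E n → Dual n, ContinuousAt σ (chartAt (E n) x₀ (expMap L c z β)) ∧
      σ (chartAt (E n) x₀ (expMap L c z β)) = β ∧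
      ∀ᶠ y in 𝓝 (chartAt (E n) x₀ (expMap L c z β)), y ∈ (chartAt (E n) x₀).target ∧ σ y ∈ W ∧
        expMap L c z (σ y) = (chartAt (E n) x₀).symm y ∧
        toCot x₀ (expCov L c z (σ y)) = (y, uGrad L c z W x₀ y) := by
  obtain ⟨σ, hσ, hσ0, hev⟩ := hW.exists_inverse hL hc0 hc hβ h₀
  refine ⟨σ, hσ.continuousAt, hσ0, hev.mono fun y hy => ⟨hy.1, hy.2.1, hy.2.2.1, ?_⟩⟩
  refine Prod.ext ?_ hy.2.2.2.fderiv.symm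
  show chartAt (E n) x₀ (expCov L c z (σ y)).proj = y
  rw [← expMap_eq (hW.ne_zero hy.2.1), hy.2.2.1, (chartAt (E n) x₀).right_inv hy.1]

/-- The graph of `du_z^c` is invariant under the Hamiltonian flow, because it consists of the
covectors `Φ_t(α)`. -/
theorem graph_invariant {β : Dual n} (hβ : β ∈ W) {x₀ : M}
    (h₀ : expMap L c z β ∈ (chartAt (E n) x₀).source) :
    ∀ᶠ r : ℝ × E n in 𝓝 (0, chartAt (E n) x₀ (expMap L c z β)),
      (cotFlow L x₀ (r.1, (r.2, uGrad L c z W x₀ r.2))).2 =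
        uGrad L c z W x₀ (cotFlow L x₀ (r.1, (r.2, uGrad L c z W x₀ r.2))).1 := by
  set y₀ := chartAt (E n) x₀ (expMap L c z β) with hy₀
  have hβ0 := hW.ne_zero hβ
  obtain ⟨σ, hσ, hσ0, hev⟩ := hW.exists_graph hL hc0 hc hβ h₀
  have hσ' : ContinuousAt (fun r : ℝ × E n => σ r.2) (0, y₀) :=
    ContinuousAt.comp (x := ((0 : ℝ), y₀)) (g := σ) (f := Prod.snd) hσ continuousAt_snd
  have hsc : ContinuousAt (fun r : ℝ × E n => 1 + r.1 * scale L c z (σ r.2)) (0, y₀) := by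
    refine continuousAt_const.add (continuousAt_fst.mul (ContinuousAt.comp (x := ((0 : ℝ), y₀))
      (g := scale L c z) (f := fun r : ℝ × E n => σ r.2) ?_ hσ'))
    show ContinuousAt _ (σ y₀)
    rw [hσ0]
    exact (contDiffAt_scale hL hc0 hβ0).continuousAt
  -- the flow moves the covector over `exp (σ y)` to the one over `exp (b (s, y))`
  set b : ℝ × E n → Dual n := fun r => (1 + r.1 * scale L c z (σ r.2)) • σ r.2 with hb
  have hbc : ContinuousAt b (0, y₀) := hsc.smul hσ'
  have hb0 : b (0, y₀) = β := by
    show (1 + 0 * _) • σ y₀ = β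
    rw [zero_mul, add_zero, one_smul]
    exact hσ0
  have hbe : ContinuousAt (fun r => expMap L c z (b r)) (0, y₀) := by
    refine ContinuousAt.comp (x := ((0 : ℝ), y₀)) (g := expMap L c z) (f := b) ?_ hbc
    rw [hb0]
    exact (contMDiffAt_expMap hL hc0 hc hβ0).continuousAt
  have e1 : ∀ᶠ r in 𝓝 ((0 : ℝ), y₀), b r ∈ W :=
    hbc.eventually (hW.isOpen.eventually_mem (hb0 ▸ hβ))
  have e2 : ∀ᶠ r : ℝ × E n in 𝓝 ((0 : ℝ), y₀), 0 < 1 + r.1 * scale L c z (σ r.2) :=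
    hsc.eventually (lt_mem_nhds (by simp))
  have hsrc : expMap L c z (b (0, y₀)) ∈ (chartAt (E n) x₀).source := by rw [hb0]; exact h₀
  have e3 : ∀ᶠ r in 𝓝 ((0 : ℝ), y₀), expMap L c z (b r) ∈ (chartAt (E n) x₀).source :=
    hbe.eventually ((chartAt (E n) x₀).open_source.eventually_mem hsrc)
  have hbch : ContinuousAt (fun r => chartAt (E n) x₀ (expMap L c z (b r))) (0, y₀) :=
    ContinuousAt.comp (x := ((0 : ℝ), y₀)) (g := chartAt (E n) x₀)
      (f := fun r => expMap L c z (b r)) ((chartAt (E n) x₀).continuousAt hsrc) hbe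
  have hev0 : ∀ᶠ y in 𝓝 (chartAt (E n) x₀ (expMap L c z (b (0, y₀)))),
      y ∈ (chartAt (E n) x₀).target ∧ σ y ∈ W ∧
        expMap L c z (σ y) = (chartAt (E n) x₀).symm y ∧
        toCot x₀ (expCov L c z (σ y)) = (y, uGrad L c z W x₀ y) := by rw [hb0]; exact hev
  filter_upwards [e1, e2, e3, hbch.eventually hev0,
    continuousAt_snd.eventually (p := fun y => y ∈ (chartAt (E n) x₀).target ∧ σ y ∈ W ∧
        expMap L c z (σ y) = (chartAt (E n) x₀).symm y ∧
        toCot x₀ (expCov L c z (σ y)) = (y, uGrad L c z W x₀ y)) hev] with r h1 h2 h3 h4 h5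
  have hσr := hW.ne_zero h5.2.1
  have h6 : ofCot x₀ (r.2, uGrad L c z W x₀ r.2) = expCov L c z (σ r.2) := by
    rw [← h5.2.2.2]
    refine ofCot_toCot ?_
    rw [← expMap_eq hσr, h5.2.2.1]
    exact symm_mem h5.1
  have h7 : cotFlow L x₀ (r.1, (r.2, uGrad L c z W x₀ r.2)) = toCot x₀ (expCov L c z (b r)) := by
    simp only [cotFlow]
    rw [h6, flow_expCov hL hc0 hc hσr h2]
  have h8 : σ (chartAt (E n) x₀ (expMap L c z (b r))) = b r := by
    refine hW.injOn h4.2.1 h1 ?_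
    rw [h4.2.2.1, (chartAt (E n) x₀).left_inv h3]
  have h9 := h4.2.2.2
  rw [h8] at h9
  rw [h7, h9]

/-- In a chart, `∇u_z^c` is the horizontal part of the Hamiltonian vector field on the graph of
`du_z^c`, and the Laplacian is its divergence. -/
theorem laplacian_eq_divE [MeasurableSpace M] [BorelSpace M] {m : Measure M}
    (hm : IsSmoothMeasure n m) {β : Dual n} (hβ : β ∈ W) {x₀ : M}
    (h₀ : expMap L c z β ∈ (chartAt (E n) x₀).source) :
    ContDiffAt ℝ ∞ (fun y => (hamVec (locH (hamiltonian L) x₀) (y, uGrad L c z W x₀ y)).1)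
      (chartAt (E n) x₀ (expMap L c z β)) ∧
    ∀ᶠ y in 𝓝 (chartAt (E n) x₀ (expMap L c z β)),
      compIn (chartAt (E n) x₀) (gradient L (uFun L c z W)) y =
        (hamVec (locH (hamiltonian L) x₀) (y, uGrad L c z W x₀ y)).1 ∧
      laplacian m L (uFun L c z W) ((chartAt (E n) x₀).symm y) =
        divE (logDensity m (chartAt (E n) x₀))
          (fun y => (hamVec (locH (hamiltonian L) x₀) (y, uGrad L c z W x₀ y)).1) y := by
  set y₀ := chartAt (E n) x₀ (expMap L c z β) with hy₀
  set V : E n → E n := fun y => (hamVec (locH (hamiltonian L) x₀) (y, uGrad L c z W x₀ y)).1 with hV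
  obtain ⟨σ, hσ, hσ0, hev⟩ := hW.exists_graph hL hc0 hc hβ h₀
  have hne : ∀ y, σ y ∈ W → expMap L c z (σ y) = (chartAt (E n) x₀).symm y →
      y ∈ (chartAt (E n) x₀).target → toCot x₀ (expCov L c z (σ y)) = (y, uGrad L c z W x₀ y) →
      uGrad L c z W x₀ y ≠ 0 := by
    intro y h1 h2 h3 h4 h5
    have h6 := hW.ne_zero h1
    have h7 : (expCov L c z (σ y)).proj ∈ (chartAt (E n) x₀).source := by
      rw [← expMap_eq h6, h2]; exact symm_mem h3
    have h8 := (toCot_snd_eq_zero_iff h7).1 (by rw [h4]; exact h5)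
    exact ccoord_expCov_ne_zero hL hc0 hc h6 h8
  have hVs : ContDiffAt ℝ ∞ V y₀ := by
    obtain ⟨h1, h2, h3, h4⟩ := hev.self_of_nhds
    exact contDiffAt_fst.comp y₀ (ContDiffAt.comp y₀ (f := fun y => (y, uGrad L c z W x₀ y))
      (hL.contDiffAt_hamVec (p := (y₀, uGrad L c z W x₀ y₀)) h1 (hne _ h2 h3 h1 h4))
      (contDiffAt_id.prodMk (hW.contDiffAt_uGrad hL hc0 hc hβ h₀)))
  have hcomp : compIn (chartAt (E n) x₀) (gradient L (uFun L c z W)) =ᶠ[𝓝 y₀] V := by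
    filter_upwards [hev] with y hy
    obtain ⟨h1, h2, h3, h4⟩ := hy
    have h5 := hW.ne_zero h2
    have h7 : (expCov L c z (σ y)).proj ∈ (chartAt (E n) x₀).source := by
      rw [← expMap_eq h5, h3]; exact symm_mem h1
    have h6 : dform (uFun L c z W) ((chartAt (E n) x₀).symm y) = expCov L c z (σ y) := by
      rw [← h3, hW.dform_uFun hL hc0 hc h2]
    have h8 : compIn (chartAt (E n) x₀) (gradient L (uFun L c z W)) y =
        tc ((chartAt (E n) x₀).symm y) x₀ ((chartAt (E n) x₀).symm y)
          (tcoord (legendre L (dform (uFun L c z W) ((chartAt (E n) x₀).symm y)))) :=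
      components_chartAt x₀ _ (symm_mem h1)
    have h9 := hL.famT_toCot h7
    have h10 : (expCov L c z (σ y)).proj = (chartAt (E n) x₀).symm y := by
      rw [← expMap_eq h5, h3]
    rw [h8, h6, ← h10, ← h9, h4]
    exact (hL.hamVec_locH_fst (p := (y, uGrad L c z W x₀ y)) h1 (hne y h2 h3 h1 h4)).symm
  refine ⟨hVs, ?_⟩
  have hd : ∀ᶠ y in 𝓝 y₀, ContDiffAt ℝ 1 V y :=
    (hVs.of_le (WithTop.coe_le_coe.2 (le_top (a := (1 : ℕ∞))))).eventually (by simp)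
  filter_upwards [hcomp.eventually_nhds, hd, hev] with y h1 h2 h3
  refine ⟨h1.self_of_nhds, ?_⟩
  have h4 : (chartAt (E n) x₀) ((chartAt (E n) x₀).symm y) = y :=
    (chartAt (E n) x₀).right_inv h3.1
  have h5 := divergence_eq_chart hm (IsManifold.chart_mem_maximalAtlas x₀)
    (gradient L (uFun L c z W)) (symm_mem h3.1) (by
      rw [h4]
      exact (h2.differentiableAt (by simp)).congr_of_eventuallyEq h1)
  rw [h4] at h5
  rw [laplacian, h5]
  exact divE_congr h1

end IsRegularDomain

/-- The weight of `τ^*(α)` in the coordinates of a bundle chart. -/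
theorem weight_legendre [MeasurableSpace M] [BorelSpace M] {m : Measure M}
    (hm : IsSmoothMeasure n m) (hL : IsLagrangian L) {x₀ : M} {p : E n × Dual n}
    (hp : p.1 ∈ (chartAt (E n) x₀).target) (hξ : p.2 ≠ 0) :
    weight m L (legendre L (ofCot x₀ p)) = logDensity m (chartAt (E n) x₀) p.1 +
      Real.log (Matrix.of fun i j : Fin n =>
        legHess L x₀ p (basisVec i) (basisVec j)).det / 2 := by
  have hT : ofTan x₀ (p.1, famT (locL L x₀) p) = legendre L (ofCot x₀ p) := hL.ofTan_famT hp
  have h1 : toTan x₀ (legendre L (ofCot x₀ p)) = (p.1, famT (locL L x₀) p) := by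
    rw [← hT]; exact toTan_ofTan (p := (p.1, famT (locL L x₀) p)) hp
  have h2 : (legendre L (ofCot x₀ p)).proj = (chartAt (E n) x₀).symm p.1 := rfl
  have h3 : famT (locL L x₀) p ≠ 0 :=
    ((hL.isFamilyLagrangian x₀).fibre p.1 hp).legT_ne_zero hξ
  have h4 : tcoord (legendre L (ofCot x₀ p)) ≠ 0 := by
    intro h
    rw [hL.famT_eq hp, h, map_zero] at h3
    exact h3 rfl
  have h5 := weight_eq hm hL (x₀ := x₀) h4 (h2 ▸ symm_mem hp)
    (fun w hw => det_hessMat_ne_zero (hL.isFibreLagrangian _) hw)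
  rw [h1, h2, (chartAt (E n) x₀).right_inv hp] at h5
  exact h5

/-- The inequality that absorbs the weight: `(a - b)²/N ≤ a²/n + b²/(N - n)`. -/
theorem sq_sub_div_le {a b n N : ℝ} (hn : 0 < n) (hN : n < N) :
    (a - b) ^ 2 / N ≤ a ^ 2 / n + b ^ 2 / (N - n) := by
  have h1 : 0 < N - n := by linarith
  have h2 : 0 < N := by linarith
  rw [div_add_div _ _ hn.ne' h1.ne', div_le_div_iff₀ h2 (by positivity)]
  nlinarith [sq_nonneg (a * (N - n) + b * n)]

/-- The Bochner-type inequality along the flow: the derivative of the Laplacian `f`. With `y(s)` the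
flow line, `J` the horizontal part of the differential of the flow on the graph of `du_z^c` and `V`
the vector field `∇u_z^c`, one has `J' = DV(y) J`, hence `(log det J)' = tr DV` and
`f = (log det J)' - (ς ∘ y)'`. Since `ψ = ς + ½ log det Q⁻¹`, the function `g` of
`IsOrthFrame.riccati` is `f + ψ'`, so that `f' + ψ'' ≤ -Ric^H - (f + ψ')²/n`; the last term is
estimated by `sq_sub_div_le`. -/
theorem IsRegularDomain.exists_deriv_laplacian [T2Space M] [MeasurableSpace M] [BorelSpace M]
    {m : Measure M} (hm : IsSmoothMeasure n m) (hW : IsRegularDomain L c z W) (hL : IsLagrangian L)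
    (hc0 : 0 < c) (hc : ForwardComplete (hamiltonian L)) (hn : 0 < n) {β : Dual n} (hβ : β ∈ W)
    {N : ℝ} (hN : n ≤ N) :
    ∃ f' : ℝ, HasDerivAt (fun s => laplacian m L (uFun L c z W)
        (flow (hamiltonian L) s (expCov L c z β)).proj) f' 0 ∧
      ∀ K : ℝ, (K : EReal) ≤ ricciN m L N (expCov L c z β) →
        f' ≤ -K - laplacian m L (uFun L c z W) (expMap L c z β) ^ 2 / N := by
  set q₀ := expCov L c z β with hq₀
  set x₀ := q₀.proj with hx₀
  have hβ0 := hW.ne_zero hβ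
  have hex : expMap L c z β = x₀ := expMap_eq hβ0
  have hself : q₀.proj ∈ (chartAt (E n) x₀).source := mem_source_self _
  have h₀ : expMap L c z β ∈ (chartAt (E n) x₀).source := hex ▸ mem_source_self _
  have hcc : ccoord q₀ ≠ 0 := ccoord_expCov_ne_zero hL hc0 hc hβ0
  obtain ⟨ε, hε, hF⟩ := exists_isCotFlow hL hc hself hcc
  obtain ⟨δ, hδ, hδε, e, he, hric⟩ := exists_frame_ricci hL hF
  set y₀ := chartAt (E n) x₀ (expMap L c z β) with hy₀
  set θ := uGrad L c z W x₀ with hθ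
  have hp₀ : toCot x₀ q₀ = (y₀, θ y₀) := by
    obtain ⟨σ, -, hσ0, hev⟩ := hW.exists_graph hL hc0 hc hβ h₀
    have := hev.self_of_nhds.2.2.2
    rwa [hσ0] at this
  have hG := (hF.isJacobiFamily hself hL).mono hδ hδε
  have hFl := hF.isHamFlow
  have hcf := fun s => hF.cotFlow_eq hself s
  have hft := fun s hs => hF.fst_mem hself (s := s) hs
  have hsn := fun s hs => hF.snd_ne_zero hself (s := s) hs
  have hlv := fun s hs b => hF.legHess_vertForm hself hL (s := s) hs b
  rw [hp₀] at he hG hFl hcf hft hsn hlv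
  set φ := cotFlow L x₀ with hφ
  set p₀ : E n × Dual n := (y₀, θ y₀) with hp₀'
  set y : ℝ → E n := fun s => (φ (s, p₀)).1 with hy
  set V : E n → E n := fun y => (hamVec (locH (hamiltonian L) x₀) (y, θ y)).1 with hV
  set J : ℝ → E n →L[ℝ] E n := fun s => (ContinuousLinearMap.fst ℝ (E n) (Dual n)).comp
    ((flowDiff φ p₀ s).comp ((ContinuousLinearMap.id ℝ (E n)).prod (fderiv ℝ θ y₀))) with hJ
  have hgr := hFl.hasDerivAt_graph (hW.contDiffAt_uGrad hL hc0 hc hβ h₀)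
    (hW.graph_invariant hL hc0 hc hβ h₀)
  obtain ⟨hVs, hlap⟩ := hW.laplacian_eq_divE hL hc0 hc hm hβ h₀
  have h0 : (0 : ℝ) ∈ Ioo (-ε) ε := ⟨by linarith, hε⟩
  have hy0 : y 0 = y₀ := by
    show (φ (0, p₀)).1 = y₀
    rw [hFl.flow_zero]
  have hJ0 : ∀ᶠ s in 𝓝 (0 : ℝ), (J s).det ≠ 0 := by
    have h1 : ContinuousAt (fun s => (J s).det) 0 :=
      ContinuousLinearMap.continuous_det.continuousAt.comp
        hgr.self_of_nhds.2.2.2.continuousAt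
    refine h1.eventually_ne ?_
    have h2 : J 0 = ContinuousLinearMap.id ℝ (E n) := by
      refine ContinuousLinearMap.ext fun x => ?_
      simp only [hJ, hFl.flowDiff_zero]
      rfl
    rw [h2, det_eq_opMat, opMat_one, Matrix.det_one]
    exact one_ne_zero
  obtain ⟨g, b, hg1, hg2, hg3⟩ := he.riccati hG (S := fderiv ℝ θ y₀)
    (hW.uGrad_symm hL hc0 hc hβ h₀) (F := fun s => legHess L x₀ (φ (s, p₀)))
    (fun s hs => hlv s (Ioo_subset_Ioo (by linarith) hδε hs)) (J := J) (fun s x => rfl) hJ0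
  set F : ℝ → ℝ := fun s => Real.log (Matrix.of fun i j : Fin n =>
    legHess L x₀ (φ (s, p₀)) (basisVec i) (basisVec j)).det / 2 with hFdef
  set ς := logDensity m (chartAt (E n) x₀) with hς
  set f : ℝ → ℝ := fun s => laplacian m L (uFun L c z W) (flow (hamiltonian L) s q₀).proj with hf
  have hyd : ∀ᶠ s in 𝓝 (0 : ℝ), HasDerivAt y (V (y s)) s := by
    filter_upwards [hgr] with s hs
    have h1 := hasDerivAt_fst (hFl.hasDerivAt_curve hs.1)
    rw [hs.2.1] at h1
    exact h1
  have hproj : ∀ s ∈ Ioo (-ε) ε,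
      (flow (hamiltonian L) s q₀).proj = (chartAt (E n) x₀).symm (y s) := by
    intro s hs
    have h1 : y s = chartAt (E n) x₀ (flow (hamiltonian L) s q₀).proj := by
      show (φ (s, p₀)).1 = _
      rw [hcf]
      rfl
    rw [h1, (chartAt (E n) x₀).left_inv (hF.mem_source s hs)]
  have hyc : ContinuousAt y 0 := hyd.self_of_nhds.continuousAt
  have hfe : ∀ᶠ s in 𝓝 (0 : ℝ), f s = divE ς V (y s) := by
    have h1 : ∀ᶠ y in 𝓝 (y 0), laplacian m L (uFun L c z W) ((chartAt (E n) x₀).symm y) =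
        divE ς V y := by
      rw [hy0]; exact hlap.mono fun y hy => hy.2
    filter_upwards [hyc.eventually h1, isOpen_Ioo.eventually_mem h0] with s h2 h3
    rw [← h2]
    simp only [hf]
    rw [hproj s h3]
  have hςd : ∀ s ∈ Ioo (-ε) ε, ContDiffAt ℝ ∞ ς (y s) := fun s hs =>
    contDiffAt_logDensity hm (IsManifold.chart_mem_maximalAtlas x₀) (hft s hs)
  have hw : ∀ s ∈ Ioo (-ε) ε, weightAlong m L q₀ s = ς (y s) + F s := by
    intro s hs
    have h1 := weight_legendre hm hL (hft s hs) (hsn s hs)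
    rw [hcf, ofCot_toCot (hF.mem_source s hs), ← hcf] at h1
    exact h1
  -- `ψ' = g - f`
  have hwd : ∀ᶠ s in 𝓝 (0 : ℝ), HasDerivAt (weightAlong m L q₀) (g s - f s) s := by
    filter_upwards [hgr, hg1, hJ0, hyd, hfe] with s h1 h2 h3 h4 h5
    have hb := bijective_of_det_ne_zero h3
    have a1 := hasDerivAt_log_det h1.2.2.2 (apply_clm_inverse hb)
    have a2 : opTr ((J s).inverse.comp ((fderiv ℝ V (y s)).comp (J s))) =
        opTr (fderiv ℝ V (y s)) := by
      rw [opTr_comp_comm]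
      congr 1
      refine ContinuousLinearMap.ext fun w => ?_
      simp only [ContinuousLinearMap.comp_apply]
      rw [apply_clm_inverse hb]
    have a3 : HasDerivAt F (g s - opTr (fderiv ℝ V (y s))) s := by
      refine ((h2.sub a1).congr_deriv (by rw [← a2])).congr_of_eventuallyEq ?_
      refine Filter.Eventually.of_forall fun t => ?_
      simp only [hFdef, Pi.sub_apply]
      ring
    have a4 : HasDerivAt (fun s => ς (y s)) (fderiv ℝ ς (y s) (V (y s))) s :=
      ((hςd s h1.1).differentiableAt (by simp)).hasFDerivAt.comp_hasDerivAt s h4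
    refine ((a4.add a3).congr_deriv ?_).congr_of_eventuallyEq ?_
    · rw [h5, divE]; ring
    · filter_upwards [isOpen_Ioo.mem_nhds h1.1] with t ht
      exact hw t ht
  have hfd : DifferentiableAt ℝ f 0 := by
    have h1 : DifferentiableAt ℝ (fun x => divE ς V x) (y 0) := by
      have a1 : ContDiffAt ℝ ∞ (fderiv ℝ V) (y 0) := by
        rw [hy0]; exact hVs.fderiv_right (m := ∞) (by exact_mod_cast le_rfl)
      have a2 : ContDiffAt ℝ ∞ (fderiv ℝ ς) (y 0) :=
        (hςd 0 h0).fderiv_right (m := ∞) (by exact_mod_cast le_rfl)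
      have a3 : ContDiffAt ℝ ∞ (fun x => divE ς V x) (y 0) := by
        refine ContDiffAt.sub (ContDiffAt.sum fun i _ => ?_) (a2.clm_apply (hy0 ▸ hVs))
        exact (basisCov i : Dual n).contDiff.contDiffAt.comp (y 0)
          (a1.clm_apply contDiffAt_const)
      exact a3.differentiableAt (by simp)
    exact (h1.comp (0 : ℝ) hyd.self_of_nhds.differentiableAt).congr_of_eventuallyEq hfe
  refine ⟨deriv f 0, hfd.hasDerivAt, fun K hK => ?_⟩
  have hw1 : deriv (weightAlong m L q₀) =ᶠ[𝓝 0] fun s => g s - f s :=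
    hwd.mono fun s hs => hs.deriv
  have hw2 : deriv (deriv (weightAlong m L q₀)) 0 =
      (∑ i, symp (deriv (e i) 0) (deriv (deriv (e i)) 0) - b) - deriv f 0 :=
    ((hg2.sub hfd.hasDerivAt).congr_of_eventuallyEq hw1).deriv
  have hw10 := hw1.self_of_nhds
  have hf0 : laplacian m L (uFun L c z W) (expMap L c z β) = f 0 := by
    simp only [hf]
    rw [flow_zero, hex]
  rw [hf0]
  have hn' : (0 : ℝ) < n := Nat.cast_pos.2 hn
  have hb : g 0 ^ 2 / n ≤ b := by
    rw [div_le_iff₀ hn']; linarith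
  rw [ricciN, if_neg hcc, hw2, hw10, hric] at hK
  -- the cases `N = n` with `ψ' = 0`, where `f = g`; `N = n` with `ψ' ≠ 0`, where the curvature is
  -- `-∞`; and `N > n`
  split_ifs at hK with h1 h2
  · have h3 := EReal.coe_le_coe_iff.1 hK
    have h4 : f 0 = g 0 := by linarith
    rw [h4, h1]
    linarith
  · exact absurd (le_bot_iff.1 hK) (EReal.coe_ne_bot K)
  · have h3 := EReal.coe_le_coe_iff.1 hK
    have h4 := sq_sub_div_le (a := g 0) (b := g 0 - f 0) hn' (lt_of_le_of_ne hN (Ne.symm h1))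
    rw [sub_sub_cancel] at h4
    linarith

end LaplacianAlong

/-! ### The scalar Riccati comparison -/

section Scalar

/-- The derivative of `s_{K,N}`. -/
def cKN (K N t : ℝ) : ℝ :=
  if 0 < K then Real.cos (√(K / N) * t)
  else if K = 0 then 1
  else Real.cosh (√(-K / N) * t)

variable {K N : ℝ}

theorem hasDerivAt_sKN (hN : 0 < N) (t : ℝ) : HasDerivAt (sKN K N) (cKN K N t) t := by
  rcases lt_trichotomy K 0 with hK | hK | hK
  · have e1 : sKN K N = fun t => √(-N / K) * Real.sinh (√(-K / N) * t) := by
      funext t; simp [sKN, hK.not_gt, hK.ne]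
    have e2 : √(-N / K) * √(-K / N) = 1 := by
      rw [← Real.sqrt_mul (div_nonneg_of_nonpos (by linarith) hK.le)]
      rw [show -N / K * (-K / N) = 1 by field_simp [hK.ne], Real.sqrt_one]
    rw [e1]
    refine ((((hasDerivAt_id t).const_mul _).sinh).const_mul _).congr_deriv ?_
    simp only [cKN, hK.not_gt, hK.ne, if_false, id, mul_one]
    linear_combination Real.cosh (√(-K / N) * t) * e2
  · have e1 : sKN K N = fun t => t := by funext t; simp [sKN, hK]
    rw [e1]
    exact (hasDerivAt_id' t).congr_deriv (by simp [cKN, hK])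
  · have e1 : sKN K N = fun t => √(N / K) * Real.sin (√(K / N) * t) := by
      funext t; simp [sKN, hK]
    have e2 : √(N / K) * √(K / N) = 1 := by
      rw [← Real.sqrt_mul (by positivity), show N / K * (K / N) = 1 by field_simp, Real.sqrt_one]
    rw [e1]
    refine ((((hasDerivAt_id t).const_mul _).sin).const_mul _).congr_deriv ?_
    simp only [cKN, hK, if_true, id, mul_one]
    linear_combination Real.cos (√(K / N) * t) * e2

theorem hasDerivAt_cKN (hN : 0 < N) (t : ℝ) :
    HasDerivAt (cKN K N) (-(K / N) * sKN K N t) t := by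
  rcases lt_trichotomy K 0 with hK | hK | hK
  · have e1 : cKN K N = fun t => Real.cosh (√(-K / N) * t) := by
      funext t; simp [cKN, hK.not_gt, hK.ne]
    have e2 : √(-N / K) * √(-K / N) = 1 := by
      rw [← Real.sqrt_mul (div_nonneg_of_nonpos (by linarith) hK.le)]
      rw [show -N / K * (-K / N) = 1 by field_simp [hK.ne], Real.sqrt_one]
    have e3 : √(-K / N) * √(-K / N) = -K / N :=
      Real.mul_self_sqrt (div_nonneg (by linarith) hN.le)
    rw [e1]
    refine (((hasDerivAt_id t).const_mul _).cosh).congr_deriv ?_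
    simp only [sKN, hK.not_gt, hK.ne, if_false, id, mul_one]
    have e4 : √(-K / N) = -(K / N) * √(-N / K) := by
      linear_combination (-√(-K / N)) * e2 + √(-N / K) * e3
    linear_combination Real.sinh (√(-K / N) * t) * e4
  · have e1 : cKN K N = fun _ => 1 := by funext t; simp [cKN, hK]
    rw [e1]
    simpa [hK] using hasDerivAt_const t (1 : ℝ)
  · have e1 : cKN K N = fun t => Real.cos (√(K / N) * t) := by
      funext t; simp [cKN, hK]
    have e2 : √(N / K) * √(K / N) = 1 := by
      rw [← Real.sqrt_mul (by positivity), show N / K * (K / N) = 1 by field_simp, Real.sqrt_one]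
    have e3 : √(K / N) * √(K / N) = K / N := Real.mul_self_sqrt (by positivity)
    rw [e1]
    refine (((hasDerivAt_id t).const_mul _).cos).congr_deriv ?_
    simp only [sKN, hK, if_true, id, mul_one]
    have e4 : √(K / N) = K / N * √(N / K) := by
      linear_combination (-√(K / N)) * e2 + √(N / K) * e3
    linear_combination (-Real.sin (√(K / N) * t)) * e4

theorem sKN_zero : sKN K N 0 = 0 := by simp [sKN]

theorem cKN_zero : cKN K N 0 = 1 := by simp [cKN]

theorem deriv_sKN (hN : 0 < N) (t : ℝ) : deriv (sKN K N) t = cKN K N t :=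
  (hasDerivAt_sKN hN t).deriv

theorem sKN_pos_of_nonpos (hN : 0 < N) (hK : K ≤ 0) {t : ℝ} (ht : 0 < t) : 0 < sKN K N t := by
  rcases hK.lt_or_eq with hK | hK
  · simp only [sKN, hK.not_gt, hK.ne, if_false]
    have h1 : 0 < √(-N / K) := Real.sqrt_pos.2 (div_pos_of_neg_of_neg (by linarith) hK)
    have h2 : 0 < √(-K / N) := Real.sqrt_pos.2 (div_pos (by linarith) hN)
    exact mul_pos h1 (Real.sinh_pos_iff.2 (mul_pos h2 ht))
  · simp [sKN, hK, ht]

theorem sKN_pos_of_lt (hN : 0 < N) (hK : 0 < K) {t : ℝ} (ht : 0 < t) (h : √(K / N) * t < Real.pi) :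
    0 < sKN K N t := by
  simp only [sKN, hK, if_true]
  have h1 : 0 < √(K / N) := Real.sqrt_pos.2 (div_pos hK hN)
  exact mul_pos (Real.sqrt_pos.2 (div_pos hN hK)) (Real.sin_pos_of_pos_of_lt_pi (mul_pos h1 ht) h)

/-- The Wronskian-type comparison of a solution of the Riccati inequality `φ' ≤ -κ - φ²` with
`s_{K,N}` started at time `ε`: with `v = φ s - s'` one has `v' ≤ -φ v` and `v(ε) = -1`. -/
theorem riccati_lt (hN : 0 < N) {φ φ' : ℝ → ℝ} {ε τ : ℝ} (hετ : ε ≤ τ)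
    (hφ : ∀ x ∈ Icc ε τ, HasDerivAt φ (φ' x) x) (hle : ∀ x ∈ Icc ε τ, φ' x ≤ -(K / N) - φ x ^ 2)
    (hs : ∀ x ∈ Icc ε τ, 0 ≤ sKN K N (x - ε)) :
    φ τ * sKN K N (τ - ε) < cKN K N (τ - ε) := by
  have hφc : ContinuousOn φ (Icc ε τ) := fun x hx => (hφ x hx).continuousAt.continuousWithinAt
  -- the integrating factor is `exp A`, and `v exp A` is non-increasing
  set A : ℝ → ℝ := fun x => ∫ t in ε..x, φ t with hA
  have hAc : ContinuousOn A (Icc ε τ) := by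
    have := intervalIntegral.continuousOn_primitive_interval'
      (hφc.intervalIntegrable_of_Icc hετ (μ := volume)) left_mem_uIcc
    rwa [uIcc_of_le hετ] at this
  have hAd : ∀ x ∈ Ioo ε τ, HasDerivAt A (φ x) x := by
    intro x hx
    refine intervalIntegral.integral_hasDerivAt_right ?_ ?_ (hφ x ⟨hx.1.le, hx.2.le⟩).continuousAt
    · exact (hφc.mono (Icc_subset_Icc le_rfl hx.2.le)).intervalIntegrable_of_Icc hx.1.le
    · exact ContinuousOn.stronglyMeasurableAtFilter isOpen_Ioo
        (hφc.mono Ioo_subset_Icc_self) x hx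
  set v : ℝ → ℝ := fun x => φ x * sKN K N (x - ε) - cKN K N (x - ε) with hv
  have hsd : ∀ x, HasDerivAt (fun x => sKN K N (x - ε)) (cKN K N (x - ε)) x := fun x =>
    (hasDerivAt_sKN hN (x - ε)).comp_sub_const x ε
  have hcd : ∀ x, HasDerivAt (fun x => cKN K N (x - ε)) (-(K / N) * sKN K N (x - ε)) x := fun x =>
    (hasDerivAt_cKN hN (x - ε)).comp_sub_const x ε
  have hvd : ∀ x ∈ Icc ε τ, HasDerivAt v (φ' x * sKN K N (x - ε) + φ x * cKN K N (x - ε) -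
      -(K / N) * sKN K N (x - ε)) x := fun x hx => ((hφ x hx).mul (hsd x)).sub (hcd x)
  have hanti : AntitoneOn (fun x => v x * Real.exp (A x)) (Icc ε τ) := by
    refine antitoneOn_of_deriv_nonpos (convex_Icc ε τ)
      (ContinuousOn.mul (fun x hx => (hvd x hx).continuousAt.continuousWithinAt)
        (Real.continuous_exp.comp_continuousOn hAc)) (fun x hx => ?_) (fun x hx => ?_)
    · rw [interior_Icc] at hx
      exact ((hvd x ⟨hx.1.le, hx.2.le⟩).mul (hAd x hx).exp).differentiableAt.differentiableWithinAt
    · rw [interior_Icc] at hx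
      have hx' : x ∈ Icc ε τ := ⟨hx.1.le, hx.2.le⟩
      have h1 := ((hvd x hx').mul (hAd x hx).exp).deriv
      have h2 : deriv (fun x => v x * Real.exp (A x)) x = Real.exp (A x) *
          (sKN K N (x - ε) * (φ' x + K / N + φ x ^ 2)) := by
        refine h1.trans ?_
        simp only [hv]
        ring
      rw [h2]
      exact mul_nonpos_of_nonneg_of_nonpos (Real.exp_pos _).le
        (mul_nonpos_of_nonneg_of_nonpos (hs x hx') (by linarith [hle x hx']))
  have h1 := hanti (left_mem_Icc.2 hετ) (right_mem_Icc.2 hετ) hετ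
  have h2 : v ε = -1 := by simp [hv, sKN_zero, cKN_zero]
  have h3 : v τ * Real.exp (A τ) < 0 := by
    refine lt_of_le_of_lt h1 ?_
    show v ε * Real.exp (A ε) < 0
    rw [h2]
    linarith [Real.exp_pos (A ε)]
  have h4 : v τ < 0 := by
    by_contra h
    exact absurd (mul_nonneg (not_lt.1 h) (Real.exp_pos (A τ)).le) (not_le.2 h3)
  simp only [hv] at h4
  linarith

/-- Comparison for the Riccati inequality `F' ≤ -K - F²/N` on `(0, b)`. No initial condition at `0`
is needed, as the comparison function has a pole there: the bound is the limit `ε → 0` of the bounds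
of `riccati_lt`. -/
theorem riccati_comparison (hN : 0 < N) {F F' : ℝ → ℝ} {b : ℝ}
    (hF : ∀ x ∈ Ioo 0 b, HasDerivAt F (F' x) x) (hle : ∀ x ∈ Ioo 0 b, F' x ≤ -K - F x ^ 2 / N)
    {t : ℝ} (ht : t ∈ Ioo 0 b) :
    0 < sKN K N t ∧ F t ≤ N * deriv (sKN K N) t / sKN K N t := by
  have hφ : ∀ x ∈ Ioo 0 b, HasDerivAt (fun x => F x / N) (F' x / N) x := fun x hx =>
    (hF x hx).div_const N
  have hφle : ∀ x ∈ Ioo 0 b, F' x / N ≤ -(K / N) - (F x / N) ^ 2 := by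
    intro x hx
    have h1 := div_le_div_of_nonneg_right (hle x hx) hN.le
    refine h1.trans (le_of_eq ?_)
    field_simp
  have hpos : ∀ x ∈ Ioo 0 b, 0 < sKN K N x := by
    rcases le_or_gt K 0 with hK | hK
    · exact fun x hx => sKN_pos_of_nonpos hN hK hx.1
    · have hq : 0 < √(K / N) := Real.sqrt_pos.2 (div_pos hK hN)
      intro x hx
      refine sKN_pos_of_lt hN hK hx.1 ?_
      by_contra hx2
      -- otherwise the comparison applies on an interval of length `D = π / √(K/N)` inside `(0, b)`,
      -- at whose end it reads `0 < -1`
      set D := Real.pi / √(K / N) with hD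
      have hD1 : √(K / N) * D = Real.pi := by rw [hD]; field_simp
      have hDx : D ≤ x := by
        rw [hD, div_le_iff₀ hq]; linarith
      have hD0 : 0 < D := div_pos Real.pi_pos hq
      set ε := (b - D) / 2 with hε
      have hε0 : 0 < ε := by rw [hε]; linarith [hx.2]
      have hεb : ε + D < b := by rw [hε]; linarith [hx.2]
      have hsub : Icc ε (ε + D) ⊆ Ioo 0 b := fun y hy =>
        ⟨lt_of_lt_of_le hε0 hy.1, lt_of_le_of_lt hy.2 hεb⟩
      have h1 := riccati_lt (K := K) (φ := fun x => F x / N) (φ' := fun x => F' x / N) hN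
        (show ε ≤ ε + D by linarith) (fun y hy => hφ y (hsub hy)) (fun y hy => hφle y (hsub hy))
        (fun y hy => by
          simp only [sKN, hK, if_true]
          refine mul_nonneg (Real.sqrt_nonneg _) (Real.sin_nonneg_of_nonneg_of_le_pi
            (mul_nonneg hq.le (by linarith [hy.1])) ?_)
          rw [← hD1]
          exact mul_le_mul_of_nonneg_left (by linarith [hy.2]) hq.le)
      rw [add_sub_cancel_left] at h1
      simp only [sKN, cKN, hK, if_true, hD1, Real.sin_pi, Real.cos_pi, mul_zero] at h1
      linarith
  refine ⟨hpos t ht, ?_⟩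
  rw [le_div_iff₀ (hpos t ht), deriv_sKN hN]
  have hlim : F t / N * sKN K N t ≤ cKN K N t := by
    have hc1 : Tendsto (fun ε => F t / N * sKN K N (t - ε)) (𝓝[>] 0)
        (𝓝 (F t / N * sKN K N t)) := by
      have h1 : ContinuousAt (fun ε => F t / N * sKN K N (t - ε)) 0 :=
        continuousAt_const.mul (ContinuousAt.comp (g := sKN K N) (f := fun ε => t - ε)
          (hasDerivAt_sKN hN _).continuousAt (continuousAt_const.sub continuousAt_id))
      have h2 := h1.tendsto
      rw [sub_zero] at h2
      exact h2.mono_left nhdsWithin_le_nhds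
    have hc2 : Tendsto (fun ε => cKN K N (t - ε)) (𝓝[>] 0) (𝓝 (cKN K N t)) := by
      have h1 : ContinuousAt (fun ε => cKN K N (t - ε)) 0 :=
        ContinuousAt.comp (g := cKN K N) (f := fun ε => t - ε)
          (hasDerivAt_cKN hN _).continuousAt (continuousAt_const.sub continuousAt_id)
      have h2 := h1.tendsto
      rw [sub_zero] at h2
      exact h2.mono_left nhdsWithin_le_nhds
    refine le_of_tendsto_of_tendsto hc1 hc2 ?_
    filter_upwards [Ioo_mem_nhdsGT ht.1] with ε hε
    have hsub : Icc ε t ⊆ Ioo 0 b := fun y hy =>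
        ⟨lt_of_lt_of_le hε.1 hy.1, lt_of_le_of_lt hy.2 ht.2⟩
    refine (riccati_lt (K := K) (φ := fun x => F x / N) (φ' := fun x => F' x / N) hN hε.2.le
      (fun y hy => hφ y (hsub hy)) (fun y hy => hφle y (hsub hy)) (fun y hy => ?_)).le
    rcases hy.1.eq_or_lt with h | h
    · rw [h, sub_self, sKN_zero]
    · exact (hpos _ ⟨by linarith, by linarith [(hsub hy).2, hε.1]⟩).le
  have h1 : F t * sKN K N t = N * (F t / N * sKN K N t) := by field_simp
  rw [h1]
  exact mul_le_mul_of_nonneg_left hlim hN.le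

theorem sKN_ratio_pos (hN : 0 < N) (hK : 0 < K) (t : ℝ) :
    N * deriv (sKN K N) t / sKN K N t = √(N * K) * Real.cot (√(K / N) * t) := by
  rw [deriv_sKN hN, Real.cot_eq_cos_div_sin]
  simp only [sKN, cKN, hK, if_true]
  have h1 : √(N * K) * √(N / K) = N := by
    rw [← Real.sqrt_mul (by positivity), show N * K * (N / K) = N * N by field_simp,
      Real.sqrt_mul_self hN.le]
  have h2 : √(N / K) ≠ 0 := (Real.sqrt_pos.2 (div_pos hN hK)).ne'
  calc N * Real.cos (√(K / N) * t) / (√(N / K) * Real.sin (√(K / N) * t))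
      = √(N * K) * √(N / K) * Real.cos (√(K / N) * t) /
        (√(N / K) * Real.sin (√(K / N) * t)) := by rw [h1]
    _ = √(N / K) * (√(N * K) * Real.cos (√(K / N) * t)) /
        (√(N / K) * Real.sin (√(K / N) * t)) := by congr 1; ring
    _ = _ := by rw [mul_div_mul_left _ _ h2, mul_div_assoc]

theorem sKN_ratio_zero (hN : 0 < N) (t : ℝ) : N * deriv (sKN 0 N) t / sKN 0 N t = N / t := by
  rw [deriv_sKN hN]
  simp [sKN, cKN]

theorem sKN_ratio_neg (hN : 0 < N) (hK : K < 0) (t : ℝ) :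
    N * deriv (sKN K N) t / sKN K N t =
      √(-(N * K)) * (Real.cosh (√(-K / N) * t) / Real.sinh (√(-K / N) * t)) := by
  rw [deriv_sKN hN]
  simp only [sKN, cKN, hK.not_gt, hK.ne, if_false]
  have hNK : 0 < -(N * K) := by nlinarith
  have h1 : √(-(N * K)) * √(-N / K) = N := by
    rw [← Real.sqrt_mul hNK.le, show -(N * K) * (-N / K) = N * N by field_simp [hK.ne],
      Real.sqrt_mul_self hN.le]
  have h2 : √(-N / K) ≠ 0 :=
    (Real.sqrt_pos.2 (div_pos_of_neg_of_neg (by linarith) hK)).ne'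
  calc N * Real.cosh (√(-K / N) * t) / (√(-N / K) * Real.sinh (√(-K / N) * t))
      = √(-(N * K)) * √(-N / K) * Real.cosh (√(-K / N) * t) /
        (√(-N / K) * Real.sinh (√(-K / N) * t)) := by rw [h1]
    _ = √(-N / K) * (√(-(N * K)) * Real.cosh (√(-K / N) * t)) /
        (√(-N / K) * Real.sinh (√(-K / N) * t)) := by congr 1; ring
    _ = _ := by rw [mul_div_mul_left _ _ h2, mul_div_assoc]

end Scalar

/-! ### The Laplacian comparison -/

section Comparison

variable {n : ℕ} {M : Type*} [TopologicalSpace M] [ChartedSpace (E n) M]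
  [IsManifold 𝓘(ℝ, E n) ∞ M] {L : TangentBundle 𝓘(ℝ, E n) M → ℝ} {c : ℝ} {z : M}
  {W : Set (Dual n)} [MeasurableSpace M] {m : Measure M}

/-- The Laplacian is a local operator. -/
theorem laplacian_congr {u v : M → ℝ} {x : M} (h : u =ᶠ[𝓝 x] v) :
    laplacian m L u x = laplacian m L v x := by
  have h1 : ∀ᶠ y in 𝓝 x, gradient L u y = gradient L v y := by
    filter_upwards [h.eventually_nhds] with y hy
    have h2 : dform (n := n) u y = dform v y :=
      congrArg (covec y) (Filter.EventuallyEq.mfderiv_eq hy)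
    simp only [gradient, h2]
    rfl
  have h3 : ContinuousAt (chartAt (E n) x).symm (chartAt (E n) x x) :=
    (chartAt (E n) x).continuousAt_symm ((chartAt (E n) x).map_source (mem_source_self x))
  have h4 : ∀ᶠ y in 𝓝 ((chartAt (E n) x).symm (chartAt (E n) x x)),
      gradient L u y = gradient L v y := by
    rw [(chartAt (E n) x).left_inv (mem_source_self x)]; exact h1
  rw [laplacian, laplacian, divergence_eq, divergence_eq]
  refine divE_congr ?_
  filter_upwards [h3.eventually h4] with y hy
  simp only [compIn, components, hy]
  rfl

variable [T2Space M] (hL : IsLagrangian L) (hc0 : 0 < c) (hc : ForwardComplete (hamiltonian L))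
include hL hc0 hc

/-- The Laplacian of `u_z^c` does not depend on the regular domain. -/
theorem IsRegularDomain.laplacian_eq {V : Set (Dual n)} (hW : IsRegularDomain L c z W)
    (hV : IsRegularDomain L c z V) {α : Dual n} (hα : hamiltonian L (covec z α) = c) {t : ℝ}
    (ht : 0 < t) (htW : t • α ∈ W) (htV : t • α ∈ V) :
    laplacian m L (uFun L c z W) (curve L z α t) = laplacian m L (uFun L c z V)
      (curve L z α t) := by
  rw [← expMap_level hL hc0 hα ht]
  exact laplacian_congr (hW.uFun_eventuallyEq hL hc0 hc hV htW htV)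

omit [MeasurableSpace M] in
theorem flow_expCov_level {α : Dual n} (hα : hamiltonian L (covec z α) = c) {s t : ℝ} (ht : 0 < t)
    (hst : 0 < t + s) : flow (hamiltonian L) s (expCov L c z (t • α)) =
      flow (hamiltonian L) (t + s) (covec z α) := by
  have h1 : t • α ≠ 0 := smul_ne_zero ht.ne' (ne_zero_of_level hL hc0 hα)
  have h2 : 1 + s * t⁻¹ = (t + s) / t := by field_simp
  have h3 : scale L c z (t • α) = t⁻¹ := scale_level hL hc0 hα ht
  rw [flow_expCov hL hc0 hc h1 (by rw [h3, h2]; exact div_pos hst ht), h3, h2, smul_smul,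
    div_mul_cancel₀ _ ht.ne', expCov_level hL hc0 hα hst]

variable [BorelSpace M] (hm : IsSmoothMeasure n m) (hn : 0 < n)
include hm hn

theorem IsRegularDomain.exists_deriv_laplacian_curve (hW : IsRegularDomain L c z W)
    {α : Dual n} (hα : hamiltonian L (covec z α) = c) {t : ℝ} (ht : 0 < t) (htW : t • α ∈ W)
    {N : ℝ} (hN : n ≤ N) :
    ∃ f' : ℝ, HasDerivAt (fun s => laplacian m L (uFun L c z W) (curve L z α s)) f' t ∧
      ∀ K : ℝ, (K : EReal) ≤ ricciN m L N (flow (hamiltonian L) t (covec z α)) →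
        f' ≤ -K - laplacian m L (uFun L c z W) (curve L z α t) ^ 2 / N := by
  obtain ⟨f', h1, h2⟩ := hW.exists_deriv_laplacian hm hL hc0 hc hn htW hN
  refine ⟨f', ?_, ?_⟩
  · have h3 : HasDerivAt (fun s => laplacian m L (uFun L c z W)
        (flow (hamiltonian L) s (expCov L c z (t • α))).proj) f' (t - t) := by rwa [sub_self]
    refine (h3.comp_sub_const t t).congr_of_eventuallyEq ?_
    filter_upwards [lt_mem_nhds ht] with s hs
    rw [flow_expCov_level hL hc0 hc hα ht (by rw [add_sub_cancel]; exact hs), add_sub_cancel]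
    rfl
  · rw [expCov_level hL hc0 hα ht, expMap_level hL hc0 hα ht] at h2
    exact h2

/-- The Laplacian comparison along one minimizing curve. -/
theorem laplacian_comparison {K N : ℝ} (hN : n ≤ N)
    (hric : ∀ q : CotangentBundle n M, hamiltonian L q = c → (K : EReal) ≤ ricciN m L N q)
    {α : Dual n} (hα : hamiltonian L (covec z α) = c) {t : ℝ} (ht : 0 < t)
    (htc : (t : EReal) < cutTime L c z α) :
    0 < sKN K N t ∧ ∀ W, IsRegularDomain L c z W → t • α ∈ W →
      laplacian m L (uFun L c z W) (curve L z α t) ≤ N * deriv (sKN K N) t / sKN K N t := by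
  obtain ⟨b, htb, hbc⟩ := EReal.lt_iff_exists_real_btwn.1 htc
  have htb' : t < b := EReal.coe_lt_coe_iff.1 htb
  have hN0 : 0 < N := lt_of_lt_of_le (Nat.cast_pos.2 hn) hN
  have hdom : ∀ s ∈ Ioo 0 b, ∃ W, IsRegularDomain L c z W ∧ s • α ∈ W := fun s hs =>
    (expMap_eq_curve_of_lt_cutTime hL hc0 hc hα hs.1 ((EReal.coe_lt_coe_iff.2 hs.2).trans hbc)).2
  choose! V hV hsV using hdom
  -- the Laplacian along the curve, with a regular domain chosen at each time
  set F : ℝ → ℝ := fun s => laplacian m L (uFun L c z (V s)) (curve L z α s) with hF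
  have hFW : ∀ W, IsRegularDomain L c z W → ∀ s ∈ Ioo 0 b, s • α ∈ W →
      F s = laplacian m L (uFun L c z W) (curve L z α s) := fun W hW s hs hsW =>
    (hV s hs).laplacian_eq hL hc0 hc hW hα hs.1 (hsV s hs) hsW
  have hd : ∀ s ∈ Ioo 0 b, ∃ f', HasDerivAt F f' s ∧ f' ≤ -K - F s ^ 2 / N := by
    intro s hs
    obtain ⟨f', h1, h2⟩ := (hV s hs).exists_deriv_laplacian_curve hL hc0 hc hm hn hα hs.1
      (hsV s hs) hN
    refine ⟨f', h1.congr_of_eventuallyEq ?_, h2 K (hric _ ?_)⟩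
    · have h3 : ∀ᶠ τ in 𝓝 s, τ • α ∈ V s :=
        (continuous_id.smul continuous_const).continuousAt.eventually
          ((hV s hs).isOpen.eventually_mem (hsV s hs))
      filter_upwards [h3, isOpen_Ioo.mem_nhds hs] with τ h4 h5
      exact hFW _ (hV s hs) τ h5 h4
    · rw [← expCov_level hL hc0 hα hs.1]
      exact hamiltonian_expCov hL hc0 hc ((hV s hs).ne_zero (hsV s hs))
  choose! F' hF' hle using hd
  obtain ⟨h1, h2⟩ := riccati_comparison hN0 hF' hle ⟨ht, htb'⟩
  exact ⟨h1, fun W hW htW => hFW W hW t ⟨ht, htb'⟩ htW ▸ h2⟩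

end Comparison

/-! ### Monotonicity of the density ratio -/

section Straight

variable {n : ℕ} {M : Type*} [TopologicalSpace M] [ChartedSpace (E n) M]
  [IsManifold 𝓘(ℝ, E n) ∞ M] {L : TangentBundle 𝓘(ℝ, E n) M → ℝ} {c : ℝ} {z : M}
  {W : Set (Dual n)}

variable [T2Space M] (hL : IsLagrangian L) (hc0 : 0 < c) (hc : ForwardComplete (hamiltonian L))
include hL hc0 hc

/-- The projected Hamiltonian flow lines are integral curves of `∇u_z^c`. -/
theorem IsRegularDomain.hasDerivAt_flow_proj (hW : IsRegularDomain L c z W) {β : Dual n}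
    (hβ : β ∈ W) {e : OpenPartialHomeomorph M (E n)}
    (he : e ∈ IsManifold.maximalAtlas 𝓘(ℝ, E n) ∞ M) (hx : expMap L c z β ∈ e.source) :
    HasDerivAt (fun s => e (flow (hamiltonian L) s (expCov L c z β)).proj)
      (components e (gradient L (uFun L c z W)) (expMap L c z β)) 0 := by
  have hβ0 := hW.ne_zero hβ
  have hq0 : ccoord (expCov L c z β) ≠ 0 := ccoord_expCov_ne_zero hL hc0 hc hβ0
  have hqx : (expCov L c z β).proj = expMap L c z β := (expMap_eq hβ0).symm
  obtain ⟨ε, -, hfe⟩ := exists_hasFlow hL hc hq0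
  have hf := hfe.self_of_nhds.1
  set q := expCov L c z β with hq
  set x := expMap L c z β with hxd
  have hs : x ∈ (chartAt (E n) x).source := mem_source_self x
  have hsq : q.proj ∈ (chartAt (E n) x).source := hqx ▸ hs
  have h1 := (hf.hamAt 0 (by linarith [hf.pos])).hasDerivAt_toCot hL (x₀ := x)
    (by rw [flow_zero]; exact hsq)
  rw [flow_zero] at h1
  have h2 : HasDerivAt (fun s => chartAt (E n) x (flow (hamiltonian L) s q).proj)
      (hamVec (locH (hamiltonian L) x) (toCot x q)).1 0 := h1.fst
  have h3 : (hamVec (locH (hamiltonian L) x) (toCot x q)).1 =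
      components (chartAt (E n) x) (gradient L (uFun L c z W)) x := by
    rw [hL.hamVec_locH_fst ((chartAt (E n) x).map_source hsq)
      (by rwa [Ne, toCot_snd_eq_zero_iff hsq]), hL.famT_toCot hsq, components_chartAt x _ hs]
    have h4 : dform (uFun L c z W) x = q := hW.dform_uFun hL hc0 hc hβ
    simp only [gradient, h4, hqx]
  rw [h3] at h2
  have h5 := contDiffAt_transition (IsManifold.chart_mem_maximalAtlas x) he
    (mem_transition_dom hs hx)
  have h6 : HasDerivAt (fun s => e ((chartAt (E n) x).symm
      (chartAt (E n) x (flow (hamiltonian L) s q).proj)))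
      (fderiv ℝ (fun y => e ((chartAt (E n) x).symm y)) (chartAt (E n) x x)
        (components (chartAt (E n) x) (gradient L (uFun L c z W)) x)) 0 := by
    refine HasFDerivAt.comp_hasDerivAt (0 : ℝ) (l := fun y => e ((chartAt (E n) x).symm y))
      (f := fun s => chartAt (E n) x (flow (hamiltonian L) s q).proj) ?_ h2
    rw [flow_zero, hqx]
    exact (h5.differentiableAt (by simp)).hasFDerivAt
  rw [components_transition (IsManifold.chart_mem_maximalAtlas x) he _ hs hx]
  refine h6.congr_of_eventuallyEq ?_
  filter_upwards [(hf.hamAt 0 (by linarith [hf.pos])).eventually_source (x₀ := x)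
    (by rw [flow_zero]; exact hsq)] with s h7
  rw [(chartAt (E n) x).left_inv h7]

theorem IsRegularDomain.hasDerivAt_curve (hW : IsRegularDomain L c z W) {α : Dual n}
    (hα : hamiltonian L (covec z α) = c) {t : ℝ} (ht : 0 < t) (htW : t • α ∈ W)
    {e : OpenPartialHomeomorph M (E n)} (he : e ∈ IsManifold.maximalAtlas 𝓘(ℝ, E n) ∞ M)
    (hx : curve L z α t ∈ e.source) :
    HasDerivAt (fun s => e (curve L z α s))
      (components e (gradient L (uFun L c z W)) (curve L z α t)) t := by
  have h1 : expMap L c z (t • α) = curve L z α t := expMap_level hL hc0 hα ht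
  have h2 := hW.hasDerivAt_flow_proj hL hc0 hc htW he (h1 ▸ hx)
  rw [h1, ← sub_self t] at h2
  refine (h2.comp_sub_const t t).congr_of_eventuallyEq ?_
  filter_upwards [lt_mem_nhds ht] with s hs
  rw [flow_expCov_level hL hc0 hc hα ht (by rw [add_sub_cancel]; exact hs), add_sub_cancel]
  rfl

variable [MeasurableSpace M] [BorelSpace M] {m : Measure M} (hm : IsSmoothMeasure n m)
include hm

/-- In a chart that straightens `∇u_z^c`, the Laplacian is the derivative of the log-density of
the measure along the curve. -/
theorem IsStraightChart.hasDerivAt_logDensity {i : Fin n} {e : OpenPartialHomeomorph M (E n)}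
    (he : IsStraightChart L c z W i e) (hW : IsRegularDomain L c z W) {α : Dual n}
    (hα : hamiltonian L (covec z α) = c) {t : ℝ} (ht : 0 < t) (htW : t • α ∈ W)
    (hx : curve L z α t ∈ e.source) :
    HasDerivAt (fun s => -logDensity m e (e (curve L z α s)))
      (laplacian m L (uFun L c z W) (curve L z α t)) t := by
  set x := curve L z α t with hxd
  have h1 : compIn e (gradient L (uFun L c z W)) =ᶠ[𝓝 (e x)] fun _ => basisVec i := by
    filter_upwards [e.open_target.mem_nhds (e.map_source hx)] with y hy
    exact he.straight _ (e.map_target hy)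
  -- the components of `∇u_z^c` are constant, so only the density contributes to the divergence
  have h2 : laplacian m L (uFun L c z W) x = -fderiv ℝ (logDensity m e) (e x) (basisVec i) := by
    rw [laplacian, divergence_eq_chart hm he.mem _ hx
      ((differentiableAt_const _).congr_of_eventuallyEq h1), divE_congr h1, divE]
    simp [opTr]
  have h3 := hW.hasDerivAt_curve hL hc0 hc hα ht htW he.mem hx
  rw [he.straight _ hx] at h3
  have h4 := ((contDiffAt_logDensity hm he.mem (e.map_source hx)).differentiableAt
    (by simp)).hasFDerivAt
  rw [h2]
  exact (h4.comp_hasDerivAt t h3).neg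

theorem IsStraightChart.hasDerivAt_mcpRatio {i : Fin n} {e : OpenPartialHomeomorph M (E n)}
    (he : IsStraightChart L c z W i e) (hW : IsRegularDomain L c z W) {α : Dual n}
    (hα : hamiltonian L (covec z α) = c) {t : ℝ} (ht : 0 < t) (htW : t • α ∈ W)
    (hx : curve L z α t ∈ e.source) {K N : ℝ} (hN : 0 < N) (hs : 0 < sKN K N t) :
    HasDerivAt (mcpRatio m L z α K N e) (mcpRatio m L z α K N e t *
      (laplacian m L (uFun L c z W) (curve L z α t) - N * deriv (sKN K N) t / sKN K N t)) t := by
  have h1 := (he.hasDerivAt_logDensity hL hc0 hc hm hW hα ht htW hx).exp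
  have h2 : HasDerivAt (sKN K N) (deriv (sKN K N) t) t := by
    rw [deriv_sKN hN]; exact hasDerivAt_sKN hN t
  have h3 := h1.div (h2.rpow_const (p := N) (Or.inl hs.ne')) (Real.rpow_pos_of_pos hs N).ne'
  refine h3.congr_deriv ?_
  rw [mcpRatio, Real.rpow_sub_one hs.ne']
  have := (Real.rpow_pos_of_pos hs N).ne'
  field_simp

/-- In a straight chart, the density ratio is non-increasing exactly when the Laplacian is bounded
by the logarithmic derivative of `s_{K,N}^N`. -/
theorem IsStraightChart.antitoneOn_mcpRatio_iff {i : Fin n} {e : OpenPartialHomeomorph M (E n)}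
    (he : IsStraightChart L c z W i e) (hW : IsRegularDomain L c z W) {α : Dual n}
    (hα : hamiltonian L (covec z α) = c) {K N : ℝ} (hN : 0 < N) {a b : ℝ} (ha : 0 ≤ a)
    (h : ∀ t ∈ Ioo a b, t • α ∈ W ∧ curve L z α t ∈ e.source ∧ 0 < sKN K N t) :
    AntitoneOn (mcpRatio m L z α K N e) (Ioo a b) ↔ ∀ t ∈ Ioo a b,
      laplacian m L (uFun L c z W) (curve L z α t) ≤ N * deriv (sKN K N) t / sKN K N t := by
  have hd := fun t (ht : t ∈ Ioo a b) => he.hasDerivAt_mcpRatio hL hc0 hc hm hW hα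
    (ha.trans_lt ht.1) (h t ht).1 (h t ht).2.1 hN (h t ht).2.2
  have hpos : ∀ t ∈ Ioo a b, 0 < mcpRatio m L z α K N e t := fun t ht =>
    div_pos (Real.exp_pos _) (Real.rpow_pos_of_pos (h t ht).2.2 N)
  constructor
  · intro hanti t ht
    have h1 := hanti.derivWithin_nonpos (x := t)
    rw [((hd t ht).hasDerivWithinAt).derivWithin (isOpen_Ioo.uniqueDiffWithinAt ht)] at h1
    have h2 := nonpos_of_mul_nonpos_right h1 (hpos t ht)
    linarith
  · intro hle
    refine antitoneOn_of_deriv_nonpos (convex_Ioo a b)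
      (fun t ht => (hd t ht).continuousAt.continuousWithinAt) ?_ ?_
    · rw [interior_Ioo]
      exact fun t ht => (hd t ht).differentiableAt.differentiableWithinAt
    · rw [interior_Ioo]
      intro t ht
      rw [(hd t ht).deriv]
      exact mul_nonpos_of_nonneg_of_nonpos (hpos t ht).le (sub_nonpos.2 (hle t ht))

end Straight

/-! ### Straight charts -/

section StraightChart

variable {n : ℕ}

theorem exists_equiv_dual {e : E n} {β : Dual n} (he : e ≠ 0) (hβ : β ≠ 0) :
    ∃ A : E n ≃L[ℝ] Dual n, A e = β := by
  have A : E n ≃L[ℝ] Dual n := (InnerProductSpace.toDual ℝ (E n)).toContinuousLinearEquiv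
  obtain ⟨B, hB⟩ := SeparatingDual.exists_continuousLinearEquiv_apply_eq (R := ℝ)
    (x := A e) (y := β) (by simpa using he) hβ
  exact ⟨A.trans B, hB⟩

variable {M : Type*} [TopologicalSpace M] [ChartedSpace (E n) M]
  [IsManifold 𝓘(ℝ, E n) ∞ M] {L : TangentBundle 𝓘(ℝ, E n) M → ℝ} {c : ℝ} {z : M}
  {W : Set (Dual n)}

/-- A preferred chart followed by the inverse of a local diffeomorphism of the model space is a
chart of the maximal atlas. -/
theorem mem_maximalAtlas_trans_symm (x₀ : M) {g : OpenPartialHomeomorph (E n) (E n)}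
    (hg : ∀ y ∈ g.source, ContDiffAt ℝ ∞ g y ∧ Function.Bijective (fderiv ℝ g y)) :
    (chartAt (E n) x₀).trans g.symm ∈ IsManifold.maximalAtlas 𝓘(ℝ, E n) ∞ M := by
  refine OpenPartialHomeomorph.mem_maximalAtlas_of_contMDiffOn _ ?_ ?_
  · intro x hx
    rw [OpenPartialHomeomorph.trans_source] at hx
    have hy : chartAt (E n) x₀ x ∈ g.target := hx.2
    obtain ⟨h1, h2⟩ := hg _ (g.map_target hy)
    obtain ⟨A, hA⟩ := bijective_isEquiv h2
    have h3 : ContDiffAt ℝ ∞ g.symm (chartAt (E n) x₀ x) := g.contDiffAt_symm (f₀' := A) hy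
      (by rw [hA]; exact (h1.differentiableAt (by simp)).hasFDerivAt) h1
    exact (h3.contMDiffAt.comp x ((contMDiffOn_chart (I := 𝓘(ℝ, E n)) (n := ∞)
      (x := x₀)).contMDiffAt ((chartAt (E n) x₀).open_source.mem_nhds hx.1))).contMDiffWithinAt
  · intro y hy
    rw [OpenPartialHomeomorph.trans_target] at hy
    have h1 : y ∈ g.source := hy.1
    have h2 : g y ∈ (chartAt (E n) x₀).target := hy.2
    exact (((contMDiffOn_chart_symm (I := 𝓘(ℝ, E n)) (n := ∞) (x := x₀)).contMDiffAt
      ((chartAt (E n) x₀).open_target.mem_nhds h2)).comp y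
      (hg y h1).1.contMDiffAt).contMDiffWithinAt

variable [T2Space M] (hL : IsLagrangian L) (hc0 : 0 < c) (hc : ForwardComplete (hamiltonian L))
include hL hc0 hc

/-- Straight charts exist around every point of a regular domain. The chart is the inverse of
`y ↦ exp_z^c(b(y))`, where the coordinates other than the `i`-th parametrize an affine hyperplane
through `β` transverse to the ray of `β`, and the `i`-th coordinate is the time of the flow. -/
theorem IsRegularDomain.exists_isStraightChart (hW : IsRegularDomain L c z W) {β : Dual n}
    (hβ : β ∈ W) (i : Fin n) :
    ∃ e, IsStraightChart L c z W i e ∧ expMap L c z β ∈ e.source := by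
  have hβ0 := hW.ne_zero hβ
  set x₀ := expMap L c z β with hx₀
  have hs₀ : x₀ ∈ (chartAt (E n) x₀).source := mem_source_self x₀
  have hsc := contDiffAt_scale hL hc0 hβ0 (z := z)
  have hscpos : 0 < scale L c z β := (scale_spec hL hc0 hβ0).1
  have hbi : (basisVec i : E n) ≠ 0 := fun h => by
    simpa [basisVec] using congrArg (fun v : E n => v i) h
  obtain ⟨A, hA⟩ := exists_equiv_dual (n := n) hbi (smul_ne_zero hscpos.ne' hβ0)
  -- `w` parametrizes the hyperplane; `b` is `w` moved for the time `y i`, see `flow_expCov`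
  set w : E n → Dual n := fun y => β + A (y - y i • basisVec i) with hw
  set b : E n → Dual n := fun y => (1 + y i * scale L c z (w y)) • w y with hb
  have hw0 : w 0 = β := by simp [hw]
  have hb0 : b 0 = β := by simp [hb, hw0]
  have hwi : ∀ (y : E n) (s : ℝ), w (y + s • basisVec i) = w y := by
    intro y s
    simp only [hw]
    congr 2
    simp [basisVec, add_smul]
  have hpr : ∀ y : E n, HasFDerivAt (fun y : E n => y i) (basisCov i : Dual n) y := fun y =>
    (basisCov i : Dual n).hasFDerivAt
  have hprs : ∀ y : E n, ContDiffAt ℝ ∞ (fun y : E n => y i) y := fun y =>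
    (basisCov i : Dual n).contDiff.contDiffAt
  have hws : ∀ y, ContDiffAt ℝ ∞ w y := fun y => contDiffAt_const.add
    ((A : E n →L[ℝ] Dual n).contDiff.contDiffAt.comp y
      (contDiffAt_id.sub ((hprs y).smul contDiffAt_const)))
  have hbs : ∀ y, w y ≠ 0 → ContDiffAt ℝ ∞ b y := fun y hy =>
    (contDiffAt_const.add ((hprs y).mul (ContDiffAt.comp y (g := scale L c z) (f := w)
      (contDiffAt_scale hL hc0 hy) (hws y)))).smul (hws y)
  -- `A` maps the `i`-th basis vector to the velocity of `b` in the direction of time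
  have hbd : HasFDerivAt b (A : E n →L[ℝ] Dual n) 0 := by
    have h1 : HasFDerivAt w ((A : E n →L[ℝ] Dual n).comp (ContinuousLinearMap.id ℝ (E n) -
        (basisCov i : Dual n).smulRight (basisVec i))) 0 :=
      ((A : E n →L[ℝ] Dual n).hasFDerivAt.comp (0 : E n)
        ((hasFDerivAt_id (0 : E n)).sub ((hpr 0).smul_const (basisVec i)))).const_add β
    have h2 : HasFDerivAt (fun y => scale L c z (w y))
        (fderiv ℝ (fun y => scale L c z (w y)) 0) 0 :=
      ((ContDiffAt.comp (0 : E n) (g := scale L c z) (f := w)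
        (by rw [hw0]; exact hsc) (hws 0)).differentiableAt (by simp)).hasFDerivAt
    have h3 := (((hpr 0).mul h2).const_add 1).smul h1
    refine h3.congr_fderiv (ContinuousLinearMap.ext fun v => ?_)
    simp [hw0, map_smul, hA, smul_smul, mul_comm]
  have hexp := contMDiffAt_expMap hL hc0 hc (z := z) hβ0
  set Ψ : E n → E n := fun y => chartAt (E n) x₀ (expMap L c z (b y)) with hΨ
  have hΨs : ∀ y, w y ≠ 0 → b y ≠ 0 → expMap L c z (b y) ∈ (chartAt (E n) x₀).source →
      ContDiffAt ℝ ∞ Ψ y := fun y h1 h2 h3 =>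
    ContDiffAt.comp y (g := fun b => chartAt (E n) x₀ (expMap L c z b)) (f := b)
      (contDiffAt_chart_comp (contMDiffAt_expMap hL hc0 hc h2) h3) (hbs y h1)
  have hΨ0 := hΨs 0 (hw0 ▸ hβ0) (hb0 ▸ hβ0) (hb0 ▸ hs₀)
  have hΨd : Function.Bijective (fderiv ℝ Ψ 0) := by
    have h1 := (bijective_dman_iff (hexp.mdifferentiableAt (by simp)) hs₀).2 (hW.regular β hβ)
    have h2 : HasFDerivAt Ψ ((fderiv ℝ (fun b => chartAt (E n) x₀ (expMap L c z b)) β).comp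
        (A : E n →L[ℝ] Dual n)) 0 := by
      refine HasFDerivAt.comp (0 : E n) (g := fun b => chartAt (E n) x₀ (expMap L c z b)) (f := b)
        ?_ hbd
      rw [hb0]
      exact ((contDiffAt_chart_comp hexp hs₀).differentiableAt (by simp)).hasFDerivAt
    rw [h2.fderiv]
    exact h1.comp A.bijective
  obtain ⟨g₀, hg1, hg2, -, hg3⟩ := exists_local_inverse hΨ0 hΨd
  have hbc : ContinuousAt b 0 := hbd.continuousAt
  have hk : ContinuousAt (fun y : E n => 1 + y i * scale L c z (w y)) 0 :=
    continuousAt_const.add ((hpr 0).continuousAt.mul (ContinuousAt.comp (x := (0 : E n))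
      (g := scale L c z) (f := w) (by rw [hw0]; exact hsc.continuousAt) (hws 0).continuousAt))
  have hev : ∀ᶠ y in 𝓝 (0 : E n), Function.Bijective (fderiv ℝ Ψ y) ∧ w y ≠ 0 ∧ b y ∈ W ∧
      expMap L c z (b y) ∈ (chartAt (E n) x₀).source ∧ 0 < 1 + y i * scale L c z (w y) := by
    refine hg3.and (((hws 0).continuousAt.eventually_ne (hw0 ▸ hβ0)).and
      ((hbc.eventually (hW.isOpen.eventually_mem (hb0 ▸ hβ))).and (Filter.Eventually.and ?_
        (hk.eventually (lt_mem_nhds (by simp))))))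
    have h1 : ContinuousAt (fun y => expMap L c z (b y)) 0 := ContinuousAt.comp (x := (0 : E n))
      (g := expMap L c z) (f := b) (by rw [hb0]; exact hexp.continuousAt) hbc
    exact h1.eventually ((chartAt (E n) x₀).open_source.eventually_mem
      (by simp only [hb0]; exact hs₀))
  obtain ⟨U, hU, hUo, hU0⟩ := eventually_nhds_iff.1 hev
  set g := g₀.restrOpen U hUo with hg
  have hgU : ∀ y ∈ g.source, y ∈ U := fun y hy => hy.2
  have hgΨ : ∀ y ∈ g.source, g y = Ψ y := fun y hy => hg2 y hy.1
  have hgs : ∀ y ∈ g.source, g =ᶠ[𝓝 y] Ψ := fun y hy => by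
    filter_upwards [g.open_source.mem_nhds hy] with y' hy' using hgΨ y' hy'
  have hmax : (chartAt (E n) x₀).trans g.symm ∈ IsManifold.maximalAtlas 𝓘(ℝ, E n) ∞ M := by
    refine mem_maximalAtlas_trans_symm x₀ fun y hy => ?_
    obtain ⟨h1, h2, h3, h4, -⟩ := hU y (hgU y hy)
    rw [(hgs y hy).fderiv_eq]
    exact ⟨(hΨs y h2 (hW.ne_zero h3) h4).congr_of_eventuallyEq (hgs y hy), h1⟩
  -- the chart is the inverse of `y ↦ exp (b y)`
  have hsrc : ∀ y ∈ g.source, expMap L c z (b y) ∈ ((chartAt (E n) x₀).trans g.symm).source ∧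
      (chartAt (E n) x₀).trans g.symm (expMap L c z (b y)) = y := by
    intro y hy
    have h1 : chartAt (E n) x₀ (expMap L c z (b y)) = g y := (hgΨ y hy).symm
    refine ⟨?_, ?_⟩
    · rw [OpenPartialHomeomorph.trans_source]
      refine ⟨(hU y (hgU y hy)).2.2.2.1, ?_⟩
      rw [mem_preimage, h1]
      exact g.map_source hy
    · show g.symm (chartAt (E n) x₀ (expMap L c z (b y))) = y
      rw [h1, g.left_inv hy]
  have hinv : ∀ x ∈ ((chartAt (E n) x₀).trans g.symm).source,
      ∃ y ∈ g.source, expMap L c z (b y) = x := by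
    intro x hx
    rw [OpenPartialHomeomorph.trans_source] at hx
    have hy : chartAt (E n) x₀ x ∈ g.target := hx.2
    have h1 := g.map_target hy
    refine ⟨_, h1, (chartAt (E n) x₀).injOn (hU _ (hgU _ h1)).2.2.2.1 hx.1 ?_⟩
    exact (hgΨ _ h1).symm.trans (g.right_inv hy)
  refine ⟨(chartAt (E n) x₀).trans g.symm, ⟨hmax, ?_, ?_⟩, ?_⟩
  · intro x hx
    obtain ⟨y, hy, rfl⟩ := hinv x hx
    exact ⟨b y, (hU y (hgU y hy)).2.2.1, rfl⟩
  · intro x hx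
    obtain ⟨y, hy, rfl⟩ := hinv x hx
    obtain ⟨-, h2, h3, -, h5⟩ := hU y (hgU y hy)
    have hby := hW.ne_zero h3
    have hd := hW.hasDerivAt_flow_proj hL hc0 hc h3 hmax hx
    have hline : HasDerivAt (fun s : ℝ => y + s • basisVec i) (basisVec i : E n) 0 := by
      simpa using ((hasDerivAt_id (0 : ℝ)).smul_const (basisVec i : E n)).const_add y
    refine hd.unique (hline.congr_of_eventuallyEq ?_)
    have e1 : ∀ᶠ s in 𝓝 (0 : ℝ), y + s • basisVec i ∈ g.source :=
      hline.continuousAt.eventually (g.open_source.eventually_mem (by simpa using hy))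
    have e2 : ∀ᶠ s in 𝓝 (0 : ℝ), 0 < 1 + s * scale L c z (b y) := by
      have : ContinuousAt (fun s : ℝ => 1 + s * scale L c z (b y)) 0 := by fun_prop
      exact this.eventually (lt_mem_nhds (by simp))
    filter_upwards [e1, e2] with s hs1 hs2
    have h6 : (1 + s * scale L c z (b y)) • b y = b (y + s • basisVec i) := by
      have h7 : scale L c z (b y) = scale L c z (w y) / (1 + y i * scale L c z (w y)) :=
        scale_smul hL hc0 h2 h5
      have h8 : (y + s • basisVec i) i = y i + s := by simp [basisVec]
      rw [h7]
      simp only [hb]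
      rw [hwi, h8, smul_smul]
      congr 1
      rw [add_mul, one_mul, mul_assoc, div_mul_cancel₀ _ h5.ne']
      ring
    have h9 := hW.ne_zero (hU _ (hgU _ hs1)).2.2.1
    rw [flow_expCov hL hc0 hc hby hs2, h6, ← expMap_eq h9]
    exact (hsrc _ hs1).2
  · have h1 := (hsrc 0 ⟨hg1, hU0⟩).1
    rwa [hb0] at h1

end StraightChart

/-! ### The measure contraction property -/

section Contraction

variable {n : ℕ} {M : Type*} [TopologicalSpace M] [ChartedSpace (E n) M]
  [IsManifold 𝓘(ℝ, E n) ∞ M] {L : TangentBundle 𝓘(ℝ, E n) M → ℝ} {c : ℝ} {z : M}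

variable [T2Space M] (hL : IsLagrangian L) (hc0 : 0 < c) (hc : ForwardComplete (hamiltonian L))
  [MeasurableSpace M] [BorelSpace M] {m : Measure M} (hm : IsSmoothMeasure n m)
include hL hc0 hc hm

/-- The measure contraction property along a curve amounts to the Laplacian bound: it is tested in
straight charts around each point of the curve, which exist, and the Laplacian does not depend on
the regular domain. -/
theorem mcpAlong_iff {α : Dual n} (hα : hamiltonian L (covec z α) = c) {K N : ℝ} (hN : 0 < N)
    (i : Fin n) (hs : ∀ t : ℝ, 0 < t → (t : EReal) < cutTime L c z α → 0 < sKN K N t) :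
    MCPAlong m L c z α K N i ↔ ∀ t : ℝ, 0 < t → (t : EReal) < cutTime L c z α →
      ∀ W, IsRegularDomain L c z W → t • α ∈ W →
        laplacian m L (uFun L c z W) (curve L z α t) ≤ N * deriv (sKN K N) t / sKN K N t := by
  constructor
  · intro h t ht htc W hW htW
    obtain ⟨V, e, a, b, hV, he, ha, htab, hab, hanti⟩ := h t ht htc
    -- the comparison function is only known to be positive before the cut time
    obtain ⟨r, htr, hrc⟩ := EReal.lt_iff_exists_real_btwn.1 htc
    have htr' : t < r := EReal.coe_lt_coe_iff.1 htr
    have hsub : Ioo a (min b r) ⊆ Ioo a b := Ioo_subset_Ioo_right (min_le_left _ _)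
    have h1 := (he.antitoneOn_mcpRatio_iff hL hc0 hc hm hV hα hN ha
      (fun s hs' => ⟨(hab s (hsub hs')).1, (hab s (hsub hs')).2, hs s (ha.trans_lt hs'.1)
        ((EReal.coe_lt_coe_iff.2 (hs'.2.trans_le (min_le_right _ _))).trans hrc)⟩)).1
      (hanti.mono hsub) t ⟨htab.1, lt_min htab.2 htr'⟩
    rwa [hW.laplacian_eq hL hc0 hc hV hα ht htW (hab t htab).1]
  · intro h T hT hTc
    obtain ⟨-, W, hW, hTW⟩ := expMap_eq_curve_of_lt_cutTime hL hc0 hc hα hT hTc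
    obtain ⟨e, he, hTe⟩ := hW.exists_isStraightChart hL hc0 hc hTW i
    rw [expMap_level hL hc0 hα hT] at hTe
    change curve L z α T ∈ e.source at hTe
    have h1 : ContinuousAt (curve L z α) T := by
      have h2 : curve L z α =ᶠ[𝓝 T] fun t => expMap L c z (t • α) := by
        filter_upwards [lt_mem_nhds hT] with t ht
        exact (expMap_level hL hc0 hα ht).symm
      refine ContinuousAt.congr ?_ h2.symm
      exact ContinuousAt.comp (x := T) (g := expMap L c z) (f := fun t : ℝ => t • α)
        (contMDiffAt_expMap hL hc0 hc (hW.ne_zero hTW)).continuousAt (by fun_prop)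
    have h3 : ∀ᶠ t in 𝓝 T, t • α ∈ W := by
      have h4 : ContinuousAt (fun t : ℝ => t • α) T := by fun_prop
      exact h4.eventually (hW.isOpen.eventually_mem hTW)
    obtain ⟨r, hTr, hrc⟩ := EReal.lt_iff_exists_real_btwn.1 hTc
    have hev : ∀ᶠ t in 𝓝 T, t • α ∈ W ∧ curve L z α t ∈ e.source ∧ t ∈ Ioo 0 r :=
      h3.and ((h1.eventually (e.open_source.eventually_mem hTe)).and
        (isOpen_Ioo.eventually_mem ⟨hT, EReal.coe_lt_coe_iff.1 hTr⟩))
    obtain ⟨a, b, hTab, hab⟩ := mem_nhds_iff_exists_Ioo_subset.1 hev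
    have hmax : ∀ t ∈ Ioo (max a 0) b, t • α ∈ W ∧ curve L z α t ∈ e.source ∧ t ∈ Ioo 0 r :=
      fun t ht => hab ⟨(le_max_left _ _).trans_lt ht.1, ht.2⟩
    have hcut : ∀ t ∈ Ioo (max a 0) b, (t : EReal) < cutTime L c z α := fun t ht =>
      (EReal.coe_lt_coe_iff.2 (hmax t ht).2.2.2).trans hrc
    refine ⟨W, e, max a 0, b, hW, he, le_max_right _ _, ⟨max_lt hTab.1 hT, hTab.2⟩,
      fun t ht => ⟨(hmax t ht).1, (hmax t ht).2.1⟩, ?_⟩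
    refine (he.antitoneOn_mcpRatio_iff hL hc0 hc hm hW hα hN (le_max_right _ _) fun t ht =>
      ⟨(hmax t ht).1, (hmax t ht).2.1, hs t (hmax t ht).2.2.1 (hcut t ht)⟩).2 fun t ht => ?_
    exact h t (hmax t ht).2.2.1 (hcut t ht) W hW (hmax t ht).1

end Contraction

end HamLap

end

theorem mainTheorem2 {n : ℕ} (hn : 2 ≤ n) {M : Type*} [TopologicalSpace M] [T2Space M]
    [SecondCountableTopology M] [ConnectedSpace M] [ChartedSpace (HamLap.E n) M]
    [IsManifold 𝓘(ℝ, HamLap.E n) ∞ M] [MeasurableSpace M] [BorelSpace M]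
    (m : Measure M) (hm : HamLap.IsSmoothMeasure n m)
    (L : TangentBundle 𝓘(ℝ, HamLap.E n) M → ℝ) (hL : HamLap.IsLagrangian L)
    (hcomplete : HamLap.ForwardComplete (HamLap.hamiltonian L))
    (c : ℝ) (hc : 0 < c) (K N : ℝ) (hN : (n : ℝ) ≤ N) :
    -- before `T_α`, the function `u_z^c` is defined near `η(t)`
    (∀ (z : M) (α : HamLap.Dual n), HamLap.hamiltonian L (HamLap.covec z α) = c →
      ∀ t : ℝ, 0 < t → (t : EReal) < HamLap.cutTime L c z α →
        HamLap.expMap L c z (t • α) = HamLap.curve L z α t ∧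
        ∃ W, HamLap.IsRegularDomain L c z W ∧ t • α ∈ W) ∧
    -- `u_z^c` is smooth, `du_z^c = Φ_t(α)` and `u_z^c = ct + ∫ L(η')` at `η(t)`
    (∀ (z : M) (W : Set (HamLap.Dual n)), HamLap.IsRegularDomain L c z W →
      ContMDiffOn 𝓘(ℝ, HamLap.E n) 𝓘(ℝ, ℝ) ∞ (HamLap.uFun L c z W)
        (HamLap.expMap L c z '' W) ∧
      ∀ α : HamLap.Dual n, HamLap.hamiltonian L (HamLap.covec z α) = c →
        ∀ t : ℝ, 0 < t → t • α ∈ W →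
          HamLap.dform (HamLap.uFun L c z W) (HamLap.curve L z α t) =
            HamLap.flow (HamLap.hamiltonian L) t (HamLap.covec z α) ∧
          HamLap.uFun L c z W (HamLap.curve L z α t) = c * t + ∫ s in (0 : ℝ)..t,
            L (HamLap.legendre L (HamLap.flow (HamLap.hamiltonian L) s (HamLap.covec z α)))) ∧
    -- Laplacian comparison
    ((∀ α : HamLap.CotangentBundle n M, HamLap.hamiltonian L α = c →
        (K : EReal) ≤ HamLap.ricciN m L N α) →
      ∀ (z : M) (α : HamLap.Dual n), HamLap.hamiltonian L (HamLap.covec z α) = c →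
      ∀ t : ℝ, 0 < t → (t : EReal) < HamLap.cutTime L c z α →
        0 < HamLap.sKN K N t ∧
        ∀ W, HamLap.IsRegularDomain L c z W → t • α ∈ W →
          HamLap.laplacian m L (HamLap.uFun L c z W) (HamLap.curve L z α t) ≤
              N * deriv (HamLap.sKN K N) t / HamLap.sKN K N t ∧
          (0 < K → HamLap.laplacian m L (HamLap.uFun L c z W) (HamLap.curve L z α t) ≤
              √(N * K) * Real.cot (√(K / N) * t)) ∧
          (K = 0 → HamLap.laplacian m L (HamLap.uFun L c z W) (HamLap.curve L z α t) ≤ N / t) ∧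
          (K < 0 → HamLap.laplacian m L (HamLap.uFun L c z W) (HamLap.curve L z α t) ≤
              √(-(N * K)) *
                (Real.cosh (√(-K / N) * t) / Real.sinh (√(-K / N) * t)))) ∧
    -- in each chart with `∇u_z^c ≡ ∂_{x^1}`, monotonicity of the ratio is equivalent to the bound
    (∀ (z : M) (α : HamLap.Dual n), HamLap.hamiltonian L (HamLap.covec z α) = c →
      ∀ (W : Set (HamLap.Dual n)) (e : OpenPartialHomeomorph M (HamLap.E n)) (a b : ℝ),
        HamLap.IsRegularDomain L c z W →
        HamLap.IsStraightChart L c z W ⟨0, by omega⟩ e → 0 ≤ a →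
        (∀ t ∈ Ioo a b, t • α ∈ W ∧ HamLap.curve L z α t ∈ e.source ∧ 0 < HamLap.sKN K N t) →
        (AntitoneOn (HamLap.mcpRatio m L z α K N e) (Ioo a b) ↔
          ∀ t ∈ Ioo a b,
            HamLap.laplacian m L (HamLap.uFun L c z W) (HamLap.curve L z α t) ≤
              N * deriv (HamLap.sKN K N) t / HamLap.sKN K N t)) ∧
    -- the measure contraction property along `η` is equivalent to the Laplacian comparison
    (∀ (z : M) (α : HamLap.Dual n), HamLap.hamiltonian L (HamLap.covec z α) = c →
      (∀ t : ℝ, 0 < t → (t : EReal) < HamLap.cutTime L c z α → 0 < HamLap.sKN K N t) →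
        (HamLap.MCPAlong m L c z α K N ⟨0, by omega⟩ ↔
          ∀ t : ℝ, 0 < t → (t : EReal) < HamLap.cutTime L c z α →
            ∀ W, HamLap.IsRegularDomain L c z W → t • α ∈ W →
              HamLap.laplacian m L (HamLap.uFun L c z W) (HamLap.curve L z α t) ≤
                N * deriv (HamLap.sKN K N) t / HamLap.sKN K N t)) := by
  have hn0 : 0 < n := by omega
  have hN0 : 0 < N := lt_of_lt_of_le (Nat.cast_pos.2 hn0) hN
  refine ⟨fun z α hα t ht htc => HamLap.expMap_eq_curve_of_lt_cutTime hL hc hcomplete hα ht htc,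
    fun z W hW => HamLap.contMDiffOn_uFun hL hc hcomplete hW, fun hric z α hα t ht htc => ?_,
    fun z α hα W e a b hW he ha h =>
      he.antitoneOn_mcpRatio_iff hL hc hcomplete hm hW hα hN0 ha h,
    fun z α hα hs => HamLap.mcpAlong_iff hL hc hcomplete hm hα hN0 _ hs⟩
  obtain ⟨h1, h2⟩ := HamLap.laplacian_comparison hL hc hcomplete hm hn0 hN hric hα ht htc
  refine ⟨h1, fun W hW htW => ?_⟩
  have h3 := h2 W hW htW
  refine ⟨h3, fun hK => ?_, fun hK => ?_, fun hK => ?_⟩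
  · rwa [HamLap.sKN_ratio_pos hN0 hK] at h3
  · subst hK
    rwa [HamLap.sKN_ratio_zero hN0] at h3
  · rwa [HamLap.sKN_ratio_neg hN0 hK] at h3
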